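/- **Setting.** For $\vartheta\in\mathbb R$ let $T_\vartheta$ be the smooth noncommutative torus: series $\sum_{p,q}a_{pq}U_1^pU_2^q$ with rapidly decreasing coefficients and $U_1U_2=e^{2\pi i\vartheta}U_2U_1$, with derivations $\partial_\mu U_\nu=i\delta_{\mu\nu}U_\nu$. A module with connection over $T_{-\theta}$ is a right module with linear maps $D_1,D_2$ such that $D_\mu(\varphi a)=D_\mu(\varphi)a+\varphi\,\partial_\mu a$. For coprime integers $n,m$ with $n-m\theta\neq0$, the Heisenberg module $\mathcal E^\theta_{n,m}$ over $T_{-\theta}$ is: for $m\ne0$ the space of Schwartz functions $\varphi_j(x)$ on $\mathbb R\times\mathbb Z_{|m|}$ with $(\varphi U_1)_j(x)=\varphi_{j-1}(x-\frac nm+\theta)$, $(\varphi U_2)_j(x)=e^{2\pi i(x-jn/m)}\varphi_j(x)$ and the constant curvature connection $D_1=\frac{imx}{n-m\theta}$, $D_2=\frac1{2\pi}\partial_x$; for $m=0$ (so $n=\pm1$) the free module $T_{-\theta}$ with $D_\mu=\partial_\mu$. **Bimodules.** A complete Morita equivalence bimodule between $T_{-\theta}$ and $T_{-\theta'}$ is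 a finitely generated projective right $T_{-\theta'}$-module which is a generator, on which $T_{-\theta}$ acts from the left as the full algebra of right-linear endomorphisms, with a constant curvature connection that satisfies the Leibniz rule for $\partial_\mu$ on the right and $D_\mu(a\psi)=\sum_\nu M_{\mu\nu}(\partial_\nu a)\psi+aD_\mu\psi$ on the left, for an invertible constant matrix $M$. Tensoring a module with connection $\nabla$ by it gives the module with connection $\sum_\nu M_{\mu\nu}\nabla_\nu\otimes1+1\otimes D_\mu$. The bimodules used are: $\mathcal E_{0,1}^{1/(s-\theta)}$, $s\in\mathbb Z$, $s\ne\theta$, with left action $(U_1\psi)(x)=\psi(x-1)$, $(U_2\psi)(x)=e^{2\pi i(\theta-s)x}\psi(x)$ and $M=(\theta-s)1$; $\mathcal E_{1,0}^{\theta+1}$, which is $T_{-\theta}$ with $T_{-(\theta+1)}$ identified with $T_{-\theta}$, and $M=1$; and $\mathcal E_{1,0}^{-\theta}$, which is $T_{-\theta}$ with $T_\theta$ identified with $T_{-\theta}$ through $U_1\mapsto U_1^{-1}$, $U_2\mapsto U_2$, with $D=(-\partial_1,\partial_2)$ and $M=\mathrm{diag}(-1,1)$. **Seiberg–Witten maps.**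 On the plane with $[\sigma^1,\sigma^2]_\star=2\pi i t$, consider $N\times N$ gauge potentials $A_\mu$ polynomial in $\sigma$, $F_{\mu\nu}=\partial_\mu A_\nu-\partial_\nu A_\mu-i[A_\mu,A_\nu]_\star$, and $D_\mu\varphi=\partial_\mu\varphi-iA_\mu\star\varphi$ or $D_\mu\Psi=\partial_\mu\Psi-i[A_\mu,\Psi]_\star$. A bundle with connection is given by transition matrices $\Omega_1,\Omega_2$ (finite sums of plane waves) with $\Omega_1(\sigma^2+2\pi)\star\Omega_2=\Omega_2(\sigma^1+2\pi)\star\Omega_1$ and a potential with $\partial_\mu\Omega_\alpha-iA_\mu(\sigma^\alpha+2\pi)\star\Omega_\alpha=-i\Omega_\alpha\star A_\mu$; its sections are the smooth $\varphi$ with $\varphi(\sigma^\alpha+2\pi)=\Omega_\alpha\star\varphi$, a right module by $\varphi U_\mu=\varphi\star e^{i\sigma^\mu}$. There is a Seiberg–Witten map from a bundle with connection at $\theta$ to one at $\theta'$ if: the potentials and the transition matrices are joined by a solution, analytic in $t$ off a finite set $P\subset\mathbb C$ with $\theta,\theta'\notin P$, of $$\frac{dA_\kappa}{dt}=-\frac\pi2\,\epsilon^{\alpha\beta}\{A_\alpha,\partial_\beta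 A_\kappa+F_{\beta\kappa}\}_\star,\qquad \frac{d\Omega}{dt}=-\frac\pi2\,\epsilon^{\alpha\beta}\{A_\alpha,\partial_\beta\Omega+D_\beta\Omega\}_\star\qquad(\epsilon^{12}=-\epsilon^{21}=1),$$ where $A$ is polynomial in $\sigma$ of bounded degree; and there are linear bijections between the spaces of sections, in the fundamental and in the adjoint representation, under which corresponding sections are joined by smooth families, for real $t\notin P$, solving $$\frac{d\varphi}{dt}=-\frac\pi2\,\epsilon^{\alpha\beta}A_\alpha\star(\partial_\beta\varphi+D_\beta\varphi)-\pi C(\varphi),\qquad\frac{d\Psi}{dt}=-\frac\pi2\,\epsilon^{\alpha\beta}\{A_\alpha,\partial_\beta\Psi+D_\beta\Psi\}_\star-\pi C'(\Psi)$$ for some covariant terms $C,C'$ (linear combinations of iterated covariant derivatives with coefficients analytic in $t$) with $C'(\Omega_\alpha)=0$. For $N\ge1$ coprime to $m$ the standard bundle has $\Omega_1=e^{im\sigma^2/N}U$, $\Omega_2=V$ ($U=\mathrm{diag}(e^{2\pi ikm/N})_{k=1}^N$, $V$ the cyclic shift), $A_1=0$, $A_2=\frac{m\sigma^1}{2\pi(N-m\theta)}$.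 A module with connection $M'$ over $T_{-\theta'}$ is a Seiberg–Witten image of $M$ over $T_{-\theta}$, written $M'\in SW_\theta^{\theta'}(M)$, if for some $k\in\mathbb Z$, $M$ is the module of sections with connection of a standard bundle at $\theta+k$ (as $T_{-(\theta+k)}=T_{-\theta}$) and $M'$ that of a bundle with connection at $\theta'+k$ to which it has a Seiberg–Witten map, where for this $(N,m)$ and $k$ the values $N$ and $2N$ are excluded for $m(\theta+k)$ and $m(\theta'+k)$. **Theorem.** 1. For all $s\in\mathbb Z$, $\theta\in\mathbb R$ (with $s\neq\theta$ for the first), $\mathcal E_{0,1}^{1/(s-\theta)}$, $\mathcal E_{1,0}^{\theta+1}$ and $\mathcal E_{1,0}^{-\theta}$ are complete Morita equivalence bimodules. 2. For coprime $n,m$ with $n-m\theta\ne0$, as modules with connection, $$\mathcal E^\theta_{n,m}\otimes\mathcal E_{0,1}^{1/(s-\theta)}\cong\mathcal E_{m,-n+ms}^{1/(s-\theta)}\ (s\ne\theta),\quad \mathcal E^\theta_{n,m}\otimes\mathcal E_{1,0}^{\theta+1}\cong\mathcal E_{n+m,m}^{\theta+1},\quad \mathcal E^\theta_{n,m}\otimes\mathcal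 E_{1,0}^{-\theta}\cong\mathcal E_{n,-m}^{-\theta}.$$ 3. For coprime $n,m$ with $n-m\theta\ne0\ne n-m\theta'$, the Seiberg–Witten images $SW_\theta^{\theta'}$ of $\mathcal E_{n,m}^\theta$ are exactly the modules with connection isomorphic to $\mathcal E_{n,m}^{\theta'}$; moreover every $k\in\mathbb Z$ with $n+km>0$ and $m(\theta+k)\ne2(n+km)\ne m(\theta'+k)$ can be used. 4. The squares commute: if $M'\in SW_\theta^{\theta'}(M)$, then (for $s\ne\theta,\theta'$ in the first case) $$M'\otimes\mathcal E_{0,1}^{\frac1{s-\theta'}}\in SW_{\frac1{s-\theta}}^{\frac1{s-\theta'}}\big(M\otimes\mathcal E_{0,1}^{\frac1{s-\theta}}\big),\quad M'\otimes\mathcal E_{1,0}^{\theta'+1}\in SW_{\theta+1}^{\theta'+1}\big(M\otimes\mathcal E_{1,0}^{\theta+1}\big),\quad M'\otimes\mathcal E_{1,0}^{-\theta'}\in SW_{-\theta}^{-\theta'}\big(M\otimes\mathcal E_{1,0}^{-\theta}\big).$$ 5. The equivalence bimodules, as right modules with connection, are themselves related: $\mathcal E_{0,1}^{1/(s-\theta')}$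 is an $SW$ image of $\mathcal E_{0,1}^{1/(s-\theta)}$ ($s\neq\theta,\theta'$), $\mathcal E_{1,0}^{\theta'+1}$ of $\mathcal E_{1,0}^{\theta+1}$, and $\mathcal E_{1,0}^{-\theta'}$ of $\mathcal E_{1,0}^{-\theta}$. 6. For $g=\begin{pmatrix}a&b\\c&d\end{pmatrix}$ call $N$ over $T_{-\theta_1}$ a $g$-dual of $M$ over $T_{-\theta}$ if it arises from $M$ by successive tensoring with these bimodules, where $g$ is the product of the corresponding matrices $\begin{pmatrix}0&1\\-1&s\end{pmatrix}$, $\begin{pmatrix}1&1\\0&1\end{pmatrix}$, $\begin{pmatrix}1&0\\0&-1\end{pmatrix}$. Then for every $g\in GL(2,\mathbb Z)$ and every $M$ over $T_{-\theta}$ with $c\theta+d\ne0$ a $g$-dual exists; every $g$-dual has $g\in GL(2,\mathbb Z)$, $c\theta+d\ne0$ and $\theta_1=\frac{a\theta+b}{c\theta+d}$; every $g$-dual of $\mathcal E_{n,m}^\theta$ ($n,m$ coprime) is isomorphic to $\mathcal E_{an+bm,\,cn+dm}^{\theta_1}$; and Seiberg–Witten maps are compatible with the whole group: if $M'\in SW_\theta^{\theta'}(M)$,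 $N$ over $T_{-\theta_1}$ is a $g$-dual of $M$ and $N'$ over $T_{-\theta_1'}$ is a $g$-dual of $M'$, then $N'\in SW_{\theta_1}^{\theta_1'}(N)$. -/

import Mathlib

noncomputable section

namespace NCT

open Complex MulOpposite
open scoped SchwartzMap TensorProduct ContDiff

/-! ### Smooth noncommutative tori -/

/-- The weight `(1+|p|)(1+|q|)` on `ℤ²`. -/
def wt (g : ℤ × ℤ) : ℝ := (1 + |(g.1 : ℝ)|) * (1 + |(g.2 : ℝ)|)

lemma wt_pos (g : ℤ × ℤ) : 0 < wt g := by unfold wt; positivity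

lemma one_le_wt (g : ℤ × ℤ) : 1 ≤ wt g := by
  unfold wt; nlinarith [abs_nonneg (g.1 : ℝ), abs_nonneg (g.2 : ℝ)]

lemma wt_add (g h : ℤ × ℤ) : wt (g + h) ≤ wt g * wt h := by
  have key : ∀ x y : ℝ, 1 + |x + y| ≤ (1 + |x|) * (1 + |y|) := fun x y => by
    nlinarith [abs_add_le x y, abs_nonneg x, abs_nonneg y]
  have h1 := key g.1 h.1
  have h2 := key g.2 h.2
  unfold wt
  push_cast [Prod.fst_add, Prod.snd_add]
  calc _ ≤ ((1 + |(g.1 : ℝ)|) * (1 + |(h.1 : ℝ)|)) * ((1 + |(g.2 : ℝ)|) * (1 + |(h.2 : ℝ)|)) :=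
        mul_le_mul h1 h2 (by positivity) (by positivity)
    _ = _ := by ring

lemma summable_wt : Summable fun g : ℤ × ℤ => (wt g ^ 2)⁻¹ := by
  have h0 : Summable fun n : ℕ => ((1 + (n : ℝ)) ^ 2)⁻¹ := by
    have := (summable_nat_add_iff 1).2 (Real.summable_nat_pow_inv.2 (one_lt_two))
    refine this.congr fun n => ?_
    push_cast; ring
  have h1 : Summable fun p : ℤ => ((1 + |(p : ℝ)|) ^ 2)⁻¹ := by
    refine Summable.of_nat_of_neg ?_ ?_
    · simpa using h0
    · simpa using h0
  refine (h1.mul_of_nonneg h1 (fun _ => by positivity) (fun _ => by positivity)).congr fun g => ?_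
  unfold wt
  rw [mul_pow, mul_inv]

/-- Rapidly decreasing (Schwartz) double sequences. -/
def rapid : Submodule ℂ (ℤ × ℤ → ℂ) where
  carrier := {a | ∀ N : ℕ, ∃ C : ℝ, ∀ g, wt g ^ N * ‖a g‖ ≤ C}
  zero_mem' := fun N => ⟨0, fun g => by simp⟩
  add_mem' := by
    intro a b ha hb N
    obtain ⟨C, hC⟩ := ha N
    obtain ⟨C', hC'⟩ := hb N
    refine ⟨C + C', fun g => ?_⟩
    have := mul_le_mul_of_nonneg_left (norm_add_le (a g) (b g)) (pow_nonneg (wt_pos g).le N)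
    have h1 := hC g
    have h2 := hC' g
    simp only [Pi.add_apply]
    linarith
  smul_mem' := by
    intro c a ha N
    obtain ⟨C, hC⟩ := ha N
    refine ⟨‖c‖ * C, fun g => ?_⟩
    have := mul_le_mul_of_nonneg_left (hC g) (norm_nonneg c)
    simp only [Pi.smul_apply, smul_eq_mul, norm_mul]
    linarith

lemma rapid_summable {a : ℤ × ℤ → ℂ} (ha : a ∈ rapid) (N : ℕ) :
    Summable fun g => wt g ^ N * ‖a g‖ := by
  obtain ⟨C, hC⟩ := ha (N + 2)
  refine Summable.of_nonneg_of_le (fun g => mul_nonneg (pow_nonneg (wt_pos g).le N) (norm_nonneg _))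
    (fun g => ?_) (summable_wt.mul_left C)
  have h := hC g
  have hw := wt_pos g
  rw [← div_eq_mul_inv, le_div_iff₀ (by positivity)]
  calc _ = wt g ^ (N + 2) * ‖a g‖ := by ring
    _ ≤ C := h

lemma rapid_norm {a : ℤ × ℤ → ℂ} (ha : a ∈ rapid) : Summable fun g => ‖a g‖ := by
  simpa using rapid_summable ha 0

/-- Multiplying by unimodular phases preserves rapid decrease. -/
lemma rapid_of_norm_le {a b : ℤ × ℤ → ℂ} (ha : a ∈ rapid) (K : ℝ) (N0 : ℕ)
    (h : ∀ g, ‖b g‖ ≤ K * wt g ^ N0 * ‖a g‖) : b ∈ rapid := by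
  intro N
  obtain ⟨C, hC⟩ := ha (N + N0)
  refine ⟨|K| * C, fun g => ?_⟩
  have hw := wt_pos g
  calc wt g ^ N * ‖b g‖ ≤ wt g ^ N * (K * wt g ^ N0 * ‖a g‖) := by gcongr; exact h g
    _ = K * (wt g ^ (N + N0) * ‖a g‖) := by ring
    _ ≤ |K| * (wt g ^ (N + N0) * ‖a g‖) := by gcongr; exact le_abs_self K
    _ ≤ |K| * C := by gcongr; exact hC g

/-- Fubini for double sums over `ℤ²`, after the substitution `k = g + h`. -/
lemma tsum_tsum_shift {F : ℤ × ℤ → ℤ × ℤ → ℂ}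
    (hF : Summable fun x : (ℤ × ℤ) × (ℤ × ℤ) => F x.1 x.2) :
    ∑' g, ∑' h, F g h = ∑' k, ∑' g, F g (k - g) := by
  let e : (ℤ × ℤ) × (ℤ × ℤ) ≃ (ℤ × ℤ) × (ℤ × ℤ) :=
    { toFun := fun x => (x.2, x.1 - x.2)
      invFun := fun x => (x.1 + x.2, x.1)
      left_inv := fun x => by simp
      right_inv := fun x => by simp }
  have h1 : Summable ((fun x : (ℤ × ℤ) × (ℤ × ℤ) => F x.1 x.2) ∘ e) := (e.summable_iff).2 hF
  rw [← hF.tsum_prod, ← e.tsum_eq, Summable.tsum_prod (f := fun x => F (e x).1 (e x).2) h1]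
  rfl

lemma summable_prod_bound {a b : ℤ × ℤ → ℂ} (ha : Summable fun g => ‖a g‖)
    (hb : Summable fun g => ‖b g‖) {B : ℤ × ℤ → ℤ × ℤ → ℂ} {K : ℝ} (hB : ∀ g h, ‖B g h‖ ≤ K) :
    Summable fun x : (ℤ × ℤ) × (ℤ × ℤ) => a x.1 * b x.2 * B x.1 x.2 := by
  refine Summable.of_norm_bounded
    ((ha.mul_of_nonneg hb (fun _ => norm_nonneg _) (fun _ => norm_nonneg _)).mul_right K) fun x => ?_
  rw [norm_mul, norm_mul]
  gcongr
  exact hB _ _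

/-- The phase `σ(g,h) = e^{-2πi ϑ q p'}` for `g = (p,q)`, `h = (p',q')`, so that
`U₁^p U₂^q · U₁^p' U₂^q' = σ(g,h) U₁^(p+p') U₂^(q+q')` when `U₁ U₂ = e^{2πiϑ} U₂ U₁`. -/
def phase (ϑ : ℝ) (g h : ℤ × ℤ) : ℂ := exp (-(2 * Real.pi * I * ϑ * g.2 * h.1))

@[simp] lemma norm_phase (ϑ : ℝ) (g h : ℤ × ℤ) : ‖phase ϑ g h‖ = 1 := by
  unfold phase
  rw [show -(2 * (Real.pi : ℂ) * I * ϑ * g.2 * h.1)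
    = ((-(2 * Real.pi * ϑ * g.2 * h.1) : ℝ) : ℂ) * I by push_cast; ring]
  exact norm_exp_ofReal_mul_I _

lemma phase_cocycle (ϑ : ℝ) (g h k : ℤ × ℤ) :
    phase ϑ g (h + k) * phase ϑ h k = phase ϑ g h * phase ϑ (g + h) k := by
  unfold phase
  rw [← exp_add, ← exp_add]
  congr 1
  push_cast [Prod.fst_add, Prod.snd_add]
  ring

/-- The smooth noncommutative torus `T_ϑ`: formal series `∑ a(p,q) U₁^p U₂^q` with rapidly
decreasing coefficients, `U₁ U₂ = e^{2πiϑ} U₂ U₁`. -/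
def Torus (_ϑ : ℝ) : Type := rapid

namespace Torus

variable {ϑ : ℝ}

instance : AddCommGroup (Torus ϑ) := inferInstanceAs (AddCommGroup rapid)
instance : Module ℂ (Torus ϑ) := inferInstanceAs (Module ℂ rapid)

/-- The coefficients of an element. -/
def coeff (a : Torus ϑ) : ℤ × ℤ → ℂ := Subtype.val (p := fun x => x ∈ rapid) a

/-- The element with given coefficients. -/
def mk (a : ℤ × ℤ → ℂ) (ha : a ∈ rapid) : Torus ϑ := (⟨a, ha⟩ : rapid)

@[simp] lemma coeff_mk (a : ℤ × ℤ → ℂ) (ha : a ∈ rapid) : (mk a ha : Torus ϑ).coeff = a := rfl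
lemma coeff_mem (a : Torus ϑ) : a.coeff ∈ rapid := Subtype.property (p := fun x => x ∈ rapid) a
@[ext] lemma ext {a b : Torus ϑ} (h : ∀ g, a.coeff g = b.coeff g) : a = b :=
  Subtype.ext (p := fun x => x ∈ rapid) (funext h)
@[simp] lemma coeff_add (a b : Torus ϑ) (g : ℤ × ℤ) : (a + b).coeff g = a.coeff g + b.coeff g := rfl
@[simp] lemma coeff_neg (a : Torus ϑ) (g : ℤ × ℤ) : (-a).coeff g = -a.coeff g := rfl
@[simp] lemma coeff_zero (g : ℤ × ℤ) : (0 : Torus ϑ).coeff g = 0 := rfl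
@[simp] lemma coeff_smul (c : ℂ) (a : Torus ϑ) (g : ℤ × ℤ) : (c • a).coeff g = c * a.coeff g := rfl

lemma norm_summable (a : Torus ϑ) : Summable fun g => ‖a.coeff g‖ := rapid_norm a.coeff_mem

lemma norm_bounded (a : Torus ϑ) : ∃ C, ∀ g, ‖a.coeff g‖ ≤ C := by
  obtain ⟨C, hC⟩ := a.coeff_mem 0
  exact ⟨C, fun g => by simpa using hC g⟩

/-- Coefficients of the product. -/
def conv (ϑ : ℝ) (a b : ℤ × ℤ → ℂ) (k : ℤ × ℤ) : ℂ :=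
  ∑' g, a g * b (k - g) * phase ϑ g (k - g)

lemma conv_term_summable {a b : ℤ × ℤ → ℂ} (ha : a ∈ rapid) (hb : b ∈ rapid) (k : ℤ × ℤ) :
    Summable fun g => ‖a g * b (k - g) * phase ϑ g (k - g)‖ := by
  obtain ⟨C, hC⟩ := hb 0
  refine Summable.of_nonneg_of_le (fun _ => norm_nonneg _) (fun g => ?_)
    ((rapid_norm ha).mul_right C)
  rw [norm_mul, norm_mul, norm_phase, mul_one]
  gcongr
  simpa using hC (k - g)

lemma conv_mem {a b : ℤ × ℤ → ℂ} (ha : a ∈ rapid) (hb : b ∈ rapid) : conv ϑ a b ∈ rapid := by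
  intro N
  obtain ⟨C, hC⟩ := hb N
  refine ⟨∑' g, wt g ^ N * ‖a g‖ * C, fun k => ?_⟩
  have hs := conv_term_summable (ϑ := ϑ) ha hb k
  have h1 : ‖conv ϑ a b k‖ ≤ ∑' g, ‖a g * b (k - g) * phase ϑ g (k - g)‖ := norm_tsum_le_tsum_norm hs
  calc wt k ^ N * ‖conv ϑ a b k‖ ≤ wt k ^ N * ∑' g, ‖a g * b (k - g) * phase ϑ g (k - g)‖ := by
        have := wt_pos k
        gcongr
    _ = ∑' g, wt k ^ N * ‖a g * b (k - g) * phase ϑ g (k - g)‖ := tsum_mul_left.symm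
    _ ≤ _ := by
        refine Summable.tsum_le_tsum (fun g => ?_) (hs.mul_left _)
          ((rapid_summable ha N).mul_right C)
        rw [norm_mul, norm_mul, norm_phase, mul_one]
        have hk : wt k ^ N ≤ wt g ^ N * wt (k - g) ^ N := by
          rw [← mul_pow]
          have := wt_add g (k - g)
          rw [add_sub_cancel] at this
          exact pow_le_pow_left₀ (wt_pos k).le this N
        have h2 := hC (k - g)
        have := wt_pos g
        calc wt k ^ N * (‖a g‖ * ‖b (k - g)‖)
            ≤ (wt g ^ N * wt (k - g) ^ N) * (‖a g‖ * ‖b (k - g)‖) := by gcongr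
          _ = wt g ^ N * ‖a g‖ * (wt (k - g) ^ N * ‖b (k - g)‖) := by ring
          _ ≤ _ := by gcongr

instance : Mul (Torus ϑ) := ⟨fun a b => mk (conv ϑ a.coeff b.coeff) (conv_mem a.coeff_mem b.coeff_mem)⟩

lemma coeff_mul (a b : Torus ϑ) (k : ℤ × ℤ) :
    (a * b).coeff k = ∑' g, a.coeff g * b.coeff (k - g) * phase ϑ g (k - g) := rfl

lemma mul_term_summable (a b : Torus ϑ) (k : ℤ × ℤ) :
    Summable fun g => a.coeff g * b.coeff (k - g) * phase ϑ g (k - g) :=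
  (conv_term_summable a.coeff_mem b.coeff_mem k).of_norm

lemma single_mem (g : ℤ × ℤ) : (Pi.single g 1 : ℤ × ℤ → ℂ) ∈ rapid := by
  intro N
  refine ⟨wt g ^ N, fun h => ?_⟩
  have := wt_pos g
  by_cases hh : h = g
  · subst hh; simp
  · simp only [Pi.single_apply, hh, if_false, norm_zero, mul_zero]; positivity

/-- The monomial `U₁^p U₂^q`. -/
def monomial (g : ℤ × ℤ) : Torus ϑ := mk (Pi.single g 1) (single_mem g)

instance : One (Torus ϑ) := ⟨monomial 0⟩

lemma coeff_one (g : ℤ × ℤ) : (1 : Torus ϑ).coeff g = if g = 0 then 1 else 0 := by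
  change (Pi.single (0 : ℤ × ℤ) (1 : ℂ) : ℤ × ℤ → ℂ) g = _
  rw [Pi.single_apply]

/-- Rearrangement of a twisted double sum: the common source of associativity of the product and of
all the module axioms below. -/
lemma twisted_sum (a b : Torus ϑ) {f : ℤ × ℤ → ℂ} {K : ℝ} (hf : ∀ g, ‖f g‖ ≤ K) :
    ∑' g, ∑' h, a.coeff g * b.coeff h * (phase ϑ g h * f (g + h))
      = ∑' k, (a * b).coeff k * f k := by
  rw [tsum_tsum_shift]
  · refine tsum_congr fun k => ?_
    rw [coeff_mul, ← tsum_mul_right]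
    refine tsum_congr fun g => ?_
    rw [add_sub_cancel]
    ring
  · refine summable_prod_bound (B := fun g h => phase ϑ g h * f (g + h))
      a.norm_summable b.norm_summable (K := K) fun g h => ?_
    rw [norm_mul, norm_phase, one_mul]
    exact hf _

lemma mul_assoc' (a b c : Torus ϑ) : a * b * c = a * (b * c) := by
  obtain ⟨K, hK⟩ := c.norm_bounded
  ext k
  have h := twisted_sum a b (f := fun g => c.coeff (k - g) * phase ϑ g (k - g)) (K := K)
    (fun g => by rw [norm_mul, norm_phase, mul_one]; exact hK _)
  have h1 : (a * b * c).coeff k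
      = ∑' g, (a * b).coeff g * (c.coeff (k - g) * phase ϑ g (k - g)) :=
    (coeff_mul (a * b) c k).trans (tsum_congr fun g => mul_assoc _ _ _)
  rw [h1, ← h, coeff_mul a (b * c) k]
  refine tsum_congr fun g => ?_
  rw [coeff_mul b c, ← tsum_mul_left, ← tsum_mul_right]
  refine tsum_congr fun h => ?_
  have e1 : k - g - h = k - (g + h) := by abel
  have e2 := phase_cocycle ϑ g h (k - (g + h))
  rw [show h + (k - (g + h)) = k - g by abel] at e2
  rw [e1]
  linear_combination (-a.coeff g * b.coeff h * c.coeff (k - (g + h))) * e2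

lemma phase_zero_left (h : ℤ × ℤ) : phase ϑ 0 h = 1 := by simp [phase]
lemma phase_zero_right (h : ℤ × ℤ) : phase ϑ h 0 = 1 := by simp [phase]

lemma one_mul' (a : Torus ϑ) : 1 * a = a := by
  ext k
  rw [coeff_mul, tsum_eq_single 0]
  · rw [coeff_one, if_pos rfl, phase_zero_left, sub_zero, one_mul, mul_one]
  · intro g hg; rw [coeff_one, if_neg hg, zero_mul, zero_mul]

lemma mul_one' (a : Torus ϑ) : a * 1 = a := by
  ext k
  rw [coeff_mul, tsum_eq_single k]
  · rw [sub_self, coeff_one, if_pos rfl, phase_zero_right, mul_one, mul_one]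
  · intro g hg
    rw [coeff_one, if_neg (sub_ne_zero.2 (Ne.symm hg)), mul_zero, zero_mul]

lemma zero_mul' (a : Torus ϑ) : 0 * a = 0 := by
  ext k
  rw [coeff_mul, coeff_zero]
  simp_rw [coeff_zero, zero_mul]
  exact tsum_zero

lemma mul_zero' (a : Torus ϑ) : a * 0 = 0 := by
  ext k
  rw [coeff_mul, coeff_zero]
  simp_rw [coeff_zero, mul_zero, zero_mul]
  exact tsum_zero

lemma mul_add' (a b c : Torus ϑ) : a * (b + c) = a * b + a * c := by
  ext k
  rw [coeff_add, coeff_mul, coeff_mul, coeff_mul,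
    ← (mul_term_summable a b k).tsum_add (mul_term_summable a c k)]
  exact tsum_congr fun g => by rw [coeff_add]; ring

lemma add_mul' (a b c : Torus ϑ) : (a + b) * c = a * c + b * c := by
  ext k
  rw [coeff_add, coeff_mul, coeff_mul, coeff_mul,
    ← (mul_term_summable a c k).tsum_add (mul_term_summable b c k)]
  exact tsum_congr fun g => by rw [coeff_add]; ring

instance : Ring (Torus ϑ) :=
  { (inferInstance : AddCommGroup (Torus ϑ)) with
    mul := (· * ·)
    one := 1
    mul_assoc := mul_assoc'
    one_mul := one_mul'
    mul_one := mul_one'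
    zero_mul := zero_mul'
    mul_zero := mul_zero'
    left_distrib := mul_add'
    right_distrib := add_mul' }

instance : Algebra ℂ (Torus ϑ) := Algebra.ofModule
  (fun c a b => by
    ext k
    rw [coeff_smul, coeff_mul, coeff_mul, ← tsum_mul_left]
    exact tsum_congr fun g => by rw [coeff_smul]; ring)
  (fun c a b => by
    ext k
    rw [coeff_smul, coeff_mul, coeff_mul, ← tsum_mul_left]
    exact tsum_congr fun g => by rw [coeff_smul]; ring)

/-- The index `p` (for `μ = 0`) or `q` (for `μ = 1`) of a monomial `U₁^p U₂^q`. -/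
def idx (μ : Fin 2) (g : ℤ × ℤ) : ℤ := if μ = 0 then g.1 else g.2

lemma idx_le_wt (μ : Fin 2) (g : ℤ × ℤ) : |(idx μ g : ℝ)| ≤ wt g := by
  unfold idx wt
  split_ifs <;> nlinarith [abs_nonneg (g.1 : ℝ), abs_nonneg (g.2 : ℝ)]

/-- The canonical derivations: `∂_μ U_ν = i δ_{μν} U_ν`. -/
def der (μ : Fin 2) : Torus ϑ →ₗ[ℂ] Torus ϑ where
  toFun a := mk (fun g => I * idx μ g * a.coeff g)
    (rapid_of_norm_le a.coeff_mem 1 1 fun g => by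
      rw [norm_mul, norm_mul, norm_I, one_mul, one_mul, pow_one, Complex.norm_intCast]
      gcongr
      exact idx_le_wt μ g)
  map_add' a b := by ext g; simp; ring
  map_smul' c a := by ext g; simp; ring

@[simp] lemma coeff_der (μ : Fin 2) (a : Torus ϑ) (g : ℤ × ℤ) :
    (der μ a).coeff g = I * idx μ g * a.coeff g := rfl

lemma der_mul (μ : Fin 2) (a b : Torus ϑ) : der μ (a * b) = der μ a * b + a * der μ b := by
  ext k
  rw [coeff_add, coeff_der, coeff_mul, coeff_mul, coeff_mul, ← tsum_mul_left,
    ← (mul_term_summable (der μ a) b k).tsum_add (mul_term_summable a (der μ b) k)]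
  refine tsum_congr fun g => ?_
  have : (idx μ k : ℂ) = idx μ g + idx μ (k - g) := by
    unfold idx; split_ifs <;> simp
  rw [coeff_der, coeff_der, this]
  ring

end Torus

/-! ### Schwartz functions -/

lemma iteratedDeriv_cexp_real (c : ℂ) (n : ℕ) :
    iteratedDeriv n (fun x : ℝ => exp (c * x)) = fun x : ℝ => c ^ n * exp (c * x) := by
  induction n with
  | zero => simp
  | succ n ih =>
    rw [iteratedDeriv_succ, ih]
    funext x
    have h : HasDerivAt (fun x : ℝ => c ^ n * exp (c * x)) (c ^ n * (exp (c * x) * (c * 1))) x :=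
      (((Complex.ofRealCLM.hasDerivAt (x := x)).const_mul c).cexp).const_mul (c ^ n)
    rw [h.deriv]
    ring

lemma iteratedFDeriv_translate (f : 𝓢(ℝ, ℂ)) (a : ℝ) (n : ℕ) (x : ℝ) :
    iteratedFDeriv ℝ n (fun x => f (x + a)) x = iteratedFDeriv ℝ n f (x + a) :=
  iteratedFDeriv_comp_add_right n a x

/-- The general term `b(p,q) e^{2πi q v x} f_p(x + p u)`. -/
def sTerm (b : ℤ × ℤ → ℂ) (u v : ℝ) (f : ℤ → 𝓢(ℝ, ℂ)) (g : ℤ × ℤ) (x : ℝ) : ℂ :=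
  b g * (exp (2 * Real.pi * I * g.2 * v * x) * f g.1 (x + g.1 * u))

lemma sTerm_contDiff (b : ℤ × ℤ → ℂ) (u v : ℝ) (f : ℤ → 𝓢(ℝ, ℂ)) (g : ℤ × ℤ) :
    ContDiff ℝ ∞ (sTerm b u v f g) := by
  unfold sTerm
  refine contDiff_const.mul (ContDiff.mul ?_ ?_)
  · exact (contDiff_const.mul Complex.ofRealCLM.contDiff).cexp
  · exact ((f g.1).smooth ⊤).comp (contDiff_id.add contDiff_const)

lemma sTerm_bound {u v : ℝ} {f : ℤ → 𝓢(ℝ, ℂ)} (hf : (Set.range f).Finite) (k n : ℕ) :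
    ∃ K : ℝ, ∀ (b : ℤ × ℤ → ℂ) (g : ℤ × ℤ) (x : ℝ),
      ‖x‖ ^ k * ‖iteratedFDeriv ℝ n (sTerm b u v f g) x‖ ≤ K * (wt g ^ (k + n) * ‖b g‖) := by
  have hC : ∀ k' n' : ℕ, ∃ C : ℝ, 0 ≤ C ∧
      ∀ p x, ‖x‖ ^ k' * ‖iteratedFDeriv ℝ n' (f p) x‖ ≤ C := by
    intro k' n'
    choose C hC0 hC using fun φ : 𝓢(ℝ, ℂ) => φ.decay k' n'
    refine ⟨∑ φ ∈ hf.toFinset, C φ, Finset.sum_nonneg fun φ _ => (hC0 φ).le, fun p x => ?_⟩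
    exact (hC (f p) x).trans (Finset.single_le_sum (f := C) (fun φ _ => (hC0 φ).le)
      (hf.mem_toFinset.2 ⟨p, rfl⟩))
  choose C hC0 hC using hC
  refine ⟨∑ i ∈ Finset.range (n + 1), (n.choose i : ℝ) * (2 * Real.pi * |v|) ^ i *
    (2 ^ (k - 1) * (C k (n - i) + |u| ^ k * C 0 (n - i))), fun b g x => ?_⟩
  have hw := wt_pos g
  have hw1 := one_le_wt g
  have hp : |(g.1 : ℝ)| ≤ wt g := Torus.idx_le_wt 0 g
  have hq : |(g.2 : ℝ)| ≤ wt g := Torus.idx_le_wt 1 g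
  have hsm1 : ContDiff ℝ ∞ (fun x : ℝ => exp (2 * Real.pi * I * g.2 * v * x)) :=
    (contDiff_const.mul Complex.ofRealCLM.contDiff).cexp
  have hsm2 : ContDiff ℝ ∞ (fun x : ℝ => f g.1 (x + g.1 * u)) :=
    ((f g.1).smooth ⊤).comp (contDiff_id.add contDiff_const)
  have h0 : iteratedFDeriv ℝ n (sTerm b u v f g) x = b g • iteratedFDeriv ℝ n
      (fun x : ℝ => exp (2 * Real.pi * I * g.2 * v * x) * f g.1 (x + g.1 * u)) x := by
    have : sTerm b u v f g = b g •
      (fun x : ℝ => exp (2 * Real.pi * I * g.2 * v * x) * f g.1 (x + g.1 * u)) := rfl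
    rw [this, iteratedFDeriv_const_smul_apply]
    exact ((hsm1.mul hsm2).of_le (mod_cast le_top)).contDiffAt
  have h1 := norm_iteratedFDeriv_mul_le hsm1 hsm2 x (n := n) (mod_cast le_top)
  rw [h0, norm_smul]
  have hterm : ∀ i ∈ Finset.range (n + 1),
      ‖x‖ ^ k * ((n.choose i : ℝ) *
        ‖iteratedFDeriv ℝ i (fun x : ℝ => exp (2 * Real.pi * I * g.2 * v * x)) x‖ *
        ‖iteratedFDeriv ℝ (n - i) (fun x : ℝ => f g.1 (x + g.1 * u)) x‖) ≤
      (n.choose i : ℝ) * (2 * Real.pi * |v|) ^ i *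
        (2 ^ (k - 1) * (C k (n - i) + |u| ^ k * C 0 (n - i))) * wt g ^ (k + n) := by
    intro i hi
    have hi' : i ≤ n := Nat.lt_succ_iff.1 (Finset.mem_range.1 hi)
    have e1 : ‖iteratedFDeriv ℝ i (fun x : ℝ => exp (2 * Real.pi * I * g.2 * v * x)) x‖
        ≤ (2 * Real.pi * |v|) ^ i * wt g ^ n := by
      rw [norm_iteratedFDeriv_eq_norm_iteratedDeriv, iteratedDeriv_cexp_real, norm_mul, norm_pow]
      have : ‖exp (2 * Real.pi * I * g.2 * v * x)‖ = 1 := by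
        rw [show (2 : ℂ) * Real.pi * I * g.2 * v * x
          = ((2 * Real.pi * g.2 * v * x : ℝ) : ℂ) * I by push_cast; ring]
        exact norm_exp_ofReal_mul_I _
      rw [this, mul_one]
      have h2 : ‖(2 : ℂ) * Real.pi * I * g.2 * v‖ = (2 * Real.pi * |v|) * |(g.2 : ℝ)| := by
        simp [abs_of_pos Real.pi_pos]
        ring
      rw [h2, mul_pow]
      have : |(g.2 : ℝ)| ^ i ≤ wt g ^ n :=
        (pow_le_pow_left₀ (abs_nonneg _) hq i).trans (pow_le_pow_right₀ hw1 hi')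
      gcongr
    have e2 : ‖x‖ ^ k * ‖iteratedFDeriv ℝ (n - i) (fun x : ℝ => f g.1 (x + g.1 * u)) x‖
        ≤ 2 ^ (k - 1) * (C k (n - i) + |u| ^ k * C 0 (n - i)) * wt g ^ k := by
      rw [iteratedFDeriv_translate]
      set y := x + g.1 * u with hy
      set d := ‖iteratedFDeriv ℝ (n - i) (f g.1) y‖ with hd
      have hx : ‖x‖ ≤ ‖y‖ + wt g * |u| := by
        have : x = y - g.1 * u := by rw [hy]; ring
        rw [this]
        refine (norm_sub_le _ _).trans ?_
        rw [Real.norm_eq_abs (g.1 * u), abs_mul]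
        gcongr
      have hxk : ‖x‖ ^ k ≤ 2 ^ (k - 1) * (‖y‖ ^ k + (wt g * |u|) ^ k) :=
        (pow_le_pow_left₀ (norm_nonneg _) hx k).trans
          (add_pow_le (norm_nonneg _) (by positivity) k)
      have a1 := hC k (n - i) g.1 y
      have a2 : d ≤ C 0 (n - i) := by simpa using hC 0 (n - i) g.1 y
      have hwk : 1 ≤ wt g ^ k := one_le_pow₀ hw1
      calc ‖x‖ ^ k * d ≤ 2 ^ (k - 1) * (‖y‖ ^ k + (wt g * |u|) ^ k) * d := by gcongr
        _ = 2 ^ (k - 1) * (‖y‖ ^ k * d + wt g ^ k * (|u| ^ k * d)) := by rw [mul_pow]; ring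
        _ ≤ 2 ^ (k - 1) * (wt g ^ k * C k (n - i) + wt g ^ k * (|u| ^ k * C 0 (n - i))) := by
          refine mul_le_mul_of_nonneg_left (add_le_add
            (a1.trans (le_mul_of_one_le_left (hC0 _ _) hwk)) ?_) (by positivity)
          gcongr
        _ = _ := by ring
    calc _ = (n.choose i : ℝ) *
        ‖iteratedFDeriv ℝ i (fun x : ℝ => exp (2 * Real.pi * I * g.2 * v * x)) x‖ *
        (‖x‖ ^ k * ‖iteratedFDeriv ℝ (n - i) (fun x : ℝ => f g.1 (x + g.1 * u)) x‖) := by ring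
      _ ≤ (n.choose i : ℝ) * ((2 * Real.pi * |v|) ^ i * wt g ^ n) *
        (2 ^ (k - 1) * (C k (n - i) + |u| ^ k * C 0 (n - i)) * wt g ^ k) := by
          gcongr
      _ = _ := by rw [pow_add]; ring
  calc ‖x‖ ^ k * (‖b g‖ * _) ≤ ‖x‖ ^ k * (‖b g‖ * ∑ i ∈ Finset.range (n + 1), (n.choose i : ℝ) *
        ‖iteratedFDeriv ℝ i (fun x : ℝ => exp (2 * Real.pi * I * g.2 * v * x)) x‖ *
        ‖iteratedFDeriv ℝ (n - i) (fun x : ℝ => f g.1 (x + g.1 * u)) x‖) := by gcongr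
    _ = ‖b g‖ * ∑ i ∈ Finset.range (n + 1), ‖x‖ ^ k * ((n.choose i : ℝ) *
        ‖iteratedFDeriv ℝ i (fun x : ℝ => exp (2 * Real.pi * I * g.2 * v * x)) x‖ *
        ‖iteratedFDeriv ℝ (n - i) (fun x : ℝ => f g.1 (x + g.1 * u)) x‖) := by
          rw [← Finset.mul_sum]; ring
    _ ≤ ‖b g‖ * ∑ i ∈ Finset.range (n + 1), (n.choose i : ℝ) * (2 * Real.pi * |v|) ^ i *
        (2 ^ (k - 1) * (C k (n - i) + |u| ^ k * C 0 (n - i))) * wt g ^ (k + n) := by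
          exact mul_le_mul_of_nonneg_left (Finset.sum_le_sum hterm) (norm_nonneg _)
    _ = _ := by rw [← Finset.sum_mul]; ring

/-- The Schwartz function `x ↦ ∑_{p,q} b(p,q) e^{2πi q v x} f_p(x + p u)`. -/
def schwartzSeries (b : ℤ × ℤ → ℂ) (hb : b ∈ rapid) (u v : ℝ) (f : ℤ → 𝓢(ℝ, ℂ))
    (hf : (Set.range f).Finite) : 𝓢(ℝ, ℂ) where
  toFun x := ∑' g, sTerm b u v f g x
  smooth' := by
    choose K hK using fun n => sTerm_bound (u := u) (v := v) hf 0 n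
    refine contDiff_tsum (v := fun n g => K n * (wt g ^ (0 + n) * ‖b g‖))
      (sTerm_contDiff b u v f) (fun n _ => (rapid_summable hb _).mul_left _) fun n g x _ => ?_
    simpa using hK n b g x
  decay' k n := by
    choose K hK using fun n => sTerm_bound (u := u) (v := v) hf 0 n
    obtain ⟨K', hK'⟩ := sTerm_bound (u := u) (v := v) hf k n
    refine ⟨∑' g, K' * (wt g ^ (k + n) * ‖b g‖), fun x => ?_⟩
    have hb0 : ∀ (m : ℕ) (g : ℤ × ℤ) (x : ℝ), ‖iteratedFDeriv ℝ m (sTerm b u v f g) x‖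
        ≤ K m * (wt g ^ (0 + m) * ‖b g‖) := fun m g x => by simpa using hK m b g x
    rw [iteratedFDeriv_tsum_apply (N := ⊤) (v := fun n g => K n * (wt g ^ (0 + n) * ‖b g‖))
      (sTerm_contDiff b u v f) (fun n _ => (rapid_summable hb _).mul_left _)
      (fun n g x _ => hb0 n g x) le_top x]
    have hs : Summable fun g => ‖iteratedFDeriv ℝ n (sTerm b u v f g) x‖ :=
      Summable.of_nonneg_of_le (fun _ => norm_nonneg _) (fun g => hb0 n g x)
        ((rapid_summable hb _).mul_left _)
    calc ‖x‖ ^ k * ‖∑' g, iteratedFDeriv ℝ n (sTerm b u v f g) x‖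
        ≤ ‖x‖ ^ k * ∑' g, ‖iteratedFDeriv ℝ n (sTerm b u v f g) x‖ := by
          gcongr; exact norm_tsum_le_tsum_norm hs
      _ = ∑' g, ‖x‖ ^ k * ‖iteratedFDeriv ℝ n (sTerm b u v f g) x‖ := tsum_mul_left.symm
      _ ≤ _ := Summable.tsum_le_tsum (fun g => hK' b g x) (hs.mul_left _)
          ((rapid_summable hb _).mul_left _)

lemma schwartzSeries_apply {b : ℤ × ℤ → ℂ} (hb : b ∈ rapid) (u v : ℝ) {f : ℤ → 𝓢(ℝ, ℂ)}
    (hf : (Set.range f).Finite) (x : ℝ) :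
    schwartzSeries b hb u v f hf x = ∑' g, sTerm b u v f g x := rfl

lemma sTerm_summable {b : ℤ × ℤ → ℂ} (hb : b ∈ rapid) (u v : ℝ) {f : ℤ → 𝓢(ℝ, ℂ)}
    (hf : (Set.range f).Finite) (x : ℝ) : Summable fun g => sTerm b u v f g x := by
  obtain ⟨K, hK⟩ := sTerm_bound (u := u) (v := v) hf 0 0
  refine Summable.of_norm_bounded ((rapid_summable hb 0).mul_left K) fun g => ?_
  simpa using hK b g x

/-- Multiplication by the coordinate on Schwartz functions. -/
def mulX : 𝓢(ℝ, ℂ) →ₗ[ℂ] 𝓢(ℝ, ℂ) :=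
  (SchwartzMap.smulLeftCLM ℂ (fun x : ℝ => (x : ℂ)) : 𝓢(ℝ, ℂ) →L[ℂ] 𝓢(ℝ, ℂ))

@[simp] lemma mulX_apply (φ : 𝓢(ℝ, ℂ)) (x : ℝ) : mulX φ x = x * φ x := by
  have h : Function.HasTemperateGrowth (fun x : ℝ => (x : ℂ)) := by fun_prop
  exact SchwartzMap.smulLeftCLM_apply_apply h φ x

/-- The derivative on Schwartz functions. -/
def derX : 𝓢(ℝ, ℂ) →ₗ[ℂ] 𝓢(ℝ, ℂ) := (SchwartzMap.derivCLM ℂ ℂ : 𝓢(ℝ, ℂ) →L[ℂ] 𝓢(ℝ, ℂ))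

@[simp] lemma derX_apply (φ : 𝓢(ℝ, ℂ)) (x : ℝ) : derX φ x = deriv φ x := rfl

lemma finite_range_map {f : ℤ → 𝓢(ℝ, ℂ)} (hf : (Set.range f).Finite)
    (L : 𝓢(ℝ, ℂ) →ₗ[ℂ] 𝓢(ℝ, ℂ)) : (Set.range fun p => L (f p)).Finite := by
  have : (Set.range fun p => L (f p)) = L '' Set.range f := by
    rw [← Set.range_comp]; rfl
  rw [this]
  exact hf.image L

lemma rapid_idx {b : ℤ × ℤ → ℂ} (hb : b ∈ rapid) (μ : Fin 2) :
    (fun g => (Torus.idx μ g : ℂ) * b g) ∈ rapid :=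
  rapid_of_norm_le hb 1 1 fun g => by
    rw [norm_mul, one_mul, pow_one, Complex.norm_intCast]
    gcongr
    exact Torus.idx_le_wt μ g

lemma schwartzSeries_mulX {b : ℤ × ℤ → ℂ} (hb : b ∈ rapid) (u v : ℝ) {f : ℤ → 𝓢(ℝ, ℂ)}
    (hf : (Set.range f).Finite) (x : ℝ) :
    x * schwartzSeries b hb u v f hf x
      = schwartzSeries b hb u v (fun p => mulX (f p)) (finite_range_map hf _) x
        - u * schwartzSeries _ (rapid_idx hb 0) u v f hf x := by
  simp only [schwartzSeries_apply]
  rw [← tsum_mul_left, ← tsum_mul_left, ← Summable.tsum_sub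
    (sTerm_summable hb u v (finite_range_map hf _) x)
    ((sTerm_summable (rapid_idx hb 0) u v hf x).mul_left _)]
  refine tsum_congr fun g => ?_
  simp only [sTerm, mulX_apply, Torus.idx, if_pos]
  push_cast
  ring

lemma schwartzSeries_deriv {b : ℤ × ℤ → ℂ} (hb : b ∈ rapid) (u v : ℝ) {f : ℤ → 𝓢(ℝ, ℂ)}
    (hf : (Set.range f).Finite) (x : ℝ) :
    deriv (schwartzSeries b hb u v f hf) x
      = schwartzSeries b hb u v (fun p => derX (f p)) (finite_range_map hf _) x
        + 2 * Real.pi * I * v * schwartzSeries _ (rapid_idx hb 1) u v f hf x := by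
  obtain ⟨K, hK⟩ := sTerm_bound (u := u) (v := v) hf 0 1
  have hd : ∀ g x, HasDerivAt (sTerm b u v f g) (deriv (sTerm b u v f g) x) x := fun g x =>
    (((sTerm_contDiff b u v f g).differentiable (by simp)) x).hasDerivAt
  have h := hasDerivAt_tsum (u := fun g => K * (wt g ^ (0 + 1) * ‖b g‖))
    ((rapid_summable hb _).mul_left _) hd (fun g x => by
      have := hK b g x
      rwa [pow_zero, one_mul, norm_iteratedFDeriv_eq_norm_iteratedDeriv, iteratedDeriv_one] at this)
    (sTerm_summable hb u v hf 0) x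
  have h' : deriv (schwartzSeries b hb u v f hf) x = ∑' g, deriv (sTerm b u v f g) x := h.deriv
  rw [h']
  simp only [schwartzSeries_apply]
  rw [← tsum_mul_left, ← Summable.tsum_add
    (sTerm_summable hb u v (finite_range_map hf _) x)
    ((sTerm_summable (rapid_idx hb 1) u v hf x).mul_left _)]
  refine tsum_congr fun g => ?_
  have e1 : HasDerivAt (fun x : ℝ => exp (2 * Real.pi * I * g.2 * v * x))
      (exp (2 * Real.pi * I * g.2 * v * x) * (2 * Real.pi * I * g.2 * v * 1)) x :=
    ((Complex.ofRealCLM.hasDerivAt (x := x)).const_mul _).cexp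
  have e2 : HasDerivAt (fun x : ℝ => f g.1 (x + g.1 * u)) (deriv (f g.1) (x + g.1 * u)) x :=
    ((f g.1).hasDerivAt (x + g.1 * u)).comp_add_const x (g.1 * u)
  have e3 := ((e1.mul e2).const_mul (b g)).deriv
  rw [show deriv (sTerm b u v f g) x = _ from e3]
  simp only [sTerm, derX_apply, Torus.idx]
  simp
  ring

/-! ### Twisted operator sums -/

/-- `∑ a(g) W_g φ` for weighted substitution operators `(W_g φ)(z) = w_g(z) φ(τ_g z)`. -/
def opSum {Z : Type} (w : ℤ × ℤ → Z → ℂ) (τ : ℤ × ℤ → Z → Z) (a : ℤ × ℤ → ℂ) (φ : Z → ℂ)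
    (z : Z) : ℂ := ∑' g, a g * (w g z * φ (τ g z))

section opSum

variable {ϑ ϑ' : ℝ} {Z : Type} {w w' : ℤ × ℤ → Z → ℂ} {τ τ' : ℤ × ℤ → Z → Z}

lemma opSum_comm (hw : ∀ g z, ‖w g z‖ = 1) (hw' : ∀ g z, ‖w' g z‖ = 1)
    (h1 : ∀ g h z, w g z * w' h (τ g z) = w' h z * w g (τ' h z))
    (h2 : ∀ g h z, τ' h (τ g z) = τ g (τ' h z))
    (a : Torus ϑ) (b : Torus ϑ') {φ : Z → ℂ} {K : ℝ} (hφ : ∀ z, ‖φ z‖ ≤ K) (z : Z) :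
    opSum w τ a.coeff (opSum w' τ' b.coeff φ) z = opSum w' τ' b.coeff (opSum w τ a.coeff φ) z := by
  unfold opSum
  have hs := summable_prod_bound (B := fun g h => w g z * w' h (τ g z) * φ (τ' h (τ g z))) (K := K)
    a.norm_summable b.norm_summable (fun g h => by
      rw [norm_mul, norm_mul, hw, hw', one_mul, one_mul]; exact hφ _)
  have hL : ∀ g, a.coeff g * (w g z * ∑' h, b.coeff h * (w' h (τ g z) * φ (τ' h (τ g z))))
      = ∑' h, a.coeff g * b.coeff h * (w g z * w' h (τ g z) * φ (τ' h (τ g z))) := fun g => by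
    rw [← tsum_mul_left, ← tsum_mul_left]; exact tsum_congr fun h => by ring
  have hR : ∀ h, b.coeff h * (w' h z * ∑' g, a.coeff g * (w g (τ' h z) * φ (τ g (τ' h z))))
      = ∑' g, a.coeff g * b.coeff h * (w g z * w' h (τ g z) * φ (τ' h (τ g z))) := fun h => by
    rw [← tsum_mul_left, ← tsum_mul_left]
    exact tsum_congr fun g => by rw [h1, h2]; ring
  simp_rw [hL, hR]
  exact (Summable.tsum_comm (f := fun g h =>
    a.coeff g * b.coeff h * (w g z * w' h (τ g z) * φ (τ' h (τ g z)))) hs).symm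

lemma opSum_mul_left (hw : ∀ g z, ‖w g z‖ = 1)
    (h1 : ∀ g h z, w g z * w h (τ g z) = phase ϑ g h * w (g + h) z)
    (h2 : ∀ g h z, τ h (τ g z) = τ (g + h) z)
    (a b : Torus ϑ) {φ : Z → ℂ} {K : ℝ} (hφ : ∀ z, ‖φ z‖ ≤ K) (z : Z) :
    opSum w τ (a * b).coeff φ z = opSum w τ a.coeff (opSum w τ b.coeff φ) z := by
  unfold opSum
  rw [← Torus.twisted_sum a b (f := fun k => w k z * φ (τ k z)) (K := K)
    (fun k => by rw [norm_mul, hw, one_mul]; exact hφ _)]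
  refine tsum_congr fun g => ?_
  rw [← tsum_mul_left, ← tsum_mul_left]
  refine tsum_congr fun h => ?_
  rw [h2]
  linear_combination (-a.coeff g * b.coeff h * φ (τ (g + h) z)) * h1 g h z

lemma opSum_mul_right (hw : ∀ g z, ‖w g z‖ = 1)
    (h1 : ∀ g h z, w h z * w g (τ h z) = phase ϑ g h * w (g + h) z)
    (h2 : ∀ g h z, τ g (τ h z) = τ (g + h) z)
    (a b : Torus ϑ) {φ : Z → ℂ} {K : ℝ} (hφ : ∀ z, ‖φ z‖ ≤ K) (z : Z) :
    opSum w τ (a * b).coeff φ z = opSum w τ b.coeff (opSum w τ a.coeff φ) z := by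
  have hs := summable_prod_bound (B := fun g h => phase ϑ g h * (w (g + h) z * φ (τ (g + h) z)))
    (K := K) a.norm_summable b.norm_summable (fun g h => by
      rw [norm_mul, norm_mul, norm_phase, hw, one_mul, one_mul]; exact hφ _)
  have hsw := Summable.tsum_comm (f := fun g h =>
    a.coeff g * b.coeff h * (phase ϑ g h * (w (g + h) z * φ (τ (g + h) z)))) hs
  have ht := Torus.twisted_sum a b (f := fun k => w k z * φ (τ k z)) (K := K)
    (fun k => by rw [norm_mul, hw, one_mul]; exact hφ _)
  unfold opSum
  rw [← ht, ← hsw]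
  refine tsum_congr fun h => ?_
  rw [← tsum_mul_left, ← tsum_mul_left]
  refine tsum_congr fun g => ?_
  rw [h2]
  linear_combination (-a.coeff g * b.coeff h * φ (τ (g + h) z)) * h1 g h z

end opSum


/-! ### Modules with connection over noncommutative tori -/

/-- A right module over the smooth noncommutative torus `T_{-θ}` together with a connection
`D_1, D_2` (a pair of linear maps with the Leibniz rule for the canonical derivations). -/
structure TorusModule (θ : ℝ) where
  carrier : Type
  [addCommGroup : AddCommGroup carrier]
  [module : Module ℂ carrier]
  [rightModule : Module (Torus (-θ))ᵐᵒᵖ carrier]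
  [tower : IsScalarTower ℂ (Torus (-θ))ᵐᵒᵖ carrier]
  D : Fin 2 → carrier →ₗ[ℂ] carrier
  leibniz : ∀ (μ : Fin 2) (φ : carrier) (a : Torus (-θ)),
    D μ (op a • φ) = op a • D μ φ + op (Torus.der μ a) • φ

attribute [instance] TorusModule.addCommGroup TorusModule.module TorusModule.rightModule
  TorusModule.tower

/-- Isomorphism of right modules with connection. -/
def TorusModule.Iso {θ : ℝ} (M N : TorusModule θ) : Prop :=
  ∃ e : M.carrier ≃ₗ[ℂ] N.carrier, (∀ (a : Torus (-θ)) φ, e (op a • φ) = op a • e φ) ∧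
    ∀ μ φ, e (M.D μ φ) = N.D μ (e φ)

/-- The underlying space of the Heisenberg module: Schwartz functions on `ℝ × ℤ_m`. -/
abbrev HSpace (m : ℤ) : Type := ZMod m.natAbs → 𝓢(ℝ, ℂ)

/-- The phase `e^{-2πi q j n/m}`, `j ∈ ℤ_m`. -/
def chi (n m : ℤ) (j : ZMod m.natAbs) (q : ℤ) : ℂ :=
  exp (-(2 * Real.pi * I * q * (j.cast : ℤ) * n / m))

lemma exp_two_pi_int (t : ℤ) : exp (2 * Real.pi * I * t) = 1 := by
  rw [mul_comm]; exact Complex.exp_int_mul_two_pi_mul_I t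

lemma chi_eq {n m : ℤ} (hm : m ≠ 0) {j : ZMod m.natAbs} {l : ℤ} (hl : (l : ZMod m.natAbs) = j)
    (q : ℤ) : chi n m j q = exp (-(2 * Real.pi * I * q * l * n / m)) := by
  have h1 : ((l : ℤ) : ZMod m.natAbs) = ((j.cast : ℤ) : ZMod m.natAbs) := by
    rw [hl, ZMod.intCast_zmod_cast]
  obtain ⟨t, ht⟩ := Int.natAbs_dvd.1 ((ZMod.intCast_eq_intCast_iff_dvd_sub _ _ _).1 h1)
  have h2 : ((j.cast : ℤ) : ℂ) = l + m * t := by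
    have : (j.cast : ℤ) = l + m * t := by linarith
    rw [this]; push_cast; ring
  have hm' : (m : ℂ) ≠ 0 := by exact_mod_cast hm
  unfold chi
  have h3 := exp_two_pi_int (-(q * t * n))
  calc exp (-(2 * Real.pi * I * q * (j.cast : ℤ) * n / m))
      = exp (-(2 * Real.pi * I * q * l * n / m) + 2 * Real.pi * I * ((-(q * t * n) : ℤ) : ℂ)) := by
        congr 1
        rw [h2]
        push_cast
        field_simp
        ring
    _ = _ := by rw [exp_add, h3, mul_one]

lemma norm_exp_real_I (r : ℝ) (z : ℂ) (h : z = r * I) : ‖exp z‖ = 1 := by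
  rw [h]; exact norm_exp_ofReal_mul_I _

lemma norm_chi (n m : ℤ) (j : ZMod m.natAbs) (q : ℤ) : ‖chi n m j q‖ = 1 :=
  norm_exp_real_I (-(2 * Real.pi * q * (j.cast : ℤ) * n / m)) _ (by push_cast; ring)

lemma chi_mem (n m : ℤ) (j : ZMod m.natAbs) {a : ℤ × ℤ → ℂ} (ha : a ∈ rapid) :
    (fun g => a g * chi n m j g.2) ∈ rapid :=
  rapid_of_norm_le ha 1 0 fun g => by simp [norm_chi]

/-- The weights `e^{2πi q (x - jn/m)}` realizing the right action of monomials. -/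
def heisW (n m : ℤ) (g : ℤ × ℤ) (z : ZMod m.natAbs × ℝ) : ℂ :=
  chi n m z.1 g.2 * exp (2 * Real.pi * I * g.2 * z.2)

/-- The substitutions `(j, x) ↦ (j - p, x + p(θ - n/m))` realizing the right action of monomials. -/
def heisτ (n m : ℤ) (θ : ℝ) (g : ℤ × ℤ) (z : ZMod m.natAbs × ℝ) : ZMod m.natAbs × ℝ :=
  (z.1 - g.1, z.2 + g.1 * (θ - n / m))

lemma norm_heisW (n m : ℤ) (g : ℤ × ℤ) (z : ZMod m.natAbs × ℝ) : ‖heisW n m g z‖ = 1 := by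
  unfold heisW
  rw [norm_mul, norm_chi, one_mul]
  exact norm_exp_real_I (2 * Real.pi * g.2 * z.2) _ (by push_cast; ring)

lemma heisτ_add (n m : ℤ) (θ : ℝ) (g h : ℤ × ℤ) (z : ZMod m.natAbs × ℝ) :
    heisτ n m θ g (heisτ n m θ h z) = heisτ n m θ (g + h) z := by
  unfold heisτ
  ext
  · push_cast [Prod.fst_add]; ring
  · push_cast [Prod.fst_add]; ring

section Heisenberg

variable (n m : ℤ) (θ : ℝ) [hm : NeZero m.natAbs]

lemma finite_shift (φ : HSpace m) (j : ZMod m.natAbs) :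
    (Set.range fun p : ℤ => φ (j - p)).Finite :=
  (Set.finite_range φ).subset (by rintro _ ⟨p, rfl⟩; exact ⟨_, rfl⟩)

/-- The right action of `∑ a(p,q) U₁^p U₂^q ∈ T_{-θ}` on `φ : ℝ × ℤ_m → ℂ` for which
`(φ ◁ U₁)_j(x) = φ_{j-1}(x - n/m + θ)` and `(φ ◁ U₂)_j(x) = φ_j(x) e^{2πi(x - jn/m)}`. -/
def heisAct (a : Torus (-θ)) (φ : HSpace m) : HSpace m := fun j =>
  schwartzSeries (fun g => a.coeff g * chi n m j g.2) (chi_mem n m j a.coeff_mem) (θ - n / m) 1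
    (fun p => φ (j - p)) (finite_shift m φ j)

lemma heisAct_apply (a : Torus (-θ)) (φ : HSpace m) (j : ZMod m.natAbs) (x : ℝ) :
    heisAct n m θ a φ j x = opSum (heisW n m) (heisτ n m θ) a.coeff (fun z => φ z.1 z.2) (j, x) := by
  unfold heisAct opSum
  rw [schwartzSeries_apply]
  refine tsum_congr fun g => ?_
  simp only [sTerm, heisW, heisτ, ofReal_one, mul_one]
  ring

lemma heisAct_summable (a : Torus (-θ)) (φ : HSpace m) (j : ZMod m.natAbs) (x : ℝ) :
    Summable fun g => a.coeff g * (heisW n m g (j, x) *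
      φ (heisτ n m θ g (j, x)).1 (heisτ n m θ g (j, x)).2) := by
  refine (sTerm_summable (chi_mem n m j a.coeff_mem) (θ - n / m) 1 (finite_shift m φ j) x).congr
    fun g => ?_
  simp only [sTerm, heisW, heisτ, ofReal_one, mul_one]
  ring

lemma HSpace_bounded (φ : HSpace m) : ∃ K : ℝ, ∀ z : ZMod m.natAbs × ℝ, ‖φ z.1 z.2‖ ≤ K := by
  refine ⟨∑ j, SchwartzMap.seminorm ℝ 0 0 (φ j), fun z => ?_⟩
  exact (SchwartzMap.norm_le_seminorm ℝ (φ z.1) z.2).trans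
    (Finset.single_le_sum (f := fun j => SchwartzMap.seminorm ℝ 0 0 (φ j))
      (fun j _ => apply_nonneg _ _) (Finset.mem_univ z.1))

lemma heisW_mul (g h : ℤ × ℤ) (z : ZMod m.natAbs × ℝ) :
    heisW n m h z * heisW n m g (heisτ n m θ h z) = phase (-θ) g h * heisW n m (g + h) z := by
  have hm0 : m ≠ 0 := Int.natAbs_ne_zero.1 hm.out
  have hm' : (m : ℂ) ≠ 0 := by exact_mod_cast hm0
  obtain ⟨j, x⟩ := z
  obtain ⟨l, rfl⟩ := ZMod.intCast_surjective j
  unfold heisW heisτ phase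
  have e1 : ((l : ZMod m.natAbs) - (h.1 : ZMod m.natAbs)) = ((l - h.1 : ℤ) : ZMod m.natAbs) := by
    push_cast; ring
  simp only [e1]
  rw [chi_eq hm0 rfl, chi_eq hm0 rfl, chi_eq hm0 rfl]
  simp only [← exp_add]
  congr 1
  push_cast [Prod.fst_add, Prod.snd_add]
  field_simp
  ring

lemma heisAct_mul (a b : Torus (-θ)) (φ : HSpace m) :
    heisAct n m θ (a * b) φ = heisAct n m θ b (heisAct n m θ a φ) := by
  obtain ⟨K, hK⟩ := HSpace_bounded m φ
  funext j
  ext x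
  have e : (fun z : ZMod m.natAbs × ℝ => heisAct n m θ a φ z.1 z.2)
      = opSum (heisW n m) (heisτ n m θ) a.coeff (fun z => φ z.1 z.2) := by
    funext z; exact heisAct_apply n m θ a φ z.1 z.2
  rw [heisAct_apply, heisAct_apply, e]
  exact opSum_mul_right (norm_heisW n m) (heisW_mul n m θ) (heisτ_add n m θ) a b hK (j, x)

lemma heisAct_one (φ : HSpace m) : heisAct n m θ 1 φ = φ := by
  funext j
  ext x
  rw [heisAct_apply]
  unfold opSum
  rw [tsum_eq_single 0]
  · rw [Torus.coeff_one, if_pos rfl, one_mul]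
    simp [heisW, heisτ, chi]
  · intro g hg
    rw [Torus.coeff_one, if_neg hg, zero_mul]

lemma heisAct_add_left (a b : Torus (-θ)) (φ : HSpace m) :
    heisAct n m θ (a + b) φ = heisAct n m θ a φ + heisAct n m θ b φ := by
  funext j
  ext x
  rw [Pi.add_apply, add_apply, heisAct_apply, heisAct_apply, heisAct_apply]
  unfold opSum
  rw [← (heisAct_summable n m θ a φ j x).tsum_add (heisAct_summable n m θ b φ j x)]
  exact tsum_congr fun g => by rw [Torus.coeff_add]; ring

lemma heisAct_add_right (a : Torus (-θ)) (φ ψ : HSpace m) :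
    heisAct n m θ a (φ + ψ) = heisAct n m θ a φ + heisAct n m θ a ψ := by
  funext j
  ext x
  rw [Pi.add_apply, add_apply, heisAct_apply, heisAct_apply, heisAct_apply]
  unfold opSum
  rw [← (heisAct_summable n m θ a φ j x).tsum_add (heisAct_summable n m θ a ψ j x)]
  exact tsum_congr fun g => by
    simp only [Pi.add_apply, add_apply]; ring

lemma heisAct_smul_left (c : ℂ) (a : Torus (-θ)) (φ : HSpace m) :
    heisAct n m θ (c • a) φ = c • heisAct n m θ a φ := by
  funext j
  ext x
  rw [Pi.smul_apply, smul_apply, heisAct_apply, heisAct_apply]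
  unfold opSum
  rw [smul_eq_mul, ← tsum_mul_left]
  exact tsum_congr fun g => by rw [Torus.coeff_smul]; ring

lemma heisAct_zero_left (φ : HSpace m) : heisAct n m θ 0 φ = 0 := by
  have := heisAct_smul_left n m θ 0 0 φ
  rwa [zero_smul, zero_smul] at this

lemma heisAct_zero_right (a : Torus (-θ)) : heisAct n m θ a (0 : HSpace m) = 0 := by
  have := heisAct_add_right n m θ a 0 0
  rw [add_zero] at this
  exact left_eq_add.1 this

/-- The right `T_{-θ}`-module structure of the Heisenberg module. -/
@[reducible] def heisRight : Module (Torus (-θ))ᵐᵒᵖ (HSpace m) where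
  smul a φ := heisAct n m θ a.unop φ
  one_smul φ := heisAct_one n m θ φ
  mul_smul a b φ := heisAct_mul n m θ b.unop a.unop φ
  smul_zero a := heisAct_zero_right n m θ a.unop
  smul_add a φ ψ := heisAct_add_right n m θ a.unop φ ψ
  add_smul a b φ := heisAct_add_left n m θ a.unop b.unop φ
  zero_smul φ := heisAct_zero_left n m θ φ

/-- The constant curvature connection `D₁ = i m x/(n - mθ)`, `D₂ = (1/2π) ∂_x`. -/
def heisD (μ : Fin 2) : HSpace m →ₗ[ℂ] HSpace m :=
  if μ = 0 then ((I * m / (n - m * θ) : ℂ) • mulX).compLeft _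
  else ((1 / (2 * Real.pi) : ℂ) • derX).compLeft _

lemma heisD_leibniz (h : (n : ℝ) - m * θ ≠ 0) (μ : Fin 2) (φ : HSpace m) (a : Torus (-θ)) :
    heisD n m θ μ (heisAct n m θ a φ)
      = heisAct n m θ a (heisD n m θ μ φ) + heisAct n m θ (Torus.der μ a) φ := by
  have hm0 : m ≠ 0 := Int.natAbs_ne_zero.1 hm.out
  have hm' : (m : ℂ) ≠ 0 := by exact_mod_cast hm0
  have h' : (n : ℂ) - m * θ ≠ 0 := by exact_mod_cast h
  have hpi : (Real.pi : ℂ) ≠ 0 := by exact_mod_cast Real.pi_ne_zero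
  funext j
  ext x
  rw [Pi.add_apply, add_apply]
  have key : ∀ ν : Fin 2, heisAct n m θ (Torus.der ν a) φ j x = I * schwartzSeries _
      (rapid_idx (chi_mem n m j a.coeff_mem) ν) (θ - n / m) 1 (fun p => φ (j - p))
      (finite_shift m φ j) x := by
    intro ν
    unfold heisAct
    rw [schwartzSeries_apply, schwartzSeries_apply, ← tsum_mul_left]
    refine tsum_congr fun g => ?_
    simp only [sTerm, Torus.coeff_der]
    ring
  rw [key μ]
  fin_cases μ
  · have e0 := schwartzSeries_mulX (chi_mem n m j a.coeff_mem) (θ - n / m) 1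
      (finite_shift m φ j) x
    have e1 : heisAct n m θ a (heisD n m θ 0 φ) j x = (I * m / (n - m * θ) : ℂ) *
        schwartzSeries _ (chi_mem n m j a.coeff_mem) (θ - n / m) 1
          (fun p => mulX (φ (j - p))) (finite_range_map (finite_shift m φ j) _) x := by
      unfold heisAct
      rw [schwartzSeries_apply, schwartzSeries_apply, ← tsum_mul_left]
      refine tsum_congr fun g => ?_
      simp only [sTerm, heisD, if_pos, LinearMap.compLeft_apply, Function.comp_apply,
        LinearMap.smul_apply, smul_apply, smul_eq_mul]
      ring
    have e2 : heisD n m θ 0 (heisAct n m θ a φ) j x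
        = (I * m / (n - m * θ) : ℂ) * (x * heisAct n m θ a φ j x) := by
      simp [heisD]
    have e3 : (I * m / (n - m * θ) : ℂ) * ((θ - n / m : ℝ) : ℂ) = -I := by
      push_cast
      field_simp
      ring
    simp only [Fin.zero_eta]
    rw [e1, e2]
    unfold heisAct
    rw [e0, mul_sub, ← mul_assoc (I * m / (n - m * θ) : ℂ) ((θ - n / m : ℝ) : ℂ), e3]
    ring
  · have e0 := schwartzSeries_deriv (chi_mem n m j a.coeff_mem) (θ - n / m) 1
      (finite_shift m φ j) x
    have e1 : heisAct n m θ a (heisD n m θ 1 φ) j x = (1 / (2 * Real.pi) : ℂ) *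
        schwartzSeries _ (chi_mem n m j a.coeff_mem) (θ - n / m) 1
          (fun p => derX (φ (j - p))) (finite_range_map (finite_shift m φ j) _) x := by
      unfold heisAct
      rw [schwartzSeries_apply, schwartzSeries_apply, ← tsum_mul_left]
      refine tsum_congr fun g => ?_
      simp only [sTerm, heisD, one_ne_zero, if_false, LinearMap.compLeft_apply,
        Function.comp_apply, LinearMap.smul_apply, smul_apply, smul_eq_mul]
      ring
    have e2 : heisD n m θ 1 (heisAct n m θ a φ) j x
        = (1 / (2 * Real.pi) : ℂ) * deriv (heisAct n m θ a φ j) x := by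
      simp [heisD]
    simp only [Fin.mk_one]
    rw [e1, e2]
    unfold heisAct
    rw [e0]
    push_cast
    field_simp

/-- The Heisenberg module of Schwartz functions on `ℝ × ℤ_m`, with its connection. -/
def schwartzModule (h : (n : ℝ) - m * θ ≠ 0) : TorusModule θ :=
  letI := heisRight n m θ
  { carrier := HSpace m
    tower := ⟨fun c a φ => heisAct_smul_left n m θ c a.unop φ⟩
    D := heisD n m θ
    leibniz := heisD_leibniz n m θ h }

end Heisenberg

/-- The free right module `T_{-θ}^N` with the canonical flat connection. -/
def freeModule (N : ℕ) (θ : ℝ) : TorusModule θ where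
  carrier := Fin N → Torus (-θ)
  tower := ⟨fun c a φ => by
    funext i
    change φ i * (c • a.unop) = c • (φ i * a.unop)
    exact mul_smul_comm c _ _⟩
  D μ := (Torus.der μ).compLeft (Fin N)
  leibniz μ φ a := by
    funext i
    change Torus.der μ (φ i * a) = Torus.der μ (φ i) * a + φ i * Torus.der μ a
    exact Torus.der_mul μ _ _

/-- The Heisenberg module `E_{n,m}^θ`, `n - mθ ≠ 0`, over `T_{-θ}`, with its constant curvature
connection: Schwartz functions on `ℝ × ℤ_m` if `m ≠ 0`, and the free module of rank `|n|` if
`m = 0`. -/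
def heis (n m : ℤ) (θ : ℝ) (h : (n : ℝ) - m * θ ≠ 0) : TorusModule θ :=
  if hm : m = 0 then freeModule n.natAbs θ
  else haveI : NeZero m.natAbs := ⟨Int.natAbs_ne_zero.2 hm⟩; schwartzModule n m θ h

/-! ### Equivalence bimodules -/

/-- A `T_{-θ}`-`T_{-θ'}` bimodule with a connection which is compatible with the canonical
derivations on the right and, up to the constant matrix `M`, with those on the left. -/
structure TorusBimodule (θ θ' : ℝ) where
  carrier : Type
  [addCommGroup : AddCommGroup carrier]
  [module : Module ℂ carrier]
  [leftModule : Module (Torus (-θ)) carrier]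
  [rightModule : Module (Torus (-θ'))ᵐᵒᵖ carrier]
  [leftTower : IsScalarTower ℂ (Torus (-θ)) carrier]
  [rightTower : IsScalarTower ℂ (Torus (-θ'))ᵐᵒᵖ carrier]
  [comm : SMulCommClass (Torus (-θ)) (Torus (-θ'))ᵐᵒᵖ carrier]
  D : Fin 2 → carrier →ₗ[ℂ] carrier
  M : Matrix (Fin 2) (Fin 2) ℂ
  leibniz_right : ∀ (μ : Fin 2) (ψ : carrier) (b : Torus (-θ')),
    D μ (op b • ψ) = op b • D μ ψ + op (Torus.der μ b) • ψ
  leibniz_left : ∀ (μ : Fin 2) (a : Torus (-θ)) (ψ : carrier),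
    D μ (a • ψ) = (∑ ν, M μ ν • Torus.der ν a • ψ) + a • D μ ψ

attribute [instance] TorusBimodule.addCommGroup TorusBimodule.module TorusBimodule.leftModule
  TorusBimodule.rightModule TorusBimodule.leftTower TorusBimodule.rightTower TorusBimodule.comm

/-- The underlying right module with connection. -/
def TorusBimodule.toRight {θ θ' : ℝ} (B : TorusBimodule θ θ') : TorusModule θ' where
  carrier := B.carrier
  D := B.D
  leibniz := B.leibniz_right

/-- A complete Morita equivalence bimodule: a Morita equivalence bimodule (finitely generated
projective generator as a right module, with the left algebra acting as the full algebra of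
right-linear endomorphisms) with a constant curvature connection, compatible with the derivations
on both sides up to an invertible constant matrix. -/
def TorusBimodule.IsCompleteMorita {θ θ' : ℝ} (B : TorusBimodule θ θ') : Prop :=
  Module.Finite (Torus (-θ'))ᵐᵒᵖ B.carrier ∧
  Module.Projective (Torus (-θ'))ᵐᵒᵖ B.carrier ∧
  (∃ (N : ℕ) (f : (Fin N → B.carrier) →ₗ[(Torus (-θ'))ᵐᵒᵖ] Torus (-θ')),
    Function.Surjective f) ∧
  (∀ f : B.carrier →ₗ[(Torus (-θ'))ᵐᵒᵖ] B.carrier, ∃! a : Torus (-θ), ∀ ψ, f ψ = a • ψ) ∧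
  (∃ F : ℂ, ∀ ψ, I • (B.D 0 (B.D 1 ψ) - B.D 1 (B.D 0 ψ)) = F • ψ) ∧
  IsUnit B.M.det

section tensor

variable {θ θ' : ℝ} (M : TorusModule θ) (B : TorusBimodule θ θ')

/-- The relations `φa ⊗ ψ = φ ⊗ aψ`. -/
def balance : Submodule ℂ (M.carrier ⊗[ℂ] B.carrier) :=
  Submodule.span ℂ {t | ∃ (φ : M.carrier) (a : Torus (-θ)) (ψ : B.carrier), t = (op a • φ) ⊗ₜ[ℂ] ψ - φ ⊗ₜ[ℂ] (a • ψ)}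

/-- Right multiplication on `M ⊗_ℂ B`. -/
def rightMul (b : (Torus (-θ'))ᵐᵒᵖ) : (M.carrier ⊗[ℂ] B.carrier) →ₗ[ℂ] (M.carrier ⊗[ℂ] B.carrier) :=
  (Module.toModuleEnd ℂ (S := (Torus (-θ'))ᵐᵒᵖ) B.carrier b).lTensor M.carrier

@[simp] lemma rightMul_tmul (b : (Torus (-θ'))ᵐᵒᵖ) (φ : M.carrier) (ψ : B.carrier) :
    rightMul M B b (φ ⊗ₜ ψ) = φ ⊗ₜ (b • ψ) := rfl

lemma rightMul_balance (b : (Torus (-θ'))ᵐᵒᵖ) :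
    balance M B ≤ (balance M B).comap (rightMul M B b) := by
  unfold balance
  rw [Submodule.span_le]
  rintro _ ⟨φ, a, ψ, rfl⟩
  refine Submodule.subset_span ⟨φ, a, b • ψ, ?_⟩
  rw [map_sub, rightMul_tmul, rightMul_tmul, smul_comm a b ψ]

/-- The connection `∑_ν M_{μν} ∇_ν ⊗ 1 + 1 ⊗ D_μ` on `M ⊗_ℂ B`. -/
def tensorD (μ : Fin 2) : (M.carrier ⊗[ℂ] B.carrier) →ₗ[ℂ] (M.carrier ⊗[ℂ] B.carrier) :=
  (∑ ν, B.M μ ν • M.D ν).rTensor B.carrier + (B.D μ).lTensor M.carrier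

lemma tensorD_tmul (μ : Fin 2) (φ : M.carrier) (ψ : B.carrier) :
    tensorD M B μ (φ ⊗ₜ ψ) = (∑ ν, B.M μ ν • (M.D ν φ ⊗ₜ[ℂ] ψ)) + φ ⊗ₜ (B.D μ ψ) := by
  simp [tensorD, TensorProduct.smul_tmul']

lemma tensorD_balance (μ : Fin 2) : balance M B ≤ (balance M B).comap (tensorD M B μ) := by
  conv_lhs => unfold balance
  rw [Submodule.span_le]
  rintro _ ⟨φ, a, ψ, rfl⟩
  have hb : ∀ (φ : M.carrier) (a : Torus (-θ)) (ψ : B.carrier), (op a • φ) ⊗ₜ[ℂ] ψ - φ ⊗ₜ[ℂ] (a • ψ) ∈ balance M B :=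
    fun φ a ψ => Submodule.subset_span ⟨φ, a, ψ, rfl⟩
  have e : tensorD M B μ ((op a • φ) ⊗ₜ[ℂ] ψ - φ ⊗ₜ[ℂ] (a • ψ))
      = (∑ ν, B.M μ ν • ((op a • M.D ν φ) ⊗ₜ[ℂ] ψ - (M.D ν φ) ⊗ₜ[ℂ] (a • ψ)))
        + (∑ ν, B.M μ ν • ((op (Torus.der ν a) • φ) ⊗ₜ[ℂ] ψ - φ ⊗ₜ[ℂ] (Torus.der ν a • ψ)))
        + ((op a • φ) ⊗ₜ[ℂ] (B.D μ ψ) - φ ⊗ₜ[ℂ] (a • B.D μ ψ)) := by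
    rw [map_sub, tensorD_tmul, tensorD_tmul, B.leibniz_left]
    simp only [M.leibniz, Fin.sum_univ_two, TensorProduct.add_tmul, TensorProduct.tmul_add,
      TensorProduct.tmul_smul, smul_sub, smul_add]
    abel
  change tensorD M B μ _ ∈ balance M B
  rw [e]
  exact add_mem (add_mem (sum_mem fun ν _ => Submodule.smul_mem _ _ (hb _ _ _))
    (sum_mem fun ν _ => Submodule.smul_mem _ _ (hb _ _ _))) (hb _ _ _)

/-- The balanced tensor product `M ⊗_{T_{-θ}} B`. -/
def BalTensor : Type := (M.carrier ⊗[ℂ] B.carrier) ⧸ balance M B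

instance : AddCommGroup (BalTensor M B) :=
  inferInstanceAs (AddCommGroup ((M.carrier ⊗[ℂ] B.carrier) ⧸ balance M B))
instance : Module ℂ (BalTensor M B) :=
  inferInstanceAs (Module ℂ ((M.carrier ⊗[ℂ] B.carrier) ⧸ balance M B))

/-- The quotient map. -/
def balMk : (M.carrier ⊗[ℂ] B.carrier) →ₗ[ℂ] BalTensor M B := (balance M B).mkQ

lemma balMk_surjective : Function.Surjective (balMk M B) := (balance M B).mkQ_surjective

/-- A `ℂ`-linear map on `M ⊗_ℂ B` preserving the relations descends to the balanced product. -/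
def balMap (f : (M.carrier ⊗[ℂ] B.carrier) →ₗ[ℂ] (M.carrier ⊗[ℂ] B.carrier))
    (hf : balance M B ≤ (balance M B).comap f) : BalTensor M B →ₗ[ℂ] BalTensor M B :=
  (balance M B).mapQ (balance M B) f hf

@[simp] lemma balMap_balMk (f : (M.carrier ⊗[ℂ] B.carrier) →ₗ[ℂ] (M.carrier ⊗[ℂ] B.carrier))
    (hf : balance M B ≤ (balance M B).comap f) (t : M.carrier ⊗[ℂ] B.carrier) :
    balMap M B f hf (balMk M B t) = balMk M B (f t) := rfl

instance : SMul (Torus (-θ'))ᵐᵒᵖ (BalTensor M B) :=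
  ⟨fun b t => balMap M B (rightMul M B b) (rightMul_balance M B b) t⟩

lemma smul_balMk (b : (Torus (-θ'))ᵐᵒᵖ) (t : M.carrier ⊗[ℂ] B.carrier) :
    b • balMk M B t = balMk M B (rightMul M B b t) := rfl

instance : Module (Torus (-θ'))ᵐᵒᵖ (BalTensor M B) where
  one_smul t := by
    obtain ⟨t, rfl⟩ := balMk_surjective M B t
    rw [smul_balMk]
    congr 1
    simp only [rightMul, map_one]
    exact LinearMap.lTensor_id_apply _ _ _
  mul_smul b c t := by
    obtain ⟨t, rfl⟩ := balMk_surjective M B t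
    simp only [smul_balMk]
    congr 1
    simp only [rightMul, map_mul]
    rw [LinearMap.lTensor_mul]; rfl
  smul_zero b := map_zero (balMap M B (rightMul M B b) (rightMul_balance M B b))
  smul_add b := map_add (balMap M B (rightMul M B b) (rightMul_balance M B b))
  add_smul b c t := by
    obtain ⟨t, rfl⟩ := balMk_surjective M B t
    simp only [smul_balMk, ← map_add]
    congr 1
    simp only [rightMul, map_add, LinearMap.lTensor_add, LinearMap.add_apply]
  zero_smul t := by
    obtain ⟨t, rfl⟩ := balMk_surjective M B t
    rw [smul_balMk]
    simp only [rightMul, map_zero, LinearMap.lTensor_zero, LinearMap.zero_apply]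

/-- The tensor product of a module with connection by a bimodule with connection. -/
def TorusModule.tensor : TorusModule θ' where
  carrier := BalTensor M B
  tower := ⟨fun c b t => by
    obtain ⟨t, rfl⟩ := balMk_surjective M B t
    rw [smul_balMk, smul_balMk, ← map_smul]
    congr 1
    induction t with
    | zero => simp
    | tmul φ ψ => simp
    | add s t hs ht => rw [map_add, hs, ht, map_add, smul_add]⟩
  D μ := balMap M B (tensorD M B μ) (tensorD_balance M B μ)
  leibniz μ t b := by
    obtain ⟨t, rfl⟩ := balMk_surjective M B t
    simp only [smul_balMk, balMap_balMk, ← map_add]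
    congr 1
    induction t with
    | zero => simp
    | tmul φ ψ =>
      simp only [rightMul_tmul, tensorD_tmul, B.leibniz_right, map_add, map_sum, map_smul,
        TensorProduct.tmul_add]
      abel
    | add s t hs ht => simp only [map_add, hs, ht]; abel

end tensor

/-! ### The three equivalence bimodules -/

section bimodS

variable (s : ℤ) (θ : ℝ)

/-- The phase `e^{-2πi q (θ-s) p}`. -/
def leftPhase (g : ℤ × ℤ) : ℂ := exp (-(2 * Real.pi * I * g.2 * (θ - s) * g.1))

lemma norm_leftPhase (g : ℤ × ℤ) : ‖leftPhase s θ g‖ = 1 :=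
  norm_exp_real_I (-(2 * Real.pi * g.2 * (θ - s) * g.1)) _ (by push_cast; ring)

lemma leftPhase_mem {a : ℤ × ℤ → ℂ} (ha : a ∈ rapid) : (fun g => a g * leftPhase s θ g) ∈ rapid :=
  rapid_of_norm_le ha 1 0 fun g => by simp [norm_leftPhase]

lemma finite_const (φ : 𝓢(ℝ, ℂ)) : (Set.range fun _ : ℤ => φ).Finite :=
  (Set.finite_singleton φ).subset (by rintro _ ⟨p, rfl⟩; rfl)

/-- The left action of `∑ a(p,q) U₁^p U₂^q ∈ T_{-θ}` on Schwartz functions for which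
`(U₁ φ)(x) = φ(x - 1)` and `(U₂ φ)(x) = e^{2πi(θ-s)x} φ(x)`. -/
def leftAct (a : Torus (-θ)) (φ : HSpace 1) : HSpace 1 := fun j =>
  schwartzSeries (fun g => a.coeff g * leftPhase s θ g) (leftPhase_mem s θ a.coeff_mem) (-1) (θ - s)
    (fun _ => φ j) (finite_const (φ j))

/-- The weights realizing the left action of monomials. -/
def leftW (g : ℤ × ℤ) (z : ZMod (1 : ℤ).natAbs × ℝ) : ℂ :=
  leftPhase s θ g * exp (2 * Real.pi * I * g.2 * (θ - s) * z.2)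

/-- The substitutions realizing the left action of monomials. -/
def leftτ (g : ℤ × ℤ) (z : ZMod (1 : ℤ).natAbs × ℝ) : ZMod (1 : ℤ).natAbs × ℝ := (z.1, z.2 - g.1)

lemma leftAct_apply (a : Torus (-θ)) (φ : HSpace 1) (j : ZMod (1 : ℤ).natAbs) (x : ℝ) :
    leftAct s θ a φ j x = opSum (leftW s θ) leftτ a.coeff (fun z => φ z.1 z.2) (j, x) := by
  unfold leftAct opSum
  rw [schwartzSeries_apply]
  refine tsum_congr fun g => ?_
  simp only [sTerm, leftW, leftτ]
  push_cast
  rw [show x + (g.1 : ℝ) * -1 = x - g.1 by ring]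
  ring

lemma leftAct_summable (a : Torus (-θ)) (φ : HSpace 1) (j : ZMod (1 : ℤ).natAbs) (x : ℝ) :
    Summable fun g => a.coeff g * (leftW s θ g (j, x) * φ (leftτ g (j, x)).1 (leftτ g (j, x)).2) := by
  refine (sTerm_summable (leftPhase_mem s θ a.coeff_mem) (-1) (θ - s) (finite_const (φ j)) x).congr
    fun g => ?_
  simp only [sTerm, leftW, leftτ]
  push_cast
  rw [show x + (g.1 : ℝ) * -1 = x - g.1 by ring]
  ring

lemma norm_leftW (g : ℤ × ℤ) (z : ZMod (1 : ℤ).natAbs × ℝ) : ‖leftW s θ g z‖ = 1 := by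
  unfold leftW
  rw [norm_mul, norm_leftPhase, one_mul]
  exact norm_exp_real_I (2 * Real.pi * g.2 * (θ - s) * z.2) _ (by push_cast; ring)

lemma leftτ_add (g h : ℤ × ℤ) (z : ZMod (1 : ℤ).natAbs × ℝ) : leftτ h (leftτ g z) = leftτ (g + h) z := by
  unfold leftτ
  ext
  · rfl
  · push_cast [Prod.fst_add]; ring

lemma leftW_mul (g h : ℤ × ℤ) (z : ZMod (1 : ℤ).natAbs × ℝ) :
    leftW s θ g z * leftW s θ h (leftτ g z) = phase (-θ) g h * leftW s θ (g + h) z := by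
  unfold leftW leftτ leftPhase phase
  have h3 := exp_two_pi_int (-(s * g.2 * h.1))
  rw [← mul_one (exp (-(2 * Real.pi * I * ((-θ : ℝ) : ℂ) * g.2 * h.1)) * _), ← h3]
  simp only [← exp_add]
  congr 1
  push_cast [Prod.fst_add, Prod.snd_add]
  ring

lemma leftAct_mul (a b : Torus (-θ)) (φ : HSpace 1) :
    leftAct s θ (a * b) φ = leftAct s θ a (leftAct s θ b φ) := by
  obtain ⟨K, hK⟩ := HSpace_bounded 1 φ
  funext j
  ext x
  have e : (fun z : ZMod (1 : ℤ).natAbs × ℝ => leftAct s θ b φ z.1 z.2)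
      = opSum (leftW s θ) leftτ b.coeff (fun z => φ z.1 z.2) := by
    funext z; exact leftAct_apply s θ b φ z.1 z.2
  rw [leftAct_apply, leftAct_apply, e]
  exact opSum_mul_left (norm_leftW s θ) (leftW_mul s θ) leftτ_add a b hK (j, x)

lemma leftAct_one (φ : HSpace 1) : leftAct s θ 1 φ = φ := by
  funext j
  ext x
  rw [leftAct_apply]
  unfold opSum
  rw [tsum_eq_single 0]
  · rw [Torus.coeff_one, if_pos rfl, one_mul]
    simp [leftW, leftτ, leftPhase]
  · intro g hg
    rw [Torus.coeff_one, if_neg hg, zero_mul]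

lemma leftAct_add_left (a b : Torus (-θ)) (φ : HSpace 1) :
    leftAct s θ (a + b) φ = leftAct s θ a φ + leftAct s θ b φ := by
  funext j
  ext x
  rw [Pi.add_apply, add_apply, leftAct_apply, leftAct_apply, leftAct_apply]
  unfold opSum
  rw [← (leftAct_summable s θ a φ j x).tsum_add (leftAct_summable s θ b φ j x)]
  exact tsum_congr fun g => by rw [Torus.coeff_add]; ring

lemma leftAct_add_right (a : Torus (-θ)) (φ ψ : HSpace 1) :
    leftAct s θ a (φ + ψ) = leftAct s θ a φ + leftAct s θ a ψ := by
  funext j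
  ext x
  rw [Pi.add_apply, add_apply, leftAct_apply, leftAct_apply, leftAct_apply]
  unfold opSum
  rw [← (leftAct_summable s θ a φ j x).tsum_add (leftAct_summable s θ a ψ j x)]
  exact tsum_congr fun g => by
    simp only [Pi.add_apply, add_apply]; ring

lemma leftAct_smul_left (c : ℂ) (a : Torus (-θ)) (φ : HSpace 1) :
    leftAct s θ (c • a) φ = c • leftAct s θ a φ := by
  funext j
  ext x
  rw [Pi.smul_apply, smul_apply, leftAct_apply, leftAct_apply]
  unfold opSum
  rw [smul_eq_mul, ← tsum_mul_left]
  exact tsum_congr fun g => by rw [Torus.coeff_smul]; ring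

lemma leftAct_zero_left (φ : HSpace 1) : leftAct s θ 0 φ = 0 := by
  have := leftAct_smul_left s θ 0 0 φ
  rwa [zero_smul, zero_smul] at this

lemma leftAct_zero_right (a : Torus (-θ)) : leftAct s θ a (0 : HSpace 1) = 0 := by
  have := leftAct_add_right s θ a 0 0
  rw [add_zero] at this
  exact left_eq_add.1 this

/-- The left `T_{-θ}`-module structure on Schwartz functions. -/
@[reducible] def leftModule : Module (Torus (-θ)) (HSpace 1) where
  smul a φ := leftAct s θ a φ
  one_smul φ := leftAct_one s θ φ
  mul_smul a b φ := leftAct_mul s θ a b φ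
  smul_zero a := leftAct_zero_right s θ a
  smul_add a φ ψ := leftAct_add_right s θ a φ ψ
  add_smul a b φ := leftAct_add_left s θ a b φ
  zero_smul φ := leftAct_zero_left s θ φ

lemma leftAct_comm (h : (s : ℝ) - θ ≠ 0) (a : Torus (-θ)) (b : Torus (-(1 / (s - θ)))) (φ : HSpace 1) :
    leftAct s θ a (heisAct 0 1 (1 / (s - θ)) b φ) = heisAct 0 1 (1 / (s - θ)) b (leftAct s θ a φ) := by
  obtain ⟨K, hK⟩ := HSpace_bounded 1 φ
  have h' : (s : ℂ) - θ ≠ 0 := by exact_mod_cast h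
  funext j
  ext x
  have e1 : (fun z : ZMod (1 : ℤ).natAbs × ℝ => heisAct 0 1 (1 / (s - θ)) b φ z.1 z.2)
      = opSum (heisW 0 1) (heisτ 0 1 (1 / (s - θ))) b.coeff (fun z => φ z.1 z.2) := by
    funext z; exact heisAct_apply 0 1 (1 / (s - θ)) b φ z.1 z.2
  have e2 : (fun z : ZMod (1 : ℤ).natAbs × ℝ => leftAct s θ a φ z.1 z.2)
      = opSum (leftW s θ) leftτ a.coeff (fun z => φ z.1 z.2) := by
    funext z; exact leftAct_apply s θ a φ z.1 z.2
  rw [leftAct_apply, heisAct_apply, e1, e2]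
  refine opSum_comm (norm_leftW s θ) (norm_heisW 0 1) ?_ ?_ a b hK (j, x)
  · intro g h z
    have hc : ∀ i q, chi 0 1 i q = 1 := fun i q => by simp [chi]
    unfold leftW leftτ heisW heisτ
    simp only [hc, one_mul]
    have h3 := exp_two_pi_int (g.2 * h.1 - h.2 * g.1)
    rw [← mul_one (exp (2 * (Real.pi : ℂ) * I * h.2 * z.2) * _), ← h3]
    simp only [leftPhase, ← exp_add]
    congr 1
    push_cast
    field_simp
    ring
  · intro g h z
    unfold leftτ heisτ
    ext
    · rfl
    · ring

/-- The bimodule `E_{0,1}^{1/(s-θ)}` with its constant curvature connection. -/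
def bimodS (h : (s : ℝ) - θ ≠ 0) : TorusBimodule θ (1 / (s - θ)) :=
  letI := heisRight 0 1 (1 / (s - θ))
  letI := leftModule s θ
  { carrier := HSpace 1
    leftTower := ⟨fun c a φ => leftAct_smul_left s θ c a φ⟩
    rightTower := ⟨fun c a φ => heisAct_smul_left 0 1 (1 / (s - θ)) c a.unop φ⟩
    comm := ⟨fun a b φ => leftAct_comm s θ h a b.unop φ⟩
    D := heisD 0 1 (1 / (s - θ))
    M := ((θ : ℂ) - s) • 1
    leibniz_right := heisD_leibniz 0 1 (1 / (s - θ)) (by simpa using h)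
    leibniz_left := by
      intro μ a φ
      have h' : (s : ℂ) - θ ≠ 0 := by exact_mod_cast h
      have hpi : (Real.pi : ℂ) ≠ 0 := by exact_mod_cast Real.pi_ne_zero
      change heisD 0 1 (1 / (s - θ)) μ (leftAct s θ a φ) =
        (∑ ν, (((θ : ℂ) - s) • (1 : Matrix (Fin 2) (Fin 2) ℂ)) μ ν • leftAct s θ (Torus.der ν a) φ)
          + leftAct s θ a (heisD 0 1 (1 / (s - θ)) μ φ)
      have hsum : (∑ ν, (((θ : ℂ) - s) • (1 : Matrix (Fin 2) (Fin 2) ℂ)) μ ν •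
          leftAct s θ (Torus.der ν a) φ) = ((θ : ℂ) - s) • leftAct s θ (Torus.der μ a) φ := by
        rw [Finset.sum_eq_single μ]
        · simp
        · intro ν _ hν; simp [Matrix.one_apply_ne (Ne.symm hν)]
        · simp
      rw [hsum]
      funext j
      ext x
      rw [Pi.add_apply, add_apply, Pi.smul_apply, smul_apply, smul_eq_mul]
      have key : ∀ ν : Fin 2, leftAct s θ (Torus.der ν a) φ j x = I * schwartzSeries _
          (rapid_idx (leftPhase_mem s θ a.coeff_mem) ν) (-1) (θ - s) (fun _ => φ j)
          (finite_const (φ j)) x := by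
        intro ν
        unfold leftAct
        rw [schwartzSeries_apply, schwartzSeries_apply, ← tsum_mul_left]
        refine tsum_congr fun g => ?_
        simp only [sTerm, Torus.coeff_der]
        ring
      rw [key μ]
      fin_cases μ
      · have e0 := schwartzSeries_mulX (leftPhase_mem s θ a.coeff_mem) (-1) (θ - s)
          (finite_const (φ j)) x
        have e1 : leftAct s θ a (heisD 0 1 (1 / (s - θ)) 0 φ) j x
            = (I * (θ - s) : ℂ) * schwartzSeries _ (leftPhase_mem s θ a.coeff_mem) (-1) (θ - s)
              (fun _ => mulX (φ j)) (finite_range_map (finite_const (φ j)) _) x := by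
          unfold leftAct
          rw [schwartzSeries_apply, schwartzSeries_apply, ← tsum_mul_left]
          refine tsum_congr fun g => ?_
          simp only [sTerm, heisD, if_pos, LinearMap.compLeft_apply, Function.comp_apply,
            LinearMap.smul_apply, smul_apply, smul_eq_mul]
          push_cast
          field_simp
          ring
        have e2 : heisD 0 1 (1 / (s - θ)) 0 (leftAct s θ a φ) j x
            = (I * (θ - s) : ℂ) * (x * leftAct s θ a φ j x) := by
          simp [heisD]
          left
          field_simp
          ring
        simp only [Fin.zero_eta]
        rw [e1, e2]
        unfold leftAct
        rw [e0]
        push_cast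
        ring
      · have e0 := schwartzSeries_deriv (leftPhase_mem s θ a.coeff_mem) (-1) (θ - s)
          (finite_const (φ j)) x
        have e1 : leftAct s θ a (heisD 0 1 (1 / (s - θ)) 1 φ) j x = (1 / (2 * Real.pi) : ℂ) *
            schwartzSeries _ (leftPhase_mem s θ a.coeff_mem) (-1) (θ - s)
              (fun _ => derX (φ j)) (finite_range_map (finite_const (φ j)) _) x := by
          unfold leftAct
          rw [schwartzSeries_apply, schwartzSeries_apply, ← tsum_mul_left]
          refine tsum_congr fun g => ?_
          simp only [sTerm, heisD, one_ne_zero, if_false, LinearMap.compLeft_apply,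
            Function.comp_apply, LinearMap.smul_apply, smul_apply, smul_eq_mul]
          ring
        have e2 : heisD 0 1 (1 / (s - θ)) 1 (leftAct s θ a φ) j x
            = (1 / (2 * Real.pi) : ℂ) * deriv (leftAct s θ a φ j) x := by
          simp [heisD]
        simp only [Fin.mk_one]
        rw [e1, e2]
        unfold leftAct
        rw [e0]
        push_cast
        field_simp
        ring }

end bimodS

/-- The bimodule structure on `T_{-θ}` obtained by restricting the right multiplication along an
algebra homomorphism intertwining the derivations up to a diagonal matrix with entries `ε`. -/
def bimodOfHom {θ θ' : ℝ} (ι : Torus (-θ') →ₐ[ℂ] Torus (-θ)) (ε : Fin 2 → ℂ)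
    (hι : ∀ μ b, ε μ • Torus.der μ (ι b) = ι (Torus.der μ b)) : TorusBimodule θ θ' :=
  letI : Module (Torus (-θ'))ᵐᵒᵖ (Torus (-θ)) := Module.compHom _ ι.toRingHom.op
  { carrier := Torus (-θ)
    rightTower := ⟨fun c b e => by
      change e * ι (c • b.unop) = c • (e * ι b.unop)
      rw [map_smul]
      exact mul_smul_comm c _ _⟩
    comm := ⟨fun a b e => (mul_assoc a e (ι b.unop)).symm⟩
    D := fun μ => ε μ • Torus.der μ
    M := Matrix.diagonal ε
    leibniz_right := fun μ e b => by
      change ε μ • Torus.der μ (e * ι b) = (ε μ • Torus.der μ e) * ι b + e * ι (Torus.der μ b)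
      rw [Torus.der_mul, ← hι, smul_add, smul_mul_assoc, mul_smul_comm]
    leibniz_left := fun μ a e => by
      rw [Finset.sum_eq_single μ]
      · change ε μ • Torus.der μ (a * e)
          = Matrix.diagonal ε μ μ • (Torus.der μ a * e) + a * (ε μ • Torus.der μ e)
        rw [Matrix.diagonal_apply_eq, Torus.der_mul, smul_add, mul_smul_comm]
      · intro ν _ hν; rw [Matrix.diagonal_apply_ne _ (Ne.symm hν), zero_smul]
      · simp }

/-- The identification `T_{-(θ+1)} = T_{-θ}`. -/
def shiftHom (θ : ℝ) : Torus (-(θ + 1)) →ₐ[ℂ] Torus (-θ) :=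
  AlgHom.ofLinearMap
    { toFun := fun a => Torus.mk a.coeff a.coeff_mem
      map_add' := fun a b => rfl
      map_smul' := fun c a => rfl }
    rfl
    (fun a b => by
      ext k
      change (a * b).coeff k = _
      rw [Torus.coeff_mul, Torus.coeff_mul]
      refine tsum_congr fun g => ?_
      change _ = a.coeff g * b.coeff (k - g) * _
      congr 1
      unfold phase
      rw [← mul_one (exp (-(2 * Real.pi * I * ((-θ : ℝ) : ℂ) * _ * _))),
        ← exp_two_pi_int (g.2 * (k - g).1), ← exp_add]
      congr 1
      push_cast
      ring)

/-- The bimodule `E_{1,0}^{θ+1}`. -/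
def bimodT (θ : ℝ) : TorusBimodule θ (θ + 1) :=
  bimodOfHom (shiftHom θ) 1 fun μ b => by rw [Pi.one_apply, one_smul]; rfl

lemma flip_mem {a : ℤ × ℤ → ℂ} (ha : a ∈ rapid) : (fun g : ℤ × ℤ => a (-g.1, g.2)) ∈ rapid := by
  intro N
  obtain ⟨C, hC⟩ := ha N
  exact ⟨C, fun g => by simpa [wt] using hC (-g.1, g.2)⟩

/-- The isomorphism `T_θ → T_{-θ}`, `U₁ ↦ U₁⁻¹`, `U₂ ↦ U₂`. -/
def flipHom (θ : ℝ) : Torus (-(-θ)) →ₐ[ℂ] Torus (-θ) :=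
  AlgHom.ofLinearMap
    { toFun := fun a => Torus.mk (fun g => a.coeff (-g.1, g.2)) (flip_mem a.coeff_mem)
      map_add' := fun a b => rfl
      map_smul' := fun c a => rfl }
    (by
      ext g
      change (1 : Torus (-(-θ))).coeff (-g.1, g.2) = _
      rw [Torus.coeff_one, Torus.coeff_one]
      simp [Prod.ext_iff])
    (fun a b => by
      ext k
      change (a * b).coeff (-k.1, k.2) = _
      rw [Torus.coeff_mul, Torus.coeff_mul,
        ← ((Equiv.neg ℤ).prodCongr (Equiv.refl ℤ)).tsum_eq]
      refine tsum_congr fun g => ?_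
      change a.coeff (-g.1, g.2) * b.coeff (-k.1 - -g.1, k.2 - g.2) * _
        = a.coeff (-g.1, g.2) * b.coeff (-(k.1 - g.1), k.2 - g.2) * _
      rw [show -k.1 - -g.1 = -(k.1 - g.1) by ring]
      congr 1
      unfold phase
      congr 1
      simp
      ring)

/-- The bimodule `E_{1,0}^{-θ}`. -/
def bimodR (θ : ℝ) : TorusBimodule θ (-θ) :=
  bimodOfHom (flipHom θ) ![-1, 1] fun μ b => by
    ext g
    change _ = I * Torus.idx μ (-g.1, g.2) * b.coeff (-g.1, g.2)
    rw [Torus.coeff_smul, Torus.coeff_der]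
    change _ * (_ * b.coeff (-g.1, g.2)) = _
    fin_cases μ
    · simp [Torus.idx]
    · simp [Torus.idx]

/-! ### Star product on the plane -/

/-- Scalar functions on the plane with coordinates `σ¹ = x`, `σ² = y`. -/
abbrev PlaneFn : Type := ℝ → ℝ → ℂ

/-- Column vector valued functions on the plane. -/
abbrev VecFn (N : ℕ) : Type := Fin N → PlaneFn

/-- Matrix valued functions on the plane. -/
abbrev MatFn (N : ℕ) : Type := Fin N → Fin N → PlaneFn

/-- Joint smoothness. -/
def IsSmooth (f : PlaneFn) : Prop := ContDiff ℝ ∞ fun z : ℝ × ℝ => f z.1 z.2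

/-- Partial derivatives. -/
def pd (μ : Fin 2) (f : PlaneFn) : PlaneFn := fun x y =>
  if μ = 0 then deriv (fun x' => f x' y) x else deriv (fun y' => f x y') y

/-- The Moyal star product `f ⋆ g = ∑_k (iπt)^k/k! · (∂₁ ⊗ ∂₂ - ∂₂ ⊗ ∂₁)^k (f ⊗ g)` restricted to the
diagonal, so that `[σ¹, σ²]_⋆ = 2πit`. It is only used when one factor is a polynomial, where the
sum is finite. -/
def star (t : ℂ) (f g : PlaneFn) : PlaneFn := fun x y =>
  ∑' k : ℕ, (I * Real.pi * t) ^ k / (k.factorial : ℂ) * ∑ j ∈ Finset.range (k + 1),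
    (-1) ^ j * (k.choose j : ℂ) *
      (((pd 0)^[k - j] ((pd 1)^[j] f)) x y * ((pd 0)^[j] ((pd 1)^[k - j] g)) x y)

/-- Matrix star product. -/
def mstar {N : ℕ} (t : ℂ) (A B : MatFn N) : MatFn N := fun i j => ∑ k, star t (A i k) (B k j)

/-- Star product of a matrix and a vector. -/
def vstar {N : ℕ} (t : ℂ) (A : MatFn N) (φ : VecFn N) : VecFn N := fun i => ∑ k, star t (A i k) (φ k)

/-- Star commutator. -/
def scomm {N : ℕ} (t : ℂ) (A B : MatFn N) : MatFn N := mstar t A B - mstar t B A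

/-- Star anticommutator. -/
def santi {N : ℕ} (t : ℂ) (A B : MatFn N) : MatFn N := mstar t A B + mstar t B A

/-- Partial derivative of a matrix function. -/
def mpd {N : ℕ} (μ : Fin 2) (A : MatFn N) : MatFn N := fun i j => pd μ (A i j)

/-- Partial derivative of a vector function. -/
def vpd {N : ℕ} (μ : Fin 2) (φ : VecFn N) : VecFn N := fun i => pd μ (φ i)

/-- The field strength `F_{μν} = ∂_μ A_ν - ∂_ν A_μ - i[A_μ, A_ν]_⋆`. -/
def fieldStrength {N : ℕ} (t : ℂ) (A : Fin 2 → MatFn N) (μ ν : Fin 2) : MatFn N :=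
  mpd μ (A ν) - mpd ν (A μ) - I • scomm t (A μ) (A ν)

/-- The covariant derivative `D_μ φ = ∂_μ φ - i A_μ ⋆ φ` in the fundamental representation. -/
def cov {N : ℕ} (t : ℂ) (A : Fin 2 → MatFn N) (μ : Fin 2) (φ : VecFn N) : VecFn N :=
  vpd μ φ - I • vstar t (A μ) φ

/-- The covariant derivative `D_μ Ψ = ∂_μ Ψ - i[A_μ, Ψ]_⋆` in the adjoint representation. -/
def covAdj {N : ℕ} (t : ℂ) (A : Fin 2 → MatFn N) (μ : Fin 2) (Ψ : MatFn N) : MatFn N :=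
  mpd μ Ψ - I • scomm t (A μ) Ψ

/-! ### The Seiberg-Witten differential equations -/

/-- Right hand side of the Seiberg-Witten equation for the gauge potential,
`-(π/2) ε^{αβ} {A_α, ∂_β A_κ + F_{βκ}}_⋆` with `ε^{12} = -ε^{21} = 1`. -/
def swGauge {N : ℕ} (t : ℂ) (A : Fin 2 → MatFn N) (κ : Fin 2) : MatFn N :=
  (-(Real.pi / 2) : ℂ) • (santi t (A 0) (mpd 1 (A κ) + fieldStrength t A 1 κ)
    - santi t (A 1) (mpd 0 (A κ) + fieldStrength t A 0 κ))

/-- Right hand side of the Seiberg-Witten equation for matter in the adjoint representation,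
without the covariant term. -/
def swAdj {N : ℕ} (t : ℂ) (A : Fin 2 → MatFn N) (Ψ : MatFn N) : MatFn N :=
  (-(Real.pi / 2) : ℂ) • (santi t (A 0) (mpd 1 Ψ + covAdj t A 1 Ψ)
    - santi t (A 1) (mpd 0 Ψ + covAdj t A 0 Ψ))

/-- Right hand side of the Seiberg-Witten equation for matter in the fundamental representation,
without the covariant term. -/
def swFund {N : ℕ} (t : ℂ) (A : Fin 2 → MatFn N) (φ : VecFn N) : VecFn N :=
  (-(Real.pi / 2) : ℂ) • (vstar t (A 0) (vpd 1 φ + cov t A 1 φ)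
    - vstar t (A 1) (vpd 0 φ + cov t A 0 φ))

/-- A covariant term: a finite linear combination of iterated covariant derivatives, with
coefficients depending on the noncommutativity parameter. -/
structure CovTerm (P : Finset ℂ) where
  words : Finset (List (Fin 2))
  c : List (Fin 2) → ℝ → ℂ
  analytic : ∀ w, AnalyticOnNhd ℝ (c w) {t : ℝ | (t : ℂ) ∉ P}

/-- The value of a covariant term on fundamental matter. -/
def CovTerm.fund {P : Finset ℂ} {N : ℕ} (C : CovTerm P) (t : ℝ) (A : Fin 2 → MatFn N)
    (φ : VecFn N) : VecFn N :=
  ∑ w ∈ C.words, C.c w t • w.foldr (cov t A) φ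

/-- The value of a covariant term on adjoint matter. -/
def CovTerm.adj {P : Finset ℂ} {N : ℕ} (C : CovTerm P) (t : ℝ) (A : Fin 2 → MatFn N)
    (Ψ : MatFn N) : MatFn N :=
  ∑ w ∈ C.words, C.c w t • w.foldr (covAdj t A) Ψ

/-! ### Bundles on the noncommutative torus -/

/-- Finite sums of plane waves `∑_q c_q e^{i(q₁ x + q₂ y)}`. -/
abbrev Wave : Type := (ℝ × ℝ) →₀ ℂ

/-- The function of a finite sum of plane waves. -/
def Wave.fn (p : Wave) : PlaneFn := fun x y => p.sum fun q c => c * exp (I * (q.1 * x + q.2 * y))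

/-- The star product `p ⋆ f` of a sum of plane waves with an arbitrary function:
`e^{iq·σ} ⋆ f = e^{iq·σ} f(x + πθ q₂, y - πθ q₁)`. -/
def Wave.starL (θ : ℝ) (p : Wave) (f : PlaneFn) : PlaneFn := fun x y =>
  p.sum fun q c => c * exp (I * (q.1 * x + q.2 * y)) *
    f (x + Real.pi * θ * q.2) (y - Real.pi * θ * q.1)

/-- The star product `f ⋆ p` of an arbitrary function with a sum of plane waves:
`f ⋆ e^{iq·σ} = e^{iq·σ} f(x - πθ q₂, y + πθ q₁)`. -/
def Wave.starR (θ : ℝ) (f : PlaneFn) (p : Wave) : PlaneFn := fun x y =>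
  p.sum fun q c => c * exp (I * (q.1 * x + q.2 * y)) *
    f (x - Real.pi * θ * q.2) (y + Real.pi * θ * q.1)

lemma Wave.starL_add (θ : ℝ) (p : Wave) (f g : PlaneFn) :
    p.starL θ (f + g) = p.starL θ f + p.starL θ g := by
  funext x y
  simp only [Wave.starL, Pi.add_apply, mul_add]
  exact Finset.sum_add_distrib

lemma Wave.starL_smul (θ : ℝ) (p : Wave) (c : ℂ) (f : PlaneFn) :
    p.starL θ (c • f) = c • p.starL θ f := by
  funext x y
  simp only [Wave.starL, Pi.smul_apply, smul_eq_mul, Finsupp.sum, Finset.mul_sum]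
  exact Finset.sum_congr rfl fun q _ => by ring

lemma Wave.starR_add (θ : ℝ) (p : Wave) (f g : PlaneFn) :
    Wave.starR θ (f + g) p = Wave.starR θ f p + Wave.starR θ g p := by
  funext x y
  simp only [Wave.starR, Pi.add_apply, mul_add]
  exact Finset.sum_add_distrib

lemma Wave.starR_smul (θ : ℝ) (p : Wave) (c : ℂ) (f : PlaneFn) :
    Wave.starR θ (c • f) p = c • Wave.starR θ f p := by
  funext x y
  simp only [Wave.starR, Pi.smul_apply, smul_eq_mul, Finsupp.sum, Finset.mul_sum]
  exact Finset.sum_congr rfl fun q _ => by ring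

/-- Translation by `2π` in the direction `α`. -/
def trans (α : Fin 2) (f : PlaneFn) : PlaneFn := fun x y =>
  if α = 0 then f (x + 2 * Real.pi) y else f x (y + 2 * Real.pi)

lemma trans_add (α : Fin 2) (f g : PlaneFn) : trans α (f + g) = trans α f + trans α g := by
  funext x y; simp only [trans, Pi.add_apply]; split_ifs <;> rfl

lemma trans_smul (α : Fin 2) (c : ℂ) (f : PlaneFn) : trans α (c • f) = c • trans α f := by
  funext x y; simp only [trans, Pi.smul_apply]; split_ifs <;> rfl

/-- A bundle with connection: transition matrices `Ω_1, Ω_2` and a gauge potential `A_1, A_2`. -/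
structure Bundle (N : ℕ) where
  Ω : Fin 2 → Fin N → Fin N → Wave
  A : Fin 2 → MatFn N

/-- The transition matrices as functions. -/
def Bundle.Ωfn {N : ℕ} (E : Bundle N) (α : Fin 2) : MatFn N := fun i j => (E.Ω α i j).fn

/-- The cocycle condition `Ω_1(σ²+2π) ⋆ Ω_2 = Ω_2(σ¹+2π) ⋆ Ω_1` and the periodicity
`∂_μ Ω_α - i A_μ(σ^α+2π) ⋆ Ω_α = - i Ω_α ⋆ A_μ` of the connection. -/
structure Bundle.IsBundle {N : ℕ} (θ : ℝ) (E : Bundle N) : Prop where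
  cocycle : ∀ i j, (∑ k, Wave.starR θ (trans 1 (E.Ω 0 i k).fn) (E.Ω 1 k j))
    = ∑ k, Wave.starR θ (trans 0 (E.Ω 1 i k).fn) (E.Ω 0 k j)
  connection : ∀ α μ, mpd μ (E.Ωfn α) - I • mstar θ (fun i j => trans α (E.A μ i j)) (E.Ωfn α)
    = -(I • mstar θ (E.Ωfn α) (E.A μ))

/-- Smooth sections: `φ(σ^α + 2π) = Ω_α ⋆ φ`. -/
def Bundle.sec {N : ℕ} (θ : ℝ) (E : Bundle N) : Submodule ℂ (VecFn N) where
  carrier := {φ | (∀ i, IsSmooth (φ i)) ∧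
    ∀ α i, trans α (φ i) = ∑ k, (E.Ω α i k).starL θ (φ k)}
  zero_mem' := by
    refine ⟨fun i => contDiff_const, fun α i => ?_⟩
    funext x y
    simp [trans, Wave.starL]
  add_mem' := by
    intro φ ψ hφ hψ
    refine ⟨fun i => (hφ.1 i).add (hψ.1 i), fun α i => ?_⟩
    simp only [Pi.add_apply]
    rw [trans_add, hφ.2, hψ.2, ← Finset.sum_add_distrib]
    exact Finset.sum_congr rfl fun k _ => (Wave.starL_add _ _ _ _).symm
  smul_mem' := by
    intro c φ hφ
    refine ⟨fun i => contDiff_const.mul (hφ.1 i), fun α i => ?_⟩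
    simp only [Pi.smul_apply]
    rw [trans_smul, hφ.2, Finset.smul_sum]
    exact Finset.sum_congr rfl fun k _ => (Wave.starL_smul _ _ _ _).symm

/-- Smooth sections of the adjoint bundle: `Ψ(σ^α + 2π) ⋆ Ω_α = Ω_α ⋆ Ψ`. -/
def Bundle.adjSec {N : ℕ} (θ : ℝ) (E : Bundle N) : Submodule ℂ (MatFn N) where
  carrier := {Ψ | (∀ i j, IsSmooth (Ψ i j)) ∧
    ∀ α i j, ∑ k, Wave.starR θ (trans α (Ψ i k)) (E.Ω α k j) = ∑ k, (E.Ω α i k).starL θ (Ψ k j)}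
  zero_mem' := by
    refine ⟨fun i j => contDiff_const, fun α i j => ?_⟩
    funext x y
    simp [trans, Wave.starL, Wave.starR]
  add_mem' := by
    intro φ ψ hφ hψ
    refine ⟨fun i j => (hφ.1 i j).add (hψ.1 i j), fun α i j => ?_⟩
    simp only [Pi.add_apply, trans_add, Wave.starR_add, Wave.starL_add, Finset.sum_add_distrib]
    rw [hφ.2, hψ.2]
  smul_mem' := by
    intro c φ hφ
    refine ⟨fun i j => contDiff_const.mul (hφ.1 i j), fun α i j => ?_⟩
    simp only [Pi.smul_apply, trans_smul, Wave.starR_smul, Wave.starL_smul, ← Finset.smul_sum]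
    rw [hφ.2]

/-! ### Seiberg-Witten maps -/

/-- A solution of the Seiberg-Witten equations for the gauge potential (polynomial in `σ`) and for
the transition matrices, analytic in the noncommutativity parameter away from finitely many poles. -/
structure GaugeSolution {N : ℕ} (P : Finset ℂ) (A Ωt : ℂ → Fin 2 → MatFn N) : Prop where
  poly : ∃ d : ℕ, ∀ t ∉ P, ∀ μ i j, ∃ p : MvPolynomial (Fin 2) ℂ, p.totalDegree ≤ d ∧
    ∀ x y : ℝ, A t μ i j x y = MvPolynomial.eval ![(x : ℂ), (y : ℂ)] p
  odeA : ∀ t ∉ P, ∀ κ i j x y,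
    HasDerivAt (fun t => A t κ i j x y) (swGauge t (A t) κ i j x y) t
  smooth : ∀ α i j, ContDiffOn ℝ ∞ (fun z : ℂ × ℝ × ℝ => Ωt z.1 α i j z.2.1 z.2.2) {z | z.1 ∉ P}
  odeΩ : ∀ t ∉ P, ∀ α i j x y,
    HasDerivAt (fun t => Ωt t α i j x y) (swAdj t (A t) (Ωt t α) i j x y) t

/-- A smooth family of fundamental matter fields solving the Seiberg-Witten equation
`dφ/dt = -(π/2) ε^{αβ} A_α ⋆ (∂_β φ + D_β φ) - π C(φ)`. -/
structure FundSolution {N : ℕ} (P : Finset ℂ) (A : ℂ → Fin 2 → MatFn N) (C : CovTerm P)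
    (Φ : ℝ → VecFn N) : Prop where
  smooth : ∀ i, ContDiffOn ℝ ∞ (fun z : ℝ × ℝ × ℝ => Φ z.1 i z.2.1 z.2.2) {z | (z.1 : ℂ) ∉ P}
  ode : ∀ t : ℝ, (t : ℂ) ∉ P → ∀ i x y, HasDerivAt (fun t => Φ t i x y)
    ((swFund t (A t) (Φ t) - (Real.pi : ℂ) • C.fund t (A t) (Φ t)) i x y) t

/-- A smooth family of adjoint matter fields solving the Seiberg-Witten equation
`dΨ/dt = -(π/2) ε^{αβ} {A_α, ∂_β Ψ + D_β Ψ}_⋆ - π C(Ψ)`. -/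
structure AdjSolution {N : ℕ} (P : Finset ℂ) (A : ℂ → Fin 2 → MatFn N) (C : CovTerm P)
    (Ψ : ℝ → MatFn N) : Prop where
  smooth : ∀ i j, ContDiffOn ℝ ∞ (fun z : ℝ × ℝ × ℝ => Ψ z.1 i j z.2.1 z.2.2) {z | (z.1 : ℂ) ∉ P}
  ode : ∀ t : ℝ, (t : ℂ) ∉ P → ∀ i j x y, HasDerivAt (fun t => Ψ t i j x y)
    ((swAdj t (A t) (Ψ t) - (Real.pi : ℂ) • C.adj t (A t) (Ψ t)) i j x y) t

/-- There is a Seiberg-Witten map from the bundle `E` at `θ` to the bundle `E'` at `θ'`: the gauge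
potentials and the transition matrices are joined by a solution of the Seiberg-Witten equations, and
so are, for suitable covariant terms, the sections in the fundamental and in the adjoint
representation, through linear bijections of the spaces of sections. -/
def SWMap {N : ℕ} (θ θ' : ℝ) (E E' : Bundle N) : Prop :=
  E.IsBundle θ ∧ E'.IsBundle θ' ∧
  ∃ (P : Finset ℂ) (A Ωt : ℂ → Fin 2 → MatFn N), (θ : ℂ) ∉ P ∧ (θ' : ℂ) ∉ P ∧
    GaugeSolution P A Ωt ∧ A θ = E.A ∧ A θ' = E'.A ∧ Ωt θ = E.Ωfn ∧ Ωt θ' = E'.Ωfn ∧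
    (∃ (C : CovTerm P) (S : E.sec θ ≃ₗ[ℂ] E'.sec θ'), ∀ φ : E.sec θ,
      ∃ Φ, FundSolution P A C Φ ∧ Φ θ = φ ∧ Φ θ' = S φ) ∧
    (∃ (C : CovTerm P) (S : E.adjSec θ ≃ₗ[ℂ] E'.adjSec θ'),
      (∀ t : ℝ, (t : ℂ) ∉ P → ∀ α, C.adj t (A t) (Ωt t α) = 0) ∧
      ∀ Ψ : E.adjSec θ, ∃ Ψt, AdjSolution P A C Ψt ∧ Ψt θ = Ψ ∧ Ψt θ' = S Ψ)

/-- The standard `U(N)` bundle of magnetic charge `m`: `Ω_1 = e^{imσ²/N} U`, `Ω_2 = V` with the clock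
and shift matrices `U, V`, and the constant curvature connection `A_1 = 0`,
`A_2 = m σ¹ / (2π(N - mθ))`. -/
def stdBundle (N : ℕ) (m : ℤ) (θ : ℝ) : Bundle N where
  Ω α k l := if α = 0
    then (if k = l then Finsupp.single ((0 : ℝ), (m / N : ℝ)) (exp (2 * Real.pi * I * (k + 1) * m / N))
      else 0)
    else (if (l : ℕ) = (k + 1) % N then Finsupp.single ((0 : ℝ), (0 : ℝ)) 1 else 0)
  A μ k l := fun x _ => if μ = 1 ∧ k = l then (m * x / (2 * Real.pi * (N - m * θ)) : ℂ) else 0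

/-- The module with connection `M` over `T_{-θ₀}` is the module of sections of the bundle `E` at
`θ`, where `θ - θ₀` is meant to be an integer, so that `T_{-θ} = T_{-θ₀}`: there is a linear
bijection onto the sections, which turns the right action of `U₁^p U₂^q` into
`φ ↦ φ ⋆ e^{ipσ¹} ⋆ e^{iqσ²}` and the connection into the covariant derivative. -/
def Bundle.IsSections {N : ℕ} {θ₀ : ℝ} (θ : ℝ) (E : Bundle N) (M : TorusModule θ₀) : Prop :=
  ∃ R : M.carrier ≃ₗ[ℂ] E.sec θ,
    (∀ φ (a : Torus (-θ₀)) i x y, HasSum (fun g : ℤ × ℤ => a.coeff g *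
      Wave.starR θ (Wave.starR θ ((R φ : VecFn N) i) (Finsupp.single ((g.1 : ℝ), 0) 1))
        (Finsupp.single (0, (g.2 : ℝ)) 1) x y) ((R (op a • φ) : VecFn N) i x y)) ∧
    ∀ μ φ, (R (M.D μ φ) : VecFn N) = cov θ E.A μ (R φ)

/-- A Seiberg-Witten map from the Heisenberg module `M` over `T_{-θ} = T_{-(θ+k)}` to the module `M'`
over `T_{-θ'} = T_{-(θ'+k)}`: `M` is the module of sections of a standard bundle at `θ + k`, with its
constant curvature connection, and `M'` is the module of sections of the bundle with connection at
`θ' + k` which is its Seiberg-Witten image. -/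
def SWRel (k : ℤ) {θ θ' : ℝ} (M : TorusModule θ) (M' : TorusModule θ') : Prop :=
  ∃ (N : ℕ) (m : ℤ) (E' : Bundle N), 0 < N ∧ IsCoprime (N : ℤ) m ∧
    (N : ℝ) - m * (θ + k) ≠ 0 ∧ (N : ℝ) - m * (θ' + k) ≠ 0 ∧
    2 * (N : ℝ) - m * (θ + k) ≠ 0 ∧ 2 * (N : ℝ) - m * (θ' + k) ≠ 0 ∧
    SWMap (θ + k) (θ' + k) (stdBundle N m (θ + k)) E' ∧
    (stdBundle N m (θ + k)).IsSections (θ + k) M ∧ E'.IsSections (θ' + k) M'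

/-- `M'` is the image of `M` under a Seiberg-Witten map `SW_θ^θ'`. -/
def IsSW {θ θ' : ℝ} (M : TorusModule θ) (M' : TorusModule θ') : Prop := ∃ k : ℤ, SWRel k M M'

/-! ### The T-duality group -/

/-- `TDual M g N`: the module with connection `N` is obtained from `M` by successively tensoring with
equivalence bimodules `E_{0,1}^{1/(s-θ)}`, `E_{1,0}^{θ+1}`, `E_{1,0}^{-θ}`, where `g` is the product
of the corresponding matrices of `GL(2,ℤ)`. -/
inductive TDual {θ : ℝ} (M : TorusModule θ) :
    Matrix (Fin 2) (Fin 2) ℤ → {θ₁ : ℝ} → TorusModule θ₁ → Prop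
  | refl : TDual M 1 M
  | S {g : Matrix (Fin 2) (Fin 2) ℤ} {θ₁ : ℝ} {N : TorusModule θ₁} (s : ℤ) (h : (s : ℝ) - θ₁ ≠ 0) :
      TDual M g N → TDual M (!![0, 1; -1, s] * g) (N.tensor (bimodS s θ₁ h))
  | T {g : Matrix (Fin 2) (Fin 2) ℤ} {θ₁ : ℝ} {N : TorusModule θ₁} :
      TDual M g N → TDual M (!![1, 1; 0, 1] * g) (N.tensor (bimodT θ₁))
  | R {g : Matrix (Fin 2) (Fin 2) ℤ} {θ₁ : ℝ} {N : TorusModule θ₁} :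
      TDual M g N → TDual M (!![1, 0; 0, -1] * g) (N.tensor (bimodR θ₁))

end NCT

end

/-!
The proof describes all modules in question by pairs of coprime integers. A Seiberg-Witten map leaves
the pair `(n, m)` of a Heisenberg module `E_{n,m}` fixed and changes `θ`, while an equivalence bimodule
acts on `(n, m)` by an integral matrix which does not depend on `θ`. Hence the two operations commute.

*Bimodules and tensor products.* Write `⟨f, g⟩` for the torus-valued pairings of Schwartz functions on
the line, whose symbols are given by lattice sums (`gabor`). A partition of unity expresses `1` as
a finite sum of such pairings, and the pairings for the two commuting actions are associative:
`⟨f, g⟩_L k = f ⟨g, k⟩_R` (`leftAct_pairL`). These two facts give a finite dual basis, fullness, and the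
identification of all right-linear endomorphisms (`bimodS_isCompleteMorita`). In the same way, a product
`P : E × B → K` together with a product `Q : K × B' → E` in the opposite direction, related by
associativity, identifies `E ⊗ B` with `K` (`tensor_iso_of_pairing`); for Heisenberg modules both
products are lattice sums (`tensP`, `tensQ`, `dualP`, `dualQ`). This yields `heis_tensor_bimodS`. The
two other bimodules come from isomorphisms of tori, and tensoring with them is restriction
(`heis_tensor_bimodT`, `heis_tensor_bimodR`).

*Sections.* The sections of the standard bundle of rank `N` and charge `m ≠ 0` at the parameter `t` are
the Zak transforms `∑_j f_j(a(j + y)) e^{ib(j + y)}` of `m`-periodic families of Schwartz functions, for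
any dilation `a ≠ 0`. For one value of `a` the Zak transform intertwines the module structures and the
connections, so that the sections form `E_{n,m}` at `θ = t - k`, where `n = N - km` (`isSections_heis`).
For `m = 0` the Zak transform is replaced by Fourier series.

*Existence of Seiberg-Witten maps.* The equations preserve potentials of the form `(0, c σ¹)`, with
`dc/dt = 2πc²`, and keep the transition matrices of the standard bundle constant. Adjoint matter is
rescaled in `σ¹`, and a section in the fundamental representation evolves by the dilation and the
amplitude of its Zak transform (`fundSolution_secFn`), with the poles `t = N/m` and `t = 2N/m`. So
standard bundles of the same rank and charge are related by a Seiberg-Witten map (`swMap_stdBundle`).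

*Uniqueness.* On polynomials of bounded degree derivatives are controlled by values. Therefore, if two
solutions for the potential agree at a point, their difference vanishes there to every order, and it is
zero by analyticity (`GaugeSolution.eq`). The equation for the transition matrices is then a transport
equation along rays in `σ¹`, and the image of a standard bundle is the standard bundle (`SWMap.eq_std`).
Consequently two modules are related exactly if they are isomorphic to `E_{n,m}` at the two parameters
with the same coprime `n, m` (`IsSW.exists_heis`, `isSW_heis`), and the curvature determines `(n, m)` up
to a common sign (`eq_or_eq_neg_of_heis_iso`).

*The duality group.* A `g`-dual of `E_{n,m}` is the Heisenberg module with charges `g(n, m)`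
(`TDual.iso_heis`), and the Euclidean algorithm, with some care to avoid the pole of the fractional
linear transformations, realizes every element of `GL(2,ℤ)` (`hasDual_of_isUnit`). Compatibility with
Seiberg-Witten maps is `IsSW.tDual`. The bimodules themselves are duals of the free module `E_{1,0}`
(`isSW_toRight`).
-/

noncomputable section
namespace NCT

open Complex MulOpposite
open scoped SchwartzMap TensorProduct ContDiff

/-! ### Criteria for rapid decrease -/

lemma iteratedDeriv_mem_of_closed {W : Submodule ℂ (ℝ → ℂ)}
    (hd : ∀ u ∈ W, Differentiable ℝ u ∧ deriv u ∈ W) (n : ℕ) {u : ℝ → ℂ} (hu : u ∈ W) :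
    iteratedDeriv n u ∈ W := by
  induction n generalizing u with
  | zero => simpa using hu
  | succ n ih => rw [iteratedDeriv_succ']; exact ih (hd u hu).2

/-- A space of functions spanned by bounded functions, whose span is closed under differentiation
and under multiplication by the coordinate, consists of Schwartz functions. -/
theorem schwartz_of_closed {S : Set (ℝ → ℂ)} (hb : ∀ u ∈ S, ∃ K : ℝ, ∀ x, ‖u x‖ ≤ K)
    (hd : ∀ u ∈ S, ∃ v ∈ Submodule.span ℂ S, ∀ x, HasDerivAt u (v x) x)
    (hx : ∀ u ∈ S, (fun x : ℝ => (x : ℂ) * u x) ∈ Submodule.span ℂ S)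
    {u : ℝ → ℂ} (hu : u ∈ S) : ∃ f : 𝓢(ℝ, ℂ), ⇑f = u := by
  set W := Submodule.span ℂ S with hW
  -- boundedness and both closure properties pass from `S` to its span.
  have hb' : ∀ u ∈ W, ∃ K : ℝ, ∀ x, ‖u x‖ ≤ K := by
    intro u hu
    induction hu using Submodule.span_induction with
    | mem u hu => exact hb u hu
    | zero => exact ⟨0, fun x => by simp⟩
    | add u v _ _ hu hv =>
      obtain ⟨K, hK⟩ := hu
      obtain ⟨K', hK'⟩ := hv
      exact ⟨K + K', fun x => (norm_add_le _ _).trans (add_le_add (hK x) (hK' x))⟩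
    | smul c u _ hu =>
      obtain ⟨K, hK⟩ := hu
      refine ⟨‖c‖ * K, fun x => ?_⟩
      rw [Pi.smul_apply, norm_smul]
      exact mul_le_mul_of_nonneg_left (hK x) (norm_nonneg _)
  have hd1 : ∀ u ∈ W, ∃ v ∈ W, ∀ x, HasDerivAt u (v x) x := by
    intro u hu
    induction hu using Submodule.span_induction with
    | mem u hu => exact hd u hu
    | zero => exact ⟨0, zero_mem _, fun x => hasDerivAt_const x (0 : ℂ)⟩
    | add u v _ _ hu hv =>
      obtain ⟨u', hu', h⟩ := hu
      obtain ⟨v', hv', h'⟩ := hv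
      exact ⟨u' + v', add_mem hu' hv', fun x => (h x).add (h' x)⟩
    | smul c u _ hu =>
      obtain ⟨u', hu', h⟩ := hu
      exact ⟨c • u', W.smul_mem c hu', fun x => (h x).const_smul c⟩
  have hd' : ∀ u ∈ W, Differentiable ℝ u ∧ deriv u ∈ W := by
    intro u hu
    obtain ⟨v, hv, h⟩ := hd1 u hu
    refine ⟨fun x => (h x).differentiableAt, ?_⟩
    rwa [show deriv u = v from funext fun x => (h x).deriv]
  have hx1 : ∀ u ∈ W, (fun x : ℝ => (x : ℂ) * u x) ∈ W := by
    intro u hu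
    induction hu using Submodule.span_induction with
    | mem u hu => exact hx u hu
    | zero => convert zero_mem W using 1; funext g; simp
    | add u v _ _ hu hv => convert add_mem hu hv using 1; funext g; simp [mul_add]
    | smul c u _ hu =>
      have := W.smul_mem c hu
      convert this using 1
      funext x
      simp only [Pi.smul_apply, smul_eq_mul]; ring
  have hx' : ∀ k : ℕ, ∀ u ∈ W, (fun x : ℝ => (x : ℂ) ^ k * u x) ∈ W := by
    intro k
    induction k with
    | zero => intro u hu; simpa using hu
    | succ k ih =>
      intro u hu
      have := ih _ (hx1 u hu)
      convert this using 1
      funext x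
      ring
  have huW : u ∈ W := Submodule.subset_span hu
  refine ⟨{ toFun := u, smooth' := ?_, decay' := ?_ }, rfl⟩
  · refine contDiff_of_differentiable_iteratedDeriv fun m _ => ?_
    exact (hd' _ (iteratedDeriv_mem_of_closed hd' m huW)).1
  · intro k n
    obtain ⟨K, hK⟩ := hb' _ (hx' k _ (iteratedDeriv_mem_of_closed hd' n huW))
    refine ⟨K, fun x => ?_⟩
    rw [norm_iteratedFDeriv_eq_norm_iteratedDeriv]
    simpa using hK x

/-- A space of double sequences spanned by bounded ones, whose span is closed under multiplication
by both indices, consists of rapidly decreasing sequences. -/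
theorem rapid_of_closed {S : Set (ℤ × ℤ → ℂ)} (hb : ∀ u ∈ S, ∃ K : ℝ, ∀ g, ‖u g‖ ≤ K)
    (hx : ∀ u ∈ S, ∀ μ : Fin 2, (fun g => (Torus.idx μ g : ℂ) * u g) ∈ Submodule.span ℂ S)
    {u : ℤ × ℤ → ℂ} (hu : u ∈ S) : u ∈ rapid := by
  set W := Submodule.span ℂ S with hW
  have hx1 : ∀ μ : Fin 2, ∀ u ∈ W, (fun g => (Torus.idx μ g : ℂ) * u g) ∈ W := by
    intro μ u hu
    induction hu using Submodule.span_induction with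
    | mem u hu => exact hx u hu μ
    | zero => convert zero_mem W using 1; funext g; simp
    | add u v _ _ hu hv => convert add_mem hu hv using 1; funext g; simp [mul_add]
    | smul c u _ hu =>
      have := W.smul_mem c hu
      convert this using 1
      funext x
      simp only [Pi.smul_apply, smul_eq_mul]; ring
  have key : ∀ N : ℕ, ∀ u ∈ W, ∃ C : ℝ, ∀ g, wt g ^ N * ‖u g‖ ≤ C := by
    intro N
    induction N with
    | zero =>
      intro u hu
      induction hu using Submodule.span_induction with
      | mem u hu => simpa using hb u hu
      | zero => exact ⟨0, fun x => by simp⟩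
      | add u v _ _ hu hv =>
        obtain ⟨K, hK⟩ := hu
        obtain ⟨K', hK'⟩ := hv
        refine ⟨K + K', fun x => ?_⟩
        have h1 := hK x
        have h2 := hK' x
        have := norm_add_le (u x) (v x)
        simp only [pow_zero, one_mul, Pi.add_apply] at *
        linarith
      | smul c u _ hu =>
        obtain ⟨K, hK⟩ := hu
        refine ⟨‖c‖ * K, fun x => ?_⟩
        rw [Pi.smul_apply, norm_smul, pow_zero, one_mul]
        have := hK x
        rw [pow_zero, one_mul] at this
        exact mul_le_mul_of_nonneg_left this (norm_nonneg _)
    -- one more factor `wt g = (1 + |p|)(1 + |q|)` is a sum of four products of indices.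
    | succ N ih =>
      intro u hu
      obtain ⟨C0, h0⟩ := ih u hu
      obtain ⟨C1, h1⟩ := ih _ (hx1 0 u hu)
      obtain ⟨C2, h2⟩ := ih _ (hx1 1 u hu)
      obtain ⟨C3, h3⟩ := ih _ (hx1 0 _ (hx1 1 u hu))
      refine ⟨C0 + C1 + C2 + C3, fun g => ?_⟩
      have e0 := h0 g
      have e1 := h1 g
      have e2 := h2 g
      have e3 := h3 g
      simp only [norm_mul, Complex.norm_intCast, Torus.idx, one_ne_zero, if_true, if_false]
        at e1 e2 e3
      have : wt g ^ (N + 1) * ‖u g‖ = wt g ^ N * ‖u g‖ + wt g ^ N * (|(g.1 : ℝ)| * ‖u g‖)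
          + wt g ^ N * (|(g.2 : ℝ)| * ‖u g‖)
          + wt g ^ N * (|(g.1 : ℝ)| * (|(g.2 : ℝ)| * ‖u g‖)) := by
        rw [pow_succ]; nth_rewrite 2 [wt]; ring
      linarith
  exact fun N => key N u (Submodule.subset_span hu)

/-! ### Affine substitutions and products of Schwartz functions -/

/-- The substitution `f ↦ f(a x + b)`, `a ≠ 0`, on Schwartz functions. -/
def affS (a : ℝˣ) (b : ℝ) : 𝓢(ℝ, ℂ) →ₗ[ℂ] 𝓢(ℝ, ℂ) :=
  ((SchwartzMap.compCLMOfContinuousLinearEquiv ℂ (ContinuousLinearEquiv.smulLeft a : ℝ ≃L[ℝ] ℝ)).comp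
    (SchwartzMap.compSubConstCLM ℂ (-b)) : 𝓢(ℝ, ℂ) →L[ℂ] 𝓢(ℝ, ℂ))

@[simp] lemma affS_apply (a : ℝˣ) (b : ℝ) (f : 𝓢(ℝ, ℂ)) (x : ℝ) :
    affS a b f x = f (a * x + b) := by
  simp [affS, Units.smul_def]

/-- The product of Schwartz functions. -/
def mulS (f g : 𝓢(ℝ, ℂ)) : 𝓢(ℝ, ℂ) := SchwartzMap.smulLeftCLM ℂ f g

@[simp] lemma mulS_apply (f g : 𝓢(ℝ, ℂ)) (x : ℝ) : mulS f g x = f x * g x :=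
  SchwartzMap.smulLeftCLM_apply_apply f.hasTemperateGrowth g x

lemma schwartz_bounded (f : 𝓢(ℝ, ℂ)) : ∃ K : ℝ, 0 ≤ K ∧ ∀ x, ‖f x‖ ≤ K :=
  ⟨_, apply_nonneg _ _, SchwartzMap.norm_le_seminorm ℝ f⟩

lemma summable_int_inv_sq : Summable fun p : ℤ => ((1 + |(p : ℝ)|) ^ 2)⁻¹ := by
  have h0 : Summable fun n : ℕ => ((1 + (n : ℝ)) ^ 2)⁻¹ := by
    refine ((summable_nat_add_iff 1).2 (Real.summable_nat_pow_inv.2 (one_lt_two))).congr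
      fun n => ?_
    push_cast; ring
  refine Summable.of_nat_of_neg ?_ ?_ <;> simpa using h0

/-- Locally uniform quadratic decay of a Schwartz function along a lattice. -/
lemma schwartz_lattice_bound (f : 𝓢(ℝ, ℂ)) {u : ℝ} (hu : u ≠ 0) :
    ∃ C : ℝ, 0 ≤ C ∧ ∀ (z : ℝ) (k : ℤ),
      ‖f (z + k * u)‖ ≤ C * (1 + |z|) ^ 2 * ((1 + |(k : ℝ)|) ^ 2)⁻¹ := by
  obtain ⟨C0, hC0, h0⟩ := f.decay 0 0
  obtain ⟨C2, hC2, h2⟩ := f.decay 2 0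
  simp only [pow_zero, one_mul, norm_iteratedFDeriv_zero] at h0 h2
  set v := 1 + |u|⁻¹ with hv
  have hu' : 0 < |u| := abs_pos.2 hu
  have hv1 : 1 ≤ v := by rw [hv]; have := inv_pos.2 hu'; linarith
  refine ⟨2 * (C0 + C2) * v ^ 2, by positivity, fun z k => ?_⟩
  set y := z + k * u with hy
  have hk : |(k : ℝ)| ≤ |u|⁻¹ * (|y| + |z|) := by
    have : (k : ℝ) * u = y - z := by rw [hy]; ring
    have h3 : |(k : ℝ)| * |u| ≤ |y| + |z| := by
      rw [← abs_mul, this]; exact abs_sub y z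
    rw [inv_mul_eq_div, le_div_iff₀ hu']
    exact h3
  -- `|k|` is controlled by `(1 + |z|)(1 + |y|)`, so decay in `y` gives decay in `k`.
  have hk1 : 1 + |(k : ℝ)| ≤ v * ((1 + |z|) * (1 + |y|)) := by
    have h4 : |u|⁻¹ * (|y| + |z|) ≤ |u|⁻¹ * ((1 + |z|) * (1 + |y|)) := by
      gcongr
      nlinarith [abs_nonneg z, abs_nonneg y]
    have h5 : 1 ≤ (1 + |z|) * (1 + |y|) := by nlinarith [abs_nonneg z, abs_nonneg y]
    rw [hv]; nlinarith
  have hk2 : (1 + |(k : ℝ)|) ^ 2 ≤ v ^ 2 * (1 + |z|) ^ 2 * (1 + |y|) ^ 2 := by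
    rw [← mul_pow, ← mul_pow, mul_assoc]
    exact pow_le_pow_left₀ (by positivity) hk1 2
  have hf : (1 + |y|) ^ 2 * ‖f y‖ ≤ 2 * (C0 + C2) := by
    have a0 := h0 y
    have a2 := h2 y
    rw [Real.norm_eq_abs] at a2
    have : (1 + |y|) ^ 2 ≤ 2 * (1 + |y| ^ 2) := by nlinarith [sq_nonneg (1 - |y|)]
    calc (1 + |y|) ^ 2 * ‖f y‖ ≤ 2 * (1 + |y| ^ 2) * ‖f y‖ := by gcongr
      _ = 2 * (‖f y‖ + |y| ^ 2 * ‖f y‖) := by ring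
      _ ≤ _ := by linarith
  rw [← div_eq_mul_inv, le_div_iff₀ (by positivity)]
  calc ‖f y‖ * (1 + |(k : ℝ)|) ^ 2
      ≤ ‖f y‖ * (v ^ 2 * (1 + |z|) ^ 2 * (1 + |y|) ^ 2) := by gcongr
    _ = v ^ 2 * (1 + |z|) ^ 2 * ((1 + |y|) ^ 2 * ‖f y‖) := by ring
    _ ≤ v ^ 2 * (1 + |z|) ^ 2 * (2 * (C0 + C2)) := by gcongr
    _ = _ := by ring

lemma schwartz_lattice_summable (f : 𝓢(ℝ, ℂ)) {u : ℝ} (hu : u ≠ 0) (z : ℝ) :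
    Summable fun k : ℤ => ‖f (z + k * u)‖ := by
  obtain ⟨C, _, h⟩ := schwartz_lattice_bound f hu
  exact Summable.of_nonneg_of_le (fun _ => norm_nonneg _) (h z) (summable_int_inv_sq.mul_left _)

/-- The sum of a Schwartz function over a shifted lattice is bounded uniformly in the shift. -/
lemma schwartz_lattice_tsum_le (f : 𝓢(ℝ, ℂ)) {u : ℝ} (hu : u ≠ 0) :
    ∃ K : ℝ, 0 ≤ K ∧ ∀ z : ℝ, ∑' k : ℤ, ‖f (z + k * u)‖ ≤ K := by
  obtain ⟨C, hC, h⟩ := schwartz_lattice_bound f hu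
  refine ⟨C * (1 + |u|) ^ 2 * ∑' k : ℤ, ((1 + |(k : ℝ)|) ^ 2)⁻¹,
    mul_nonneg (by positivity) (tsum_nonneg fun _ => by positivity), fun z => ?_⟩
  -- shifting the summation index reduces to `z` in a fundamental domain of the lattice `uℤ`.
  have h1 : ∑' k : ℤ, ‖f (z + k * u)‖ = ∑' k : ℤ, ‖f (u * Int.fract (z / u) + k * u)‖ := by
    rw [← (Equiv.subRight ⌊z / u⌋).tsum_eq]
    refine tsum_congr fun k => ?_
    congr 2
    have : z = u * (⌊z / u⌋ + Int.fract (z / u)) := by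
      rw [Int.floor_add_fract]; field_simp
    simp only [Equiv.subRight_apply]
    push_cast
    nth_rewrite 1 [this]
    ring
  rw [h1, ← tsum_mul_left]
  refine Summable.tsum_le_tsum (fun k => ?_) (schwartz_lattice_summable f hu _)
    (summable_int_inv_sq.mul_left _)
  refine (h _ k).trans ?_
  have : |u * Int.fract (z / u)| ≤ |u| := by
    rw [abs_mul, abs_of_nonneg (Int.fract_nonneg (z / u))]
    exact mul_le_of_le_one_right (abs_nonneg _) (Int.fract_lt_one _).le
  gcongr

/-! ### Fourier series on the line -/

lemma norm_exp_two_pi (q : ℤ) (x : ℝ) : ‖exp (2 * Real.pi * I * q * x)‖ = 1 :=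
  norm_exp_real_I (2 * Real.pi * q * x) _ (by push_cast; ring)

lemma integral_exp_int (n : ℤ) :
    ∫ x in (0 : ℝ)..1, exp (2 * Real.pi * I * n * x) = if n = 0 then 1 else 0 := by
  split_ifs with h
  · simp [h]
  · have hn : (2 * Real.pi * I * n : ℂ) ≠ 0 := by
      simp [h, Real.pi_ne_zero]
    rw [integral_exp_mul_complex hn]
    simp only [ofReal_one, mul_one, ofReal_zero, mul_zero, exp_zero]
    rw [exp_two_pi_int, sub_self, zero_div]

/-- The coefficients of an absolutely convergent Fourier series. -/
lemma fourier_coeff_of_tsum {c : ℤ → ℂ} (hc : Summable fun q => ‖c q‖) (n : ℤ) :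
    ∫ x in (0 : ℝ)..1, (∑' q, c q * exp (2 * Real.pi * I * q * x)) * exp (-(2 * Real.pi * I * n * x))
      = c n := by
  have hcont : ∀ q : ℤ, Continuous fun x : ℝ => c q * exp (2 * Real.pi * I * ((q - n : ℤ) : ℂ) * x) :=
    fun q => by fun_prop
  have h1 := intervalIntegral.hasSum_intervalIntegral_of_summable_norm (a := (0 : ℝ)) (b := 1)
    (f := fun q => (⟨_, hcont q⟩ : C(ℝ, ℂ))) (by
      refine Summable.of_nonneg_of_le (fun _ => norm_nonneg _) (fun q => ?_) hc
      rw [ContinuousMap.norm_le _ (norm_nonneg _)]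
      intro x
      simp only [ContinuousMap.restrict_apply, ContinuousMap.coe_mk, norm_mul]
      rw [norm_exp_two_pi, mul_one])
  have h2 : ∀ x : ℝ, (∑' q, c q * exp (2 * Real.pi * I * q * x)) * exp (-(2 * Real.pi * I * n * x))
      = ∑' q, c q * exp (2 * Real.pi * I * ((q - n : ℤ) : ℂ) * x) := by
    intro x
    rw [← tsum_mul_right]
    refine tsum_congr fun q => ?_
    rw [mul_assoc, ← exp_add]
    congr 2
    push_cast; ring
  simp_rw [h2]
  refine (h1.unique ?_)
  have h3 : ∀ q : ℤ, ∫ x in (0 : ℝ)..1, c q * exp (2 * Real.pi * I * ((q - n : ℤ) : ℂ) * x)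
      = if q = n then c n else 0 := by
    intro q
    rw [intervalIntegral.integral_const_mul, integral_exp_int]
    simp only [sub_eq_zero]
    split_ifs with h
    · rw [h, mul_one]
    · rw [mul_zero]
  simp only [ContinuousMap.coe_mk, h3]
  exact hasSum_ite_eq n (c n)

/-- An absolutely convergent Fourier series vanishing identically has zero coefficients. -/
lemma fourier_unique {c : ℤ → ℂ} (hc : Summable fun q => ‖c q‖)
    (h : ∀ x : ℝ, ∑' q, c q * exp (2 * Real.pi * I * q * x) = 0) (n : ℤ) : c n = 0 := by
  rw [← fourier_coeff_of_tsum hc n]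
  simp [h]

/-- Pointwise Fourier inversion for periodic functions with summable coefficients. -/
lemma fourier_inversion {f : ℝ → ℂ} (hf : Continuous f) (hp : Function.Periodic f 1)
    (hs : Summable fun q : ℤ => ∫ x in (0 : ℝ)..1, f x * exp (-(2 * Real.pi * I * q * x))) (x : ℝ) :
    HasSum (fun q : ℤ => (∫ x in (0 : ℝ)..1, f x * exp (-(2 * Real.pi * I * q * x)))
      * exp (2 * Real.pi * I * q * x)) (f x) := by
  let F : C(UnitAddCircle, ℂ) := ⟨hp.lift, continuous_coinduced_dom.mpr hf⟩
  have hF : (fourierCoeff F : ℤ → ℂ)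
      = fun q : ℤ => ∫ x in (0 : ℝ)..1, f x * exp (-(2 * Real.pi * I * q * x)) := by
    funext q
    rw [fourierCoeff_eq_intervalIntegral _ _ 0]
    simp only [div_one, one_smul, zero_add]
    refine intervalIntegral.integral_congr fun x _ => ?_
    change _ * f x = _
    rw [fourier_coe_apply, mul_comm]
    congr 2
    push_cast
    ring
  have h := has_pointwise_sum_fourier_series_of_summable (f := F) (by rw [hF]; exact hs) x
  rw [hF] at h
  refine (iff_of_eq (congrArg (HasSum · _) (funext fun q => ?_))).mp h
  rw [fourier_coe_apply, smul_eq_mul]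
  congr 2
  push_cast
  ring

open FourierTransform in
/-- Poisson summation: the periodization of `f` is the Fourier series of the samples of its Fourier
transform. -/
lemma poisson (f : 𝓢(ℝ, ℂ)) (z : ℝ) :
    ∑' q : ℤ, 𝓕 (f : ℝ → ℂ) q * exp (2 * Real.pi * I * q * z) = ∑' k : ℤ, f (z + k) := by
  rw [SchwartzMap.tsum_eq_tsum_fourier]
  refine tsum_congr fun q => ?_
  rw [fourier_coe_apply, ← SchwartzMap.fourier_coe]
  congr 2
  push_cast
  ring

/-! ### Torus-valued pairings of Schwartz functions -/

open FourierTransform in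
/-- The sampled short-time Fourier transform `(p,q) ↦ ∫ h(z) g(z + p u) e^{-2πi q z} dz`. -/
def gaborCoeff (u : ℝ) (h g : 𝓢(ℝ, ℂ)) (k : ℤ × ℤ) : ℂ :=
  𝓕 (mulS h (affS 1 (k.1 * u) g) : ℝ → ℂ) k.2

open FourierTransform in
lemma gaborCoeff_eq (u : ℝ) (h g : 𝓢(ℝ, ℂ)) (k : ℤ × ℤ) :
    gaborCoeff u h g k
      = ∫ z : ℝ, exp (((-2 * Real.pi * z * k.2 : ℝ) : ℂ) * I) * (h z * g (z + k.1 * u)) := by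
  rw [gaborCoeff, Real.fourier_real_eq_integral_exp_smul]
  refine MeasureTheory.integral_congr_ae (Filter.Eventually.of_forall fun z => ?_)
  simp

lemma gaborCoeff_bounded (u : ℝ) (h g : 𝓢(ℝ, ℂ)) : ∃ K : ℝ, ∀ k, ‖gaborCoeff u h g k‖ ≤ K := by
  obtain ⟨K, hK0, hK⟩ := schwartz_bounded g
  refine ⟨∫ z : ℝ, ‖h z‖ * K, fun k => ?_⟩
  rw [gaborCoeff_eq]
  refine MeasureTheory.norm_integral_le_of_norm_le (h.integrable.norm.mul_const K)
    (Filter.Eventually.of_forall fun z => ?_)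
  rw [norm_mul, norm_exp_ofReal_mul_I, one_mul, norm_mul]
  gcongr
  exact hK _

lemma gaborCoeff_idx_zero {u : ℝ} (hu : u ≠ 0) (h g : 𝓢(ℝ, ℂ)) :
    (fun k => (Torus.idx 0 k : ℂ) * gaborCoeff u h g k)
      = (u⁻¹ : ℂ) • (gaborCoeff u h (mulX g) - gaborCoeff u (mulX h) g) := by
  have hu' : (u : ℂ) ≠ 0 := by exact_mod_cast hu
  funext k
  have hi : ∀ h g : 𝓢(ℝ, ℂ), MeasureTheory.Integrable fun z : ℝ =>
      exp (((-2 * Real.pi * z * k.2 : ℝ) : ℂ) * I) * (h z * g (z + k.1 * u)) := by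
    intro h g
    refine (mulS h (affS 1 (k.1 * u) g)).integrable.norm.mono' (by fun_prop)
      (Filter.Eventually.of_forall fun z => ?_)
    rw [norm_mul, norm_exp_ofReal_mul_I, one_mul]
    simp
  simp only [Pi.smul_apply, Pi.sub_apply, smul_eq_mul]
  rw [gaborCoeff_eq, gaborCoeff_eq, gaborCoeff_eq, ← MeasureTheory.integral_sub (hi _ _) (hi _ _),
    ← MeasureTheory.integral_const_mul, ← MeasureTheory.integral_const_mul]
  refine MeasureTheory.integral_congr_ae (Filter.Eventually.of_forall fun z => ?_)
  simp only [mulX_apply, Torus.idx, if_true]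
  push_cast
  field_simp
  ring

open FourierTransform in
lemma gaborCoeff_idx_one (u : ℝ) (h g : 𝓢(ℝ, ℂ)) :
    (fun k => (Torus.idx 1 k : ℂ) * gaborCoeff u h g k)
      = ((2 * Real.pi * I)⁻¹ : ℂ) • (gaborCoeff u (derX h) g + gaborCoeff u h (derX g)) := by
  have hpi : (Real.pi : ℂ) ≠ 0 := by exact_mod_cast Real.pi_ne_zero
  funext k
  set F := mulS h (affS 1 (k.1 * u) g) with hF
  have hd : deriv (F : ℝ → ℂ)
      = ⇑(mulS (derX h) (affS 1 (k.1 * u) g) + mulS h (affS 1 (k.1 * u) (derX g))) := by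
    funext z
    have e1 := h.hasDerivAt z
    have e2 := (g.hasDerivAt (z + k.1 * u)).comp_add_const z (k.1 * u)
    have e3 : (F : ℝ → ℂ) = fun z => h z * g (z + k.1 * u) := by funext z; simp [hF]
    rw [e3]
    refine (e1.mul e2).deriv.trans ?_
    simp
  have h1 := Real.fourier_deriv F.integrable F.differentiable
    (by rw [hd]; exact SchwartzMap.integrable _)
  have h2 := congrFun h1 (k.2 : ℝ)
  rw [hd, ← SchwartzMap.fourier_coe, FourierTransform.fourier_add, add_apply,
    SchwartzMap.fourier_coe, SchwartzMap.fourier_coe] at h2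
  simp only [Pi.smul_apply, Pi.add_apply, smul_eq_mul, gaborCoeff] at h2 ⊢
  rw [h2, ← hF]
  simp only [Torus.idx, one_ne_zero, if_false]
  push_cast
  field_simp

lemma gaborCoeff_rapid {u : ℝ} (hu : u ≠ 0) (h g : 𝓢(ℝ, ℂ)) : gaborCoeff u h g ∈ rapid := by
  -- integration by parts turns both index multiplications into combinations of other coefficients
  -- of the same kind, namely those of `zh`, `zg`, `h'`, `g'`
  refine rapid_of_closed (S := Set.range fun x : 𝓢(ℝ, ℂ) × 𝓢(ℝ, ℂ) => gaborCoeff u x.1 x.2)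
    ?_ ?_ ⟨(h, g), rfl⟩
  · rintro _ ⟨x, rfl⟩
    exact gaborCoeff_bounded u x.1 x.2
  · rintro _ ⟨x, rfl⟩ μ
    have hm : ∀ h g, gaborCoeff u h g ∈ Submodule.span ℂ
        (Set.range fun x : 𝓢(ℝ, ℂ) × 𝓢(ℝ, ℂ) => gaborCoeff u x.1 x.2) :=
      fun h g => Submodule.subset_span ⟨(h, g), rfl⟩
    fin_cases μ
    · simp only [Fin.zero_eta]
      rw [gaborCoeff_idx_zero hu]
      exact Submodule.smul_mem _ _ (sub_mem (hm _ _) (hm _ _))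
    · simp only [Fin.mk_one]
      rw [gaborCoeff_idx_one]
      exact Submodule.smul_mem _ _ (add_mem (hm _ _) (hm _ _))

/-- The element `∑ V(p,q) U₁^p U₂^q`, `V(p,q) = ∫ h(z) g(z + p u) e^{-2πi q z} dz`, of a torus. -/
def gabor {ϑ u : ℝ} (hu : u ≠ 0) (h g : 𝓢(ℝ, ℂ)) : Torus ϑ :=
  Torus.mk (gaborCoeff u h g) (gaborCoeff_rapid hu h g)

/-- The periodic function `∑_q a(p,q) e^{2πi q z}`. In terms of these symbols the actions of the
torus on functions become single sums over translations, and the elements `gabor` lattice sums of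
products. -/
def Torus.symb {ϑ : ℝ} (a : Torus ϑ) (p : ℤ) (z : ℝ) : ℂ :=
  ∑' q : ℤ, a.coeff (p, q) * exp (2 * Real.pi * I * q * z)

lemma Torus.coeff_summable_snd {ϑ : ℝ} (a : Torus ϑ) (p : ℤ) :
    Summable fun q : ℤ => ‖a.coeff (p, q)‖ :=
  a.norm_summable.comp_injective (i := fun q : ℤ => (p, q)) fun q q' h => by simpa using h

/-- An element of the torus is determined by its symbol. -/
lemma Torus.ext_symb {ϑ : ℝ} {a b : Torus ϑ} (h : ∀ p z, a.symb p z = b.symb p z) : a = b := by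
  ext ⟨p, q⟩
  have hs : ∀ (a : Torus ϑ) (z : ℝ), Summable fun q : ℤ =>
      a.coeff (p, q) * exp (2 * Real.pi * I * q * z) := fun a z =>
    Summable.of_norm (by simpa [norm_mul, norm_exp_two_pi] using a.coeff_summable_snd p)
  have h1 := fourier_unique (c := fun q => (a + -b).coeff (p, q)) ((a + -b).coeff_summable_snd p)
    (fun z => by
      have := h p z
      unfold symb at this
      rw [← sub_eq_zero, ← (hs a z).tsum_sub (hs b z)] at this
      rw [← this]
      refine tsum_congr fun q => ?_
      rw [Torus.coeff_add, Torus.coeff_neg]; ring) q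
  rw [Torus.coeff_add, Torus.coeff_neg] at h1
  linear_combination h1

/-- By Poisson summation the symbol of a pairing is a lattice sum, without any Fourier transform. -/
lemma gabor_symb {ϑ u : ℝ} (hu : u ≠ 0) (h g : 𝓢(ℝ, ℂ)) (p : ℤ) (z : ℝ) :
    (gabor hu h g : Torus ϑ).symb p z = ∑' k : ℤ, h (z + k) * g (z + k + p * u) := by
  unfold Torus.symb gabor gaborCoeff
  rw [show (∑' k : ℤ, h (z + k) * g (z + k + p * u))
    = ∑' k : ℤ, (mulS h (affS 1 (p * u) g)) (z + k) from tsum_congr fun k => by simp]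
  rw [← poisson]
  rfl

lemma one_symb {ϑ : ℝ} (p : ℤ) (z : ℝ) :
    (1 : Torus ϑ).symb p z = if p = 0 then 1 else 0 := by
  unfold Torus.symb
  rw [tsum_eq_single 0]
  · by_cases hp : p = 0 <;> simp [Torus.coeff_one, hp, Prod.ext_iff]
  · intro q hq
    rw [Torus.coeff_one, if_neg (by simp [Prod.ext_iff, hq]), zero_mul]

lemma symb_add {ϑ : ℝ} (a b : Torus ϑ) (p : ℤ) (z : ℝ) :
    (a + b).symb p z = a.symb p z + b.symb p z := by
  have hs : ∀ (a : Torus ϑ) (z : ℝ), Summable fun q : ℤ =>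
      a.coeff (p, q) * exp (2 * Real.pi * I * q * z) := fun a z =>
    Summable.of_norm (by simpa [norm_mul, norm_exp_two_pi] using a.coeff_summable_snd p)
  unfold Torus.symb
  rw [← (hs a z).tsum_add (hs b z)]
  exact tsum_congr fun q => by rw [Torus.coeff_add]; ring

lemma symb_sum {ϑ : ℝ} {ι : Type*} (s : Finset ι) (a : ι → Torus ϑ) (p : ℤ) (z : ℝ) :
    (∑ i ∈ s, a i).symb p z = ∑ i ∈ s, (a i).symb p z := by
  classical
  induction s using Finset.induction_on with
  | empty => simp [Torus.symb]
  | insert i s hi ih => rw [Finset.sum_insert hi, Finset.sum_insert hi, symb_add, ih]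

/-! ### The actions in terms of symbols -/

lemma summable_gabor {u : ℝ} (hu : u ≠ 0) (h g : 𝓢(ℝ, ℂ)) (z : ℝ) :
    Summable fun x : ℤ × ℤ => ‖h (z + x.2) * g (z + x.2 + x.1 * u)‖ := by
  obtain ⟨K, hK0, hK⟩ := schwartz_lattice_tsum_le g hu
  have h1 : Summable fun x : ℤ × ℤ => ‖h (z + x.1)‖ * ‖g (z + x.1 + x.2 * u)‖ := by
    refine (summable_prod_of_nonneg fun x => by positivity).2 ⟨fun k => ?_, ?_⟩
    · exact (schwartz_lattice_summable g hu (z + k)).mul_left ‖h (z + k)‖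
    · have h2 : Summable fun k : ℤ => ‖h (z + k)‖ := by
        simpa using schwartz_lattice_summable h one_ne_zero z
      refine Summable.of_nonneg_of_le (fun k => tsum_nonneg fun _ => by positivity) (fun k => ?_)
        (h2.mul_right K)
      change ∑' l : ℤ, ‖h (z + k)‖ * ‖g (z + k + l * u)‖ ≤ _
      rw [tsum_mul_left]
      exact mul_le_mul_of_nonneg_left (hK _) (norm_nonneg _)
  refine ((Equiv.prodComm ℤ ℤ).summable_iff.2 h1).congr fun x => ?_
  simp

lemma summable_gabor_mul {u : ℝ} (hu : u ≠ 0) (h g : 𝓢(ℝ, ℂ)) (z : ℝ) {F : ℤ × ℤ → ℂ} {K : ℝ}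
    (hF : ∀ x, ‖F x‖ ≤ K) :
    Summable fun x : ℤ × ℤ => h (z + x.2) * g (z + x.2 + x.1 * u) * F x := by
  refine Summable.of_norm_bounded ((summable_gabor hu h g z).mul_right K) fun x => ?_
  rw [norm_mul]
  gcongr
  exact hF x

lemma leftAct_symb (s : ℤ) (θ : ℝ) (a : Torus (-θ)) (φ : HSpace 1) (j : ZMod (1 : ℤ).natAbs)
    (x : ℝ) : leftAct s θ a φ j x = ∑' p : ℤ, a.symb p ((θ - s) * (x - p)) * φ j (x - p) := by
  rw [leftAct_apply]
  unfold opSum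
  rw [(leftAct_summable s θ a φ j x).tsum_prod]
  refine tsum_congr fun p => ?_
  rw [Torus.symb, ← tsum_mul_right]
  refine tsum_congr fun q => ?_
  simp only [leftW, leftτ, leftPhase]
  rw [← exp_add, ← mul_assoc]
  congr 3
  push_cast
  ring

lemma heisAct_symb (n m : ℤ) (θ : ℝ) [hm : NeZero m.natAbs] (a : Torus (-θ)) (φ : HSpace m)
    {j : ZMod m.natAbs} {l : ℤ} (hl : (l : ZMod m.natAbs) = j) (x : ℝ) :
    heisAct n m θ a φ j x
      = ∑' p : ℤ, a.symb p (x - l * n / m) * φ (j - p) (x + p * (θ - n / m)) := by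
  have hm0 : m ≠ 0 := Int.natAbs_ne_zero.1 hm.out
  rw [heisAct_apply]
  unfold opSum
  rw [(heisAct_summable n m θ a φ j x).tsum_prod]
  refine tsum_congr fun p => ?_
  rw [Torus.symb, ← tsum_mul_right]
  refine tsum_congr fun q => ?_
  simp only [heisW, heisτ, chi_eq hm0 hl]
  rw [← exp_add, ← mul_assoc]
  congr 3
  push_cast
  ring

/-! ### Bump functions and partitions of unity -/

lemma exists_schwartz_bump (c : ℝ) {r : ℝ} (hr : 0 < r) :
    ∃ f : 𝓢(ℝ, ℂ), f c = 1 ∧ ∀ x, r ≤ |x - c| → f x = 0 := by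
  let b : ContDiffBump c := ⟨r / 2, r, by positivity, by linarith⟩
  have h1 : HasCompactSupport fun x => (b x : ℂ) :=
    b.hasCompactSupport.comp_left (g := fun y : ℝ => (y : ℂ)) (by simp)
  refine ⟨h1.toSchwartzMap (ofRealCLM.contDiff.comp b.contDiff), ?_, fun x hx => ?_⟩
  · change (b c : ℂ) = 1
    rw [b.one_of_mem_closedBall (Metric.mem_closedBall_self (by positivity))]
    simp
  · change (b x : ℂ) = 0
    rw [b.zero_of_le_dist (by simpa [Real.dist_eq] using hx)]
    simp

open Real in
/-- A smooth function, supported in `[-1, 1]`, whose integer translates sum to `1`. -/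
lemma exists_partition : ∃ ρ χ : 𝓢(ℝ, ℂ), (∀ y, 1 ≤ |y| → ρ y = 0) ∧ (∀ y, 2 ≤ |y| → χ y = 0) ∧
    (∀ y, ρ y * χ y = ρ y) ∧ ∀ y, HasSum (fun k : ℤ => ρ (y + k)) 1 := by
  -- `ρ(y) = T(y + 1) - T(y)` and `χ(y) = T(2 + y) T(2 - y)` for the smooth step function `T`, so
  -- that the sum of the translates of `ρ` telescopes and `χ = 1` on the support of `ρ`
  have hr0 : ∀ y : ℝ, 1 ≤ |y| → smoothTransition (y + 1) - smoothTransition y = 0 := by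
    intro y hy
    rcases le_abs.1 hy with h | h
    · rw [smoothTransition.one_of_one_le h, smoothTransition.one_of_one_le (by linarith), sub_self]
    · rw [smoothTransition.zero_of_nonpos (by linarith), smoothTransition.zero_of_nonpos
        (by linarith), sub_self]
  have hc0 : ∀ y : ℝ, 2 ≤ |y| → smoothTransition (2 + y) * smoothTransition (2 - y) = 0 := by
    intro y hy
    rcases le_abs.1 hy with h | h
    · rw [smoothTransition.zero_of_nonpos (x := 2 - y) (by linarith), mul_zero]
    · rw [smoothTransition.zero_of_nonpos (x := 2 + y) (by linarith), zero_mul]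
  have cpt : ∀ (f : ℝ → ℝ) (R : ℝ), (∀ y, R ≤ |y| → f y = 0) →
      HasCompactSupport fun y => (f y : ℂ) := by
    intro f R hf
    refine HasCompactSupport.of_support_subset_isCompact (isCompact_closedBall (0 : ℝ) R)
      fun y hy => ?_
    rw [Metric.mem_closedBall, Real.dist_eq, sub_zero]
    by_contra h
    exact hy (by simp [hf y (by linarith)])
  have sT : ContDiff ℝ ∞ smoothTransition := smoothTransition.contDiff
  have h1 : ContDiff ℝ ∞ fun y => smoothTransition (y + 1) - smoothTransition y :=
    (sT.comp (contDiff_id.add contDiff_const)).sub sT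
  have h2 : ContDiff ℝ ∞ fun y => smoothTransition (2 + y) * smoothTransition (2 - y) :=
    (sT.comp (contDiff_const.add contDiff_id)).mul (sT.comp (contDiff_const.sub contDiff_id))
  refine ⟨(cpt _ 1 hr0).toSchwartzMap (ofRealCLM.contDiff.comp h1),
    (cpt _ 2 hc0).toSchwartzMap (ofRealCLM.contDiff.comp h2), ?_, ?_, ?_, ?_⟩
  · intro y hy
    change ((smoothTransition (y + 1) - smoothTransition y : ℝ) : ℂ) = 0
    rw [hr0 y hy, ofReal_zero]
  · intro y hy
    change ((smoothTransition (2 + y) * smoothTransition (2 - y) : ℝ) : ℂ) = 0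
    rw [hc0 y hy, ofReal_zero]
  · intro y
    change ((smoothTransition (y + 1) - smoothTransition y : ℝ) : ℂ) *
      ((smoothTransition (2 + y) * smoothTransition (2 - y) : ℝ) : ℂ)
        = ((smoothTransition (y + 1) - smoothTransition y : ℝ) : ℂ)
    rcases le_or_gt 1 |y| with h | h
    · rw [hr0 y h]; simp
    · rw [abs_lt] at h
      rw [smoothTransition.one_of_one_le (x := 2 + y) (by linarith),
        smoothTransition.one_of_one_le (x := 2 - y) (by linarith)]
      simp
  · intro y
    change HasSum (fun k : ℤ => ((smoothTransition (y + k + 1) - smoothTransition (y + k) : ℝ) : ℂ)) 1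
    rw [← (Equiv.subRight ⌊y⌋).hasSum_iff]
    have hfl := Int.fract_nonneg y
    have hfl' := Int.fract_lt_one y
    have hy : ∀ k : ℤ, y + ((k - ⌊y⌋ : ℤ) : ℝ) = Int.fract y + k := by
      intro k; rw [← Int.self_sub_floor]; push_cast; ring
    -- after moving `y` into `[0, 1)` only the translates by `-1` and `0` survive
    have h0 : ∀ k ∉ ({-1, 0} : Finset ℤ), ((fun k : ℤ => ((smoothTransition (y + k + 1)
        - smoothTransition (y + k) : ℝ) : ℂ)) ∘ (Equiv.subRight ⌊y⌋)) k = 0 := by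
      intro k hk
      simp only [Finset.mem_insert, Finset.mem_singleton, not_or] at hk
      simp only [Function.comp_apply, Equiv.subRight_apply]
      rw [hy]
      have : 1 ≤ |Int.fract y + k| := by
        rcases lt_or_ge k (-1) with h | h
        · have : (k : ℝ) ≤ -2 := by exact_mod_cast (by omega : k ≤ -2)
          rw [le_abs]; right; linarith
        · have : (1 : ℝ) ≤ k := by exact_mod_cast (by omega : 1 ≤ k)
          rw [le_abs]; left; linarith
      rw [hr0 _ this, ofReal_zero]
    have := hasSum_sum_of_ne_finset_zero (L := SummationFilter.unconditional ℤ) h0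
    convert this using 1
    rw [Finset.sum_pair (by norm_num)]
    simp only [Function.comp_apply, Equiv.subRight_apply]
    rw [hy, hy, smoothTransition.zero_of_nonpos (x := Int.fract y + ((-1 : ℤ) : ℝ))
      (by push_cast; linarith), smoothTransition.one_of_one_le (x := Int.fract y + ((0 : ℤ) : ℝ) + 1)
      (by push_cast; linarith)]
    push_cast
    ring_nf

/-- The unit of the torus is a finite sum of pairings of compactly supported functions. -/
lemma exists_gabor_sum_eq_one {u : ℝ} (hu : u ≠ 0) :
    ∃ (n : ℕ) (h g : Fin n → 𝓢(ℝ, ℂ)), ∀ ϑ : ℝ, ∑ i, (gabor hu (h i) (g i) : Torus ϑ) = 1 := by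
  obtain ⟨ρ, χ, hρ, hχ, hρχ, hsum⟩ := exists_partition
  -- the functions `ρ(nz + i)`, `χ(nz + i)` are supported in intervals of length `O(1/n)`: for `n
  -- > 3/|u|` the supports of `ρ(n·+i)` and of the translates of `χ(n·+i)` by `pu`, `p ≠ 0`, are
  -- disjoint.
  obtain ⟨n, hn⟩ := exists_nat_gt (3 / |u|)
  have hu' : 0 < |u| := abs_pos.2 hu
  have hn0 : 0 < (n : ℝ) := lt_trans (by positivity) hn
  have hnn : n ≠ 0 := by rintro rfl; simp at hn0
  have : NeZero n := ⟨hnn⟩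
  let un : ℝˣ := Units.mk0 (n : ℝ) hn0.ne'
  refine ⟨n, fun i => affS un (i : ℝ) ρ, fun i => affS un (i : ℝ) χ, fun ϑ => ?_⟩
  refine Torus.ext_symb fun p z => ?_
  rw [symb_sum, one_symb]
  simp only [gabor_symb, affS_apply]
  change ∑ i : Fin n, ∑' k : ℤ, ρ (n * (z + k) + (i : ℕ)) * χ (n * (z + k + p * u) + (i : ℕ)) = _
  split_ifs with hp
  · subst hp
    -- for `p = 0` the double sum over `i` and `k` is the partition of unity at `nz`, as every
    -- integer is `nk + i` for a unique pair
    have h1 := ((Int.divModEquiv n).symm.hasSum_iff).2 (hsum (n * z))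
    have h2 := h1.summable.tsum_prod
    have h3 : ∀ k : ℤ, ∀ i : Fin n,
        ((fun k : ℤ => ρ (n * z + k)) ∘ (Int.divModEquiv n).symm) (k, i)
          = ρ (n * (z + k) + (i : ℕ)) := by
      intro k i
      simp only [Function.comp_apply, Int.divModEquiv_symm_apply]
      congr 1
      push_cast
      ring
    have h4 : ∑' k : ℤ, ∑ i : Fin n, ρ (n * (z + k) + (i : ℕ)) = 1 := by
      rw [← h1.tsum_eq, h2]
      refine tsum_congr fun k => ?_
      rw [tsum_fintype]
      exact Finset.sum_congr rfl fun i _ => (h3 k i).symm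
    rw [← h4, Summable.tsum_finsetSum]
    · refine Finset.sum_congr rfl fun i _ => tsum_congr fun k => ?_
      rw [Int.cast_zero, zero_mul, add_zero, hρχ]
    · intro i _
      have := h1.summable.comp_injective (i := fun k : ℤ => (k, i)) (fun k k' h => by simpa using h)
      exact this.congr fun k => h3 k i
  · refine Finset.sum_eq_zero fun i _ => ?_
    rw [← tsum_zero]
    refine tsum_congr fun k => ?_
    set y := (n : ℝ) * (z + k) + (i : ℕ) with hy
    have e : (n : ℝ) * (z + k + p * u) + (i : ℕ) = y + n * (p * u) := by rw [hy]; ring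
    rw [e]
    rcases le_or_gt 1 |y| with h | h
    · rw [hρ y h, zero_mul]
    · have hp1 : (1 : ℝ) ≤ |(p : ℝ)| := by exact_mod_cast Int.one_le_abs hp
      have : 3 ≤ |(n : ℝ) * (p * u)| := by
        rw [abs_mul, abs_mul, abs_of_pos hn0]
        have := (div_lt_iff₀ hu').1 hn
        nlinarith
      rw [hχ _ (by
        have := abs_sub_abs_le_abs_sub ((n : ℝ) * (p * u)) (-y)
        rw [abs_neg, sub_neg_eq_add, add_comm (_ * _) y] at this
        linarith), mul_zero]

/-! ### The Morita context of the Schwartz space -/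

instance : Subsingleton (ZMod (1 : ℤ).natAbs) := inferInstanceAs (Subsingleton (ZMod 1))

/-- Schwartz functions on `ℝ` as Schwartz functions on `ℝ × ℤ_1`. -/
def ofS (f : 𝓢(ℝ, ℂ)) : HSpace 1 := fun _ => f

@[simp] lemma ofS_apply (f : 𝓢(ℝ, ℂ)) (j : ZMod (1 : ℤ).natAbs) : ofS f j = f := rfl

lemma ofS_zero (φ : HSpace 1) : ofS (φ 0) = φ := by
  funext j; rw [Subsingleton.elim j 0]; rfl

section MoritaContext

variable {s : ℤ} {θ : ℝ}

lemma sub_swap_ne (h : (s : ℝ) - θ ≠ 0) : θ - s ≠ 0 := fun h' => h (by linarith)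

/-- The scaling factor `-1/(s-θ)`. -/
def scaleU (h : (s : ℝ) - θ ≠ 0) : ℝˣ :=
  Units.mk0 (-(1 / (s - θ))) (neg_ne_zero.2 (one_div_ne_zero h))

@[simp] lemma coe_scaleU (h : (s : ℝ) - θ ≠ 0) : (scaleU h : ℝ) = -(1 / (s - θ)) := rfl

/-- The `T_{-θ}`-valued pairing on Schwartz functions. The rescaling turns the lattice `ℤ + (s-θ)ℤ`
of `gabor` into `(1/(s-θ))ℤ + ℤ`, on which the left action takes place. -/
def pairL (h : (s : ℝ) - θ ≠ 0) (f g : 𝓢(ℝ, ℂ)) : Torus (-θ) :=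
  gabor (sub_swap_ne h) (affS (scaleU h) 0 g) (affS (scaleU h) 0 f)

/-- The `T_{-1/(s-θ)}`-valued pairing on Schwartz functions. -/
def pairR (h : (s : ℝ) - θ ≠ 0) (g f : 𝓢(ℝ, ℂ)) : Torus (-(1 / (s - θ))) :=
  gabor (one_div_ne_zero h) f g

variable (h : (s : ℝ) - θ ≠ 0)

lemma pairL_symb (f g : 𝓢(ℝ, ℂ)) (p : ℤ) (z : ℝ) :
    (pairL h f g).symb p z
      = ∑' k : ℤ, g (-(1 / (s - θ)) * (z + k)) * f (-(1 / (s - θ)) * (z + k) + p) := by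
  rw [pairL, gabor_symb]
  refine tsum_congr fun k => ?_
  rw [affS_apply, affS_apply, coe_scaleU]
  congr 2
  · ring
  · field_simp
    ring

lemma pairR_symb (g f : 𝓢(ℝ, ℂ)) (p : ℤ) (z : ℝ) :
    (pairR h g f).symb p z = ∑' k : ℤ, f (z + k) * g (z + k + p * (1 / (s - θ))) :=
  gabor_symb _ _ _ _ _

lemma heisAct_zero_one_symb (b : Torus (-(1 / (s - θ)))) (φ : HSpace 1) (j : ZMod (1 : ℤ).natAbs)
    (x : ℝ) : heisAct 0 1 (1 / (s - θ)) b φ j x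
      = ∑' p : ℤ, b.symb p x * φ 0 (x + p * (1 / (s - θ))) := by
  rw [heisAct_symb 0 1 (1 / (s - θ)) b φ (l := 0) (Subsingleton.elim _ _)]
  refine tsum_congr fun p => ?_
  rw [Subsingleton.elim (j - (p : ZMod (1 : ℤ).natAbs)) 0]
  simp

/-- Both sides are the double sum `∑_{p,l} k(x + p) g(x + p + l/(s-θ)) f(x + l/(s-θ))`, summed in
the two possible orders. -/
lemma pairing_assoc (f g k : 𝓢(ℝ, ℂ)) (x : ℝ) :
    ∑' p : ℤ, (pairL h f g).symb p ((θ - s) * (x - p)) * k (x - p)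
      = ∑' l : ℤ, (pairR h g k).symb l x * f (x + l * (1 / (s - θ))) := by
  obtain ⟨K, hK0, hK⟩ := schwartz_bounded f
  have hs := summable_gabor_mul (one_div_ne_zero h) k g x
    (F := fun y : ℤ × ℤ => f (x + y.1 * (1 / (s - θ)))) (fun y => hK _)
  have e : ∀ p : ℤ, (pairL h f g).symb p ((θ - s) * (x - p)) * k (x - p)
      = ∑' l : ℤ, k (x + (-p : ℤ)) * g (x + (-p : ℤ) + l * (1 / (s - θ)))
        * f (x + l * (1 / (s - θ))) := by
    intro p
    rw [pairL_symb, ← tsum_mul_right, ← (Equiv.neg ℤ).tsum_eq]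
    refine tsum_congr fun l => ?_
    rw [Equiv.neg_apply]
    have e1 : -(1 / (s - θ)) * ((θ - s) * (x - p) + (-l : ℤ))
        = x + (-p : ℤ) + l * (1 / (s - θ)) := by
      push_cast
      field_simp
      ring
    rw [e1, show x + ((-p : ℤ) : ℝ) + l * (1 / (s - θ)) + p = x + l * (1 / (s - θ)) by
      push_cast; ring, show x - (p : ℝ) = x + (-p : ℤ) by push_cast; ring]
    ring
  calc _ = ∑' p : ℤ, ∑' l : ℤ, k (x + (-p : ℤ)) * g (x + (-p : ℤ) + l * (1 / (s - θ)))
        * f (x + l * (1 / (s - θ))) := tsum_congr e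
    _ = ∑' p : ℤ, ∑' l : ℤ, k (x + p) * g (x + p + l * (1 / (s - θ)))
        * f (x + l * (1 / (s - θ))) := (Equiv.neg ℤ).tsum_eq fun p : ℤ =>
          ∑' l : ℤ, k (x + p) * g (x + p + l * (1 / (s - θ))) * f (x + l * (1 / (s - θ)))
    _ = ∑' l : ℤ, ∑' p : ℤ, k (x + p) * g (x + p + l * (1 / (s - θ)))
        * f (x + l * (1 / (s - θ))) := Summable.tsum_comm (f := fun l p : ℤ =>
          k (x + p) * g (x + p + l * (1 / (s - θ))) * f (x + l * (1 / (s - θ)))) hs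
    _ = _ := tsum_congr fun l => by rw [tsum_mul_right, pairR_symb]

/-- Associativity of the two pairings: `⟨f, g⟩_L k = f ⟨g, k⟩_R`. -/
lemma leftAct_pairL (f g : 𝓢(ℝ, ℂ)) (k : 𝓢(ℝ, ℂ)) :
    leftAct s θ (pairL h f g) (ofS k) = heisAct 0 1 (1 / (s - θ)) (pairR h g k) (ofS f) := by
  funext j
  ext x
  rw [leftAct_symb, heisAct_zero_one_symb]
  exact pairing_assoc h f g k x

/-- The right action on Schwartz functions is faithful. -/
lemma heisAct_faithful (h : (s : ℝ) - θ ≠ 0) {b b' : Torus (-(1 / (s - θ)))}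
    (hb : ∀ f : 𝓢(ℝ, ℂ), heisAct 0 1 (1 / (s - θ)) b (ofS f)
      = heisAct 0 1 (1 / (s - θ)) b' (ofS f)) : b = b' := by
  refine Torus.ext_symb fun p z => ?_
  have hu : 0 < |1 / (s - θ)| := abs_pos.2 (one_div_ne_zero h)
  -- a bump at `z + p/(s-θ)` isolates the value `b.symb p z` in the sum over the translates
  obtain ⟨f, hf1, hf0⟩ := exists_schwartz_bump (z + p * (1 / (s - θ))) hu
  have h1 := congrArg (fun φ : HSpace 1 => φ 0 z) (hb f)
  simp only [heisAct_zero_one_symb, ofS_apply] at h1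
  have h0 : ∀ c : ℤ → ℂ, ∑' q : ℤ, c q * f (z + q * (1 / (s - θ))) = c p := by
    intro c
    rw [tsum_eq_single p, hf1, mul_one]
    intro q hq
    rw [hf0, mul_zero]
    rw [show z + q * (1 / (s - θ)) - (z + p * (1 / (s - θ))) = ((q - p : ℤ) : ℝ) * (1 / (s - θ)) by
      push_cast; ring, abs_mul]
    have : (1 : ℝ) ≤ |((q - p : ℤ) : ℝ)| := by
      exact_mod_cast Int.one_le_abs (sub_ne_zero.2 hq)
    exact le_mul_of_one_le_left (abs_nonneg _) this
  rwa [h0, h0] at h1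

/-- The left action on Schwartz functions is faithful. -/
lemma leftAct_faithful (h : (s : ℝ) - θ ≠ 0) {a a' : Torus (-θ)}
    (ha : ∀ f : 𝓢(ℝ, ℂ), leftAct s θ a (ofS f) = leftAct s θ a' (ofS f)) : a = a' := by
  refine Torus.ext_symb fun p z => ?_
  set x := (θ - s)⁻¹ * z + p with hx
  have hz : (θ - s) * (x - p) = z := by
    rw [hx, add_sub_cancel_right, mul_inv_cancel_left₀ (sub_swap_ne h)]
  -- a bump at `x - p` isolates the value `a.symb p z`
  obtain ⟨f, hf1, hf0⟩ := exists_schwartz_bump (x - p) one_pos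
  have h1 := congrArg (fun φ : HSpace 1 => φ 0 x) (ha f)
  simp only [leftAct_symb, ofS_apply] at h1
  have h0 : ∀ c : ℤ → ℂ, ∑' q : ℤ, c q * f (x - q) = c p := by
    intro c
    rw [tsum_eq_single p, hf1, mul_one]
    intro q hq
    rw [hf0, mul_zero]
    rw [show x - q - (x - p) = ((p - q : ℤ) : ℝ) by push_cast; ring]
    exact_mod_cast Int.one_le_abs (sub_ne_zero.2 (Ne.symm hq))
  rwa [h0 (fun q => a.symb q ((θ - s) * (x - q))), h0 (fun q => a'.symb q ((θ - s) * (x - q))),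
    hz] at h1

lemma pairR_add (g f f' : 𝓢(ℝ, ℂ)) : pairR h g (f + f') = pairR h g f + pairR h g f' := by
  refine heisAct_faithful h fun k => ?_
  rw [heisAct_add_left, ← leftAct_pairL, ← leftAct_pairL, ← leftAct_pairL, ← leftAct_add_right]
  rfl

lemma pairR_act (g : 𝓢(ℝ, ℂ)) (b : Torus (-(1 / (s - θ)))) (φ : HSpace 1) :
    pairR h g (heisAct 0 1 (1 / (s - θ)) b φ 0) = pairR h g (φ 0) * b := by
  refine heisAct_faithful h fun k => ?_
  rw [← leftAct_pairL, ofS_zero, leftAct_comm s θ h, heisAct_mul, ← leftAct_pairL, ofS_zero]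

lemma pairL_act (g : 𝓢(ℝ, ℂ)) (a : Torus (-θ)) (φ : HSpace 1) :
    pairL h (leftAct s θ a φ 0) g = a * pairL h (φ 0) g := by
  refine leftAct_faithful h fun k => ?_
  rw [leftAct_pairL, ofS_zero, ← leftAct_comm s θ h, leftAct_mul, leftAct_pairL, ofS_zero]

lemma exists_pairR_sum_eq_one :
    ∃ (n : ℕ) (g f : Fin n → 𝓢(ℝ, ℂ)), ∑ i, pairR h (g i) (f i) = 1 := by
  obtain ⟨n, f, g, hfg⟩ := exists_gabor_sum_eq_one (one_div_ne_zero h)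
  exact ⟨n, g, f, hfg _⟩

lemma exists_pairL_sum_eq_one :
    ∃ (n : ℕ) (f g : Fin n → 𝓢(ℝ, ℂ)), ∑ i, pairL h (f i) (g i) = 1 := by
  obtain ⟨n, g, f, hfg⟩ := exists_gabor_sum_eq_one (sub_swap_ne h)
  have e : ∀ f : 𝓢(ℝ, ℂ), affS (scaleU h) 0 (affS (scaleU h)⁻¹ 0 f) = f := by
    intro f
    ext x
    simp only [affS_apply, add_zero, Units.inv_mul_cancel_left]
  refine ⟨n, fun i => affS (scaleU h)⁻¹ 0 (f i), fun i => affS (scaleU h)⁻¹ 0 (g i), ?_⟩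
  simp only [pairL, e]
  exact hfg _

lemma leftAct_sum {ι : Type*} (t : Finset ι) (a : ι → Torus (-θ)) (φ : HSpace 1) :
    leftAct s θ (∑ i ∈ t, a i) φ = ∑ i ∈ t, leftAct s θ (a i) φ := by
  classical
  induction t using Finset.induction_on with
  | empty => simp [leftAct_zero_left]
  | insert i t hi ih => rw [Finset.sum_insert hi, Finset.sum_insert hi, leftAct_add_left, ih]

lemma leftAct_sum_pairL {ι : Type*} (t : Finset ι) (φ : ι → HSpace 1) (g : ι → 𝓢(ℝ, ℂ))
    (ψ : HSpace 1) : leftAct s θ (∑ i ∈ t, pairL h (φ i 0) (g i)) ψ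
      = ∑ i ∈ t, heisAct 0 1 (1 / (s - θ)) (pairR h (g i) (ψ 0)) (φ i) := by
  rw [leftAct_sum]
  refine Finset.sum_congr rfl fun i _ => ?_
  conv_lhs => rw [← ofS_zero ψ]
  rw [leftAct_pairL, ofS_zero]

end MoritaContext

lemma heisD_comm (n m : ℤ) (θ : ℝ) [NeZero m.natAbs] (φ : HSpace m) :
    heisD n m θ 0 (heisD n m θ 1 φ) - heisD n m θ 1 (heisD n m θ 0 φ)
      = (-(I * m / (n - m * θ)) * (1 / (2 * Real.pi)) : ℂ) • φ := by
  funext j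
  ext x
  have hd : deriv (fun x : ℝ => (x : ℂ) * φ j x) x = φ j x + x * deriv (φ j) x := by
    have := ((Complex.ofRealCLM.hasDerivAt (x := x)).mul ((φ j).hasDerivAt x)).deriv
    refine Eq.trans this ?_
    simp
  have hd' : deriv (mulX (φ j)) x = φ j x + x * deriv (φ j) x := by
    rw [← hd]; congr 1; funext y; simp
  have hd2 : deriv (⇑((I * m / (n - m * θ) : ℂ) • mulX (φ j))) x
      = (I * m / (n - m * θ) : ℂ) * (φ j x + x * deriv (φ j) x) := by
    rw [← hd', ← smul_eq_mul]
    exact deriv_const_smul _ (SchwartzMap.differentiableAt _)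
  simp only [heisD, if_pos, one_ne_zero, if_false, LinearMap.compLeft_apply, Function.comp_apply,
    LinearMap.smul_apply, Pi.sub_apply, sub_apply, Pi.smul_apply, smul_apply, mulX_apply,
    derX_apply, smul_eq_mul]
  rw [hd2]
  ring

/-- Schwartz functions on the line form a complete Morita equivalence bimodule: since `1` is a
finite sum of values of either pairing and the pairings are associative, a finite dual basis exists,
every right-linear endomorphism is given by an element of the left torus, and the module is a
generator. -/
theorem bimodS_isCompleteMorita (s : ℤ) (θ : ℝ) (h : (s : ℝ) - θ ≠ 0) :
    (bimodS s θ h).IsCompleteMorita := by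
  obtain ⟨n, f, g, hfg⟩ := exists_pairL_sum_eq_one h
  obtain ⟨n', g', f', hgf⟩ := exists_pairR_sum_eq_one h
  let E := (bimodS s θ h).carrier
  let B := Torus (-(1 / (s - θ)))
  -- the coordinate functionals `ψ ↦ ⟨g, ψ⟩_R`
  let coord : 𝓢(ℝ, ℂ) → E →ₗ[Bᵐᵒᵖ] B := fun k =>
    { toFun := fun ψ => pairR h k ((ψ : HSpace 1) 0)
      map_add' := fun ψ ψ' => pairR_add h k _ _
      map_smul' := fun b ψ => pairR_act h k b.unop ψ }
  let fE : Fin n → E := fun i => ofS (f i)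
  let fE' : Fin n' → E := fun i => ofS (f' i)
  have hexp : ∀ ψ : E, ψ = ∑ i, op (coord (g i) ψ) • fE i := by
    intro ψ
    have h1 : ∀ ψ : HSpace 1, ψ = ∑ i, heisAct 0 1 (1 / (s - θ)) (pairR h (g i) (ψ 0))
        (ofS (f i)) := by
      intro ψ
      rw [← leftAct_sum_pairL, show ∑ i, pairL h (ofS (f i) 0) (g i) = 1 from hfg, leftAct_one]
    exact h1 ψ
  -- the dual basis exhibits the module as a retract of a free module
  let toFree : E →ₗ[Bᵐᵒᵖ] (Fin n → Bᵐᵒᵖ) :=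
    { toFun := fun ψ i => op (coord (g i) ψ)
      map_add' := fun ψ ψ' => by funext i; simp
      map_smul' := fun b ψ => by
        funext i
        change op (coord (g i) (b • ψ)) = b * op (coord (g i) ψ)
        rw [map_smul]; rfl }
  let ofFree : (Fin n → Bᵐᵒᵖ) →ₗ[Bᵐᵒᵖ] E := Fintype.linearCombination Bᵐᵒᵖ fE
  have hof : ∀ ψ, ofFree (toFree ψ) = ψ := fun ψ => (hexp ψ).symm
  refine ⟨?_, ?_, ?_, ?_, ?_, ?_⟩
  · exact Module.Finite.of_surjective ofFree fun ψ => ⟨_, hof ψ⟩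
  · exact Module.Projective.of_split toFree ofFree (LinearMap.ext hof)
  · -- generator: `1 = ∑ ⟨g', f'⟩_R` exhibits the torus as a quotient of a power of the module
    refine ⟨n', ∑ i, (coord (g' i)).comp (LinearMap.proj i), fun b => ?_⟩
    refine ⟨fun i => op b • fE' i, ?_⟩
    simp only [LinearMap.coe_sum, Finset.sum_apply, LinearMap.comp_apply, LinearMap.proj_apply,
      map_smul]
    change ∑ i, pairR h (g' i) (f' i) * b = b
    rw [← Finset.sum_mul, hgf, one_mul]
  · -- an endomorphism `F` acts as `∑ ⟨F f_i, g_i⟩_L`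
    intro F
    refine ⟨∑ i, pairL h ((F (fE i) : HSpace 1) 0) (g i), fun ψ => ?_, fun a ha => ?_⟩
    · conv_lhs => rw [hexp ψ, map_sum]
      simp only [map_smul]
      exact (leftAct_sum_pairL h Finset.univ (fun i => F (fE i)) g ψ).symm
    · have h1 : ∀ i, a * pairL h (f i) (g i) = pairL h ((F (fE i) : HSpace 1) 0) (g i) := by
        intro i
        have := ha (fE i)
        rw [this]
        exact (pairL_act h (g i) a (ofS (f i))).symm
      rw [← Finset.sum_congr rfl fun i _ => h1 i, ← Finset.mul_sum, hfg, mul_one]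
  · refine ⟨I * (-(I * (1 : ℤ) / ((0 : ℤ) - (1 : ℤ) * (1 / (s - θ) : ℝ))) * (1 / (2 * Real.pi))),
      fun ψ => ?_⟩
    rw [mul_smul]
    exact congrArg (fun φ : HSpace 1 => I • φ) (heisD_comm 0 1 (1 / (s - θ)) ψ)
  · change IsUnit (((θ : ℂ) - s) • (1 : Matrix (Fin 2) (Fin 2) ℂ)).det
    rw [Matrix.det_smul, Matrix.det_one, mul_one, isUnit_iff_ne_zero]
    have : (θ : ℂ) - s ≠ 0 := by exact_mod_cast sub_swap_ne h
    exact pow_ne_zero _ this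

/-! ### Lattice sums of products of Schwartz functions -/

lemma schwartz_decay_two (f : 𝓢(ℝ, ℂ)) : ∃ C : ℝ, 0 ≤ C ∧ ∀ y, (1 + |y|) ^ 2 * ‖f y‖ ≤ C := by
  obtain ⟨C0, hC0, h0⟩ := f.decay 0 0
  obtain ⟨C2, hC2, h2⟩ := f.decay 2 0
  simp only [pow_zero, one_mul, norm_iteratedFDeriv_zero] at h0 h2
  refine ⟨2 * (C0 + C2), by positivity, fun y => ?_⟩
  have a0 := h0 y
  have a2 := h2 y
  rw [Real.norm_eq_abs] at a2
  have : (1 + |y|) ^ 2 ≤ 2 * (1 + |y| ^ 2) := by nlinarith [sq_nonneg (1 - |y|)]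
  calc (1 + |y|) ^ 2 * ‖f y‖ ≤ 2 * (1 + |y| ^ 2) * ‖f y‖ := by gcongr
    _ = 2 * (‖f y‖ + |y| ^ 2 * ‖f y‖) := by ring
    _ ≤ _ := by linarith

section Lattice

variable {a b c d e r : ℝ}

/-- The summand `f_t(ax + bt + c) g(dx + et + r)`. -/
def latTerm (a b c d e r : ℝ) (f : ℤ → 𝓢(ℝ, ℂ)) (g : 𝓢(ℝ, ℂ)) (t : ℤ) (x : ℝ) : ℂ :=
  f t (a * x + b * t + c) * g (d * x + e * t + r)

/-- The determinant condition makes the index `t` a combination of the two arguments and a constant,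
so that the decay of the two factors yields a bound summable in `t` and uniform in `x`. -/
lemma latTerm_bound (hdet : a * e - b * d ≠ 0) {f : ℤ → 𝓢(ℝ, ℂ)} (hf : (Set.range f).Finite)
    (g : 𝓢(ℝ, ℂ)) : ∃ K : ℝ, ∀ t x,
      ‖latTerm a b c d e r f g t x‖ ≤ K * ((1 + |(t : ℝ)|) ^ 2)⁻¹ := by
  choose C hC0 hC using schwartz_decay_two
  have hCf : ∀ t, C (f t) ≤ ∑ φ ∈ hf.toFinset, C φ := fun t =>
    Finset.single_le_sum (f := C) (fun φ _ => hC0 φ) (hf.mem_toFinset.2 ⟨t, rfl⟩)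
  set Cf := ∑ φ ∈ hf.toFinset, C φ with hCfdef
  have hCf0 : 0 ≤ Cf := Finset.sum_nonneg fun φ _ => hC0 φ
  set D := 1 + (|a| + |d| + |a * r - d * c|) / |a * e - b * d| with hD
  have hdet' : 0 < |a * e - b * d| := abs_pos.2 hdet
  have hD0 : 0 < D := by positivity
  refine ⟨D ^ 2 * (Cf * C g), fun t x => ?_⟩
  unfold latTerm
  set u := a * x + b * t + c with hu
  set v := d * x + e * t + r with hv
  have h1 : |(t : ℝ)| ≤ (|a| + |d| + |a * r - d * c|) / |a * e - b * d| * ((1 + |u|) * (1 + |v|)) := by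
    rw [div_mul_eq_mul_div, le_div_iff₀ hdet', ← abs_mul,
      show (t : ℝ) * (a * e - b * d) = a * v - d * u - (a * r - d * c) by rw [hu, hv]; ring]
    have e1 : |a * v - d * u - (a * r - d * c)| ≤ |a| * |v| + |d| * |u| + |a * r - d * c| := by
      refine (abs_sub _ _).trans (add_le_add ((abs_sub _ _).trans ?_) le_rfl)
      rw [abs_mul, abs_mul]
    refine e1.trans ?_
    have hu0 := abs_nonneg u
    have hv0 := abs_nonneg v
    have e2 : |v| ≤ (1 + |u|) * (1 + |v|) := by nlinarith
    have e3 : |u| ≤ (1 + |u|) * (1 + |v|) := by nlinarith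
    have e4 : 1 ≤ (1 + |u|) * (1 + |v|) := by nlinarith
    rw [add_mul, add_mul]
    gcongr
    exact le_mul_of_one_le_right (abs_nonneg _) e4
  have h2 : 1 + |(t : ℝ)| ≤ D * ((1 + |u|) * (1 + |v|)) := by
    have e4 : 1 ≤ (1 + |u|) * (1 + |v|) := by nlinarith [abs_nonneg u, abs_nonneg v]
    rw [hD, add_mul, one_mul]
    exact add_le_add e4 h1
  have h3 : (1 + |(t : ℝ)|) ^ 2 ≤ D ^ 2 * ((1 + |u|) ^ 2 * (1 + |v|) ^ 2) := by
    rw [← mul_pow, ← mul_pow]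
    exact pow_le_pow_left₀ (by positivity) h2 2
  rw [← div_eq_mul_inv, le_div_iff₀ (by positivity), norm_mul]
  calc ‖f t u‖ * ‖g v‖ * (1 + |(t : ℝ)|) ^ 2
      ≤ ‖f t u‖ * ‖g v‖ * (D ^ 2 * ((1 + |u|) ^ 2 * (1 + |v|) ^ 2)) := by gcongr
    _ = D ^ 2 * (((1 + |u|) ^ 2 * ‖f t u‖) * ((1 + |v|) ^ 2 * ‖g v‖)) := by ring
    _ ≤ D ^ 2 * (Cf * C g) := by
      have := hC (f t) u
      have := hC g v
      have := hCf t
      gcongr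
      linarith

lemma latTerm_summable (hdet : a * e - b * d ≠ 0) {f : ℤ → 𝓢(ℝ, ℂ)} (hf : (Set.range f).Finite)
    (g : 𝓢(ℝ, ℂ)) (x : ℝ) : Summable fun t => latTerm a b c d e r f g t x := by
  obtain ⟨K, hK⟩ := latTerm_bound (c := c) (r := r) hdet hf g
  exact Summable.of_norm_bounded (summable_int_inv_sq.mul_left K) fun t => hK t x

lemma latSum_hasDerivAt (hdet : a * e - b * d ≠ 0) {f : ℤ → 𝓢(ℝ, ℂ)} (hf : (Set.range f).Finite)
    (g : 𝓢(ℝ, ℂ)) (x : ℝ) : HasDerivAt (fun x => ∑' t, latTerm a b c d e r f g t x)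
      (a * (∑' t, latTerm a b c d e r (fun t => derX (f t)) g t x)
        + d * ∑' t, latTerm a b c d e r f (derX g) t x) x := by
  have hf' := finite_range_map hf derX
  obtain ⟨K, hK⟩ := latTerm_bound (c := c) (r := r) hdet hf' g
  obtain ⟨K', hK'⟩ := latTerm_bound (c := c) (r := r) hdet hf (derX g)
  have hd : ∀ (t : ℤ) (x : ℝ), HasDerivAt (latTerm a b c d e r f g t)
      (a * latTerm a b c d e r (fun t => derX (f t)) g t x
        + d * latTerm a b c d e r f (derX g) t x) x := by
    intro t x
    have e1 : HasDerivAt (fun x : ℝ => a * x + b * t + c) a x := by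
      simpa using (((hasDerivAt_id x).const_mul a).add_const (b * t)).add_const c
    have e2 : HasDerivAt (fun x : ℝ => d * x + e * t + r) d x := by
      simpa using (((hasDerivAt_id x).const_mul d).add_const (e * t)).add_const r
    have e3 := ((f t).hasDerivAt (a * x + b * t + c)).scomp x e1
    have e4 := (g.hasDerivAt (d * x + e * t + r)).scomp x e2
    refine (e3.mul e4).congr_deriv ?_
    simp only [latTerm, derX_apply, Function.comp_apply, real_smul]
    ring
  have h := hasDerivAt_tsum (u := fun t : ℤ => (|a| * K + |d| * K') * ((1 + |(t : ℝ)|) ^ 2)⁻¹)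
    (summable_int_inv_sq.mul_left _) hd (fun t x => by
      refine (norm_add_le _ _).trans ?_
      rw [norm_mul, norm_mul, norm_real, norm_real, Real.norm_eq_abs, Real.norm_eq_abs, add_mul,
        mul_assoc, mul_assoc]
      gcongr
      · exact hK t x
      · exact hK' t x) (latTerm_summable hdet hf g x) x
  rwa [Summable.tsum_add ((latTerm_summable hdet hf' g x).mul_left _)
    ((latTerm_summable hdet hf (derX g) x).mul_left _), tsum_mul_left, tsum_mul_left] at h

/-- Lattice sums of this kind are bounded, and the space they span is closed under differentiation
and multiplication by the coordinate. -/
lemma exists_latSum (hdet : a * e - b * d ≠ 0) {f : ℤ → 𝓢(ℝ, ℂ)} (hf : (Set.range f).Finite)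
    (g : 𝓢(ℝ, ℂ)) :
    ∃ F : 𝓢(ℝ, ℂ), ⇑F = fun x => ∑' t, latTerm a b c d e r f g t x := by
  refine schwartz_of_closed (S := {u | ∃ (f : ℤ → 𝓢(ℝ, ℂ)) (g : 𝓢(ℝ, ℂ)),
    (Set.range f).Finite ∧ u = fun x => ∑' t, latTerm a b c d e r f g t x}) ?_ ?_ ?_ ⟨f, g, hf, rfl⟩
  · rintro _ ⟨f, g, hf, rfl⟩
    obtain ⟨K, hK⟩ := latTerm_bound (c := c) (r := r) hdet hf g
    exact ⟨_, fun x => tsum_of_norm_bounded (summable_int_inv_sq.mul_left K).hasSum fun t => hK t x⟩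
  · rintro _ ⟨f, g, hf, rfl⟩
    refine ⟨_, add_mem (Submodule.smul_mem _ (a : ℂ) (Submodule.subset_span
      ⟨fun t => derX (f t), g, finite_range_map hf _, rfl⟩)) (Submodule.smul_mem _ (d : ℂ)
      (Submodule.subset_span ⟨f, derX g, hf, rfl⟩)), fun x => latSum_hasDerivAt hdet hf g x⟩
  · rintro _ ⟨f, g, hf, rfl⟩
    -- the coordinate is a combination of the two arguments `ax + bt + c`, `dx + et + r` and `1`
    have h : (fun x : ℝ => (x : ℂ) * ∑' t, latTerm a b c d e r f g t x)
        = ((e / (a * e - b * d) : ℝ) : ℂ) •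
            (fun x => ∑' t, latTerm a b c d e r (fun t => mulX (f t)) g t x)
          + (((-(b / (a * e - b * d)) : ℝ) : ℂ) •
            (fun x => ∑' t, latTerm a b c d e r f (mulX g) t x)
          + ((-((e * c - b * r) / (a * e - b * d)) : ℝ) : ℂ) •
            (fun x => ∑' t, latTerm a b c d e r f g t x)) := by
      funext x
      simp only [Pi.add_apply, Pi.smul_apply, smul_eq_mul]
      rw [← tsum_mul_left, ← tsum_mul_left, ← tsum_mul_left, ← tsum_mul_left,
        ← Summable.tsum_add ((latTerm_summable hdet hf (mulX g) x).mul_left _)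
          ((latTerm_summable hdet hf g x).mul_left _),
        ← Summable.tsum_add
          ((latTerm_summable hdet (finite_range_map hf _) g x).mul_left _)
          (((latTerm_summable hdet hf (mulX g) x).mul_left _).add
            ((latTerm_summable hdet hf g x).mul_left _))]
      refine tsum_congr fun t => ?_
      simp only [latTerm, mulX_apply]
      have hx : (x : ℂ) = ((e / (a * e - b * d) : ℝ) : ℂ) * ((a * x + b * t + c : ℝ) : ℂ)
          + (((-(b / (a * e - b * d)) : ℝ) : ℂ) * ((d * x + e * t + r : ℝ) : ℂ)
          + ((-((e * c - b * r) / (a * e - b * d)) : ℝ) : ℂ)) := by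
        norm_cast
        have e1 : e / (a * e - b * d) * (a * x + b * t + c)
            + (-(b / (a * e - b * d)) * (d * x + e * t + r) + -((e * c - b * r) / (a * e - b * d)))
            = x * (a * e - b * d) / (a * e - b * d) := by ring
        rw [e1, mul_div_cancel_right₀ _ hdet]
      linear_combination (f t (a * x + b * t + c) * g (d * x + e * t + r)) * hx
    rw [h]
    exact add_mem (Submodule.smul_mem _ _ (Submodule.subset_span
      ⟨_, g, finite_range_map hf _, rfl⟩)) (add_mem (Submodule.smul_mem _ _ (Submodule.subset_span
      ⟨f, mulX g, hf, rfl⟩)) (Submodule.smul_mem _ _ (Submodule.subset_span ⟨f, g, hf, rfl⟩)))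

/-- The Schwartz function `x ↦ ∑_t f_t(ax + bt + c) g(dx + et + r)`, where `ae - bd ≠ 0` and only
finitely many different `f_t` occur. -/
def latSum (a b c d e r : ℝ) (hdet : a * e - b * d ≠ 0) {f : ℤ → 𝓢(ℝ, ℂ)}
    (hf : (Set.range f).Finite) (g : 𝓢(ℝ, ℂ)) : 𝓢(ℝ, ℂ) :=
  (exists_latSum (c := c) (r := r) hdet hf g).choose

lemma latSum_apply (hdet : a * e - b * d ≠ 0) {f : ℤ → 𝓢(ℝ, ℂ)} (hf : (Set.range f).Finite)
    (g : 𝓢(ℝ, ℂ)) (x : ℝ) :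
    latSum a b c d e r hdet hf g x = ∑' t, latTerm a b c d e r f g t x :=
  congrFun (exists_latSum (c := c) (r := r) hdet hf g).choose_spec x

lemma latSum_deriv (hdet : a * e - b * d ≠ 0) {f : ℤ → 𝓢(ℝ, ℂ)} (hf : (Set.range f).Finite)
    (g : 𝓢(ℝ, ℂ)) (x : ℝ) : deriv (latSum a b c d e r hdet hf g) x
      = a * latSum a b c d e r hdet (finite_range_map hf derX) g x
        + d * latSum a b c d e r hdet hf (derX g) x := by
  rw [latSum_apply, latSum_apply, ← (latSum_hasDerivAt hdet hf g x).deriv]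
  congr 1
  funext y
  exact latSum_apply hdet hf g y

end Lattice

/-! ### Tensor products computed by a Morita context -/

lemma balMk_smul_tmul {θ θ' : ℝ} (M : TorusModule θ) (B : TorusBimodule θ θ') (φ : M.carrier)
    (a : Torus (-θ)) (ψ : B.carrier) :
    balMk M B ((op a • φ) ⊗ₜ ψ) = balMk M B (φ ⊗ₜ (a • ψ)) :=
  (Submodule.Quotient.eq _).2 (Submodule.subset_span ⟨φ, a, ψ, rfl⟩)

/-- The tensor product `M ⊗ B` is computed by any module `N` with a balanced bilinear map `P : M × B
→ N` which is compatible with the right actions and the connections, has generating values, and has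
a linear inverse `G` on the level of the balanced tensor product. -/
theorem tensor_iso_of_bilinear {θ θ' : ℝ} (M : TorusModule θ) (B : TorusBimodule θ θ')
    (N : TorusModule θ') (P : M.carrier →ₗ[ℂ] B.carrier →ₗ[ℂ] N.carrier)
    (hbal : ∀ (φ : M.carrier) (a : Torus (-θ)) (ψ : B.carrier), P (op a • φ) ψ = P φ (a • ψ))
    (hright : ∀ (φ : M.carrier) (ψ : B.carrier) (b : Torus (-θ')),
      P φ (op b • ψ) = op b • P φ ψ)
    (hD : ∀ μ φ ψ, N.D μ (P φ ψ) = (∑ ν, B.M μ ν • P (M.D ν φ) ψ) + P φ (B.D μ ψ))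
    (G : N.carrier →ₗ[ℂ] BalTensor M B) (hG : ∀ φ ψ, G (P φ ψ) = balMk M B (φ ⊗ₜ ψ))
    (hsurj : ∀ ν, ∃ t, TensorProduct.lift P t = ν) :
    (M.tensor B).Iso N := by
  let e : BalTensor M B →ₗ[ℂ] N.carrier := (balance M B).liftQ (TensorProduct.lift P) (by
    unfold balance
    rw [Submodule.span_le]
    rintro _ ⟨φ, a, ψ, rfl⟩
    change TensorProduct.lift P _ = 0
    rw [map_sub, TensorProduct.lift.tmul, TensorProduct.lift.tmul, hbal, sub_self])
  have he : ∀ t, e (balMk M B t) = TensorProduct.lift P t := fun t => rfl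
  have hGe : ∀ t, G (e t) = t := fun t => by
    obtain ⟨t, rfl⟩ := balMk_surjective M B t
    rw [he]
    induction t with
    | zero => simp
    | tmul φ ψ => rw [TensorProduct.lift.tmul, hG]
    | add t t' ht ht' => rw [map_add, map_add, map_add, ht, ht']
  have hes : Function.Surjective e := fun ν => by
    obtain ⟨t, ht⟩ := hsurj ν
    exact ⟨balMk M B t, ht⟩
  refine ⟨LinearEquiv.ofBijective e ⟨Function.LeftInverse.injective hGe, hes⟩, fun b t => ?_,
    fun μ t => ?_⟩
  · obtain ⟨t, rfl⟩ := balMk_surjective M B t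
    change e (op b • balMk M B t) = op b • e (balMk M B t)
    rw [smul_balMk, he, he]
    induction t with
    | zero => simp
    | tmul φ ψ => rw [rightMul_tmul, TensorProduct.lift.tmul, TensorProduct.lift.tmul, hright]
    | add t t' ht ht' => rw [map_add, map_add, map_add, ht, ht', smul_add]
  · obtain ⟨t, rfl⟩ := balMk_surjective M B t
    change e (balMk M B (tensorD M B μ t)) = N.D μ (e (balMk M B t))
    rw [he, he]
    induction t with
    | zero => simp
    | tmul φ ψ =>
      rw [tensorD_tmul, map_add, map_sum, TensorProduct.lift.tmul, TensorProduct.lift.tmul, hD]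
      simp only [map_smul, TensorProduct.lift.tmul]
    | add t t' ht ht' => rw [map_add, map_add, map_add, map_add, ht, ht']

/-- Let `B` be an equivalence bimodule with pairings `L : B × B' → T_{-θ}` and
`R : B' × B → T_{-θ'}` which are associative, linear and full. The tensor product `M ⊗ B` is computed
by any module `N` with two products `P : M × B → N` and `Q : N × B' → M` which are
associative with respect to the pairings; the isomorphism is induced by `P`. -/
theorem tensor_iso_of_pairing {θ θ' : ℝ} (M : TorusModule θ) (B : TorusBimodule θ θ')
    (N : TorusModule θ') {B' : Type} (L : B.carrier → B' → Torus (-θ))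
    (R : B' → B.carrier → Torus (-θ'))
    (hLR : ∀ f g k, L f g • k = op (R g k) • f)
    (hL : ∀ (a : Torus (-θ)) f g, L (a • f) g = a * L f g)
    (hR : ∀ g f (b : Torus (-θ')), R g (op b • f) = R g f * b)
    {n n' : ℕ} (f : Fin n → B.carrier) (g : Fin n → B') (hfg : ∑ i, L (f i) (g i) = 1)
    (f' : Fin n' → B.carrier) (g' : Fin n' → B') (hgf : ∑ i, R (g' i) (f' i) = 1)
    (P : M.carrier →ₗ[ℂ] B.carrier →ₗ[ℂ] N.carrier) (Q : B' → N.carrier →ₗ[ℂ] M.carrier)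
    (hQP : ∀ φ ψ g, Q g (P φ ψ) = op (L ψ g) • φ)
    (hPQ : ∀ ν g ψ, P (Q g ν) ψ = op (R g ψ) • ν)
    (hD : ∀ μ φ ψ, N.D μ (P φ ψ) = (∑ ν, B.M μ ν • P (M.D ν φ) ψ) + P φ (B.D μ ψ)) :
    (M.tensor B).Iso N := by
  -- the dual bases expand every element of `N` in values of `P` and every element of `M` in
  -- values of `Q`
  have hN : ∀ ν, ν = ∑ i, P (Q (g' i) ν) (f' i) := fun ν => by
    simp_rw [hPQ]
    rw [← Finset.sum_smul, ← Finset.op_sum, hgf, op_one, one_smul]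
  have hM : ∀ φ, φ = ∑ i, Q (g i) (P φ (f i)) := fun φ => by
    simp_rw [hQP]
    rw [← Finset.sum_smul, ← Finset.op_sum, hfg, op_one, one_smul]
  -- balancedness follows from `QP = φ L`, applied to the expansion of the values of `P`
  have hbal : ∀ (φ : M.carrier) (a : Torus (-θ)) (ψ : B.carrier),
      P (op a • φ) ψ = P φ (a • ψ) := fun φ a ψ => by
    rw [hN (P (op a • φ) ψ), hN (P φ (a • ψ))]
    refine Finset.sum_congr rfl fun i _ => ?_
    rw [hQP, hQP, hL, op_mul, mul_smul]
  have hright : ∀ (φ : M.carrier) (ψ : B.carrier) (b : Torus (-θ')),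
      P φ (op b • ψ) = op b • P φ ψ := fun φ ψ b => by
    have key : ∀ ψ, P φ ψ = ∑ i, op (R (g i) ψ) • P φ (f i) := fun ψ => by
      conv_lhs => rw [hM φ]
      rw [map_sum, LinearMap.sum_apply]
      exact Finset.sum_congr rfl fun i _ => hPQ _ _ _
    rw [key (op b • ψ), key ψ, Finset.smul_sum]
    refine Finset.sum_congr rfl fun i _ => ?_
    rw [hR, op_mul, mul_smul]
  -- moving the scalar `L(ψ, g)` across the tensor sign and using associativity of the pairings
  have hinv : ∀ φ ψ, balMk M B (φ ⊗ₜ ψ) = ∑ i, balMk M B (Q (g' i) (P φ ψ) ⊗ₜ f' i) := by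
    intro φ ψ
    simp_rw [hQP, balMk_smul_tmul, hLR]
    rw [← map_sum, ← TensorProduct.tmul_sum, ← Finset.sum_smul, ← Finset.op_sum, hgf, op_one,
      one_smul]
  let G : N.carrier →ₗ[ℂ] BalTensor M B :=
    ∑ i, (balMk M B).comp (((TensorProduct.mk ℂ M.carrier B.carrier).flip (f' i)).comp (Q (g' i)))
  have hG : ∀ ν, G ν = ∑ i, balMk M B (Q (g' i) ν ⊗ₜ f' i) := fun ν => by
    simp [G, LinearMap.sum_apply]
  refine tensor_iso_of_bilinear M B N P hbal hright hD G (fun φ ψ => by rw [hG, hinv]) fun ν => ?_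
  refine ⟨∑ i, Q (g' i) ν ⊗ₜ f' i, ?_⟩
  rw [map_sum]
  exact (hN ν).symm

lemma leftAct_pairL' {s : ℤ} {θ : ℝ} (h : (s : ℝ) - θ ≠ 0) (f : HSpace 1) (g : 𝓢(ℝ, ℂ))
    (k : HSpace 1) : leftAct s θ (pairL h (f 0) g) k
      = heisAct 0 1 (1 / (s - θ)) (pairR h g (k 0)) f := by
  have := leftAct_pairL h (f 0) g (k 0)
  rwa [ofS_zero, ofS_zero] at this

/-- The criterion `tensor_iso_of_pairing` for the Morita context of Schwartz functions. -/
theorem tensor_bimodS_iso {s : ℤ} {θ : ℝ} (h : (s : ℝ) - θ ≠ 0) (M : TorusModule θ)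
    (N : TorusModule (1 / (s - θ)))
    (P : M.carrier →ₗ[ℂ] HSpace 1 →ₗ[ℂ] N.carrier) (Q : 𝓢(ℝ, ℂ) → N.carrier →ₗ[ℂ] M.carrier)
    (hQP : ∀ φ ψ g, Q g (P φ ψ) = op (pairL h (ψ 0) g) • φ)
    (hPQ : ∀ ν g ψ, P (Q g ν) ψ = op (pairR h g (ψ 0)) • ν)
    (hD : ∀ μ φ ψ, N.D μ (P φ ψ)
      = ((θ : ℂ) - s) • P (M.D μ φ) ψ + P φ (heisD 0 1 (1 / (s - θ)) μ ψ)) :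
    (M.tensor (bimodS s θ h)).Iso N := by
  obtain ⟨n, f, g, hfg⟩ := exists_pairL_sum_eq_one h
  obtain ⟨n', g', f', hgf⟩ := exists_pairR_sum_eq_one h
  refine tensor_iso_of_pairing M (bimodS s θ h) N (B' := 𝓢(ℝ, ℂ))
    (fun f g => pairL h ((f : HSpace 1) 0) g) (fun g f => pairR h g ((f : HSpace 1) 0))
    (fun f g k => ?_) (fun a f g => pairL_act h g a f) (fun g f b => pairR_act h g b f)
    (fun i => ofS (f i)) g hfg (fun i => ofS (f' i)) g' hgf P Q hQP hPQ fun μ φ ψ => ?_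
  · exact leftAct_pairL' h f g k
  · refine (hD μ φ ψ).trans (congrArg (· + P φ (heisD 0 1 (1 / (s - θ)) μ ψ)) ?_)
    change _ = ∑ ν, (((θ : ℂ) - s) • (1 : Matrix (Fin 2) (Fin 2) ℂ)) μ ν • P (M.D ν φ) ψ
    rw [Finset.sum_eq_single μ]
    · simp
    · intro ν _ hν; simp [Matrix.one_apply_ne (Ne.symm hν)]
    · simp

/-! ### The product of two Heisenberg modules -/

/-- Any representative of a residue class differs from the chosen one by a multiple of `m`. -/
lemma exists_lift_eq {m : ℤ} {j : ZMod m.natAbs} {l : ℤ} (hl : (l : ZMod m.natAbs) = j) :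
    ∃ r : ℤ, (j.cast : ℤ) = l + m * r := by
  have h1 : ((l : ℤ) : ZMod m.natAbs) = ((j.cast : ℤ) : ZMod m.natAbs) := by
    rw [hl, ZMod.intCast_zmod_cast]
  obtain ⟨t, ht⟩ := Int.natAbs_dvd.1 ((ZMod.intCast_eq_intCast_iff_dvd_sub _ _ _).1 h1)
  exact ⟨t, by linarith⟩

lemma intCast_mul_natAbs (m r : ℤ) : ((m * r : ℤ) : ZMod m.natAbs) = 0 := by
  rw [ZMod.intCast_zmod_eq_zero_iff_dvd]
  exact Int.natAbs_dvd.2 (dvd_mul_right m r)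

lemma finite_range_comp {m : ℤ} [NeZero m.natAbs] (φ : HSpace m) (k : ℤ → ZMod m.natAbs) :
    (Set.range fun t => φ (k t)).Finite :=
  (Set.finite_range φ).subset (by rintro _ ⟨p, rfl⟩; exact ⟨_, rfl⟩)

section Heisenberg

variable (n m s : ℤ) (θ : ℝ) [hm : NeZero m.natAbs] [hm' : NeZero (-n + m * s).natAbs]

include hm in
lemma cast_ne_zero_of_natAbs : (m : ℝ) ≠ 0 := by
  exact_mod_cast Int.natAbs_ne_zero.1 hm.out

omit hm in
include hm' in
lemma dual_cast_ne_zero : -(n : ℝ) + m * s ≠ 0 := by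
  exact_mod_cast Int.natAbs_ne_zero.1 hm'.out

include hm hm' in
lemma tensP_det : -((s : ℝ) - θ) * 1 - (θ - n / m) * 1 ≠ 0 := by
  have h1 := cast_ne_zero_of_natAbs m
  have h2 := dual_cast_ne_zero n m s
  rw [show -((s : ℝ) - θ) * 1 - (θ - n / m) * 1 = -((-n + m * s) / m) by field_simp; ring]
  exact neg_ne_zero.2 (div_ne_zero h2 h1)

include hm hm' in
lemma tensQ_det (h : (s : ℝ) - θ ≠ 0) :
    -(1 / ((s : ℝ) - θ)) * -(1 / (s - θ))
      - (m / (-n + m * s : ℤ) - 1 / (s - θ)) * -(1 / (s - θ)) ≠ 0 := by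
  have h1 := cast_ne_zero_of_natAbs m
  have h2 := dual_cast_ne_zero n m s
  push_cast
  rw [show -(1 / ((s : ℝ) - θ)) * -(1 / (s - θ))
      - (m / (-n + m * s) - 1 / (s - θ)) * -(1 / (s - θ)) = m / (-n + m * s) * (1 / (s - θ)) by
    ring]
  exact mul_ne_zero (div_ne_zero h1 h2) (one_div_ne_zero h)

/-- The product `E_{n,m} × E_{0,1} → E_{m,-n+ms}`. The chosen representative of the class `J` enters
the defining lattice sum; `tensP_apply` shows that every representative gives the same function. -/
def tensP (φ : HSpace m) (ψ : HSpace 1) : HSpace (-n + m * s) := fun J =>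
  latSum (-((s : ℝ) - θ)) (θ - n / m)
    ((s - θ) * ((J.cast : ℤ) * m / (-n + m * s : ℤ)) - (J.cast : ℤ)) 1 1
    (-((J.cast : ℤ) * m / (-n + m * s : ℤ))) (tensP_det n m s θ)
    (finite_range_comp φ fun t => ((-t : ℤ) : ZMod m.natAbs)) (ψ 0)

lemma tensP_apply (φ : HSpace m) (ψ : HSpace 1) {J : ZMod (-n + m * s).natAbs} {l : ℤ}
    (hl : (l : ZMod (-n + m * s).natAbs) = J) (X : ℝ) :
    tensP n m s θ φ ψ J X = ∑' t : ℤ, φ ((-t : ℤ) : ZMod m.natAbs)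
        (-((s : ℝ) - θ) * (X - l * m / (-n + m * s : ℤ)) - l + t * (θ - n / m))
        * ψ 0 (X - l * m / (-n + m * s : ℤ) + t) := by
  have h1 := cast_ne_zero_of_natAbs m
  obtain ⟨r, hr⟩ := exists_lift_eq hl
  rw [tensP, latSum_apply, hr, ← (Equiv.addRight (m * r)).tsum_eq]
  refine tsum_congr fun t => ?_
  rw [latTerm, Equiv.coe_addRight]
  -- passing to another representative `l + (-n+ms) r` shifts the summation index by `mr`
  have e0 : ((-(t + m * r) : ℤ) : ZMod m.natAbs) = ((-t : ℤ) : ZMod m.natAbs) := by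
    rw [neg_add, Int.cast_add, ← mul_neg, intCast_mul_natAbs, add_zero]
  have hM : (n : ℝ) = m * s - (-n + m * s : ℤ) := by push_cast; ring
  have h2 : ((-n + m * s : ℤ) : ℝ) ≠ 0 := by
    push_cast; exact dual_cast_ne_zero n m s
  simp only [e0, Int.cast_add l, Int.cast_add t, Int.cast_mul (-n + m * s) r,
    Int.cast_mul m r, Int.cast_neg]
  generalize ((-n + m * s : ℤ) : ℝ) = M' at hM h2
  rw [hM]
  congr 2
  · field_simp
    ring
  · field_simp
    ring

/-- The product `E_{m,-n+ms} × E_{0,1}' → E_{n,m}` in the opposite direction, again independent of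
the representative of `j` by `tensQ_apply`. -/
def tensQ (h : (s : ℝ) - θ ≠ 0) (g : 𝓢(ℝ, ℂ)) (ν : HSpace (-n + m * s)) : HSpace m := fun j =>
  latSum (-(1 / ((s : ℝ) - θ))) (m / (-n + m * s : ℤ) - 1 / (s - θ))
    (1 / (s - θ) * ((j.cast : ℤ) * n / m) + (j.cast : ℤ)
      - s * (j.cast : ℤ) * m / (-n + m * s : ℤ))
    (-(1 / (s - θ))) (-(1 / (s - θ))) (1 / (s - θ) * ((j.cast : ℤ) * n / m))
    (tensQ_det n m s θ h)
    (finite_range_comp ν fun k => ((k - s * (j.cast : ℤ) : ℤ) : ZMod (-n + m * s).natAbs)) g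

lemma tensQ_apply (h : (s : ℝ) - θ ≠ 0) (g : 𝓢(ℝ, ℂ)) (ν : HSpace (-n + m * s))
    {j : ZMod m.natAbs} {l : ℤ} (hl : (l : ZMod m.natAbs) = j) (x : ℝ) :
    tensQ n m s θ h g ν j x = ∑' k : ℤ, ν ((k - s * l : ℤ) : ZMod (-n + m * s).natAbs)
        (-(1 / (s - θ)) * (x - l * n / m + k) + l + (k - s * l) * m / (-n + m * s : ℤ))
        * g (-(1 / (s - θ)) * (x - l * n / m + k)) := by
  have h1 := cast_ne_zero_of_natAbs m
  obtain ⟨r, hr⟩ := exists_lift_eq hl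
  rw [tensQ, latSum_apply, hr, ← (Equiv.addRight (n * r)).tsum_eq]
  refine tsum_congr fun k => ?_
  rw [latTerm, Equiv.coe_addRight]
  -- passing to another representative `l + mr` shifts the summation index by `nr`
  have e0 : ((k + n * r - s * (l + m * r) : ℤ) : ZMod (-n + m * s).natAbs)
      = ((k - s * l : ℤ) : ZMod (-n + m * s).natAbs) := by
    rw [show k + n * r - s * (l + m * r) = k - s * l + (-n + m * s) * (-r) by ring,
      Int.cast_add, intCast_mul_natAbs, add_zero]
  have hM : (n : ℝ) = m * s - (-n + m * s : ℤ) := by push_cast; ring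
  have h2 : ((-n + m * s : ℤ) : ℝ) ≠ 0 := by
    push_cast; exact dual_cast_ne_zero n m s
  simp only [e0, Int.cast_add l, Int.cast_add k,
    Int.cast_mul m r, Int.cast_mul n r]
  generalize ((-n + m * s : ℤ) : ℝ) = M' at hM h2
  rw [hM]
  congr 2
  · field_simp
    ring
  · field_simp
    ring

/-- Both sides are the double sum over `p, k` of `g(Y_k) ψ(Y_k + p) φ_{l-p}(x + p(θ - n/m))` with
`Y_k = -(x - ln/m + k)/(s-θ)`. -/
lemma tensQ_tensP (h : (s : ℝ) - θ ≠ 0) (φ : HSpace m) (ψ : HSpace 1) (g : 𝓢(ℝ, ℂ)) :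
    tensQ n m s θ h g (tensP n m s θ φ ψ) = heisAct n m θ (pairL h (ψ 0) g) φ := by
  obtain ⟨K, hK⟩ := HSpace_bounded m φ
  funext j
  ext x
  obtain ⟨l, rfl⟩ := ZMod.intCast_surjective j
  set Y : ℤ → ℝ := fun k => -(1 / (s - θ)) * (x - l * n / m + k) with hY
  set F : ℤ → ℤ → ℂ := fun p k => g (Y k) * ψ 0 (Y k + p)
    * φ ((l : ZMod m.natAbs) - p) (x + p * (θ - n / m)) with hF
  have hs : Summable fun y : ℤ × ℤ => F y.1 y.2 := by
    refine (summable_gabor_mul (sub_swap_ne h) (affS (scaleU h) 0 g) (affS (scaleU h) 0 (ψ 0))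
      (x - l * n / m) (F := fun y : ℤ × ℤ => φ ((l : ZMod m.natAbs) - y.1)
        (x + y.1 * (θ - n / m))) (K := K) (fun y => hK (_, _))).congr fun y => ?_
    rw [affS_apply, affS_apply, coe_scaleU, hF, hY]
    congr 3
    · ring
    · field_simp
      ring
  have hL : tensQ n m s θ h g (tensP n m s θ φ ψ) (l : ZMod m.natAbs) x
      = ∑' k : ℤ, ∑' p : ℤ, F p k := by
    rw [tensQ_apply n m s θ h g _ rfl]
    refine tsum_congr fun k => ?_
    rw [tensP_apply n m s θ φ ψ rfl, ← tsum_mul_right, ← (Equiv.addRight l).tsum_eq (F · k)]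
    refine tsum_congr fun t => ?_
    rw [Equiv.coe_addRight]
    have e1 : -(1 / ((s : ℝ) - θ)) * (x - l * n / m + k) + l + (k - s * l) * m / (-n + m * s : ℤ)
        - ((k - s * l : ℤ) : ℝ) * m / (-n + m * s : ℤ) = Y k + l := by
      rw [hY]; push_cast; ring
    have e2 : -((s : ℝ) - θ) * (Y k + l) = x - l * n / m + k - (s - θ) * l := by
      rw [hY]; field_simp; ring
    have e3 : ((-t : ℤ) : ZMod m.natAbs) = (l : ZMod m.natAbs) - ((t + l : ℤ) : ZMod m.natAbs) := by
      push_cast; ring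
    rw [e1, e2, e3]
    have e4 : x - l * n / m + k - (s - θ) * l - ((k - s * l : ℤ) : ℝ) + t * (θ - n / m)
        = x + ((t + l : ℤ) : ℝ) * (θ - n / m) := by push_cast; ring
    rw [e4, show Y k + (l : ℝ) + t = Y k + ((t + l : ℤ) : ℝ) by push_cast; ring]
    ring
  rw [hL, heisAct_symb n m θ _ φ rfl]
  refine (Summable.tsum_comm (f := F) hs).trans ?_
  refine tsum_congr fun p => ?_
  rw [tsum_mul_right, pairL_symb]

/-- Both sides are the double sum over `p, t` of `ψ(y + t) g(y + t + p/(s-θ)) ν_{l-p}(X + p(1/(s-θ)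
- m/(-n+ms)))`. -/
lemma tensP_tensQ (h : (s : ℝ) - θ ≠ 0) (ν : HSpace (-n + m * s)) (g : 𝓢(ℝ, ℂ)) (ψ : HSpace 1) :
    tensP n m s θ (tensQ n m s θ h g ν) ψ
      = heisAct m (-n + m * s) (1 / (s - θ)) (pairR h g (ψ 0)) ν := by
  obtain ⟨K, hK⟩ := HSpace_bounded _ ν
  funext J
  ext X
  obtain ⟨l, rfl⟩ := ZMod.intCast_surjective J
  set y : ℝ := X - l * m / (-n + m * s : ℤ) with hy
  set F : ℤ → ℤ → ℂ := fun p t => ψ 0 (y + t) * g (y + t + p * (1 / (s - θ)))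
    * ν ((l : ZMod (-n + m * s).natAbs) - p) (X + p * (1 / (s - θ) - m / (-n + m * s : ℤ))) with hF
  have hs : Summable fun y : ℤ × ℤ => F y.1 y.2 :=
    summable_gabor_mul (one_div_ne_zero h) (ψ 0) g y (F := fun y : ℤ × ℤ =>
      ν ((l : ZMod (-n + m * s).natAbs) - y.1) (X + y.1 * (1 / (s - θ) - m / (-n + m * s : ℤ))))
      (fun y => hK (_, _))
  have hL : tensP n m s θ (tensQ n m s θ h g ν) ψ (l : ZMod (-n + m * s).natAbs) X
      = ∑' t : ℤ, ∑' p : ℤ, F p t := by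
    rw [tensP_apply n m s θ _ ψ rfl]
    refine tsum_congr fun t => ?_
    rw [tensQ_apply n m s θ h g ν rfl, ← tsum_mul_right, ← (Equiv.subLeft (l - s * t)).tsum_eq]
    refine tsum_congr fun p => ?_
    rw [Equiv.subLeft_apply]
    have e1 : -(1 / ((s : ℝ) - θ)) * (-((s : ℝ) - θ) * y - l + t * (θ - n / m)
        - ((-t : ℤ) : ℝ) * n / m + ((l - s * t - p : ℤ) : ℝ)) = y + t + p * (1 / (s - θ)) := by
      push_cast; field_simp; ring
    have e2 : ((l - s * t - p - s * -t : ℤ) : ZMod (-n + m * s).natAbs)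
        = (l : ZMod (-n + m * s).natAbs) - p := by
      push_cast; ring
    rw [e1, e2, hF]
    have e3 : y + t + p * (1 / (s - θ)) + ((-t : ℤ) : ℝ)
        + (((l - s * t - p : ℤ) : ℝ) - s * ((-t : ℤ) : ℝ)) * m / (-n + m * s : ℤ)
        = X + p * (1 / (s - θ) - m / (-n + m * s : ℤ)) := by rw [hy]; push_cast; ring
    rw [e3]
    ring
  rw [hL, heisAct_symb m (-n + m * s) (1 / (s - θ)) _ ν rfl]
  refine (Summable.tsum_comm (f := F) hs).trans ?_
  refine tsum_congr fun p => ?_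
  rw [tsum_mul_right, pairR_symb]

end Heisenberg

section Lattice

variable {a b c d e r : ℝ} (hdet : a * e - b * d ≠ 0) {f f' : ℤ → 𝓢(ℝ, ℂ)}
  (hf : (Set.range f).Finite) (hf' : (Set.range f').Finite)

lemma latSum_add_left (hff' : (Set.range fun t => f t + f' t).Finite) (g : 𝓢(ℝ, ℂ)) :
    latSum a b c d e r hdet hff' g
      = latSum a b c d e r hdet hf g + latSum a b c d e r hdet hf' g := by
  ext x
  rw [add_apply, latSum_apply, latSum_apply, latSum_apply,
    ← (latTerm_summable hdet hf g x).tsum_add (latTerm_summable hdet hf' g x)]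
  exact tsum_congr fun t => by simp only [latTerm, add_apply]; ring

lemma latSum_smul_left (k : ℂ) (hkf : (Set.range fun t => k • f t).Finite) (g : 𝓢(ℝ, ℂ)) :
    latSum a b c d e r hdet hkf g = k • latSum a b c d e r hdet hf g := by
  ext x
  rw [smul_apply, latSum_apply, latSum_apply, smul_eq_mul, ← tsum_mul_left]
  exact tsum_congr fun t => by simp only [latTerm, smul_apply, smul_eq_mul]; ring

lemma latSum_add_right (g g' : 𝓢(ℝ, ℂ)) :
    latSum a b c d e r hdet hf (g + g')
      = latSum a b c d e r hdet hf g + latSum a b c d e r hdet hf g' := by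
  ext x
  rw [add_apply, latSum_apply, latSum_apply, latSum_apply,
    ← (latTerm_summable hdet hf g x).tsum_add (latTerm_summable hdet hf g' x)]
  exact tsum_congr fun t => by simp only [latTerm, add_apply]; ring

lemma latSum_smul_right (k : ℂ) (g : 𝓢(ℝ, ℂ)) :
    latSum a b c d e r hdet hf (k • g) = k • latSum a b c d e r hdet hf g := by
  ext x
  rw [smul_apply, latSum_apply, latSum_apply, smul_eq_mul, ← tsum_mul_left]
  exact tsum_congr fun t => by simp only [latTerm, smul_apply, smul_eq_mul]; ring

end Lattice

section Heisenberg

variable (n m s : ℤ) (θ : ℝ) [hm : NeZero m.natAbs] [hm' : NeZero (-n + m * s).natAbs]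

omit hm in
lemma heisD_zero_apply (φ : HSpace m) (j : ZMod m.natAbs) :
    heisD n m θ 0 φ j = (I * m / (n - m * θ) : ℂ) • mulX (φ j) := rfl

omit hm in
lemma heisD_one_apply (φ : HSpace m) (j : ZMod m.natAbs) :
    heisD n m θ 1 φ j = (1 / (2 * Real.pi) : ℂ) • derX (φ j) := rfl

omit hm hm' in
/-- The coefficients of the coordinates `X` in the connections of the three modules match: the
identity behind the Leibniz rule for `D_1`. -/
lemma tensP_connection_aux {n m M s θ : ℝ} (hm : m ≠ 0) (hM : M ≠ 0) (hn : n = m * s - M)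
    (h : s - θ ≠ 0) (h0 : n - m * θ ≠ 0) (l t X : ℝ) :
    M / (m - M * (1 / (s - θ))) * X = (θ - s) * (m / (n - m * θ)) *
        (-(s - θ) * X + (θ - n / m) * t + ((s - θ) * (l * m / M) - l))
      + 1 / (0 - 1 * (1 / (s - θ))) * (1 * X + 1 * t + -(l * m / M)) := by
  obtain ⟨δ, rfl⟩ : ∃ δ, θ = s - δ := ⟨s - θ, by ring⟩
  subst hn
  rw [sub_sub_cancel] at *
  have h1 : m * δ - M ≠ 0 := by
    intro h'; apply h0; linear_combination h'
  have e1 : m - M * (1 / δ) = (m * δ - M) / δ := by field_simp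
  have e2 : m * s - M - m * (s - δ) = m * δ - M := by ring
  rw [e1, e2]
  field_simp
  ring

/-- The product intertwines the connections; for `D_1` this is an identity between coordinates, for
`D_2` the product rule for lattice sums. -/
lemma tensP_heisD (h : (s : ℝ) - θ ≠ 0) (h0 : (n : ℝ) - m * θ ≠ 0) (μ : Fin 2) (φ : HSpace m)
    (ψ : HSpace 1) : heisD m (-n + m * s) (1 / (s - θ)) μ (tensP n m s θ φ ψ)
      = ((θ : ℂ) - s) • tensP n m s θ (heisD n m θ μ φ) ψ
        + tensP n m s θ φ (heisD 0 1 (1 / (s - θ)) μ ψ) := by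
  have hpi : (Real.pi : ℂ) ≠ 0 := by exact_mod_cast Real.pi_ne_zero
  have h1 := cast_ne_zero_of_natAbs m
  have h2 : ((-n + m * s : ℤ) : ℝ) ≠ 0 := by
    push_cast; exact dual_cast_ne_zero n m s
  have hM : (n : ℝ) = m * s - (-n + m * s : ℤ) := by push_cast; ring
  have hf := finite_range_comp φ fun t => ((-t : ℤ) : ZMod m.natAbs)
  funext J
  ext X
  rw [Pi.add_apply, add_apply, Pi.smul_apply, smul_apply, smul_eq_mul]
  fin_cases μ
  · simp only [Fin.zero_eta, heisD_zero_apply, smul_apply, mulX_apply, smul_eq_mul]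
    simp only [tensP, heisD_zero_apply]
    rw [latSum_smul_left _ (finite_range_map hf mulX), latSum_smul_right]
    simp only [smul_apply, smul_eq_mul, latSum_apply]
    rw [← tsum_mul_left, ← tsum_mul_left, ← tsum_mul_left, ← tsum_mul_left, ← tsum_mul_left,
      ← Summable.tsum_add]
    · refine tsum_congr fun t => ?_
      simp only [latTerm, mulX_apply]
      have key := congrArg (fun y : ℝ => (y : ℂ)) (tensP_connection_aux h1 h2 hM h h0
        (J.cast : ℤ) t X)
      push_cast at key ⊢
      linear_combination (I * φ (-(t : ZMod m.natAbs)) (-(s - θ) * X + (θ - n / m) * t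
        + ((s - θ) * ((J.cast : ℤ) * m / (-n + m * s)) - (J.cast : ℤ)))
        * ψ 0 (1 * X + 1 * t + -((J.cast : ℤ) * m / (-n + m * s)))) * key
    · exact ((latTerm_summable (tensP_det n m s θ) (finite_range_map hf mulX) _ X).mul_left _).mul_left _
    · exact (latTerm_summable (tensP_det n m s θ) hf _ X).mul_left _
  · simp only [Fin.mk_one, heisD_one_apply, smul_apply, derX_apply, smul_eq_mul]
    simp only [tensP, heisD_one_apply]
    rw [latSum_deriv, latSum_smul_left _ (finite_range_map hf derX), latSum_smul_right]
    simp only [smul_apply, smul_eq_mul]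
    push_cast
    ring

/-- The tensor product of `E_{n,m}` with `bimodS`, when neither `E_{n,m}` nor the product is a free
module, that is, `m ≠ 0` and `-n + ms ≠ 0`. -/
lemma schwartzModule_tensor_bimodS (h : (s : ℝ) - θ ≠ 0) (h0 : (n : ℝ) - m * θ ≠ 0)
    (h' : (m : ℝ) - (-n + m * s : ℤ) * (1 / (s - θ)) ≠ 0) :
    ((schwartzModule n m θ h0).tensor (bimodS s θ h)).Iso
      (schwartzModule m (-n + m * s) (1 / (s - θ)) h') := by
  let P : HSpace m →ₗ[ℂ] HSpace 1 →ₗ[ℂ] HSpace (-n + m * s) :=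
    LinearMap.mk₂ ℂ (tensP n m s θ)
      (fun φ φ' ψ => funext fun J => latSum_add_left _ _ _ _ _)
      (fun k φ ψ => funext fun J => latSum_smul_left _ _ _ _ _)
      (fun φ ψ ψ' => funext fun J => latSum_add_right _ _ _ _)
      (fun k φ ψ => funext fun J => latSum_smul_right _ _ _ _)
  let Q : 𝓢(ℝ, ℂ) → HSpace (-n + m * s) →ₗ[ℂ] HSpace m := fun g =>
    { toFun := tensQ n m s θ h g
      map_add' := fun ν ν' => funext fun J => latSum_add_left _ _ _ _ _
      map_smul' := fun k ν => funext fun J => latSum_smul_left _ _ _ _ _ }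
  exact tensor_bimodS_iso h (schwartzModule n m θ h0)
    (schwartzModule m (-n + m * s) (1 / (s - θ)) h') P Q
    (fun φ ψ g => tensQ_tensP n m s θ h φ ψ g) (fun ν g ψ => tensP_tensQ n m s θ h ν g ψ)
    (fun μ φ ψ => tensP_heisD n m s θ h h0 μ φ ψ)

end Heisenberg

/-! ### Linearity of the pairings and periodicity of symbols -/

lemma symb_smul {ϑ : ℝ} (c : ℂ) (a : Torus ϑ) (p : ℤ) (z : ℝ) :
    (c • a).symb p z = c * a.symb p z := by
  unfold Torus.symb
  rw [← tsum_mul_left]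
  exact tsum_congr fun q => by rw [Torus.coeff_smul]; ring

lemma symb_add_int {ϑ : ℝ} (a : Torus ϑ) (p : ℤ) (z : ℝ) (k : ℤ) :
    a.symb p (z + k) = a.symb p z := by
  unfold Torus.symb
  refine tsum_congr fun q => ?_
  rw [← mul_one (exp (2 * Real.pi * I * q * z)), ← exp_two_pi_int (q * k), ← exp_add]
  congr 2
  push_cast
  ring

lemma norm_symb_le {ϑ : ℝ} (a : Torus ϑ) (p : ℤ) (z : ℝ) :
    ‖a.symb p z‖ ≤ ∑' q : ℤ, ‖a.coeff (p, q)‖ :=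
  tsum_of_norm_bounded (a.coeff_summable_snd p).hasSum fun q => by
    rw [norm_mul, norm_exp_two_pi, mul_one]

lemma tsum_shear {F : ℤ → ℤ → ℂ} (hs : Summable fun y : ℤ × ℤ => F y.1 y.2) :
    ∑' k : ℤ, ∑' l : ℤ, F (k + l) l = ∑' k : ℤ, ∑' l : ℤ, F k l := by
  let e : ℤ × ℤ ≃ ℤ × ℤ :=
    { toFun := fun y => (y.1 + y.2, y.2)
      invFun := fun y => (y.1 - y.2, y.2)
      left_inv := fun y => by simp
      right_inv := fun y => by simp }
  have hs' : Summable fun y : ℤ × ℤ => F (y.1 + y.2) y.2 := hs.comp_injective e.injective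
  calc _ = ∑' l : ℤ, ∑' k : ℤ, F (k + l) l :=
        (Summable.tsum_comm (f := fun k l => F (k + l) l) hs').symm
    _ = ∑' l : ℤ, ∑' k : ℤ, F k l := tsum_congr fun l => (Equiv.addRight l).tsum_eq (F · l)
    _ = _ := Summable.tsum_comm (f := F) hs

section gabor

variable {ϑ u : ℝ} (hu : u ≠ 0)

include hu in
lemma summable_gabor_snd (h g : 𝓢(ℝ, ℂ)) (p : ℤ) (z : ℝ) :
    Summable fun k : ℤ => h (z + k) * g (z + k + p * u) :=
  Summable.of_norm ((summable_gabor hu h g z).comp_injective (i := fun k : ℤ => (p, k))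
    fun q q' h => by simpa using h)

lemma gabor_add_left (h h' g : 𝓢(ℝ, ℂ)) :
    (gabor hu (h + h') g : Torus ϑ) = gabor hu h g + gabor hu h' g := by
  refine Torus.ext_symb fun p z => ?_
  rw [symb_add, gabor_symb, gabor_symb, gabor_symb,
    ← (summable_gabor_snd hu h g p z).tsum_add (summable_gabor_snd hu h' g p z)]
  exact tsum_congr fun k => by rw [add_apply]; ring

lemma gabor_add_right (h g g' : 𝓢(ℝ, ℂ)) :
    (gabor hu h (g + g') : Torus ϑ) = gabor hu h g + gabor hu h g' := by
  refine Torus.ext_symb fun p z => ?_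
  rw [symb_add, gabor_symb, gabor_symb, gabor_symb,
    ← (summable_gabor_snd hu h g p z).tsum_add (summable_gabor_snd hu h g' p z)]
  exact tsum_congr fun k => by rw [add_apply]; ring

lemma gabor_smul_left (c : ℂ) (h g : 𝓢(ℝ, ℂ)) :
    (gabor hu (c • h) g : Torus ϑ) = c • gabor hu h g := by
  refine Torus.ext_symb fun p z => ?_
  rw [symb_smul, gabor_symb, gabor_symb, ← tsum_mul_left]
  exact tsum_congr fun k => by rw [smul_apply, smul_eq_mul]; ring

lemma gabor_smul_right (c : ℂ) (h g : 𝓢(ℝ, ℂ)) :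
    (gabor hu h (c • g) : Torus ϑ) = c • gabor hu h g := by
  refine Torus.ext_symb fun p z => ?_
  rw [symb_smul, gabor_symb, gabor_symb, ← tsum_mul_left]
  exact tsum_congr fun k => by rw [smul_apply, smul_eq_mul]; ring

lemma der_zero_gabor (h g : 𝓢(ℝ, ℂ)) : Torus.der 0 (gabor hu h g : Torus ϑ)
    = (I * u⁻¹ : ℂ) • gabor hu h (mulX g) + (-(I * u⁻¹) : ℂ) • gabor hu (mulX h) g := by
  ext k
  have h1 := congrFun (gaborCoeff_idx_zero hu h g) k
  simp only [Pi.smul_apply, Pi.sub_apply, smul_eq_mul] at h1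
  rw [Torus.coeff_der, Torus.coeff_add, Torus.coeff_smul, Torus.coeff_smul]
  simp only [gabor, Torus.coeff_mk]
  push_cast
  linear_combination I * h1

lemma der_one_gabor (h g : 𝓢(ℝ, ℂ)) : Torus.der 1 (gabor hu h g : Torus ϑ)
    = (1 / (2 * Real.pi) : ℂ) • gabor hu (derX h) g
      + (1 / (2 * Real.pi) : ℂ) • gabor hu h (derX g) := by
  ext k
  have h1 := congrFun (gaborCoeff_idx_one u h g) k
  simp only [Pi.smul_apply, Pi.add_apply, smul_eq_mul] at h1
  have hpi : (Real.pi : ℂ) ≠ 0 := by exact_mod_cast Real.pi_ne_zero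
  rw [Torus.coeff_der, Torus.coeff_add, Torus.coeff_smul, Torus.coeff_smul]
  simp only [gabor, Torus.coeff_mk]
  rw [mul_assoc, h1]
  field_simp

end gabor

lemma affS_mulX (a : ℝˣ) (f : 𝓢(ℝ, ℂ)) : affS a 0 (mulX f) = (a : ℂ) • mulX (affS a 0 f) := by
  ext x
  simp
  ring

lemma derX_affS (a : ℝˣ) (b : ℝ) (f : 𝓢(ℝ, ℂ)) :
    derX (affS a b f) = (a : ℂ) • affS a b (derX f) := by
  ext x
  have e1 : HasDerivAt (fun x : ℝ => (a : ℝ) * x + b) a x := by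
    simpa using ((hasDerivAt_id x).const_mul (a : ℝ)).add_const b
  have e2 := ((f.hasDerivAt (a * x + b)).scomp x e1).deriv
  rw [derX_apply, smul_apply, affS_apply, derX_apply, smul_eq_mul]
  have e3 : (affS a b f : ℝ → ℂ) = (f : ℝ → ℂ) ∘ fun x : ℝ => (a : ℝ) * x + b := by
    funext x; simp
  rw [e3, e2, real_smul]

/-! ### The product of `E_{s,1}` with `bimodS`, a free module -/

section DualProduct

variable {s : ℤ} {θ : ℝ} (h : (s : ℝ) - θ ≠ 0)

/-- The product `T_{-1/(s-θ)} × S(ℝ) → E_{s,1}`. It is expressed through a left action, of the torus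
with the reflected index `p`, which provides the Schwartz property. -/
def dualQ (g : 𝓢(ℝ, ℂ)) (b : Torus (-(1 / (s - θ)))) : HSpace 1 :=
  leftAct 0 (-(1 / (s - θ))) (Torus.mk (fun k => b.coeff (-k.1, k.2)) (flip_mem b.coeff_mem))
    (ofS (affS (scaleU h) 0 g))

lemma dualQ_apply (g : 𝓢(ℝ, ℂ)) (b : Torus (-(1 / (s - θ)))) (j : ZMod (1 : ℤ).natAbs) (x : ℝ) :
    dualQ h g b j x
      = ∑' k : ℤ, b.symb k (-(1 / (s - θ)) * (x + k)) * g (-(1 / (s - θ)) * (x + k)) := by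
  rw [dualQ, leftAct_symb, ← (Equiv.neg ℤ).tsum_eq]
  refine tsum_congr fun k => ?_
  rw [Equiv.neg_apply, ofS_apply, affS_apply, coe_scaleU, add_zero]
  have e : x - ((-k : ℤ) : ℝ) = x + k := by push_cast; ring
  rw [e, Int.cast_zero, sub_zero]
  congr 1
  unfold Torus.symb
  refine tsum_congr fun q => ?_
  rw [Torus.coeff_mk, neg_neg]

/-- The product `E_{s,1} × E_{0,1} → T_{-1/(s-θ)}`, a rescaled pairing. -/
def dualP (φ ψ : HSpace 1) : Torus (-(1 / (s - θ))) :=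
  pairR h (affS (scaleU h)⁻¹ 0 (φ 0)) (ψ 0)

lemma coe_scaleU_inv : ((scaleU h)⁻¹ : ℝˣ) = (-(s - θ) : ℝ) := by
  rw [Units.val_inv_eq_inv_val, coe_scaleU, one_div, ← neg_inv, inv_inv]

/-- Both sides are the double sum over `p, k` of `g(Y_k) ψ(Y_k + p) φ(x + p(θ - s))` with `Y_k = -(x
+ k)/(s-θ)`. -/
lemma dualQ_dualP (φ ψ : HSpace 1) (g : 𝓢(ℝ, ℂ)) :
    dualQ h g (dualP h φ ψ) = heisAct s 1 θ (pairL h (ψ 0) g) φ := by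
  obtain ⟨K, hK⟩ := HSpace_bounded 1 φ
  funext j
  ext x
  set Y : ℤ → ℝ := fun k => -(1 / (s - θ)) * (x + k) with hY
  set F : ℤ → ℤ → ℂ := fun p k => g (Y k) * ψ 0 (Y k + p) * φ 0 (x + p * (θ - s)) with hF
  have hs : Summable fun y : ℤ × ℤ => F y.1 y.2 := by
    refine (summable_gabor_mul (sub_swap_ne h) (affS (scaleU h) 0 g) (affS (scaleU h) 0 (ψ 0))
      x (F := fun y : ℤ × ℤ => φ 0 (x + y.1 * (θ - s))) (K := K) (fun y => hK (0, _))).congr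
      fun y => ?_
    rw [affS_apply, affS_apply, coe_scaleU, hF, hY]
    congr 3
    · ring
    · field_simp
      ring
  have hL : dualQ h g (dualP h φ ψ) j x = ∑' k : ℤ, ∑' p : ℤ, F p k := by
    rw [dualQ_apply]
    refine tsum_congr fun k => ?_
    rw [dualP, pairR_symb, ← tsum_mul_right]
    refine tsum_congr fun p => ?_
    rw [affS_apply, coe_scaleU_inv]
    have e1 : -((s : ℝ) - θ) * (Y k + p + k * (1 / (s - θ))) + 0 = x + p * (θ - s) := by
      rw [hY]; field_simp; ring
    change ψ 0 (Y k + p) * φ 0 (-((s : ℝ) - θ) * (Y k + p + k * (1 / (s - θ))) + 0) * g (Y k) = _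
    rw [e1, hF]
    ring
  rw [hL, heisAct_symb s 1 θ _ φ (l := 0) (Subsingleton.elim _ _)]
  refine (Summable.tsum_comm (f := F) hs).trans ?_
  refine tsum_congr fun p => ?_
  rw [tsum_mul_right, pairL_symb, Subsingleton.elim (j - (p : ZMod (1 : ℤ).natAbs)) 0]
  simp [hY]

/-- The product `dualQ` is the adjoint of the right action with respect to the left pairing. -/
lemma pairL_heisAct (b : Torus (-(1 / (s - θ)))) (f : HSpace 1) (g : 𝓢(ℝ, ℂ)) :
    pairL h (heisAct 0 1 (1 / (s - θ)) b f 0) g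
      = pairL h (f 0) (affS (scaleU h)⁻¹ 0 (dualQ h g b 0)) := by
  refine Torus.ext_symb fun p z => ?_
  obtain ⟨K, hK0, hK⟩ := schwartz_bounded (f 0)
  set w : ℤ → ℝ := fun k => -(1 / (s - θ)) * (z + k) with hw
  set F : ℤ → ℤ → ℂ := fun k l => g (w k) * b.symb l (w k) * f 0 (w k + p + l * (1 / (s - θ)))
    with hF
  have hs : Summable fun y : ℤ × ℤ => F y.1 y.2 := by
    have h1 : Summable fun k : ℤ => ‖g (w k)‖ := by
      refine (schwartz_lattice_summable g (u := -(1 / (s - θ)))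
        (neg_ne_zero.2 (one_div_ne_zero h)) (-(1 / (s - θ)) * z)).congr fun k => ?_
      rw [hw]; congr 2; ring
    have h2 : Summable fun l : ℤ => ∑' q : ℤ, ‖b.coeff (l, q)‖ := b.norm_summable.prod
    refine Summable.of_norm_bounded
      ((h1.mul_of_nonneg h2 (fun _ => norm_nonneg _)
        (fun _ => tsum_nonneg fun _ => norm_nonneg _)).mul_right K) fun y => ?_
    rw [hF, norm_mul, norm_mul]
    gcongr
    · exact norm_symb_le _ _ _
    · exact hK _
  have hL : (pairL h (heisAct 0 1 (1 / (s - θ)) b f 0) g).symb p z = ∑' k : ℤ, ∑' l : ℤ, F k l := by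
    rw [pairL_symb]
    refine tsum_congr fun k => ?_
    rw [heisAct_zero_one_symb, ← tsum_mul_left]
    refine tsum_congr fun l => ?_
    rw [symb_add_int]
    exact (mul_assoc _ _ _).symm
  -- the two double sums differ by the shear `k ↦ k + l` of the indices
  have hR : (pairL h (f 0) (affS (scaleU h)⁻¹ 0 (dualQ h g b 0))).symb p z
      = ∑' k : ℤ, ∑' l : ℤ, F (k + l) l := by
    rw [pairL_symb]
    refine tsum_congr fun k => ?_
    rw [affS_apply, coe_scaleU_inv, dualQ_apply, ← tsum_mul_right]
    refine tsum_congr fun l => ?_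
    have e1 : -(1 / ((s : ℝ) - θ)) * (-(s - θ) * (-(1 / (s - θ)) * (z + k)) + 0 + l)
        = w (k + l) := by
      rw [hw]; push_cast; field_simp; ring
    have e2 : -(1 / ((s : ℝ) - θ)) * (z + k) + p = w (k + l) + p + l * (1 / (s - θ)) := by
      rw [hw]; push_cast; ring
    rw [e1, e2, hF]
    ring
  rw [hL, hR]
  exact (tsum_shear hs).symm

lemma dualQ_add (g : 𝓢(ℝ, ℂ)) (b b' : Torus (-(1 / (s - θ)))) :
    dualQ h g (b + b') = dualQ h g b + dualQ h g b' := by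
  rw [dualQ, dualQ, dualQ, ← leftAct_add_left]
  rfl

lemma dualQ_smul (g : 𝓢(ℝ, ℂ)) (c : ℂ) (b : Torus (-(1 / (s - θ)))) :
    dualQ h g (c • b) = c • dualQ h g b := by
  rw [dualQ, dualQ, ← leftAct_smul_left]
  rfl

/-- Since the right action is faithful, the identity can be tested on Schwartz functions, where it
follows from the associativity of the pairings. -/
lemma dualP_dualQ (b : Torus (-(1 / (s - θ)))) (g : 𝓢(ℝ, ℂ)) (ψ : HSpace 1) :
    dualP h (dualQ h g b) ψ = b * pairR h g (ψ 0) := by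
  refine heisAct_faithful h fun f => ?_
  rw [heisAct_mul, dualP, ← leftAct_pairL', ← leftAct_pairL', pairL_heisAct]

lemma dualP_heisD (μ : Fin 2) (φ ψ : HSpace 1) :
    Torus.der μ (dualP h φ ψ) = ((θ : ℂ) - s) • dualP h (heisD s 1 θ μ φ) ψ
      + dualP h φ (heisD 0 1 (1 / (s - θ)) μ ψ) := by
  have h' : (s : ℂ) - θ ≠ 0 := by exact_mod_cast h
  have hpi : (Real.pi : ℂ) ≠ 0 := by exact_mod_cast Real.pi_ne_zero
  fin_cases μ
  · simp only [Fin.zero_eta, dualP, pairR, heisD_zero_apply, map_smul, affS_mulX,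
      gabor_smul_left, gabor_smul_right, der_zero_gabor, smul_smul, coe_scaleU_inv]
    congr 2
    · push_cast
      field_simp
      ring
    · push_cast
      field_simp
      ring
  · have e : affS (scaleU h)⁻¹ 0 (derX (φ 0))
        = (-(s - θ : ℂ))⁻¹ • derX (affS (scaleU h)⁻¹ 0 (φ 0)) := by
      rw [derX_affS, coe_scaleU_inv, smul_smul]
      push_cast
      rw [inv_mul_cancel₀ (neg_ne_zero.2 h'), one_smul]
    simp only [Fin.mk_one, dualP, pairR, heisD_one_apply, map_smul, e,
      gabor_smul_left, gabor_smul_right, der_one_gabor, smul_smul]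
    rw [add_comm]
    congr 2
    field_simp
    ring

/-- The tensor product of `E_{s,1}` with `bimodS` is free of rank one. -/
lemma schwartzModule_tensor_bimodS_free (h0 : (s : ℝ) - (1 : ℤ) * θ ≠ 0) :
    ((schwartzModule s 1 θ h0).tensor (bimodS s θ h)).Iso (freeModule 1 (1 / (s - θ))) := by
  let P : HSpace 1 →ₗ[ℂ] HSpace 1 →ₗ[ℂ] (Fin 1 → Torus (-(1 / (s - θ)))) :=
    LinearMap.mk₂ ℂ (fun φ ψ _ => dualP h φ ψ)
      (fun φ φ' ψ => funext fun _ => by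
        simp only [dualP, pairR, Pi.add_apply, map_add, gabor_add_right])
      (fun k φ ψ => funext fun _ => by
        simp only [dualP, pairR, Pi.smul_apply, map_smul, gabor_smul_right])
      (fun φ ψ ψ' => funext fun _ => by
        simp only [dualP, pairR, Pi.add_apply, gabor_add_left])
      (fun k φ ψ => funext fun _ => by
        simp only [dualP, pairR, Pi.smul_apply, gabor_smul_left])
  let Q : 𝓢(ℝ, ℂ) → (Fin 1 → Torus (-(1 / (s - θ)))) →ₗ[ℂ] HSpace 1 := fun g =>
    { toFun := fun b => dualQ h g (b 0)
      map_add' := fun b b' => dualQ_add h g _ _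
      map_smul' := fun k b => dualQ_smul h g k _ }
  refine tensor_bimodS_iso h (schwartzModule s 1 θ h0) (freeModule 1 (1 / (s - θ))) P Q
    (fun φ ψ g => dualQ_dualP h φ ψ g) (fun b g ψ => funext fun i => ?_)
    (fun μ φ ψ => funext fun _ => dualP_heisD h μ φ ψ)
  rw [Subsingleton.elim i 0]
  exact dualP_dualQ h (b 0) g ψ

end DualProduct

/-! ### Isomorphisms of modules with connection -/

namespace TorusModule

variable {θ θ' : ℝ}

lemma Iso.refl (M : TorusModule θ) : M.Iso M :=
  ⟨LinearEquiv.refl ℂ _, fun _ _ => rfl, fun _ _ => rfl⟩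

lemma Iso.symm {M N : TorusModule θ} (h : M.Iso N) : N.Iso M := by
  obtain ⟨e, h1, h2⟩ := h
  refine ⟨e.symm, fun a φ => ?_, fun μ φ => ?_⟩
  · rw [LinearEquiv.symm_apply_eq, h1, LinearEquiv.apply_symm_apply]
  · rw [LinearEquiv.symm_apply_eq, h2, LinearEquiv.apply_symm_apply]

lemma Iso.trans {M N K : TorusModule θ} (h : M.Iso N) (h' : N.Iso K) : M.Iso K := by
  obtain ⟨e, h1, h2⟩ := h
  obtain ⟨e', h1', h2'⟩ := h'
  exact ⟨e.trans e', fun a φ => by simp only [LinearEquiv.trans_apply, h1, h1'],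
    fun μ φ => by simp only [LinearEquiv.trans_apply, h2, h2']⟩

/-- Tensoring with a bimodule respects isomorphism of modules with connection. -/
lemma Iso.tensor {M N : TorusModule θ} (h : M.Iso N) (B : TorusBimodule θ θ') :
    (M.tensor B).Iso (N.tensor B) := by
  obtain ⟨e, h1, h2⟩ := h
  have h1' : ∀ (a : Torus (-θ)) ν, e.symm (op a • ν) = op a • e.symm ν := fun a ν => by
    rw [LinearEquiv.symm_apply_eq, h1, LinearEquiv.apply_symm_apply]
  let P : M.carrier →ₗ[ℂ] B.carrier →ₗ[ℂ] (N.tensor B).carrier :=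
    (TensorProduct.mk ℂ N.carrier B.carrier).compr₂ (balMk N B) ∘ₗ e.toLinearMap
  have hP : ∀ φ ψ, P φ ψ = balMk N B (e φ ⊗ₜ ψ) := fun _ _ => rfl
  -- the inverse descends `e⁻¹ ⊗ 1` to the balanced tensor product
  let G : BalTensor N B →ₗ[ℂ] BalTensor M B :=
    (balance N B).liftQ ((balMk M B).comp (e.symm.toLinearMap.rTensor B.carrier)) (by
      unfold balance
      rw [Submodule.span_le]
      rintro _ ⟨φ, a, ψ, rfl⟩
      change balMk M B (e.symm.toLinearMap.rTensor B.carrier _) = 0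
      rw [map_sub, map_sub, LinearMap.rTensor_tmul, LinearMap.rTensor_tmul,
        LinearEquiv.coe_coe, h1', balMk_smul_tmul, sub_self])
  have hG : ∀ t, G (balMk N B t) = balMk M B (e.symm.toLinearMap.rTensor B.carrier t) :=
    fun t => rfl
  refine tensor_iso_of_bilinear M B (N.tensor B) P (fun φ a ψ => ?_) (fun φ ψ b => ?_)
    (fun μ φ ψ => ?_) G (fun φ ψ => ?_) fun ν => ?_
  · rw [hP, hP, h1, balMk_smul_tmul]
  · rw [hP, hP]; rfl
  · simp only [hP, h2]
    change balMk N B (tensorD N B μ _) = _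
    rw [tensorD_tmul, map_add, map_sum]
    simp only [map_smul]
    rfl
  · refine (hG (e φ ⊗ₜ ψ)).trans ?_
    rw [LinearMap.rTensor_tmul, LinearEquiv.coe_coe, LinearEquiv.symm_apply_apply]
  · obtain ⟨t, rfl⟩ := balMk_surjective N B ν
    refine ⟨e.symm.toLinearMap.rTensor B.carrier t, ?_⟩
    induction t with
    | zero => simp only [map_zero]; rfl
    | tmul φ ψ =>
      rw [LinearMap.rTensor_tmul, TensorProduct.lift.tmul, hP, LinearEquiv.coe_coe,
        LinearEquiv.apply_symm_apply]
    | add t t' ht ht' => rw [map_add, map_add, ht, ht', map_add]; rfl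

instance (M : TorusModule θ) : SMulCommClass ℂ (Torus (-θ))ᵐᵒᵖ M.carrier :=
  IsScalarTower.to_smulCommClass

lemma op_smul_smul (M : TorusModule θ) (c : ℂ) (a : Torus (-θ)) (φ : M.carrier) :
    op (c • a) • φ = c • op a • φ := by
  rw [op_smul, smul_assoc]

/-- Restriction of a module with connection along an algebra homomorphism which intertwines the
derivations up to a diagonal matrix. -/
def restrict (M : TorusModule θ) (ι : Torus (-θ') →ₐ[ℂ] Torus (-θ)) (ε : Fin 2 → ℂ)
    (hι : ∀ μ b, ε μ • Torus.der μ (ι b) = ι (Torus.der μ b)) : TorusModule θ' :=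
  letI : Module (Torus (-θ'))ᵐᵒᵖ M.carrier := Module.compHom _ ι.toRingHom.op
  { carrier := M.carrier
    tower := ⟨fun c b φ => by
      change op (ι (c • b.unop)) • φ = c • op (ι b.unop) • φ
      rw [map_smul, op_smul_smul]⟩
    D := fun μ => ε μ • M.D μ
    leibniz := fun μ φ b => by
      change ε μ • M.D μ (op (ι b) • φ) = op (ι b) • ε μ • M.D μ φ + op (ι (Torus.der μ b)) • φ
      rw [M.leibniz, smul_add, ← hι, op_smul_smul, smul_comm] }

/-- Tensoring with the bimodule of a homomorphism is restriction along that homomorphism. -/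
lemma tensor_bimodOfHom (M : TorusModule θ) (ι : Torus (-θ') →ₐ[ℂ] Torus (-θ)) (ε : Fin 2 → ℂ)
    (hι : ∀ μ b, ε μ • Torus.der μ (ι b) = ι (Torus.der μ b)) :
    (M.tensor (bimodOfHom ι ε hι)).Iso (M.restrict ι ε hι) := by
  -- the isomorphism is `φ ⊗ e ↦ φ e`, with inverse `φ ↦ φ ⊗ 1`
  let P : M.carrier →ₗ[ℂ] Torus (-θ) →ₗ[ℂ] M.carrier := LinearMap.mk₂ ℂ (fun φ e => op e • φ)
    (fun φ φ' e => smul_add _ _ _) (fun c φ e => smul_comm _ _ _)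
    (fun φ e e' => by rw [op_add, add_smul]) (fun c φ e => op_smul_smul M c e φ)
  let G : M.carrier →ₗ[ℂ] BalTensor M (bimodOfHom ι ε hι) :=
    (balMk M (bimodOfHom ι ε hι)).comp
      ((TensorProduct.mk ℂ M.carrier (Torus (-θ))).flip 1)
  refine tensor_iso_of_bilinear M (bimodOfHom ι ε hι) (M.restrict ι ε hι) P (fun φ a e => ?_)
    (fun φ e b => ?_) (fun μ φ e => ?_) G (fun φ e => ?_)
    fun (φ : M.carrier) => ⟨φ ⊗ₜ (1 : Torus (-θ)), ?_⟩
  · have key : ∀ e : Torus (-θ), op e • op a • φ = op (a * e) • φ := fun e => by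
      rw [op_mul, mul_smul]
    exact key e
  · have key : ∀ e : Torus (-θ), op (e * ι b) • φ = op (ι b) • op e • φ := fun e => by
      rw [op_mul, mul_smul]
    exact key e
  · have key : ∀ e : Torus (-θ), ε μ • M.D μ (op e • φ) = (∑ ν, Matrix.diagonal ε μ ν •
        (op e • M.D ν φ)) + op (ε μ • Torus.der μ e) • φ := fun e => by
      rw [Finset.sum_eq_single μ, Matrix.diagonal_apply_eq, M.leibniz, smul_add, op_smul_smul]
      · intro ν _ hν; rw [Matrix.diagonal_apply_ne _ (Ne.symm hν), zero_smul]
      · simp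
    exact key e
  · refine (balMk_smul_tmul M (bimodOfHom ι ε hι) φ e (1 : Torus (-θ))).trans ?_
    congr 2
    exact mul_one (M := Torus (-θ)) e
  · have key : op (1 : Torus (-θ)) • φ = φ := by rw [op_one, one_smul]
    exact key

end TorusModule

/-- The free module of rank one is a unit for the tensor product. -/
lemma freeModule_tensor {θ θ' : ℝ} (B : TorusBimodule θ θ') :
    ((freeModule 1 θ).tensor B).Iso B.toRight := by
  have : SMulCommClass ℂ (Torus (-θ)) B.carrier := IsScalarTower.to_smulCommClass
  -- the isomorphism is the left action `a ⊗ ψ ↦ aψ`, with inverse `ψ ↦ 1 ⊗ ψ`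
  let P : (Fin 1 → Torus (-θ)) →ₗ[ℂ] B.carrier →ₗ[ℂ] B.carrier :=
    LinearMap.mk₂ ℂ (fun a ψ => a 0 • ψ) (fun a a' ψ => add_smul _ _ _)
      (fun c a ψ => smul_assoc c (a 0) ψ) (fun a ψ ψ' => smul_add _ _ _) (fun c a ψ => smul_comm _ _ _)
  let u : Fin 1 → Torus (-θ) := fun _ => 1
  let G : B.carrier →ₗ[ℂ] BalTensor (freeModule 1 θ) B :=
    (balMk (freeModule 1 θ) B).comp (TensorProduct.mk ℂ (Fin 1 → Torus (-θ)) B.carrier u)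
  refine tensor_iso_of_bilinear (freeModule 1 θ) B B.toRight P (fun φ a ψ => ?_)
    (fun φ ψ b => ?_) (fun μ φ ψ => ?_) G (fun φ ψ => ?_) fun (ψ : B.carrier) => ⟨u ⊗ₜ ψ, ?_⟩
  · exact mul_smul ((φ : Fin 1 → Torus (-θ)) 0) a ψ
  · exact smul_comm ((φ : Fin 1 → Torus (-θ)) 0) (op b) ψ
  · exact B.leibniz_left μ ((φ : Fin 1 → Torus (-θ)) 0) ψ
  · refine (balMk_smul_tmul (freeModule 1 θ) B u ((φ : Fin 1 → Torus (-θ)) 0) ψ).symm.trans ?_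
    congr 2
    funext i
    rw [Subsingleton.elim i 0]
    exact one_mul _
  · exact one_smul (Torus (-θ)) ψ

/-- Along an isomorphism of tori, free modules correspond to free modules of the same rank. -/
lemma freeModule_restrict {θ θ' : ℝ} (N : ℕ) (ι : Torus (-θ') →ₐ[ℂ] Torus (-θ)) (ε : Fin 2 → ℂ)
    (hι : ∀ μ b, ε μ • Torus.der μ (ι b) = ι (Torus.der μ b)) (hb : Function.Bijective ι) :
    ((freeModule N θ).restrict ι ε hι).Iso (freeModule N θ') := by
  let e : Torus (-θ') ≃ₗ[ℂ] Torus (-θ) := LinearEquiv.ofBijective ι.toLinearMap hb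
  have he : ∀ b, e b = ι b := fun b => rfl
  refine TorusModule.Iso.symm ⟨LinearEquiv.piCongrRight fun _ : Fin N => e, fun b φ => ?_,
    fun μ φ => ?_⟩
  · funext i
    exact map_mul ι ((φ : Fin N → Torus (-θ')) i) b
  · funext i
    exact (hι μ ((φ : Fin N → Torus (-θ')) i)).symm

/-! ### The bimodules of isomorphisms of tori -/

/-- The bimodule of an isomorphism of algebras is a complete Morita equivalence bimodule. -/
lemma bimodOfHom_isCompleteMorita {θ θ' : ℝ} (ι : Torus (-θ') →ₐ[ℂ] Torus (-θ)) (ε : Fin 2 → ℂ)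
    (hι : ∀ μ b, ε μ • Torus.der μ (ι b) = ι (Torus.der μ b)) (hb : Function.Bijective ι)
    (hε : ∀ μ, ε μ ≠ 0) : (bimodOfHom ι ε hι).IsCompleteMorita := by
  let A := Torus (-θ)
  let B := Torus (-θ')
  let E := (bimodOfHom ι ε hι).carrier
  let e0 : B ≃ₗ[ℂ] A := LinearEquiv.ofBijective ι.toLinearMap hb
  have he0 : ∀ b, e0 b = ι b := fun b => rfl
  have he0' : ∀ a, ι (e0.symm a) = a := fun a => e0.apply_symm_apply a
  have hmul : ∀ (a : A) (b : B), e0.symm (a * ι b) = e0.symm a * b := fun a b => by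
    rw [LinearEquiv.symm_apply_eq, he0, map_mul, he0']
  -- as a right module the bimodule is free of rank one
  let e : Bᵐᵒᵖ ≃ₗ[Bᵐᵒᵖ] E :=
    { toFun := fun b => ι b.unop
      invFun := fun a => op (e0.symm a)
      map_add' := fun b b' => map_add ι b.unop b'.unop
      map_smul' := fun b b' => map_mul ι b'.unop b.unop
      left_inv := fun b => congrArg op (e0.symm_apply_apply b.unop)
      right_inv := fun a => he0' a }
  refine ⟨Module.Finite.equiv e, Module.Projective.of_equiv e, ⟨1, ?_, ?_⟩, ?_, ⟨0, ?_⟩, ?_⟩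
  · exact
      { toFun := fun a => e0.symm (a 0)
        map_add' := fun a a' => map_add e0.symm (a 0 : A) (a' 0 : A)
        map_smul' := fun b a => hmul (a 0 : A) b.unop }
  · intro b
    exact ⟨fun _ => ι b, e0.symm_apply_apply b⟩
  · -- an endomorphism is left multiplication by its value at `1`
    intro F
    refine ⟨F (1 : A), fun ψ => ?_, fun a ha => ?_⟩
    · have h1 : ∀ ψ : A, ψ = (1 : A) * ι (e0.symm ψ) := fun ψ => by rw [one_mul, he0']
      have h2 : F ψ = F ((1 : A) * ι (e0.symm ψ) : A) := congrArg F (h1 ψ)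
      have h3 : F ((1 : A) * ι (e0.symm ψ) : A) = (show A from F (1 : A)) * ι (e0.symm ψ) :=
        F.map_smul (op (e0.symm ψ)) (show E from (1 : A))
      refine (h2.trans h3).trans ?_
      exact congrArg (fun x : A => (show A from F (1 : A)) * x) (he0' ψ)
    · exact (mul_one a).symm.trans (ha (1 : A)).symm
  · intro ψ
    have key : ∀ ψ : A, I • ((ε 0 • Torus.der 0 (ε 1 • Torus.der 1 ψ))
        - ε 1 • Torus.der 1 (ε 0 • Torus.der 0 ψ)) = (0 : ℂ) • ψ := fun ψ => by
      ext k
      simp only [map_smul, Torus.coeff_smul, sub_eq_add_neg, Torus.coeff_add, Torus.coeff_neg,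
        Torus.coeff_der, zero_smul, Torus.coeff_zero]
      ring
    exact key ψ
  · change IsUnit (Matrix.diagonal ε).det
    rw [Matrix.det_diagonal, isUnit_iff_ne_zero]
    exact Finset.prod_ne_zero_iff.2 fun μ _ => hε μ

lemma shiftHom_bijective (θ : ℝ) : Function.Bijective (shiftHom θ) :=
  ⟨fun a b h => by
    ext g
    exact congrArg (fun x : Torus (-θ) => x.coeff g) h,
  fun a => ⟨Torus.mk a.coeff a.coeff_mem, rfl⟩⟩

lemma flipHom_bijective (θ : ℝ) : Function.Bijective (flipHom θ) :=
  ⟨fun a b h => by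
    ext g
    have := congrArg (fun x : Torus (-θ) => x.coeff (-g.1, g.2)) h
    change a.coeff (- -g.1, g.2) = b.coeff (- -g.1, g.2) at this
    simpa only [neg_neg] using this,
  fun a => ⟨Torus.mk _ (flip_mem a.coeff_mem), by
    ext g
    change a.coeff (- -g.1, g.2) = _
    rw [neg_neg]⟩⟩

lemma shiftHom_symb (θ : ℝ) (a : Torus (-(θ + 1))) (p : ℤ) (z : ℝ) :
    (shiftHom θ a).symb p z = a.symb p z := rfl

lemma flipHom_symb (θ : ℝ) (a : Torus (-(-θ))) (p : ℤ) (z : ℝ) :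
    (flipHom θ a).symb p z = a.symb (-p) z := rfl

theorem bimodT_isCompleteMorita (θ : ℝ) : (bimodT θ).IsCompleteMorita :=
  bimodOfHom_isCompleteMorita _ _ _ (shiftHom_bijective θ) fun _ => one_ne_zero

theorem bimodR_isCompleteMorita (θ : ℝ) : (bimodR θ).IsCompleteMorita :=
  bimodOfHom_isCompleteMorita _ _ _ (flipHom_bijective θ) fun μ => by
    fin_cases μ <;> simp

/-! ### The tensor products of Heisenberg modules with the equivalence bimodules -/

lemma heis_congr {n m n' m' : ℤ} {θ : ℝ} (hn : n = n') (hm : m = m') (h : (n : ℝ) - m * θ ≠ 0)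
    (h' : (n' : ℝ) - m' * θ ≠ 0) : (heis n m θ h).Iso (heis n' m' θ h') := by
  subst hn hm
  exact TorusModule.Iso.refl _

lemma heis_of_ne (n m : ℤ) (θ : ℝ) (h : (n : ℝ) - m * θ ≠ 0) [hm : NeZero m.natAbs] :
    heis n m θ h = schwartzModule n m θ h :=
  dif_neg (Int.natAbs_ne_zero.1 hm.out)

lemma heis_zero (n : ℤ) (θ : ℝ) (h : (n : ℝ) - (0 : ℤ) * θ ≠ 0) :
    heis n 0 θ h = freeModule n.natAbs θ := dif_pos rfl

/-- `E_{-n,-m}` and `E_{n,m}` are the same module. -/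
lemma heis_neg (n m : ℤ) (θ : ℝ) (h : (n : ℝ) - m * θ ≠ 0)
    (h' : ((-n : ℤ) : ℝ) - (-m : ℤ) * θ ≠ 0) : (heis n m θ h).Iso (heis (-n) (-m) θ h') := by
  by_cases hm : m = 0
  · subst hm
    refine TorusModule.Iso.trans ?_ (heis_congr rfl (neg_zero (G := ℤ)).symm (by simpa using h') h')
    rw [heis_zero, heis_zero, Int.natAbs_neg]
    exact TorusModule.Iso.refl _
  have : NeZero m.natAbs := ⟨Int.natAbs_ne_zero.2 hm⟩
  have : NeZero (-m).natAbs := ⟨Int.natAbs_ne_zero.2 (neg_ne_zero.2 hm)⟩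
  rw [heis_of_ne, heis_of_ne]
  -- the index sets agree, and the formulas depend on `n` and `m` through `n/m` and the curvature
  let σ : ZMod (-m).natAbs ≃+* ZMod m.natAbs := ZMod.ringEquivCongr (Int.natAbs_neg m)
  refine ⟨LinearEquiv.funCongrLeft ℂ 𝓢(ℝ, ℂ) σ.toEquiv, fun a φ => ?_, fun μ φ => ?_⟩
  · change (fun j => heisAct n m θ a φ (σ j)) = heisAct (-n) (-m) θ a (fun j => φ (σ j))
    funext j
    ext x
    obtain ⟨l, rfl⟩ := ZMod.intCast_surjective j
    rw [heisAct_symb n m θ a φ (l := l) (by rw [map_intCast]), heisAct_symb (-n) (-m) θ a _ rfl]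
    refine tsum_congr fun p => ?_
    rw [map_sub, map_intCast, map_intCast]
    push_cast
    rw [neg_div_neg_eq, mul_neg, neg_div_neg_eq]
  · change (fun j => heisD n m θ μ φ (σ j)) = heisD (-n) (-m) θ μ (fun j => φ (σ j))
    have e : (I * (-m : ℤ) / ((-n : ℤ) - (-m : ℤ) * θ) : ℂ) = I * m / (n - m * θ) := by
      push_cast
      rw [mul_neg, ← neg_div_neg_eq, neg_neg]
      congr 1
      ring
    funext j
    fin_cases μ
    · exact congrArg (fun c : ℂ => c • mulX (φ (σ j))) e.symm
    · rfl

/-- Both modules live on the same space; the actions agree because symbols are `1`-periodic and `(n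
+ m)/m` differs from `n/m` by an integer. -/
lemma heis_tensor_bimodT (n m : ℤ) (θ : ℝ) (h : (n : ℝ) - m * θ ≠ 0) :
    ∃ h', ((heis n m θ h).tensor (bimodT θ)).Iso (heis (n + m) m (θ + 1) h') := by
  have h' : ((n + m : ℤ) : ℝ) - m * (θ + 1) ≠ 0 := by
    intro h0; apply h; push_cast at h0; linear_combination h0
  refine ⟨h', (TorusModule.tensor_bimodOfHom _ _ _ _).trans ?_⟩
  by_cases hm : m = 0
  · subst hm
    refine TorusModule.Iso.trans ?_
      (heis_congr (add_zero n).symm rfl (by simpa using h') h')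
    rw [heis_zero, heis_zero]
    exact freeModule_restrict _ _ _ _ (shiftHom_bijective θ)
  have : NeZero m.natAbs := ⟨Int.natAbs_ne_zero.2 hm⟩
  have hm' := cast_ne_zero_of_natAbs m
  rw [heis_of_ne, heis_of_ne]
  refine ⟨LinearEquiv.refl ℂ (HSpace m), fun a φ => ?_, fun μ φ => ?_⟩
  · change heisAct n m θ (shiftHom θ a) φ = heisAct (n + m) m (θ + 1) a φ
    funext j
    ext x
    obtain ⟨l, rfl⟩ := ZMod.intCast_surjective j
    rw [heisAct_symb n m θ _ φ rfl, heisAct_symb (n + m) m (θ + 1) a φ rfl]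
    refine tsum_congr fun p => ?_
    have e1 : x - l * ((n + m : ℤ) : ℝ) / m = x - l * n / m + (-l : ℤ) := by
      push_cast; field_simp; ring
    have e2 : θ + 1 - ((n + m : ℤ) : ℝ) / m = θ - n / m := by push_cast; field_simp; ring
    rw [e1, e2, symb_add_int, shiftHom_symb]
  · change (1 : Fin 2 → ℂ) μ • heisD n m θ μ φ = heisD (n + m) m (θ + 1) μ φ
    rw [Pi.one_apply, one_smul]
    have e : (I * m / ((n + m : ℤ) - m * (θ + 1 : ℝ)) : ℂ) = I * m / (n - m * θ) := by
      congr 1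
      push_cast
      ring
    funext j
    fin_cases μ
    · exact congrArg (fun c : ℂ => c • mulX (φ j)) e.symm
    · rfl

/-- The reflection of the discrete variable identifies the restriction of `E_{n,m}` along `U_1 ↦
U_1⁻¹` with `E_{-n,m}`, which is `E_{n,-m}`. -/
lemma heis_tensor_bimodR (n m : ℤ) (θ : ℝ) (h : (n : ℝ) - m * θ ≠ 0) :
    ∃ h', ((heis n m θ h).tensor (bimodR θ)).Iso (heis n (-m) (-θ) h') := by
  have h' : (n : ℝ) - (-m : ℤ) * (-θ) ≠ 0 := by
    intro h0; apply h; push_cast at h0; linear_combination h0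
  refine ⟨h', (TorusModule.tensor_bimodOfHom _ _ _ _).trans ?_⟩
  by_cases hm : m = 0
  · subst hm
    refine TorusModule.Iso.trans ?_
      (heis_congr rfl (neg_zero (G := ℤ)).symm (by simpa using h') h')
    rw [heis_zero, heis_zero]
    exact freeModule_restrict _ _ _ _ (flipHom_bijective θ)
  have h'' : ((-n : ℤ) : ℝ) - m * (-θ) ≠ 0 := by
    intro h0; apply h; push_cast at h0; linear_combination -h0
  have h3 : ((-(-n) : ℤ) : ℝ) - (-m : ℤ) * (-θ) ≠ 0 := by rwa [neg_neg]
  refine TorusModule.Iso.trans ?_ ((heis_neg (-n) m (-θ) h'' h3).trans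
    (heis_congr (neg_neg n) rfl h3 h'))
  have : NeZero m.natAbs := ⟨Int.natAbs_ne_zero.2 hm⟩
  have hm' := cast_ne_zero_of_natAbs m
  rw [heis_of_ne, heis_of_ne]
  refine ⟨LinearEquiv.funCongrLeft ℂ 𝓢(ℝ, ℂ) (Equiv.neg (ZMod m.natAbs)), fun a φ => ?_,
    fun μ φ => ?_⟩
  · change (fun j => heisAct n m θ (flipHom θ a) φ (-j))
      = heisAct (-n) m (-θ) a (fun j => φ (-j))
    funext j
    ext x
    obtain ⟨l, rfl⟩ := ZMod.intCast_surjective j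
    rw [heisAct_symb n m θ _ φ (l := -l) (by push_cast; rfl), heisAct_symb (-n) m (-θ) a _ rfl,
      ← (Equiv.neg ℤ).tsum_eq]
    refine tsum_congr fun p => ?_
    rw [Equiv.neg_apply, flipHom_symb]
    have e1 : x - ((-l : ℤ) : ℝ) * n / m = x - l * ((-n : ℤ) : ℝ) / m := by push_cast; ring
    have e2 : x + ((-p : ℤ) : ℝ) * (θ - n / m) = x + p * (-θ - ((-n : ℤ) : ℝ) / m) := by
      push_cast; ring
    have e3 : -(l : ZMod m.natAbs) - ((-p : ℤ) : ZMod m.natAbs) = -((l : ZMod m.natAbs) - p) := by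
      push_cast; ring
    rw [e1, e2, e3]
    simp only [neg_neg]
  · change (fun j => ((![-1, 1] : Fin 2 → ℂ) μ • heisD n m θ μ φ) (-j))
      = heisD (-n) m (-θ) μ (fun j => φ (-j))
    have e : (I * m / ((-n : ℤ) - m * (-θ : ℝ)) : ℂ) = -(I * m / (n - m * θ)) := by
      rw [← div_neg]
      congr 1
      push_cast
      ring
    funext j
    fin_cases μ
    · refine Eq.trans ?_ (congrArg (fun c : ℂ => c • mulX (φ (-j))) e.symm)
      refine (smul_smul (-1 : ℂ) (I * m / (n - m * θ) : ℂ) (mulX (φ (-j)))).trans ?_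
      rw [neg_one_mul]
    · exact one_smul ℂ _

/-- As a right module with connection, `bimodS` is `E_{0,1}`. -/
lemma heis_zero_one_tensor (s : ℤ) (θ : ℝ) (h : (s : ℝ) - θ ≠ 0)
    (h' : ((0 : ℤ) : ℝ) - (1 : ℤ) * (1 / (s - θ)) ≠ 0) :
    (bimodS s θ h).toRight.Iso (heis 0 1 (1 / (s - θ)) h') := by
  rw [heis_of_ne]
  exact TorusModule.Iso.refl (schwartzModule 0 1 (1 / (s - θ)) h')

/-- The degenerate cases are `m = 0`, where `E_{±1,0}` is the unit of the tensor product, and `-n +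
ms = 0`, where coprimality forces `m = ±1` and the product is free. -/
lemma heis_tensor_bimodS (n m : ℤ) (θ : ℝ) (h : (n : ℝ) - m * θ ≠ 0) (hnm : IsCoprime n m)
    (s : ℤ) (hs : (s : ℝ) - θ ≠ 0) :
    ∃ h', ((heis n m θ h).tensor (bimodS s θ hs)).Iso
      (heis m (-n + m * s) (1 / (s - θ)) h') := by
  have h' : (m : ℝ) - (-n + m * s : ℤ) * (1 / (s - θ)) ≠ 0 := by
    have e : (m : ℝ) - (-n + m * s : ℤ) * (1 / (s - θ)) = (n - m * θ) * (1 / (s - θ)) := by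
      push_cast; field_simp; ring
    rw [e]
    exact mul_ne_zero h (one_div_ne_zero hs)
  refine ⟨h', ?_⟩
  by_cases hm : m = 0
  · subst hm
    have hn : n.natAbs = 1 := Int.isUnit_iff_natAbs_eq.1 (isCoprime_zero_right.1 hnm)
    have h1 : ((0 : ℤ) : ℝ) - (1 : ℤ) * (1 / (s - θ)) ≠ 0 := by simpa using hs
    have h2 : ((-0 : ℤ) : ℝ) - (-1 : ℤ) * (1 / (s - θ)) ≠ 0 := by simpa using hs
    -- the unit case, up to the sign of `n`
    have key : ((heis n 0 θ h).tensor (bimodS s θ hs)).Iso (heis 0 1 (1 / (s - θ)) h1) := by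
      rw [heis_zero, hn]
      exact (freeModule_tensor _).trans (heis_zero_one_tensor s θ hs h1)
    rcases Int.natAbs_eq n with hn' | hn' <;> rw [hn] at hn'
    · exact key.trans ((heis_neg 0 1 _ h1 h2).trans (heis_congr (by simp) (by simp [hn']) _ _))
    · exact key.trans (heis_congr rfl (by simp [hn']) _ _)
  have : NeZero m.natAbs := ⟨Int.natAbs_ne_zero.2 hm⟩
  by_cases hm' : -n + m * s = 0
  · -- the free product: `n = ms` and `m = ±1`
    have hn : n = m * s := by linarith
    have hm1 : m.natAbs = 1 := by
      refine Int.isUnit_iff_natAbs_eq.1 (hnm.isUnit_of_dvd' ⟨s, hn⟩ dvd_rfl)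
    have h0 : (s : ℝ) - (1 : ℤ) * θ ≠ 0 := by simpa using hs
    have h00 : ((1 : ℤ) : ℝ) - (0 : ℤ) * (1 / (s - θ)) ≠ 0 := by simp
    have key : ((heis s 1 θ h0).tensor (bimodS s θ hs)).Iso (heis 1 0 (1 / (s - θ)) h00) := by
      rw [heis_of_ne, heis_zero]
      exact schwartzModule_tensor_bimodS_free hs h0
    have h3 : ((-s : ℤ) : ℝ) - (-1 : ℤ) * θ ≠ 0 := by
      intro h4; apply hs; push_cast at h4; linear_combination -h4
    have h5 : ((-1 : ℤ) : ℝ) - (-0 : ℤ) * (1 / (s - θ)) ≠ 0 := by simp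
    rcases Int.natAbs_eq m with hm2 | hm2 <;> rw [hm1] at hm2
    · refine ((heis_congr (by simp [hn, hm2]) (by simp [hm2]) h h0).tensor _).trans
        (key.trans (heis_congr (by simp [hm2]) hm'.symm _ _))
    · refine (((heis_congr (by simp [hn, hm2]) (by simp [hm2]) h h3).trans
        (heis_neg s 1 θ h0 h3).symm).tensor _).trans
        (key.trans ((heis_neg 1 0 _ h00 h5).trans
          (heis_congr (by simp [hm2]) (by rw [hm', neg_zero]) _ _)))
  have : NeZero (-n + m * s).natAbs := ⟨Int.natAbs_ne_zero.2 hm'⟩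
  rw [heis_of_ne, heis_of_ne]
  exact schwartzModule_tensor_bimodS n m s θ hs h h'

/-! ### The duality group -/

/-- The matrix of a dual is invertible and acts on the parameter by a fractional linear
transformation. -/
lemma TDual.mobius {g : Matrix (Fin 2) (Fin 2) ℤ} {θ θ₁ : ℝ} {M : TorusModule θ}
    {N : TorusModule θ₁} (h : TDual M g N) :
    IsUnit g.det ∧ (g 1 0 : ℝ) * θ + g 1 1 ≠ 0 ∧
      θ₁ = (g 0 0 * θ + g 0 1) / (g 1 0 * θ + g 1 1) := by
  induction h with
  | refl => simp
  | @S g θ₁ N s hs h ih =>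
    obtain ⟨h1, h2, h3⟩ := ih
    have e : ((!![0, 1; -1, s] * g) 1 0 : ℝ) * θ + ((!![0, 1; -1, s] * g) 1 1 : ℤ)
        = (s - θ₁) * (g 1 0 * θ + g 1 1) := by
      rw [h3]
      simp only [Matrix.mul_apply, Fin.sum_univ_two, Matrix.of_apply, Matrix.cons_val',
        Matrix.cons_val_zero, Matrix.cons_val_one, Matrix.cons_val_fin_one]
      push_cast
      field_simp
      ring
    refine ⟨?_, ?_, ?_⟩
    · rw [Matrix.det_mul]
      exact (by simp [Matrix.det_fin_two] : IsUnit (!![0, 1; -1, s] : Matrix _ _ ℤ).det).mul h1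
    · rw [e]; exact mul_ne_zero hs h2
    · rw [e]
      simp only [Matrix.mul_apply, Fin.sum_univ_two, Matrix.of_apply, Matrix.cons_val',
        Matrix.cons_val_zero, Matrix.cons_val_one, Matrix.cons_val_fin_one]
      push_cast
      field_simp
      ring
  | @T g θ₁ N h ih =>
    obtain ⟨h1, h2, h3⟩ := ih
    refine ⟨?_, ?_, ?_⟩
    · rw [Matrix.det_mul]
      exact (by simp [Matrix.det_fin_two] : IsUnit (!![1, 1; 0, 1] : Matrix _ _ ℤ).det).mul h1
    · simpa [Matrix.mul_apply] using h2
    · rw [h3]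
      simp only [Matrix.mul_apply, Fin.sum_univ_two, Matrix.of_apply, Matrix.cons_val',
        Matrix.cons_val_zero, Matrix.cons_val_one, Matrix.cons_val_fin_one]
      push_cast
      simp only [zero_mul, one_mul, zero_add]
      rw [div_add_one h2]
      congr 1
      ring
  | @R g θ₁ N h ih =>
    obtain ⟨h1, h2, h3⟩ := ih
    refine ⟨?_, ?_, ?_⟩
    · rw [Matrix.det_mul]
      exact (by simp [Matrix.det_fin_two] : IsUnit (!![1, 0; 0, -1] : Matrix _ _ ℤ).det).mul h1
    · intro h4
      apply h2
      simp [Matrix.mul_apply] at h4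
      linarith
    · rw [h3]
      simp only [Matrix.mul_apply, Fin.sum_univ_two, Matrix.of_apply, Matrix.cons_val',
        Matrix.cons_val_zero, Matrix.cons_val_one, Matrix.cons_val_fin_one]
      push_cast
      rw [← div_neg]
      congr 1 <;> ring

lemma TDual.trans {g g' : Matrix (Fin 2) (Fin 2) ℤ} {θ θ₁ θ₂ : ℝ} {M : TorusModule θ}
    {N : TorusModule θ₁} {K : TorusModule θ₂} (h : TDual M g N) (h' : TDual N g' K) :
    TDual M (g' * g) K := by
  induction h' with
  | refl => rwa [one_mul]
  | S s hs _ ih => rw [mul_assoc]; exact TDual.S s hs ih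
  | T _ ih => rw [mul_assoc]; exact TDual.T ih
  | R _ ih => rw [mul_assoc]; exact TDual.R ih

/-- A dual of a Heisenberg module is the Heisenberg module whose charges are transformed by the
matrix. -/
lemma TDual.iso_heis {g : Matrix (Fin 2) (Fin 2) ℤ} {θ θ₁ : ℝ} {M : TorusModule θ}
    {N : TorusModule θ₁} (h : TDual M g N) {n m : ℤ} (hnm : IsCoprime n m) {h0}
    (hM : M.Iso (heis n m θ h0)) :
    IsCoprime (g 0 0 * n + g 0 1 * m) (g 1 0 * n + g 1 1 * m) ∧
      ∃ h', N.Iso (heis (g 0 0 * n + g 0 1 * m) (g 1 0 * n + g 1 1 * m) θ₁ h') := by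
  have conv : ∀ {θ : ℝ} {K : TorusModule θ} {n m n' m' : ℤ}, n = n' → m = m' →
      (IsCoprime n m ∧ ∃ h', K.Iso (heis n m θ h')) →
      (IsCoprime n' m' ∧ ∃ h', K.Iso (heis n' m' θ h')) := by
    rintro θ K n m _ _ rfl rfl h
    exact h
  induction h with
  | refl => exact conv (by simp) (by simp) ⟨hnm, h0, hM⟩
  | @S g θ₁ N s hs h ih =>
    obtain ⟨h1, h2, h3⟩ := ih
    obtain ⟨h4, h5⟩ := heis_tensor_bimodS _ _ θ₁ h2 h1 s hs
    refine conv ?_ ?_ ⟨?_, h4, (h3.tensor _).trans h5⟩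
    · simp [Matrix.mul_apply]
    · simp [Matrix.mul_apply]; ring
    · exact IsCoprime.add_mul_left_right h1.symm.neg_right s
  | @T g θ₁ N h ih =>
    obtain ⟨h1, h2, h3⟩ := ih
    obtain ⟨h4, h5⟩ := heis_tensor_bimodT _ _ θ₁ h2
    refine conv ?_ ?_ ⟨?_, h4, (h3.tensor _).trans h5⟩
    · simp [Matrix.mul_apply]; ring
    · simp [Matrix.mul_apply]
    · have := IsCoprime.add_mul_left_left h1 1
      rwa [mul_one] at this
  | @R g θ₁ N h ih =>
    obtain ⟨h1, h2, h3⟩ := ih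
    obtain ⟨h4, h5⟩ := heis_tensor_bimodR _ _ θ₁ h2
    refine conv ?_ ?_ ⟨h1.neg_right, h4, (h3.tensor _).trans h5⟩
    · simp [Matrix.mul_apply]
    · simp [Matrix.mul_apply]; ring

/-- Every module over `T_{-θ}` has a dual for the matrix `g`. -/
def HasDual (g : Matrix (Fin 2) (Fin 2) ℤ) (θ : ℝ) : Prop :=
  ∀ M : TorusModule θ, ∃ (θ₁ : ℝ) (N : TorusModule θ₁), TDual M g N

lemma HasDual.mul {g g' : Matrix (Fin 2) (Fin 2) ℤ} {θ : ℝ} (h : HasDual g θ)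
    (h' : HasDual g' ((g 0 0 * θ + g 0 1) / (g 1 0 * θ + g 1 1))) : HasDual (g' * g) θ := by
  intro M
  obtain ⟨θ₁, N, hN⟩ := h M
  obtain ⟨_, _, rfl⟩ := hN.mobius
  obtain ⟨θ₂, K, hK⟩ := h' N
  exact ⟨θ₂, K, hN.trans hK⟩

lemma hasDual_S (s : ℤ) {θ : ℝ} (h : (s : ℝ) - θ ≠ 0) : HasDual !![0, 1; -1, s] θ := fun M =>
  ⟨_, _, by simpa using TDual.S s h (TDual.refl (M := M))⟩

lemma hasDual_T (θ : ℝ) : HasDual !![1, 1; 0, 1] θ := fun M =>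
  ⟨_, _, by simpa using TDual.T (TDual.refl (M := M))⟩

lemma hasDual_R (θ : ℝ) : HasDual !![1, 0; 0, -1] θ := fun M =>
  ⟨_, _, by simpa using TDual.R (TDual.refl (M := M))⟩

lemma hasDual_one (θ : ℝ) : HasDual 1 θ := fun _ => ⟨_, _, TDual.refl⟩

lemma hasDual_translation (k : ℤ) : ∀ θ : ℝ, HasDual !![1, k; 0, 1] θ := by
  -- with `T = !![1, 1; 0, 1]` and `R = !![1, 0; 0, -1]`, the inverse of `T` is `R T R`
  have hinv : ∀ θ, HasDual !![1, -1; 0, 1] θ := fun θ => by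
    have := ((hasDual_R θ).mul (hasDual_T _)).mul (hasDual_R _)
    convert this using 1
    simp
  induction k using Int.induction_on with
  | zero => intro θ; rw [← Matrix.one_fin_two]; exact hasDual_one θ
  | succ k ih =>
    intro θ
    convert (ih θ).mul (hasDual_T _) using 1
    simp
  | pred k ih =>
    intro θ
    convert (ih θ).mul (hinv _) using 1
    simp [sub_eq_add_neg]

lemma hasDual_neg_one (θ : ℝ) : HasDual (-1) θ := by
  -- the square of `!![0, 1; -1, 0]` is `-1`, but its first factor has its pole at `θ = 0`
  have key : ∀ θ : ℝ, θ ≠ 0 → HasDual (-1) θ := fun θ hθ => by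
    have h1 : ((0 : ℤ) : ℝ) - θ ≠ 0 := by simpa using hθ
    convert (hasDual_S 0 h1).mul (hasDual_S 0 ?_) using 1
    · rw [Matrix.one_fin_two]; simp
    · simp [hθ]
  by_cases hθ : θ = 0
  · -- conjugate by a translation
    subst hθ
    have := ((hasDual_T 0).mul (key _ (by simp))).mul (hasDual_translation (-1) _)
    convert this using 1
    rw [Matrix.one_fin_two]
    simp
  · exact key θ hθ

lemma HasDual.neg {g : Matrix (Fin 2) (Fin 2) ℤ} {θ : ℝ} (h : HasDual g θ) : HasDual (-g) θ := by
  have := h.mul (hasDual_neg_one _)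
  rwa [neg_mul, one_mul] at this

lemma hasDual_upper {a b d : ℤ} (h : IsUnit (a * d)) (θ : ℝ) : HasDual !![a, b; 0, d] θ := by
  have key : ∀ b d : ℤ, IsUnit d → HasDual !![1, b; 0, d] θ := fun b d hd => by
    rcases Int.isUnit_iff.1 hd with rfl | rfl
    · exact hasDual_translation b θ
    · convert (hasDual_translation b θ).mul (hasDual_R _) using 1
      simp
  obtain ⟨ha, hd⟩ := IsUnit.mul_iff.1 h
  rcases Int.isUnit_iff.1 ha with rfl | rfl
  · exact key b d hd
  · convert (key (-b) (-d) hd.neg).neg using 1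
    simp

/-- The descent step of the Euclidean algorithm, avoiding the pole. -/
lemma exists_descent {a b c d : ℤ} (h : IsUnit (a * d - b * c)) (hc : c ≠ 0) {θ : ℝ}
    (hθ : (c : ℝ) * θ + d ≠ 0) :
    ∃ k : ℤ, (a + k * c).natAbs < c.natAbs ∧ ((a + k * c : ℤ) : ℝ) * θ + (b + k * d : ℤ) ≠ 0 := by
  -- two consecutive values of `k` shorten the column, and the pole meets at most one of them
  have hr0 := Int.emod_nonneg a hc
  have hr1 := Int.emod_lt_abs a hc
  have hr := Int.emod_add_mul_ediv a c
  set r := a % c with hrdef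
  set q := a / c with hqdef
  by_cases h1 : ((a + -q * c : ℤ) : ℝ) * θ + (b + -q * d : ℤ) ≠ 0
  · refine ⟨-q, ?_, h1⟩
    have : a + -q * c = r := by linarith
    have := Int.abs_eq_natAbs c
    rw [‹a + -q * c = r›]; omega
  · push Not at h1
    have hr2 : r ≠ 0 := by
      intro h0
      have e1 : a + -q * c = 0 := by linarith
      rw [e1] at h1
      have e2 : b + -q * d = 0 := by
        simp only [Int.cast_zero, zero_mul, zero_add] at h1; exact_mod_cast h1
      have : a * d - b * c = 0 := by linear_combination d * e1 - c * e2
      rw [this] at h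
      exact not_isUnit_zero h
    have hsgn : c.sign * c = |c| := Int.sign_mul_self_eq_abs c
    refine ⟨-q - c.sign, ?_, ?_⟩
    · have : a + (-q - c.sign) * c = r - |c| := by linarith [hsgn]
      have h3 := Int.abs_eq_natAbs c
      rw [this]; omega
    · have e : ((a + (-q - c.sign) * c : ℤ) : ℝ) * θ + (b + (-q - c.sign) * d : ℤ)
          = (((a + -q * c : ℤ) : ℝ) * θ + (b + -q * d : ℤ)) - c.sign * (c * θ + d) := by
        push_cast; ring
      rw [e, h1, zero_sub]
      refine neg_ne_zero.2 (mul_ne_zero ?_ hθ)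
      exact_mod_cast mt Int.sign_eq_zero_iff_zero.1 hc

/-- All elements of `GL(2,ℤ)` without a pole at `θ` are realized, by induction on the size of the
lower left entry. -/
lemma hasDual_of_isUnit (N : ℕ) : ∀ (a b c d : ℤ) (θ : ℝ), c.natAbs ≤ N →
    IsUnit (a * d - b * c) → (c : ℝ) * θ + d ≠ 0 → HasDual !![a, b; c, d] θ := by
  induction N with
  | zero =>
    intro a b c d θ hc hu _
    obtain rfl : c = 0 := by omega
    exact hasDual_upper (by simpa using hu) θ
  | succ N ih =>
    intro a b c d θ hcN hu hθ
    by_cases hc : c = 0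
    · subst hc
      exact hasDual_upper (by simpa using hu) θ
    obtain ⟨k, hk1, hk2⟩ := exists_descent hu hc hθ
    -- `g = T^{-k} S g'` with `S = !![0, 1; -1, 0]`, where the lower row of `g'` is the upper
    -- row of `g` plus `k` times its lower row
    have h1 : HasDual !![-c, -d; a + k * c, b + k * d] θ := by
      refine ih _ _ _ _ θ (by omega) ?_ hk2
      convert hu using 1
      ring
    have h2 : ((0 : ℤ) : ℝ) - ((-c : ℤ) * θ + (-d : ℤ)) / ((a + k * c : ℤ) * θ + (b + k * d : ℤ))
        ≠ 0 := by
      rw [Int.cast_zero, zero_sub, neg_ne_zero]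
      refine div_ne_zero ?_ hk2
      intro h3; apply hθ; push_cast at h3; linear_combination -h3
    convert (h1.mul (hasDual_S 0 h2)).mul (hasDual_translation (-k) _) using 1
    simp

/-! ### Modulated lattice sums of Schwartz functions -/

/-- The terms `f_j(a(j + y)) e^{ib(j + y)}` at `z = (a, b, y)` of the lattice sums that describe
sections of the standard bundles. -/
def zakTerm (f : ℤ → 𝓢(ℝ, ℂ)) (j : ℤ) (z : ℝ × ℝ × ℝ) : ℂ :=
  f j (z.1 * (j + z.2.2)) * exp (I * (z.2.1 * (j + z.2.2) : ℝ))

/-- The Zak transform with dilation: `∑_j f_j(a(j + y)) e^{ib(j + y)}` at `z = (a, b, y)`. -/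
def zak (f : ℤ → 𝓢(ℝ, ℂ)) (z : ℝ × ℝ × ℝ) : ℂ := ∑' j, zakTerm f j z

/-- The domain `a ≠ 0`. -/
def zakDom : Set (ℝ × ℝ × ℝ) := {z | z.1 ≠ 0}

lemma isOpen_zakDom : IsOpen zakDom := isOpen_ne_fun continuous_fst continuous_const

lemma norm_zakTerm (f : ℤ → 𝓢(ℝ, ℂ)) (j : ℤ) (z : ℝ × ℝ × ℝ) :
    ‖zakTerm f j z‖ = ‖f j (z.1 * (j + z.2.2))‖ := by
  unfold zakTerm
  rw [norm_mul, mul_comm I, norm_exp_ofReal_mul_I, mul_one]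

/-- Uniform decay of the terms where the dilation is bounded below and `y` is bounded; the range of
the family is finite, so that the constant is independent of `j`. -/
lemma zakTerm_bound {f : ℤ → 𝓢(ℝ, ℂ)} (hf : (Set.range f).Finite) {A : ℝ} (hA : 0 < A) (Y : ℝ) :
    ∃ C : ℝ, 0 ≤ C ∧ ∀ z : ℝ × ℝ × ℝ, A ≤ |z.1| → |z.2.2| ≤ Y → ∀ j,
      ‖zakTerm f j z‖ ≤ C * ((1 + |(j : ℝ)|) ^ 2)⁻¹ := by
  choose C hC0 hC using schwartz_decay_two
  obtain ⟨D, hD⟩ := (hf.image C).bddAbove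
  set K := 1 + |Y| + A⁻¹ with hK
  have hA' := inv_pos.2 hA
  have hK0 : 0 < K := by positivity
  refine ⟨K ^ 2 * |D|, by positivity, fun z ha hy j => ?_⟩
  rw [norm_zakTerm, ← div_eq_mul_inv, le_div_iff₀ (by positivity)]
  -- the argument `a(j + y)` grows at least like `j`
  have h1 : 1 + |(j : ℝ)| ≤ K * (1 + |z.1 * (j + z.2.2)|) := by
    have e1 : |(j : ℝ)| ≤ |j + z.2.2| + |Y| := by
      calc |(j : ℝ)| = |(j + z.2.2) - z.2.2| := by ring_nf
        _ ≤ |j + z.2.2| + |z.2.2| := abs_sub _ _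
        _ ≤ _ := add_le_add_right (hy.trans (le_abs_self Y)) _
    have e2 : |j + z.2.2| ≤ A⁻¹ * |z.1 * (j + z.2.2)| := by
      rw [abs_mul, ← mul_assoc]
      have : 1 ≤ A⁻¹ * |z.1| := by
        rw [inv_mul_eq_div, le_div_iff₀ hA, one_mul]; exact ha
      nlinarith [abs_nonneg (j + z.2.2)]
    have e3 : 0 ≤ |z.1 * (j + z.2.2)| := abs_nonneg _
    rw [hK]
    nlinarith [abs_nonneg Y, mul_nonneg (abs_nonneg Y) e3]
  have h2 := hC (f j) (z.1 * (j + z.2.2))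
  have h3 : C (f j) ≤ |D| := (hD ⟨f j, ⟨j, rfl⟩, rfl⟩).trans (le_abs_self D)
  calc _ ≤ ‖f j (z.1 * (j + z.2.2))‖ * (K * (1 + |z.1 * (j + z.2.2)|)) ^ 2 := by gcongr
    _ = K ^ 2 * ((1 + |z.1 * (j + z.2.2)|) ^ 2 * ‖f j (z.1 * (j + z.2.2))‖) := by ring
    _ ≤ _ := by gcongr; exact h2.trans h3

lemma summable_zakTerm {f : ℤ → 𝓢(ℝ, ℂ)} (hf : (Set.range f).Finite) {z : ℝ × ℝ × ℝ}
    (hz : z ∈ zakDom) : Summable fun j => ‖zakTerm f j z‖ := by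
  obtain ⟨C, _, hC⟩ := zakTerm_bound hf (abs_pos.2 hz) |z.2.2|
  exact Summable.of_nonneg_of_le (fun _ => norm_nonneg _) (hC z le_rfl le_rfl)
    (summable_int_inv_sq.mul_left C)

/-- The real-linear form `c₁ da + c₂ db + c₃ dy` with complex coefficients. -/
def form (c₁ c₂ c₃ : ℂ) : ℝ × ℝ × ℝ →L[ℝ] ℂ :=
  (ContinuousLinearMap.fst ℝ ℝ (ℝ × ℝ)).smulRight c₁ +
    ((ContinuousLinearMap.fst ℝ ℝ ℝ).comp (ContinuousLinearMap.snd ℝ ℝ (ℝ × ℝ))).smulRight c₂ +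
    ((ContinuousLinearMap.snd ℝ ℝ ℝ).comp (ContinuousLinearMap.snd ℝ ℝ (ℝ × ℝ))).smulRight c₃

lemma form_apply (c₁ c₂ c₃ : ℂ) (v : ℝ × ℝ × ℝ) :
    form c₁ c₂ c₃ v = v.1 * c₁ + v.2.1 * c₂ + v.2.2 * c₃ := by
  simp [form]

lemma norm_form_le (c₁ c₂ c₃ : ℂ) : ‖form c₁ c₂ c₃‖ ≤ ‖c₁‖ + ‖c₂‖ + ‖c₃‖ := by
  refine ContinuousLinearMap.opNorm_le_bound _ (by positivity) fun v => ?_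
  rw [form_apply]
  have h1 : |v.1| ≤ ‖v‖ := norm_fst_le v
  have h2 : |v.2.1| ≤ ‖v‖ := (norm_fst_le v.2).trans (norm_snd_le v)
  have h3 : |v.2.2| ≤ ‖v‖ := (norm_snd_le v.2).trans (norm_snd_le v)
  refine (norm_add₃_le).trans ?_
  simp only [norm_mul, norm_real, Real.norm_eq_abs]
  nlinarith [mul_le_mul_of_nonneg_right h1 (norm_nonneg c₁),
    mul_le_mul_of_nonneg_right h2 (norm_nonneg c₂), mul_le_mul_of_nonneg_right h3 (norm_nonneg c₃)]

/-- The differential of a sum or term, expressed through the sums or terms of `f`, `xf`, `f'`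
and `xf'`. -/
def zakForm (z : ℝ × ℝ × ℝ) (F Fx Fd Fxd : ℂ) : ℝ × ℝ × ℝ →L[ℝ] ℂ :=
  form (Fxd / z.1) (I / z.1 * Fx) (z.1 * Fd + I * z.2.1 * F)

/-- Multiplication of all members of a family by the coordinate. -/
def famX (f : ℤ → 𝓢(ℝ, ℂ)) : ℤ → 𝓢(ℝ, ℂ) := fun j => mulX (f j)

/-- The derivatives of the members of a family. -/
def famD (f : ℤ → 𝓢(ℝ, ℂ)) : ℤ → 𝓢(ℝ, ℂ) := fun j => derX (f j)

lemma finite_famX {f : ℤ → 𝓢(ℝ, ℂ)} (hf : (Set.range f).Finite) : (Set.range (famX f)).Finite :=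
  finite_range_map hf _

lemma finite_famD {f : ℤ → 𝓢(ℝ, ℂ)} (hf : (Set.range f).Finite) : (Set.range (famD f)).Finite :=
  finite_range_map hf _

lemma hasFDerivAt_zakTerm (f : ℤ → 𝓢(ℝ, ℂ)) (j : ℤ) {z : ℝ × ℝ × ℝ} (hz : z ∈ zakDom) :
    HasFDerivAt (zakTerm f j) (zakForm z (zakTerm f j z) (zakTerm (famX f) j z)
      (zakTerm (famD f) j z) (zakTerm (famX (famD f)) j z)) z := by
  have hz' : (z.1 : ℂ) ≠ 0 := by exact_mod_cast hz
  have h1 : HasFDerivAt (fun z : ℝ × ℝ × ℝ => z.1) (ContinuousLinearMap.fst ℝ ℝ (ℝ × ℝ)) z :=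
    hasFDerivAt_fst
  have h2 : HasFDerivAt (fun z : ℝ × ℝ × ℝ => z.2.1) ((ContinuousLinearMap.fst ℝ ℝ ℝ).comp
    (ContinuousLinearMap.snd ℝ ℝ (ℝ × ℝ))) z := hasFDerivAt_fst.comp z hasFDerivAt_snd
  have h3 : HasFDerivAt (fun z : ℝ × ℝ × ℝ => (j : ℝ) + z.2.2) ((ContinuousLinearMap.snd ℝ ℝ ℝ).comp
    (ContinuousLinearMap.snd ℝ ℝ (ℝ × ℝ))) z :=
    (hasFDerivAt_snd.comp z hasFDerivAt_snd).const_add _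
  have h4 := HasFDerivAt.comp (g := f j) (f := fun z : ℝ × ℝ × ℝ => z.1 * (j + z.2.2)) z
    (f j).differentiableAt.hasDerivAt.hasFDerivAt (h1.mul h3)
  have h5 := (((Complex.ofRealCLM.hasFDerivAt).comp z (h2.mul h3)).const_mul I).cexp
  refine (h4.mul h5).congr_fderiv ?_
  refine ContinuousLinearMap.ext fun v => ?_
  have e1 : mulX (derX (f j)) (z.1 * (j + z.2.2)) = (z.1 * (j + z.2.2)) * deriv (f j) (z.1 * (j + z.2.2)) := by
    simp
  simp [zakForm, form_apply, zakTerm, famX, famD]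
  field_simp
  ring

lemma hasFDerivAt_zak {f : ℤ → 𝓢(ℝ, ℂ)} (hf : (Set.range f).Finite) {z : ℝ × ℝ × ℝ}
    (hz : z ∈ zakDom) : HasFDerivAt (zak f) (zakForm z (zak f z) (zak (famX f) z)
      (zak (famD f) z) (zak (famX (famD f)) z)) z := by
  have hz0 : 0 < |z.1| := abs_pos.2 hz
  -- in a small ball around `z` the differentials of the terms are dominated by a convergent
  -- series
  set r := min (|z.1| / 2) 1 with hr
  have hr0 : 0 < r := by positivity
  have hball : ∀ w ∈ Metric.ball z r, |z.1| / 2 ≤ |w.1| ∧ |w.1| ≤ |z.1| + 1 ∧ |w.2.1| ≤ |z.2.1| + 1 ∧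
      |w.2.2| ≤ |z.2.2| + 1 := by
    intro w hw
    rw [Metric.mem_ball, dist_eq_norm] at hw
    have h1 : |w.1 - z.1| < r := (norm_fst_le (w - z)).trans_lt hw
    have h2 : |w.2.1 - z.2.1| < r := ((norm_fst_le (w - z).2).trans (norm_snd_le _)).trans_lt hw
    have h3 : |w.2.2 - z.2.2| < r := ((norm_snd_le (w - z).2).trans (norm_snd_le _)).trans_lt hw
    have l1 := min_le_left (|z.1| / 2) 1
    have l2 := min_le_right (|z.1| / 2) 1
    have a1 := abs_sub_abs_le_abs_sub z.1 w.1
    have a1' := abs_sub_abs_le_abs_sub w.1 z.1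
    have a2 := abs_sub_abs_le_abs_sub w.2.1 z.2.1
    have a3 := abs_sub_abs_le_abs_sub w.2.2 z.2.2
    rw [abs_sub_comm z.1 w.1] at a1
    exact ⟨by linarith, by linarith, by linarith, by linarith⟩
  have hA : 0 < |z.1| / 2 := by positivity
  obtain ⟨C1, hC1, b1⟩ := zakTerm_bound hf hA (|z.2.2| + 1)
  obtain ⟨C2, hC2, b2⟩ := zakTerm_bound (finite_famX hf) hA (|z.2.2| + 1)
  obtain ⟨C3, hC3, b3⟩ := zakTerm_bound (finite_famD hf) hA (|z.2.2| + 1)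
  obtain ⟨C4, hC4, b4⟩ := zakTerm_bound (finite_famX (finite_famD hf)) hA (|z.2.2| + 1)
  have hdom : ∀ w ∈ Metric.ball z r, w ∈ zakDom := fun w hw =>
    abs_pos.1 (hA.trans_le (hball w hw).1)
  have key := hasFDerivAt_tsum_of_isPreconnected (𝕜 := ℝ) (s := Metric.ball z r) (x := z) (x₀ := z)
    (f := zakTerm f) (f' := fun j w => zakForm w (zakTerm f j w) (zakTerm (famX f) j w)
      (zakTerm (famD f) j w) (zakTerm (famX (famD f)) j w))
    (summable_int_inv_sq.mul_left (C4 / (|z.1| / 2) + 1 / (|z.1| / 2) * C2 + ((|z.1| + 1) * C3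
      + (|z.2.1| + 1) * C1))) Metric.isOpen_ball
    (convex_ball z r).isPreconnected (fun j w hw => hasFDerivAt_zakTerm f j (hdom w hw))
    (fun j w hw => by
      obtain ⟨h1, h2, h3, h4⟩ := hball w hw
      refine (norm_form_le _ _ _).trans ?_
      have c1 := b1 w h1 h4 j
      have c2 := b2 w h1 h4 j
      have c3 := b3 w h1 h4 j
      have c4 := b4 w h1 h4 j
      set q := ((1 + |(j : ℝ)|) ^ 2)⁻¹
      have e1 : ‖zakTerm (famX (famD f)) j w / w.1‖ ≤ (C4 * q) / (|z.1| / 2) := by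
        rw [norm_div, norm_real, Real.norm_eq_abs]; gcongr
      have e2 : ‖I / w.1 * zakTerm (famX f) j w‖ ≤ 1 / (|z.1| / 2) * (C2 * q) := by
        rw [norm_mul, norm_div, norm_I, norm_real, Real.norm_eq_abs]; gcongr
      have e3 : ‖w.1 * zakTerm (famD f) j w + I * w.2.1 * zakTerm f j w‖
          ≤ (|z.1| + 1) * (C3 * q) + (|z.2.1| + 1) * (C1 * q) := by
        refine (norm_add_le _ _).trans ?_
        rw [norm_mul, norm_mul, norm_mul, norm_I, one_mul, norm_real, norm_real,
          Real.norm_eq_abs, Real.norm_eq_abs]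
        gcongr
      refine (add_le_add (add_le_add e1 e2) e3).trans (le_of_eq ?_)
      ring)
    (Metric.mem_ball_self hr0) (summable_zakTerm hf hz).of_norm (Metric.mem_ball_self hr0)
  refine key.congr_fderiv ?_
  have s1 := (summable_zakTerm hf hz).of_norm.hasSum
  have s2 := (summable_zakTerm (finite_famX hf) hz).of_norm.hasSum
  have s3 := (summable_zakTerm (finite_famD hf) hz).of_norm.hasSum
  have s4 := (summable_zakTerm (finite_famX (finite_famD hf)) hz).of_norm.hasSum
  refine HasSum.tsum_eq ?_
  have hsm : ∀ {L : ℝ × ℝ × ℝ →L[ℝ] ℝ} {c : ℤ → ℂ} {S : ℂ}, HasSum c S →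
      HasSum (fun j => L.smulRight (c j)) (L.smulRight S) := fun {L c S} h =>
    h.mapL (ContinuousLinearMap.smulRightL ℝ (ℝ × ℝ × ℝ) ℂ L)
  exact ((hsm (s4.div_const _)).add (hsm (s2.mul_left _))).add
    (hsm ((s3.mul_left _).add (s1.mul_left _)))

/-- The differential of a lattice sum is a combination of lattice sums, so that smoothness follows
by induction on the order, for all families at once. -/
lemma contDiffOn_zak {f : ℤ → 𝓢(ℝ, ℂ)} (hf : (Set.range f).Finite) :
    ContDiffOn ℝ ∞ (zak f) zakDom := by
  rw [contDiffOn_infty]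
  intro n
  induction n generalizing f with
  | zero => exact contDiffOn_zero.2 fun z hz => (hasFDerivAt_zak hf hz).continuousAt.continuousWithinAt
  | succ n ih =>
    push_cast
    rw [contDiffOn_succ_iff_fderiv_of_isOpen isOpen_zakDom]
    refine ⟨fun z hz => (hasFDerivAt_zak hf hz).differentiableAt.differentiableWithinAt,
      by simp, ?_⟩
    refine ContDiffOn.congr (f := fun z => zakForm z (zak f z) (zak (famX f) z)
      (zak (famD f) z) (zak (famX (famD f)) z)) ?_ fun z hz => (hasFDerivAt_zak hf hz).fderiv
    have ha : ContDiffOn ℝ n (fun z : ℝ × ℝ × ℝ => (z.1 : ℂ)) zakDom :=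
      (ofRealCLM.contDiff.comp contDiff_fst).contDiffOn
    have hb : ContDiffOn ℝ n (fun z : ℝ × ℝ × ℝ => (z.2.1 : ℂ)) zakDom :=
      (ofRealCLM.contDiff.comp (contDiff_fst.comp contDiff_snd)).contDiffOn
    have ha0 : ContDiffOn ℝ n (fun z : ℝ × ℝ × ℝ => (z.1 : ℂ)⁻¹) zakDom :=
      ha.inv fun z hz => by exact_mod_cast hz
    have hsm : ∀ {L : ℝ × ℝ × ℝ →L[ℝ] ℝ} {c : ℝ × ℝ × ℝ → ℂ}, ContDiffOn ℝ n c zakDom →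
        ContDiffOn ℝ n (fun z => L.smulRight (c z)) zakDom := fun {L c} h =>
      (ContinuousLinearMap.smulRightL ℝ (ℝ × ℝ × ℝ) ℂ L).contDiff.comp_contDiffOn h
    have i1 := ih hf
    have i2 := ih (finite_famX hf)
    have i3 := ih (finite_famD hf)
    have i4 := ih (finite_famX (finite_famD hf))
    exact ((hsm (i4.mul ha0)).add (hsm ((contDiffOn_const.mul ha0).mul i2))).add
      (hsm ((ha.mul i3).add ((contDiffOn_const.mul hb).mul i1)))

/-- The derivative of a lattice sum along a curve. -/
lemma hasDerivAt_zak_comp {f : ℤ → 𝓢(ℝ, ℂ)} (hf : (Set.range f).Finite) {a b y : ℝ → ℝ}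
    {a' b' y' s : ℝ} (ha : HasDerivAt a a' s) (hb : HasDerivAt b b' s) (hy : HasDerivAt y y' s)
    (h0 : a s ≠ 0) : HasDerivAt (fun s => zak f (a s, b s, y s))
      (a' * (zak (famX (famD f)) (a s, b s, y s) / a s)
        + b' * (I / a s * zak (famX f) (a s, b s, y s))
        + y' * (a s * zak (famD f) (a s, b s, y s) + I * b s * zak f (a s, b s, y s))) s := by
  have := (hasFDerivAt_zak hf (z := (a s, b s, y s)) h0).comp_hasDerivAt s (ha.prodMk (hb.prodMk hy))
  rwa [zakForm, form_apply] at this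

/-! ### Smooth functions on the plane -/

lemma IsSmooth.hasFDerivAt {f : PlaneFn} (hf : IsSmooth f) (z : ℝ × ℝ) :
    HasFDerivAt (fun z : ℝ × ℝ => f z.1 z.2) (fderiv ℝ (fun z : ℝ × ℝ => f z.1 z.2) z) z :=
  (hf.differentiable (by simp) z).hasFDerivAt

lemma IsSmooth.hasDerivAt_zero {f : PlaneFn} (hf : IsSmooth f) (x y : ℝ) :
    HasDerivAt (fun x => f x y) (fderiv ℝ (fun z : ℝ × ℝ => f z.1 z.2) (x, y) (1, 0)) x :=
  (hf.hasFDerivAt (x, y)).comp_hasDerivAt (f := fun x => (x, y)) x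
    ((hasDerivAt_id x).prodMk (hasDerivAt_const x y))

lemma IsSmooth.hasDerivAt_one {f : PlaneFn} (hf : IsSmooth f) (x y : ℝ) :
    HasDerivAt (fun y => f x y) (fderiv ℝ (fun z : ℝ × ℝ => f z.1 z.2) (x, y) (0, 1)) y :=
  (hf.hasFDerivAt (x, y)).comp_hasDerivAt (f := fun y => (x, y)) y
    ((hasDerivAt_const y x).prodMk (hasDerivAt_id y))

lemma IsSmooth.hasDerivAt_pd_zero {f : PlaneFn} (hf : IsSmooth f) (x y : ℝ) :
    HasDerivAt (fun x => f x y) (pd 0 f x y) x := by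
  have := hf.hasDerivAt_zero x y
  simpa [pd, this.deriv] using this

lemma IsSmooth.hasDerivAt_pd_one {f : PlaneFn} (hf : IsSmooth f) (x y : ℝ) :
    HasDerivAt (fun y => f x y) (pd 1 f x y) y := by
  have := hf.hasDerivAt_one x y
  simpa [pd, this.deriv] using this

lemma IsSmooth.pd {f : PlaneFn} (hf : IsSmooth f) (μ : Fin 2) : IsSmooth (pd μ f) := by
  have h1 : ContDiff ℝ ∞ (fderiv ℝ fun z : ℝ × ℝ => f z.1 z.2) :=
    hf.fderiv_right (m := ∞) (by simp)
  have key : ∀ v : ℝ × ℝ, IsSmooth fun x y => fderiv ℝ (fun z : ℝ × ℝ => f z.1 z.2) (x, y) v :=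
    fun v => h1.clm_apply contDiff_const
  fin_cases μ
  · convert key (1, 0) using 1
    funext x y
    exact (hf.hasDerivAt_pd_zero x y).unique (hf.hasDerivAt_zero x y)
  · convert key (0, 1) using 1
    funext x y
    exact (hf.hasDerivAt_pd_one x y).unique (hf.hasDerivAt_one x y)

lemma IsSmooth.continuous {f : PlaneFn} (hf : IsSmooth f) : Continuous fun z : ℝ × ℝ => f z.1 z.2 :=
  ContDiff.continuous hf

/-! ### The Zak transform -/

section Zak

variable {m : ℤ}

/-- The `m`-periodic family of Schwartz functions of an element of `HSpace m`. -/
def fam (h : HSpace m) : ℤ → 𝓢(ℝ, ℂ) := fun j => h (j : ZMod m.natAbs)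

lemma finite_fam [NeZero m.natAbs] (h : HSpace m) : (Set.range (fam h)).Finite :=
  finite_range_comp h _

/-- Smooth functions of `(u, y)` with the quasiperiodicity of the Zak transform of an `m`-periodic
family of Schwartz functions. -/
structure IsZak (m : ℤ) (F : PlaneFn) : Prop where
  smooth : IsSmooth F
  shift : ∀ u y, F (u + 1) y = exp (2 * Real.pi * I * y) * F u y
  periodic : ∀ u y, F u (y + m) = F u y

lemma IsZak.bounded {F : PlaneFn} (hm : m ≠ 0) (hF : IsZak m F) :
    ∃ K : ℝ, 0 ≤ K ∧ ∀ u ∈ Set.Icc (0 : ℝ) 1, ∀ y, ‖F u y‖ ≤ K := by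
  have hc : IsCompact (Set.Icc (0 : ℝ) 1 ×ˢ Set.Icc (-|(m : ℝ)|) |(m : ℝ)|) := isCompact_Icc.prod isCompact_Icc
  obtain ⟨K, hK⟩ := hc.exists_bound_of_continuousOn (hF.smooth.continuous.continuousOn)
  refine ⟨|K|, abs_nonneg _, fun u hu y => ?_⟩
  have hm' : (m : ℝ) ≠ 0 := by exact_mod_cast hm
  have hp : Function.Periodic (F u) m := hF.periodic u
  have e : F u y = F u (m * Int.fract (y / m)) := by
    have h1 := hp.sub_zsmul_eq ⌊y / m⌋ (x := y)
    rw [← h1]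
    congr 1
    rw [Int.fract, zsmul_eq_mul]
    field_simp
  rw [e]
  refine (hK (u, _) ⟨hu, ?_⟩).trans (le_abs_self K)
  have h2 := Int.fract_nonneg (y / (m : ℝ))
  have h3 := (Int.fract_lt_one (y / (m : ℝ))).le
  rw [Set.mem_Icc, ← abs_le, abs_mul, abs_of_nonneg h2]
  exact mul_le_of_le_one_right (abs_nonneg _) h3

lemma IsZak.pd_zero {F : PlaneFn} (hF : IsZak m F) : IsZak m (pd 0 F) where
  smooth := hF.smooth.pd 0
  shift u y := by
    have h1 := (hF.smooth.hasDerivAt_pd_zero (u + 1) y).comp_add_const u 1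
    have h2 := (hF.smooth.hasDerivAt_pd_zero u y).const_mul (exp (2 * Real.pi * I * y))
    exact (h1.congr_of_eventuallyEq (.of_forall fun u => (hF.shift u y).symm)).unique h2
  periodic u y := by
    have h1 := hF.smooth.hasDerivAt_pd_zero u (y + m)
    have h2 := hF.smooth.hasDerivAt_pd_zero u y
    exact (h1.congr_of_eventuallyEq (.of_forall fun u => (hF.periodic u y).symm)).unique h2

/-- The function `∂_y F - 2πiu F`, whose inverse Zak transform is the derivative. -/
lemma IsZak.pd_one {F : PlaneFn} (hF : IsZak m F) :
    IsZak m (fun u y => pd 1 F u y - 2 * Real.pi * I * u * F u y) where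
  smooth := by
    refine ContDiff.sub (hF.smooth.pd 1) (ContDiff.mul (contDiff_const.mul ?_) hF.smooth)
    exact ofRealCLM.contDiff.comp contDiff_fst
  shift u y := by
    have h1 := hF.smooth.hasDerivAt_pd_one (u + 1) y
    have he : HasDerivAt (fun y : ℝ => exp (2 * Real.pi * I * y))
        (exp (2 * Real.pi * I * y) * (2 * Real.pi * I * 1)) y :=
      ((Complex.ofRealCLM.hasDerivAt (x := y)).const_mul (2 * Real.pi * I)).cexp
    have h2 := he.mul (hF.smooth.hasDerivAt_pd_one u y)
    have h3 := (h1.congr_of_eventuallyEq (.of_forall fun y => (hF.shift u y).symm)).unique h2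
    rw [h3, hF.shift]
    push_cast
    ring
  periodic u y := by
    have h1 := (hF.smooth.hasDerivAt_pd_one u (y + m)).comp_add_const y (m : ℝ)
    have h2 := hF.smooth.hasDerivAt_pd_one u y
    rw [(h1.congr_of_eventuallyEq (.of_forall fun y => (hF.periodic u y).symm)).unique h2, hF.periodic]

/-- The inverse Zak transform: `F(u, y - j) e^{-2πiyu}` has period `1` in `u`, and the value at `y`
of the `j`-th function is its integral over a period. -/
def zakInv (F : PlaneFn) (j : ℤ) (y : ℝ) : ℂ :=
  ∫ u in (0 : ℝ)..1, F u (y - j) * exp (-(2 * Real.pi * I * y * u))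

lemma norm_exp_neg_real (y u : ℝ) : ‖exp (-(2 * Real.pi * I * y * u))‖ = 1 :=
  norm_exp_real_I (-(2 * Real.pi * y * u)) _ (by push_cast; ring)

lemma zakInv_bounded {F : PlaneFn} (hm : m ≠ 0) (hF : IsZak m F) (j : ℤ) :
    ∃ K : ℝ, ∀ y, ‖zakInv F j y‖ ≤ K := by
  obtain ⟨K, _, hK⟩ := hF.bounded hm
  refine ⟨K * |1 - 0|, fun y => intervalIntegral.norm_integral_le_of_norm_le_const fun u hu => ?_⟩
  rw [Set.uIoc_of_le zero_le_one] at hu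
  rw [norm_mul, norm_exp_neg_real, mul_one]
  exact hK u ⟨hu.1.le, hu.2⟩ _

lemma continuous_zakInv_integrand {F : PlaneFn} (hF : IsSmooth F) (j : ℤ) (y : ℝ) :
    Continuous fun u : ℝ => F u (y - j) * exp (-(2 * Real.pi * I * y * u)) := by
  have h1 : Continuous fun u : ℝ => F u (y - j) :=
    hF.continuous.comp (continuous_id.prodMk continuous_const)
  fun_prop

/-- Differentiation of an inverse Zak transform gives an inverse Zak transform. -/
lemma hasDerivAt_zakInv {F : PlaneFn} (hm : m ≠ 0) (hF : IsZak m F) (j : ℤ) (y : ℝ) :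
    HasDerivAt (zakInv F j) (zakInv (fun u y => pd 1 F u y - 2 * Real.pi * I * u * F u y) j y
      ) y := by
  obtain ⟨K, _, hK⟩ := hF.pd_one.bounded hm
  have hi : ∀ y, Continuous fun u : ℝ => (pd 1 F u (y - j) - 2 * Real.pi * I * u * F u (y - j))
      * exp (-(2 * Real.pi * I * y * u)) := fun y =>
    continuous_zakInv_integrand hF.pd_one.smooth j y
  have hd : ∀ u y : ℝ, HasDerivAt (fun y : ℝ => F u (y - j) * exp (-(2 * Real.pi * I * y * u)))
      ((pd 1 F u (y - j) - 2 * Real.pi * I * u * F u (y - j))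
        * exp (-(2 * Real.pi * I * y * u))) y := fun u y => by
    have he : HasDerivAt (fun y : ℝ => exp (-(2 * Real.pi * I * y * u)))
        (exp (-(2 * Real.pi * I * y * u)) * -(2 * Real.pi * I * 1 * u)) y :=
      (((Complex.ofRealCLM.hasDerivAt (x := y)).const_mul (2 * Real.pi * I)).mul_const
        (u : ℂ)).neg.cexp
    have h1 := ((hF.smooth.hasDerivAt_pd_one u (y - j)).comp_sub_const y (j : ℝ)).mul he
    refine h1.congr_deriv ?_
    ring
  exact (intervalIntegral.hasDerivAt_integral_of_dominated_loc_of_deriv_le (bound := fun _ => K)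
    Filter.univ_mem
    (.of_forall fun y => (continuous_zakInv_integrand hF.smooth j y).aestronglyMeasurable)
    ((continuous_zakInv_integrand hF.smooth j y).intervalIntegrable _ _)
    (hi y).aestronglyMeasurable
    (.of_forall fun u hu y _ => by
      rw [Set.uIoc_of_le zero_le_one] at hu
      rw [norm_mul, norm_exp_neg_real, mul_one]
      exact hK u ⟨hu.1.le, hu.2⟩ _)
    (by simp) (.of_forall fun u _ y _ => hd u y)).2

/-- Integration by parts; the boundary terms cancel by quasiperiodicity. -/
lemma mul_zakInv {F : PlaneFn} (hF : IsZak m F) (j : ℤ) (y : ℝ) :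
    2 * Real.pi * I * y * zakInv F j y = zakInv (pd 0 F) j y := by
  have hd : ∀ u : ℝ, HasDerivAt (fun u : ℝ => F u (y - j) * exp (-(2 * Real.pi * I * y * u)))
      (pd 0 F u (y - j) * exp (-(2 * Real.pi * I * y * u))
        - 2 * Real.pi * I * y * (F u (y - j) * exp (-(2 * Real.pi * I * y * u)))) u := fun u => by
    have he : HasDerivAt (fun u : ℝ => exp (-(2 * Real.pi * I * y * u)))
        (exp (-(2 * Real.pi * I * y * u)) * -(2 * Real.pi * I * y * 1)) u :=
      ((Complex.ofRealCLM.hasDerivAt (x := u)).const_mul (2 * Real.pi * I * y)).neg.cexp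
    refine ((hF.smooth.hasDerivAt_pd_zero u (y - j)).mul he).congr_deriv ?_
    ring
  have c1 := continuous_zakInv_integrand hF.smooth j y
  have c2 := continuous_zakInv_integrand hF.pd_zero.smooth j y
  have h1 := intervalIntegral.integral_eq_sub_of_hasDerivAt (a := 0) (b := 1) (fun u _ => hd u)
    ((c2.sub (c1.const_mul _)).intervalIntegrable _ _)
  rw [intervalIntegral.integral_sub (c2.intervalIntegrable _ _) ((c1.const_mul _).intervalIntegrable _ _),
    intervalIntegral.integral_const_mul] at h1
  have h2 := hF.shift 0 (y - j)
  have h3 : exp (2 * Real.pi * I * ((y - j : ℝ) : ℂ)) * exp (-(2 * Real.pi * I * y * (1 : ℝ))) = 1 := by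
    rw [← exp_add]
    convert exp_two_pi_int (-j) using 2
    push_cast; ring
  have h4 : F 1 (y - j) * exp (-(2 * Real.pi * I * y * (1 : ℝ)))
      - F 0 (y - j) * exp (-(2 * Real.pi * I * y * (0 : ℝ))) = 0 := by
    rw [zero_add] at h2
    rw [h2]
    simp only [ofReal_zero, mul_zero, neg_zero, exp_zero, mul_one]
    linear_combination F 0 (y - j) * h3
  rw [h4] at h1
  unfold zakInv
  linear_combination -h1

/-- The inverse Zak transforms are bounded and closed under differentiation and multiplication by
the coordinate, hence Schwartz functions. -/
lemma exists_schwartz_zakInv {F : PlaneFn} (hm : m ≠ 0) (hF : IsZak m F) (j : ℤ) :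
    ∃ f : 𝓢(ℝ, ℂ), ⇑f = zakInv F j := by
  refine schwartz_of_closed (S := {v | ∃ F, IsZak m F ∧ ∃ j : ℤ, v = zakInv F j}) ?_ ?_ ?_
    ⟨F, hF, j, rfl⟩
  · rintro _ ⟨F, hF, j, rfl⟩
    exact zakInv_bounded hm hF j
  · rintro _ ⟨F, hF, j, rfl⟩
    exact ⟨_, Submodule.subset_span ⟨_, hF.pd_one, j, rfl⟩, hasDerivAt_zakInv hm hF j⟩
  · rintro _ ⟨F, hF, j, rfl⟩
    have hpi : (2 * Real.pi * I : ℂ) ≠ 0 := by simp [Real.pi_ne_zero]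
    have : (fun x : ℝ => (x : ℂ) * zakInv F j x) = (2 * Real.pi * I : ℂ)⁻¹ • zakInv (pd 0 F) j := by
      funext x
      rw [Pi.smul_apply, ← mul_zakInv hF, smul_eq_mul]
      field_simp
    rw [this]
    exact Submodule.smul_mem _ _ (Submodule.subset_span ⟨_, hF.pd_zero, j, rfl⟩)

lemma zakInv_add_mul {F : PlaneFn} (hF : IsZak m F) (j r : ℤ) : zakInv F (j + m * r) = zakInv F j := by
  funext y
  unfold zakInv
  refine intervalIntegral.integral_congr fun u _ => ?_
  have hp : Function.Periodic (F u) m := hF.periodic u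
  have h1 := hp.sub_zsmul_eq r (x := y - j)
  have h2 : y - ((j + m * r : ℤ) : ℝ) = y - j - r • (m : ℝ) := by
    push_cast [zsmul_eq_mul]; ring
  rw [h2, h1]

/-- Every smooth quasiperiodic function is a Zak transform, by Fourier inversion of `G(u) = F(u, y)
e^{-2πiyu}` whose coefficients are the values of the inverse Zak transform. -/
lemma exists_zak_eq [NeZero m.natAbs] {F : PlaneFn} (hF : IsZak m F) :
    ∃ h : HSpace m, ∀ u y, F u y = zak (fam h) (1, 2 * Real.pi * u, y) := by
  have hm : m ≠ 0 := Int.natAbs_ne_zero.1 (NeZero.ne _)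
  choose f hf using exists_schwartz_zakInv hm hF
  have hper : ∀ i j : ℤ, (i : ZMod m.natAbs) = j → f i = f j := by
    intro i j h
    obtain ⟨r, hr⟩ := Int.natAbs_dvd.1 ((ZMod.intCast_eq_intCast_iff_dvd_sub _ _ _).1 h)
    have : j = i + m * r := by linarith
    ext y
    rw [hf, hf, this, zakInv_add_mul hF]
  refine ⟨fun j => f j.cast, fun u y => ?_⟩
  have hfam : fam (m := m) (fun j => f j.cast) = f := by
    funext j
    exact hper _ _ (by simp)
  have hfin : (Set.range f).Finite := hfam ▸ finite_fam _
  rw [hfam]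
  set G : ℝ → ℂ := fun u => F u y * exp (-(2 * Real.pi * I * y * u)) with hG
  have hGc : Continuous G := by
    have h1 : Continuous fun u : ℝ => F u y :=
      hF.smooth.continuous.comp (continuous_id.prodMk continuous_const)
    fun_prop
  have hGp : Function.Periodic G 1 := fun u => by
    simp only [hG]
    rw [hF.shift]
    have : exp (2 * Real.pi * I * y) * exp (-(2 * Real.pi * I * y * ((u + 1 : ℝ) : ℂ)))
        = exp (-(2 * Real.pi * I * y * u)) := by
      rw [← exp_add]; congr 1; push_cast; ring
    rw [← this]; ring
  have hcoef : ∀ q : ℤ, ∫ x in (0 : ℝ)..1, G x * exp (-(2 * Real.pi * I * q * x)) = f q (q + y) := by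
    intro q
    rw [hf]
    unfold zakInv
    refine intervalIntegral.integral_congr fun x _ => ?_
    change F x y * _ * _ = F x (q + y - q) * _
    rw [add_sub_cancel_left, mul_assoc, ← exp_add]
    congr 2
    push_cast; ring
  have hsum : Summable fun q : ℤ => f q (q + y) := by
    refine ((summable_zakTerm hfin (z := (1, 0, y)) one_ne_zero).congr fun q => ?_).of_norm
    rw [norm_zakTerm, one_mul]
  have h1 := fourier_inversion hGc hGp (by simpa only [hcoef] using hsum) u
  simp only [hcoef] at h1
  have h2 := h1.mul_right (exp (2 * Real.pi * I * y * u))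
  have h3 : G u * exp (2 * Real.pi * I * y * u) = F u y := by
    simp only [hG]
    rw [mul_assoc, ← exp_add, neg_add_cancel, exp_zero, mul_one]
  rw [h3] at h2
  rw [← h2.tsum_eq]
  refine tsum_congr fun q => ?_
  simp only [zakTerm, one_mul]
  rw [mul_assoc, ← exp_add]
  congr 2
  push_cast; ring

/-- A Zak transform is a Fourier series in `b`, with coefficients the values of the functions. -/
lemma eq_zero_of_zak_eq_zero [NeZero m.natAbs] {h : HSpace m} {a : ℝ} (ha : a ≠ 0)
    (h0 : ∀ b y, zak (fam h) (a, b, y) = 0) : h = 0 := by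
  funext j
  obtain ⟨l, rfl⟩ := ZMod.intCast_surjective j
  ext x
  have key := fourier_unique (c := fun q => fam h q (a * (q + (x / a - l)))) ?_ ?_ l
  · rw [add_sub_cancel, mul_div_cancel₀ _ ha] at key
    exact key
  · exact (summable_zakTerm (finite_fam h) (z := (a, 0, x / a - l)) ha).congr fun q => norm_zakTerm _ _ _
  · intro u
    have h1 := h0 (2 * Real.pi * u) (x / a - l)
    unfold zak at h1
    have h2 : ∀ q : ℤ, zakTerm (fam h) q (a, 2 * Real.pi * u, x / a - l)
        = exp (2 * Real.pi * I * u * ((x / a - l : ℝ) : ℂ)) *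
          (fam h q (a * (q + (x / a - l))) * exp (2 * Real.pi * I * q * u)) := fun q => by
      simp only [zakTerm]
      rw [mul_left_comm, ← exp_add]
      congr 2
      push_cast; ring
    simp only [h2, tsum_mul_left] at h1
    exact (mul_eq_zero.1 h1).resolve_left (exp_ne_zero _)

lemma zak_add_two_pi (f : ℤ → 𝓢(ℝ, ℂ)) (a b y : ℝ) :
    zak f (a, b + 2 * Real.pi, y) = exp (2 * Real.pi * I * y) * zak f (a, b, y) := by
  unfold zak
  rw [← tsum_mul_left]
  refine tsum_congr fun j => ?_
  simp only [zakTerm]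
  rw [mul_left_comm, ← exp_add]
  have : exp (I * ((b + 2 * Real.pi) * (j + y) : ℝ)) = exp (2 * Real.pi * I * y + I * (b * (j + y) : ℝ)) := by
    rw [← one_mul (exp (2 * Real.pi * I * y + _)), ← exp_two_pi_int j, ← exp_add]
    congr 1
    push_cast; ring
  rw [this]

lemma zak_add_int (f : ℤ → 𝓢(ℝ, ℂ)) (a b y : ℝ) (p : ℤ) :
    zak f (a, b, y + p) = zak (fun j => f (j - p)) (a, b, y) := by
  unfold zak
  rw [← (Equiv.addRight p).tsum_eq fun j => zakTerm (fun j => f (j - p)) j (a, b, y)]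
  refine tsum_congr fun j => ?_
  simp only [zakTerm, Equiv.coe_addRight, add_sub_cancel_right]
  rw [show ((j + p : ℤ) : ℝ) + y = j + (y + p) by push_cast; ring]

end Zak

/-! ### Star products with linear gauge potentials -/

@[simp] lemma pd_zero' (μ : Fin 2) : pd μ 0 = 0 := by
  funext x y
  simp [pd]

lemma pd_smul (μ : Fin 2) (c : ℂ) (f : PlaneFn) : pd μ (c • f) = c • pd μ f := by
  funext x y
  simp only [pd, Pi.smul_apply, smul_eq_mul]
  split_ifs <;> exact deriv_const_mul_field' _ |> fun h => congrFun h _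

lemma pd_iterate_zero (μ : Fin 2) (k : ℕ) : (pd μ)^[k] 0 = 0 := Function.iterate_fixed (pd_zero' μ) k

/-- The affine function `c σ¹ + d`. -/
def aff (c d : ℂ) : PlaneFn := fun x _ => c * x + d

/-- The linear function `c σ¹`. -/
def lin (c : ℂ) : PlaneFn := aff c 0

lemma pd_zero_aff (c d : ℂ) : pd 0 (aff c d) = fun _ _ => c := by
  funext x y
  have : HasDerivAt (fun x : ℝ => c * (x : ℂ) + d) (c * 1) x :=
    ((Complex.ofRealCLM.hasDerivAt (x := x)).const_mul c).add_const d
  simp [pd, aff, this.deriv]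

lemma pd_one_aff (c d : ℂ) : pd 1 (aff c d) = 0 := by
  funext x y
  simp [pd, aff]

lemma pd_const (μ : Fin 2) (c : ℂ) : pd μ (fun _ _ => c) = 0 := by
  funext x y
  simp [pd]

lemma pd_zero_iterate_aff (c d : ℂ) {k : ℕ} (hk : 2 ≤ k) : (pd 0)^[k] (aff c d) = 0 := by
  obtain ⟨k, rfl⟩ := Nat.exists_eq_add_of_le' hk
  rw [Function.iterate_add_apply]
  simp only [Function.iterate_succ_apply, Function.iterate_zero_apply]
  rw [pd_zero_aff, pd_const, pd_iterate_zero]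

lemma pd_one_iterate_aff (c d : ℂ) {j : ℕ} (hj : 1 ≤ j) : (pd 1)^[j] (aff c d) = 0 := by
  obtain ⟨j, rfl⟩ := Nat.exists_eq_add_of_le' hj
  rw [Function.iterate_add_apply, Function.iterate_one, pd_one_aff, pd_iterate_zero]

lemma star_aff_left (t c d : ℂ) (g : PlaneFn) :
    star t (aff c d) g = fun x y => (c * x + d) * g x y + I * Real.pi * t * c * pd 1 g x y := by
  funext x y
  unfold star
  -- derivatives of order two of an affine function vanish
  rw [tsum_eq_sum (s := Finset.range 2)]
  · simp [Finset.sum_range_succ, pd_zero_aff, pd_one_aff]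
    simp [aff]
    ring
  · intro k hk
    rw [Finset.mem_range, not_lt] at hk
    refine mul_eq_zero_of_right _ (Finset.sum_eq_zero fun j _ => ?_)
    rcases Nat.eq_zero_or_pos j with rfl | hj
    · rw [Nat.sub_zero, Function.iterate_zero_apply, pd_zero_iterate_aff c d hk]
      simp
    · rw [pd_one_iterate_aff c d hj, pd_iterate_zero]
      simp

lemma star_lin_left (t c : ℂ) (g : PlaneFn) :
    star t (lin c) g = fun x y => c * x * g x y + I * Real.pi * t * c * pd 1 g x y := by
  unfold lin
  rw [star_aff_left]
  simp only [add_zero]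

lemma star_lin_right (t c : ℂ) (g : PlaneFn) :
    star t g (lin c) = fun x y => c * x * g x y - I * Real.pi * t * c * pd 1 g x y := by
  funext x y
  unfold star lin
  rw [tsum_eq_sum (s := Finset.range 2)]
  · simp [Finset.sum_range_succ, pd_zero_aff, pd_one_aff]
    simp [aff]
    ring
  · intro k hk
    rw [Finset.mem_range, not_lt] at hk
    refine mul_eq_zero_of_right _ (Finset.sum_eq_zero fun j hj => ?_)
    rw [Finset.mem_range] at hj
    rcases Nat.eq_zero_or_pos (k - j) with h0 | h0
    · rw [h0, Function.iterate_zero_apply, Function.iterate_zero_apply,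
        pd_zero_iterate_aff c 0 (by omega)]
      simp
    · rw [pd_one_iterate_aff c 0 h0, pd_iterate_zero]
      simp

lemma star_zero_left (t : ℂ) (g : PlaneFn) : star t 0 g = 0 := by
  funext x y
  simp [star, pd_iterate_zero]

lemma star_zero_right (t : ℂ) (g : PlaneFn) : star t g 0 = 0 := by
  funext x y
  simp [star, pd_iterate_zero]

/-- The matrix potential `c σ¹` times the identity. -/
def linPot {N : ℕ} (c : ℂ) : MatFn N := fun k l => if k = l then lin c else 0

/-- The gauge potential `A_1 = 0`, `A_2 = c σ¹`. -/
def pot {N : ℕ} (c : ℂ) : Fin 2 → MatFn N := fun μ => if μ = 0 then 0 else linPot c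

section

variable {N : ℕ} (t c : ℂ)

@[simp] lemma pot_zero : pot c 0 = (0 : MatFn N) := rfl

@[simp] lemma pot_one : pot c 1 = (linPot c : MatFn N) := rfl

lemma vstar_zero (φ : VecFn N) : vstar t 0 φ = 0 := by
  funext i
  simp [vstar, star_zero_left]

lemma mstar_zero_left (B : MatFn N) : mstar t 0 B = 0 := by
  funext i j
  simp [mstar, star_zero_left]

lemma mstar_zero_right (B : MatFn N) : mstar t B 0 = 0 := by
  funext i j
  simp [mstar, star_zero_right]

lemma vstar_linPot (φ : VecFn N) (i : Fin N) : vstar t (linPot c) φ i = star t (lin c) (φ i) := by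
  unfold vstar linPot
  rw [Finset.sum_eq_single i]
  · simp
  · intro k _ hk
    rw [if_neg (Ne.symm hk), star_zero_left]
  · simp

lemma mstar_linPot_left (B : MatFn N) (i j : Fin N) :
    mstar t (linPot c) B i j = star t (lin c) (B i j) := by
  unfold mstar linPot
  rw [Finset.sum_eq_single i]
  · simp
  · intro k _ hk
    rw [if_neg (Ne.symm hk), star_zero_left]
  · simp

lemma mstar_linPot_right (B : MatFn N) (i j : Fin N) :
    mstar t B (linPot c) i j = star t (B i j) (lin c) := by
  unfold mstar linPot
  rw [Finset.sum_eq_single j]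
  · simp
  · intro k _ hk
    rw [if_neg hk, star_zero_right]
  · simp

lemma santi_linPot (B : MatFn N) (i j : Fin N) :
    santi t (linPot c) B i j = fun x y => 2 * (c * x * B i j x y) := by
  unfold santi
  rw [Pi.add_apply, Pi.add_apply, mstar_linPot_left, mstar_linPot_right, star_lin_left, star_lin_right]
  funext x y
  simp only [Pi.add_apply]
  ring

lemma santi_zero (B : MatFn N) : santi t 0 B = 0 := by
  unfold santi
  rw [mstar_zero_left, mstar_zero_right, add_zero]

lemma cov_pot_zero (φ : VecFn N) : cov t (pot c) 0 φ = vpd 0 φ := by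
  unfold cov
  rw [pot_zero, vstar_zero, smul_zero, sub_zero]

lemma cov_pot_one (φ : VecFn N) (i : Fin N) (x y : ℝ) : cov t (pot c) 1 φ i x y
    = pd 1 (φ i) x y - I * (c * x * φ i x y + I * Real.pi * t * c * pd 1 (φ i) x y) := by
  unfold cov
  simp only [pot_one, Pi.sub_apply, Pi.smul_apply, vstar_linPot, star_lin_left, vpd, smul_eq_mul]

lemma covAdj_pot_zero (Ψ : MatFn N) : covAdj t (pot c) 0 Ψ = mpd 0 Ψ := by
  unfold covAdj scomm
  rw [pot_zero, mstar_zero_left, mstar_zero_right, sub_zero, smul_zero, sub_zero]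

/-- For the potential `(0, c σ¹)` the equation of adjoint matter is a transport equation in `σ¹`. -/
lemma swAdj_pot (Ψ : MatFn N) (i j : Fin N) (x y : ℝ) :
    swAdj t (pot c) Ψ i j x y = 2 * Real.pi * c * x * pd 0 (Ψ i j) x y := by
  unfold swAdj
  simp only [pot_zero, pot_one, santi_zero, zero_sub, Pi.smul_apply, Pi.neg_apply, santi_linPot,
    covAdj_pot_zero, Pi.add_apply, mpd, smul_eq_mul]
  ring

lemma swFund_pot (φ : VecFn N) (i : Fin N) (x y : ℝ) : swFund t (pot c) φ i x y
    = Real.pi * c * (x * pd 0 (φ i) x y + I * Real.pi * t * pd 1 (pd 0 (φ i)) x y) := by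
  have h2 : (vpd 0 φ + cov t (pot c) 0 φ) i = (2 : ℂ) • pd 0 (φ i) := by
    rw [cov_pot_zero, Pi.add_apply, ← two_smul ℂ]; rfl
  unfold swFund
  simp only [pot_zero, pot_one, vstar_zero, zero_sub, Pi.smul_apply, Pi.neg_apply, vstar_linPot,
    h2, star_lin_left, pd_smul, smul_eq_mul]
  ring

/-- The potentials `(0, c σ¹)` are preserved: the equation reduces to `dc/dt = 2πc²`. -/
lemma swGauge_pot (κ : Fin 2) (i j : Fin N) (x y : ℝ) : swGauge t (pot c) κ i j x y
    = if κ = 1 ∧ i = j then 2 * Real.pi * c ^ 2 * x else 0 := by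
  have hz : ∀ μ, mpd μ (0 : MatFn N) = 0 := fun μ => by
    funext i j; simp [mpd]
  unfold swGauge
  simp only [pot_zero, pot_one, santi_zero, zero_sub, Pi.smul_apply, Pi.neg_apply, santi_linPot]
  have h0 : (mpd 0 (pot c 0) + fieldStrength t (pot c) 0 0 : MatFn N) = 0 := by
    unfold fieldStrength scomm
    simp [hz]
  have h1 : (mpd 0 (pot c 1) + fieldStrength t (pot c) 0 1 : MatFn N) i j
      = fun _ _ => if i = j then 2 * c else 0 := by
    unfold fieldStrength scomm
    rw [pot_zero, pot_one, mstar_zero_left, mstar_zero_right, hz]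
    funext x y
    by_cases h : i = j
    · simp [mpd, linPot, h, lin, pd_zero_aff]; ring
    · simp [mpd, linPot, h]
  fin_cases κ
  · have := congrFun (congrFun (congrFun (congrFun h0 i) j) x) y
    simp only [pot_zero, Pi.zero_apply] at this
    simp [this]
  · simp only [Fin.mk_one, h1]
    by_cases h : i = j
    · simp [h]; ring
    · simp [h]

end

lemma stdBundle_A (N : ℕ) (m : ℤ) (t : ℝ) :
    (stdBundle N m t).A = pot ((m / (2 * Real.pi * (N - m * t)) : ℂ)) := by
  funext μ k l x y
  fin_cases μ
  · simp [stdBundle, pot]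
  · by_cases h : k = l
    · simp [stdBundle, pot, linPot, lin, aff, h]; ring
    · simp [stdBundle, pot, linPot, h]

/-! ### Sections of the standard bundles -/

/-- Sections of the standard bundle in terms of functions: the star product with a plane wave is a
translation followed by multiplication by the wave. -/
lemma mem_sec_stdBundle {N : ℕ} (hN : 0 < N) {m : ℤ} {t : ℝ} {φ : VecFn N} :
    φ ∈ (stdBundle N m t).sec t ↔ (∀ i, IsSmooth (φ i)) ∧
      (∀ i x y, φ i (x + 2 * Real.pi) y = exp (I * (m * (y + 2 * Real.pi * (i + 1)) / N : ℝ)) *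
        φ i (x + Real.pi * t * (m / N)) y) ∧
      ∀ i x y, φ i x (y + 2 * Real.pi) = φ ⟨(i + 1) % N, Nat.mod_lt _ hN⟩ x y := by
  have hN' : (N : ℂ) ≠ 0 := by exact_mod_cast hN.ne'
  have h0 : ∀ i x y, (∑ k, ((stdBundle N m t).Ω 0 i k).starL t (φ k)) x y
      = exp (I * (m * (y + 2 * Real.pi * (i + 1)) / N : ℝ)) * φ i (x + Real.pi * t * (m / N)) y := by
    intro i x y
    rw [Finset.sum_eq_single i]
    · simp only [stdBundle, if_pos, Wave.starL]
      rw [Finsupp.sum_single_index (by simp)]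
      simp only [ofReal_zero, zero_mul, zero_add, mul_zero, sub_zero, ← exp_add]
      congr 2
      push_cast
      field_simp
      ring
    · intro k _ hk
      simp only [stdBundle, if_pos, if_neg hk.symm]
      funext x y
      simp [Wave.starL]
    · simp
  have h1 : ∀ i x y, (∑ k, ((stdBundle N m t).Ω 1 i k).starL t (φ k)) x y
      = φ ⟨(i + 1) % N, Nat.mod_lt _ hN⟩ x y := by
    intro i x y
    rw [Finset.sum_eq_single ⟨(i + 1) % N, Nat.mod_lt _ hN⟩]
    · simp only [stdBundle, one_ne_zero, if_false, if_pos, Wave.starL]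
      rw [Finsupp.sum_single_index (by simp)]
      simp
    · intro k _ hk
      have : ¬ ((k : ℕ) = (i + 1) % N) := fun h => hk (Fin.ext h)
      simp only [stdBundle, one_ne_zero, if_false, if_neg this]
      funext x y
      simp [Wave.starL]
    · simp
  constructor
  · intro h
    refine ⟨h.1, fun i x y => ?_, fun i x y => ?_⟩
    · rw [← h0, ← h.2 0 i]; simp [trans]
    · rw [← h1, ← h.2 1 i]; simp [trans]
  · intro h
    refine ⟨h.1, fun α i => ?_⟩
    funext x y
    fin_cases α
    · refine Eq.trans ?_ (h0 i x y).symm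
      rw [← h.2.1]; simp [trans]
    · refine Eq.trans ?_ (h1 i x y).symm
      rw [← h.2.2]; simp [trans]

section

variable {N : ℕ} {m : ℤ} {t : ℝ}

/-- The section of the standard bundle at `t` which is the Zak transform, dilated by `a`, of an
element of `HSpace m`; it is a section for every `a ≠ 0`. -/
def secFn (N : ℕ) {m : ℤ} (t a : ℝ) (h : HSpace m) : VecFn N := fun i x y =>
  zak (fam h) (a, 2 * N / (2 * N - m * t) * x, m * (y + 2 * Real.pi * (i + 1)) / (2 * Real.pi * N))

lemma secFn_smooth [NeZero m.natAbs] {a : ℝ} (ha : a ≠ 0) (h : HSpace m) (i : Fin N) :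
    IsSmooth (secFn N t a h i) := by
  have h1 : ContDiff ℝ ∞ fun z : ℝ × ℝ => (a, 2 * (N : ℝ) / (2 * N - m * t) * z.1,
      (m : ℝ) * (z.2 + 2 * Real.pi * (i + 1)) / (2 * Real.pi * N)) :=
    contDiff_const.prodMk ((contDiff_const.mul contDiff_fst).prodMk
      ((contDiff_const.mul (contDiff_snd.add contDiff_const)).div_const _))
  exact (contDiffOn_zak (finite_fam h)).comp_contDiff h1 fun z => ha

lemma secFn_mem [NeZero m.natAbs] (hN : 0 < N) (ht : 2 * (N : ℝ) - m * t ≠ 0) {a : ℝ} (ha : a ≠ 0)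
    (h : HSpace m) : secFn N t a h ∈ (stdBundle N m t).sec t := by
  have hN' : (N : ℝ) ≠ 0 := by exact_mod_cast hN.ne'
  have hpi := Real.pi_ne_zero
  refine (mem_sec_stdBundle hN).2 ⟨secFn_smooth ha h, fun i x y => ?_, fun i x y => ?_⟩
  · simp only [secFn]
    have e1 : 2 * (N : ℝ) / (2 * N - m * t) * (x + 2 * Real.pi)
        = 2 * N / (2 * N - m * t) * (x + Real.pi * t * (m / N)) + 2 * Real.pi := by
      field_simp; ring
    rw [e1, zak_add_two_pi]
    congr 2
    push_cast
    field_simp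
  · simp only [secFn]
    have hs : (fun j => fam h (j - m)) = fam h := by
      funext j
      simp only [fam]
      congr 1
      push_cast
      have := intCast_mul_natAbs m 1
      rw [mul_one] at this
      rw [this, sub_zero]
    rcases Nat.lt_or_ge (i + 1 : ℕ) N with h1 | h1
    · rw [Nat.mod_eq_of_lt h1]
      congr 3
      push_cast; ring
    · have h2 : (i + 1 : ℕ) = N := by omega
      have e : (m : ℝ) * (y + 2 * Real.pi + 2 * Real.pi * (i + 1)) / (2 * Real.pi * N)
          = m * (y + 2 * Real.pi * (((i + 1) % N : ℕ) + 1)) / (2 * Real.pi * N) + m := by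
        have h3 : (i : ℝ) + 1 = N := by exact_mod_cast h2
        rw [h2, Nat.mod_self, h3]
        push_cast
        field_simp; ring
      rw [e, zak_add_int, hs]

lemma secFn_add [NeZero m.natAbs] {a : ℝ} (ha : a ≠ 0) (h h' : HSpace m) :
    secFn N t a (h + h') = secFn N t a h + secFn N t a h' := by
  funext i x y
  refine Eq.trans ?_ (Summable.tsum_add (summable_zakTerm (finite_fam h) ha).of_norm
    (summable_zakTerm (finite_fam h') ha).of_norm)
  refine tsum_congr fun j => ?_
  simp only [zakTerm, fam, Pi.add_apply, add_apply]
  ring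

lemma secFn_smul (a : ℝ) (c : ℂ) (h : HSpace m) : secFn N t a (c • h) = c • secFn N t a h := by
  funext i x y
  refine Eq.trans ?_ tsum_mul_left
  refine tsum_congr fun j => ?_
  simp only [zakTerm, fam, Pi.smul_apply, smul_apply, smul_eq_mul]
  ring

lemma secFn_eq_zero [NeZero m.natAbs] (hN : 0 < N) (ht : 2 * (N : ℝ) - m * t ≠ 0) {a : ℝ} (ha : a ≠ 0)
    {h : HSpace m} (h0 : secFn N t a h = 0) : h = 0 := by
  have hN' : (N : ℝ) ≠ 0 := by exact_mod_cast hN.ne'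
  have hm : (m : ℝ) ≠ 0 := by exact_mod_cast Int.natAbs_ne_zero.1 (NeZero.ne m.natAbs)
  have hpi := Real.pi_ne_zero
  refine eq_zero_of_zak_eq_zero ha fun b y => ?_
  have h1 := congrFun (congrFun (congrFun h0 ⟨0, hN⟩) ((2 * N - m * t) / (2 * N) * b))
    (2 * Real.pi * N / m * y - 2 * Real.pi)
  simp only [secFn] at h1
  convert h1 using 4
  · field_simp
  · push_cast; field_simp; ring
  · rfl

lemma sec_periodic (hN : 0 < N) {φ : VecFn N} (hφ : ∀ i x y, φ i x (y + 2 * Real.pi)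
    = φ ⟨(i + 1) % N, Nat.mod_lt _ hN⟩ x y) (k : ℕ) (x y : ℝ) :
    φ ⟨0, hN⟩ x (y + 2 * Real.pi * k) = φ ⟨k % N, Nat.mod_lt _ hN⟩ x y := by
  induction k generalizing y with
  | zero => simp
  | succ k ih =>
    rw [show y + 2 * Real.pi * (k + 1 : ℕ) = (y + 2 * Real.pi) + 2 * Real.pi * k by push_cast; ring,
      ih, hφ]
    congr 2
    simp

lemma exists_secFn_eq [NeZero m.natAbs] (hN : 0 < N) (ht : 2 * (N : ℝ) - m * t ≠ 0) {a : ℝ}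
    (ha : a ≠ 0) {φ : VecFn N} (hφ : φ ∈ (stdBundle N m t).sec t) : ∃ h : HSpace m, secFn N t a h = φ := by
  have hN' : (N : ℝ) ≠ 0 := by exact_mod_cast hN.ne'
  have hm : (m : ℝ) ≠ 0 := by exact_mod_cast Int.natAbs_ne_zero.1 (NeZero.ne m.natAbs)
  have hpi := Real.pi_ne_zero
  obtain ⟨hs, h1, h2⟩ := (mem_sec_stdBundle hN).1 hφ
  -- the first component, as a function of rescaled variables, determines the others and is
  -- quasiperiodic; its inverse Zak transform is rescaled to the dilation `a`
  set ℓ : ℝ := Real.pi * (2 * N - m * t) / N with hℓ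
  set F : PlaneFn := fun u y => φ ⟨0, hN⟩ (ℓ * u) (2 * Real.pi * N / m * y - 2 * Real.pi) with hFdef
  have hF : IsZak m F := by
    refine ⟨?_, fun u y => ?_, fun u y => ?_⟩
    · have : ContDiff ℝ ∞ fun z : ℝ × ℝ => (ℓ * z.1, 2 * Real.pi * N / m * z.2 - 2 * Real.pi) :=
        (contDiff_const.mul contDiff_fst).prodMk ((contDiff_const.mul contDiff_snd).sub contDiff_const)
      exact (hs ⟨0, hN⟩).comp this
    · simp only [hFdef]
      have e1 : ℓ * (u + 1) = (ℓ * u - Real.pi * t * (m / N)) + 2 * Real.pi := by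
        rw [hℓ]; field_simp; ring
      rw [e1, h1, sub_add_cancel]
      congr 2
      have hmC : (m : ℂ) ≠ 0 := by exact_mod_cast hm
      have hNC : (N : ℂ) ≠ 0 := by exact_mod_cast hN'
      have hpC : (Real.pi : ℂ) ≠ 0 := by exact_mod_cast hpi
      push_cast
      field_simp
      ring
    · have hp := sec_periodic hN h2 N
      simp only [hFdef]
      rw [show 2 * Real.pi * N / m * (y + m) - 2 * Real.pi
        = (2 * Real.pi * N / m * y - 2 * Real.pi) + 2 * Real.pi * N by field_simp; ring, hp]
      simp
  obtain ⟨h, hh⟩ := exists_zak_eq hF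
  refine ⟨fun j => affS (Units.mk0 a ha)⁻¹ 0 (h j), ?_⟩
  funext i x y
  have e1 : φ i x y = F (x / ℓ) (m * (y + 2 * Real.pi * (i + 1)) / (2 * Real.pi * N)) := by
    have hp := sec_periodic hN h2 i x y
    have hℓ0 : ℓ ≠ 0 := by rw [hℓ]; exact div_ne_zero (mul_ne_zero hpi ht) hN'
    simp only [Nat.mod_eq_of_lt i.2] at hp
    rw [← hp]
    simp only [hFdef]
    congr 1
    · field_simp
    · field_simp; ring
  rw [e1, hh]
  unfold secFn zak
  refine tsum_congr fun j => ?_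
  simp only [zakTerm, fam, affS_apply, Units.val_inv_eq_inv_val, Units.val_mk0, add_zero, one_mul]
  rw [inv_mul_cancel_left₀ ha, hℓ]
  congr 5
  field_simp

end

section

variable {N : ℕ} {m : ℤ} {t : ℝ}

/-- The dilated Zak transform as a bijection of `HSpace m` onto the sections of the standard
bundle. -/
def secEquiv [NeZero m.natAbs] (hN : 0 < N) (ht : 2 * (N : ℝ) - m * t ≠ 0) {a : ℝ} (ha : a ≠ 0) :
    HSpace m ≃ₗ[ℂ] (stdBundle N m t).sec t :=
  LinearEquiv.ofBijective
    { toFun := fun h => ⟨secFn N t a h, secFn_mem hN ht ha h⟩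
      map_add' := fun h h' => Subtype.ext (secFn_add ha h h')
      map_smul' := fun c h => Subtype.ext (secFn_smul a c h) }
    ⟨(injective_iff_map_eq_zero _).2 fun _ h0 => secFn_eq_zero hN ht ha (congrArg Subtype.val h0),
      fun φ => (exists_secFn_eq hN ht ha φ.2).imp fun _ h => Subtype.ext h⟩

@[simp] lemma secEquiv_apply [NeZero m.natAbs] (hN : 0 < N) (ht : 2 * (N : ℝ) - m * t ≠ 0) {a : ℝ}
    (ha : a ≠ 0) (h : HSpace m) : (secEquiv hN ht ha h : VecFn N) = secFn N t a h := rfl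

lemma pd_zero_secFn [NeZero m.natAbs] {a : ℝ} (ha : a ≠ 0) (h : HSpace m) (i : Fin N) (x y : ℝ) :
    pd 0 (secFn N t a h i) x y
      = (2 * N / (2 * N - m * t) : ℝ) * (I / a) * secFn N t a (fun j => mulX (h j)) i x y := by
  have h1 := hasDerivAt_zak_comp (finite_fam h) (s := x) (hasDerivAt_const x a)
    ((hasDerivAt_id x).const_mul (2 * (N : ℝ) / (2 * N - m * t)))
    (hasDerivAt_const x (m * (y + 2 * Real.pi * (i + 1)) / (2 * Real.pi * N))) ha
  refine ((secFn_smooth ha h i).hasDerivAt_pd_zero x y).unique (h1.congr_deriv ?_)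
  simp only [id, ofReal_zero, zero_mul, zero_add, mul_one, add_zero]
  exact (mul_assoc _ _ _).symm

lemma pd_one_secFn [NeZero m.natAbs] {a : ℝ} (ha : a ≠ 0) (h : HSpace m) (i : Fin N) (x y : ℝ) :
    pd 1 (secFn N t a h i) x y = (m / (2 * Real.pi * N) : ℝ) *
      (a * secFn N t a (fun j => derX (h j)) i x y
        + I * (2 * N / (2 * N - m * t) * x : ℝ) * secFn N t a h i x y) := by
  have h1 := hasDerivAt_zak_comp (finite_fam h) (s := y) (hasDerivAt_const y a)
    (hasDerivAt_const y (2 * (N : ℝ) / (2 * N - m * t) * x))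
    ((((hasDerivAt_id y).add_const (2 * Real.pi * ((i : ℝ) + 1))).const_mul (m : ℝ)).div_const
      (2 * Real.pi * N)) ha
  refine ((secFn_smooth ha h i).hasDerivAt_pd_one x y).unique (h1.congr_deriv ?_)
  simp only [id, ofReal_zero, zero_mul, zero_add, mul_one]
  rfl

/-- The module structure on sections of the standard bundle, termwise in the Zak transform. The
dilation `κ` is the one for which `κ(j + w)` is the coordinate of the Heisenberg module. -/
lemma starR_secFn [NeZero m.natAbs] {n k : ℤ} {θ : ℝ} (hN : 0 < N) (hn : n = N - k * m)
    (ht : t = θ + k) (ht2 : 2 * (N : ℝ) - m * t ≠ 0)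
    (φ : HSpace m) (g : ℤ × ℤ) (i : Fin N) (x y : ℝ) {κ : ℝ}
    (hκ : κ = 2 * N * (N - m * t) / (m * (2 * N - m * t))) {w : ℝ}
    (hw : w = m * (y + 2 * Real.pi * (i + 1)) / (2 * Real.pi * N)) :
    Wave.starR t (Wave.starR t (secFn N t κ φ i) (Finsupp.single ((g.1 : ℝ), 0) 1))
        (Finsupp.single (0, (g.2 : ℝ)) 1) x y
      = ∑' j : ℤ, heisW n m g (j, κ * (j + w)) *
          φ (heisτ n m θ g (j, κ * (j + w))).1 (heisτ n m θ g (j, κ * (j + w))).2 *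
          exp (I * (2 * N / (2 * N - m * t) * x * (j + w) : ℝ)) := by
  have hN' : (N : ℝ) ≠ 0 := by exact_mod_cast hN.ne'
  have hm0 : m ≠ 0 := Int.natAbs_ne_zero.1 (NeZero.ne m.natAbs)
  have hm : (m : ℝ) ≠ 0 := by exact_mod_cast hm0
  have hpi := Real.pi_ne_zero
  have hNC : (N : ℂ) ≠ 0 := by exact_mod_cast hN'
  have hmC : (m : ℂ) ≠ 0 := by exact_mod_cast hm
  have hpC : (Real.pi : ℂ) ≠ 0 := by exact_mod_cast hpi
  have ht2C : 2 * (N : ℂ) - m * t ≠ 0 := by exact_mod_cast ht2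
  obtain ⟨p, q⟩ := g
  simp only [Wave.starR]
  rw [Finsupp.sum_single_index (by simp), Finsupp.sum_single_index (by simp)]
  simp only [secFn, zak]
  rw [← mul_assoc, ← tsum_mul_left, ← (Equiv.subRight p).tsum_eq]
  refine tsum_congr fun j => ?_
  simp only [zakTerm, Equiv.subRight_apply, heisW, heisτ, fam]
  have e1 : κ * (((j - p : ℤ) : ℝ) + m * (y + Real.pi * t * p + 2 * Real.pi * (i + 1)) / (2 * Real.pi * N))
      = κ * (j + w) + p * (θ - n / m) := by
    have : θ = t - k := by linarith
    rw [hw, hκ, this, hn]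
    push_cast
    field_simp
    ring
  have e2 : ((j - p : ℤ) : ZMod m.natAbs) = j - p := by push_cast; rfl
  have e3 : ∀ z : ℝ, z = m * (y + Real.pi * t * p + 2 * Real.pi * (i + 1)) / (2 * Real.pi * N) →
      κ * (((j - p : ℤ) : ℝ) + z) = κ * (j + w) + p * (θ - n / m) := fun z hz => by rw [hz, e1]
  rw [e3 _ (by ring), e2, chi_eq hm0 rfl]
  have aux : ∀ {A B C D P Q R : ℂ}, A * C * D = P * Q * R → 1 * A * (1 * D) * (B * C) = B * (P * Q) * R :=
    fun {A B C D P Q R} h => by linear_combination B * h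
  have aux' : ∀ {B P Q R S : ℂ}, S = B * (P * Q) * R → S = P * Q * B * R :=
    fun {B P Q R S} h => by rw [h]; ring
  refine aux' (aux ?_)
  simp only [← exp_add]
  have h5 := exp_two_pi_int (q * j * k + q * (i + 1))
  rw [← mul_one (exp _), ← h5, ← exp_add]
  congr 1
  rw [hw, hκ, hn]
  have hT : (t : ℂ) = θ + k := by rw [ht]; push_cast; rfl
  push_cast
  generalize (t : ℂ) = T at *
  field_simp
  ring

/-- The Heisenberg module with `m ≠ 0` is the module of sections of every standard bundle of the
same magnetic charge whose rank `n + km` is positive. -/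
lemma isSections_schwartzModule [NeZero m.natAbs] {n k : ℤ} {θ : ℝ} (hN : 0 < N)
    (hn : n = N - k * m) (ht : t = θ + k) (ht1 : (N : ℝ) - m * t ≠ 0)
    (ht2 : 2 * (N : ℝ) - m * t ≠ 0) (h : (n : ℝ) - m * θ ≠ 0) :
    (stdBundle N m t).IsSections t (schwartzModule n m θ h) := by
  have hN' : (N : ℝ) ≠ 0 := by exact_mod_cast hN.ne'
  have hm0 : m ≠ 0 := Int.natAbs_ne_zero.1 (NeZero.ne m.natAbs)
  have hm : (m : ℝ) ≠ 0 := by exact_mod_cast hm0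
  have hpi := Real.pi_ne_zero
  have hnm : (n : ℝ) - m * θ = N - m * t := by rw [hn, ht]; push_cast; ring
  set κ : ℝ := 2 * N * (N - m * t) / (m * (2 * N - m * t)) with hκ
  have hκ0 : κ ≠ 0 := by
    rw [hκ]; exact div_ne_zero (mul_ne_zero (mul_ne_zero two_ne_zero hN') ht1) (mul_ne_zero hm ht2)
  refine ⟨secEquiv hN ht2 hκ0, ?_, ?_⟩
  · have key : ∀ (φ : HSpace m) (a : Torus (-θ)) (i : Fin N) (x y : ℝ),
        HasSum (fun g : ℤ × ℤ => a.coeff g *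
          Wave.starR t (Wave.starR t (secFn N t κ φ i) (Finsupp.single ((g.1 : ℝ), 0) 1))
            (Finsupp.single (0, (g.2 : ℝ)) 1) x y) (secFn N t κ (heisAct n m θ a φ) i x y) := by
      intro φ a i x y
      set w : ℝ := m * (y + 2 * Real.pi * (i + 1)) / (2 * Real.pi * N) with hw
      set E : ℤ → ℂ := fun j => exp (I * (2 * N / (2 * N - m * t) * x * (j + w) : ℝ)) with hE
      have hEn : ∀ j, ‖E j‖ = 1 := fun j =>
        norm_exp_real_I (2 * N / (2 * N - m * t) * x * (j + w)) _ (mul_comm _ _)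
      set F : ℤ × ℤ → ℤ → ℂ := fun g j => a.coeff g * (heisW n m g (j, κ * (j + w)) *
          φ (heisτ n m θ g (j, κ * (j + w))).1 (heisτ n m θ g (j, κ * (j + w))).2 * E j) with hF
      -- lattice sums of the components are bounded uniformly in the shift
      choose K hK0 hK using fun l => schwartz_lattice_tsum_le (φ l) hκ0
      have hb : ∀ (g : ℤ × ℤ) (j : ℤ), ‖F g j‖
          ≤ ‖a.coeff g‖ * ∑ l, ‖φ l ((κ * w + g.1 * (θ - n / m)) + j * κ)‖ := by
        intro g j
        simp only [hF]
        rw [norm_mul, norm_mul, norm_mul, norm_heisW, hEn, one_mul, mul_one]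
        gcongr
        simp only [heisτ]
        rw [show κ * (j + w) + g.1 * (θ - n / m) = (κ * w + g.1 * (θ - n / m)) + j * κ by ring]
        exact Finset.single_le_sum (f := fun l => ‖φ l ((κ * w + g.1 * (θ - n / m)) + j * κ)‖)
          (fun _ _ => norm_nonneg _) (Finset.mem_univ _)
      have hsl : ∀ z : ℝ, Summable fun j : ℤ => ∑ l, ‖φ l (z + j * κ)‖ := fun z =>
        summable_sum fun l _ => schwartz_lattice_summable (φ l) hκ0 z
      -- the double series converges absolutely, so that the sum over the torus elements and
      -- the lattice sum commute
      have hs1 : ∀ g, Summable fun j => ‖F g j‖ := fun g =>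
        Summable.of_nonneg_of_le (fun _ => norm_nonneg _) (hb g) ((hsl _).mul_left _)
      have hs : Summable fun z : (ℤ × ℤ) × ℤ => F z.1 z.2 := by
        refine Summable.of_norm ((summable_prod_of_nonneg fun _ => norm_nonneg _).2 ⟨hs1, ?_⟩)
        refine Summable.of_nonneg_of_le (fun _ => tsum_nonneg fun _ => norm_nonneg _) (fun g => ?_)
          (a.norm_summable.mul_right (∑ l, K l))
        refine ((hs1 g).tsum_le_tsum (hb g) ((hsl _).mul_left _)).trans ?_
        rw [tsum_mul_left, Summable.tsum_finsetSum fun l _ => schwartz_lattice_summable (φ l) hκ0 _]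
        gcongr with l
        exact hK l _
      have h1 : ∀ g, ∑' j, F g j = a.coeff g *
          Wave.starR t (Wave.starR t (secFn N t κ φ i) (Finsupp.single ((g.1 : ℝ), 0) 1))
            (Finsupp.single (0, (g.2 : ℝ)) 1) x y := fun g => by
        rw [starR_secFn hN hn ht ht2 φ g i x y hκ hw, ← tsum_mul_left]
      have h2 : ∀ j, ∑' g, F g j = zakTerm (fam (heisAct n m θ a φ)) j
          (κ, 2 * N / (2 * N - m * t) * x, w) := fun j => by
        simp only [zakTerm, fam]
        rw [heisAct_apply]
        unfold opSum
        rw [← tsum_mul_right]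
        refine tsum_congr fun g => ?_
        simp only [hF, hE]
        ring
      have h3 : HasSum (fun g => ∑' j, F g j) (∑' g, ∑' j, F g j) := hs.prod.hasSum
      simp only [h1] at h3
      convert h3 using 1
      refine Eq.trans (tsum_congr fun j => (h2 j).symm) ?_
      refine (Summable.tsum_comm (f := fun g j => F g j) hs).trans (tsum_congr h1)
    exact key
  · have hω : (2 * N / (2 * N - m * t) : ℂ) * (I / κ) = I * m / (n - m * θ) := by
      have e : ((n : ℂ) - m * θ) = N - m * t := by exact_mod_cast hnm
      have h1 : (N : ℂ) - m * t ≠ 0 := by exact_mod_cast ht1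
      have h2 : 2 * (N : ℂ) - m * t ≠ 0 := by exact_mod_cast ht2
      have h3 : (N : ℂ) ≠ 0 := by exact_mod_cast hN'
      have h4 : (m : ℂ) ≠ 0 := by exact_mod_cast hm
      rw [e, hκ]
      push_cast
      field_simp
    have key : ∀ (μ : Fin 2) (φ : HSpace m), secFn N t κ (heisD n m θ μ φ)
        = cov t (stdBundle N m t).A μ (secFn N t κ φ) := by
      intro μ φ
      rw [stdBundle_A]
      funext i x y
      fin_cases μ
      · simp only [Fin.zero_eta]
        rw [cov_pot_zero]
        simp only [vpd]
        rw [pd_zero_secFn hκ0]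
        have e : heisD n m θ 0 φ = (I * m / (n - m * θ) : ℂ) • fun j => mulX (φ j) := rfl
        rw [e, secFn_smul, ← hω]
        simp only [Pi.smul_apply, smul_eq_mul]
        push_cast
        rfl
      · simp only [Fin.mk_one]
        rw [cov_pot_one, pd_one_secFn hκ0]
        have e : heisD n m θ 1 φ = (1 / (2 * Real.pi) : ℂ) • fun j => derX (φ j) := rfl
        rw [e, secFn_smul]
        simp only [Pi.smul_apply, smul_eq_mul]
        generalize secFn N t κ (fun j => derX (φ j)) i x y = A
        generalize secFn N t κ φ i x y = B
        have h1 : (N : ℂ) - m * t ≠ 0 := by exact_mod_cast ht1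
        have h2 : 2 * (N : ℂ) - m * t ≠ 0 := by exact_mod_cast ht2
        have h3 : (N : ℂ) ≠ 0 := by exact_mod_cast hN'
        have h4 : (m : ℂ) ≠ 0 := by exact_mod_cast hm
        have h5 : (Real.pi : ℂ) ≠ 0 := by exact_mod_cast hpi
        have hI : I * I = -1 := I_mul_I
        have hI2 : I ^ 2 = -1 := I_sq
        have hI3 : I ^ 3 = -I := I_pow_three
        rw [hκ]
        push_cast
        field_simp
        ring_nf
        simp only [hI2, hI3]
        ring
    exact fun μ φ => key μ φ

end

/-! ### Functions on the commutative torus -/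

/-- The plane wave `e^{ipσ¹} ⋆ e^{iqσ²} = e^{-iπtpq} e^{i(pσ¹ + qσ²)}`. -/
def wave (t : ℝ) (g : ℤ × ℤ) (z : ℝ × ℝ) : ℂ :=
  exp (((g.1 * z.1 + g.2 * z.2 - Real.pi * t * g.1 * g.2 : ℝ) : ℂ) * I)

lemma norm_wave (t : ℝ) (g : ℤ × ℤ) (z : ℝ × ℝ) : ‖wave t g z‖ = 1 := norm_exp_ofReal_mul_I _

/-- The function on the plane of an element of the torus. -/
def torusFn (t : ℝ) {ϑ : ℝ} (a : Torus ϑ) (z : ℝ × ℝ) : ℂ := ∑' g, a.coeff g * wave t g z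

/-- The real-linear form `c₁ dx + c₂ dy` with complex coefficients. -/
def form2 (c₁ c₂ : ℂ) : ℝ × ℝ →L[ℝ] ℂ :=
  (ContinuousLinearMap.fst ℝ ℝ ℝ).smulRight c₁ + (ContinuousLinearMap.snd ℝ ℝ ℝ).smulRight c₂

lemma form2_apply (c₁ c₂ : ℂ) (v : ℝ × ℝ) : form2 c₁ c₂ v = v.1 * c₁ + v.2 * c₂ := by
  simp [form2]

lemma norm_form2_le (c₁ c₂ : ℂ) : ‖form2 c₁ c₂‖ ≤ ‖c₁‖ + ‖c₂‖ := by
  refine ContinuousLinearMap.opNorm_le_bound _ (by positivity) fun v => ?_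
  rw [form2_apply]
  have h1 : |v.1| ≤ ‖v‖ := norm_fst_le v
  have h2 : |v.2| ≤ ‖v‖ := norm_snd_le v
  refine (norm_add_le _ _).trans ?_
  simp only [norm_mul, norm_real, Real.norm_eq_abs]
  nlinarith [mul_le_mul_of_nonneg_right h1 (norm_nonneg c₁),
    mul_le_mul_of_nonneg_right h2 (norm_nonneg c₂)]

section

variable (t : ℝ) {ϑ : ℝ}

lemma summable_wave (a : Torus ϑ) (z : ℝ × ℝ) : Summable fun g => a.coeff g * wave t g z :=
  Summable.of_norm (a.norm_summable.congr fun g => by rw [norm_mul, norm_wave, mul_one])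

lemma hasFDerivAt_wave (a : Torus ϑ) (g : ℤ × ℤ) (z : ℝ × ℝ) :
    HasFDerivAt (fun z => a.coeff g * wave t g z)
      (form2 ((Torus.der 0 a).coeff g * wave t g z) ((Torus.der 1 a).coeff g * wave t g z)) z := by
  have h1 : HasFDerivAt (fun z : ℝ × ℝ => (g.1 : ℝ) * z.1 + g.2 * z.2 - Real.pi * t * g.1 * g.2)
      ((g.1 : ℝ) • ContinuousLinearMap.fst ℝ ℝ ℝ + (g.2 : ℝ) • ContinuousLinearMap.snd ℝ ℝ ℝ) z :=
    ((hasFDerivAt_fst.const_mul _).add (hasFDerivAt_snd.const_mul _)).sub_const _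
  have h2 := (((Complex.ofRealCLM.hasFDerivAt).comp z h1).mul_const I).cexp.const_mul (a.coeff g)
  refine h2.congr_fderiv (ContinuousLinearMap.ext fun v => ?_)
  simp [form2_apply, Torus.coeff_der, Torus.idx, wave]
  ring

/-- The derivations of the torus act on functions as partial derivatives. -/
lemma hasFDerivAt_torusFn (a : Torus ϑ) (z : ℝ × ℝ) : HasFDerivAt (torusFn t a)
    (form2 (torusFn t (Torus.der 0 a) z) (torusFn t (Torus.der 1 a) z)) z := by
  have key := hasFDerivAt_tsum (𝕜 := ℝ) (f := fun g z => a.coeff g * wave t g z) (x₀ := z)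
    (f' := fun g z => form2 ((Torus.der 0 a).coeff g * wave t g z)
      ((Torus.der 1 a).coeff g * wave t g z))
    ((Torus.der 0 a).norm_summable.add (Torus.der 1 a).norm_summable)
    (fun g z => hasFDerivAt_wave t a g z)
    (fun g z => (norm_form2_le _ _).trans (by rw [norm_mul, norm_mul, norm_wave, mul_one, mul_one]))
    (summable_wave t a z) z
  refine key.congr_fderiv (HasSum.tsum_eq ?_)
  have hsm : ∀ {L : ℝ × ℝ →L[ℝ] ℝ} {c : ℤ × ℤ → ℂ} {S : ℂ}, HasSum c S →
      HasSum (fun j => L.smulRight (c j)) (L.smulRight S) := fun {L c S} h =>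
    h.mapL (ContinuousLinearMap.smulRightL ℝ (ℝ × ℝ) ℂ L)
  exact (hsm (summable_wave t _ z).hasSum).add (hsm (summable_wave t _ z).hasSum)

lemma contDiff_torusFn (a : Torus ϑ) : ContDiff ℝ ∞ (torusFn t a) := by
  rw [contDiff_infty]
  intro n
  induction n generalizing a with
  | zero =>
    exact contDiff_zero.2 (continuous_iff_continuousAt.2 fun z =>
      (hasFDerivAt_torusFn t a z).continuousAt)
  | succ n ih =>
    push_cast
    rw [contDiff_succ_iff_fderiv]
    refine ⟨fun z => (hasFDerivAt_torusFn t a z).differentiableAt, by simp, ?_⟩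
    rw [show fderiv ℝ (torusFn t a) = _ from funext fun z => (hasFDerivAt_torusFn t a z).fderiv]
    have hsm : ∀ {L : ℝ × ℝ →L[ℝ] ℝ} {c : ℝ × ℝ → ℂ}, ContDiff ℝ n c →
        ContDiff ℝ n (fun z => L.smulRight (c z)) := fun {L c} h =>
      (ContinuousLinearMap.smulRightL ℝ (ℝ × ℝ) ℂ L).contDiff.comp h
    exact (hsm (ih _)).add (hsm (ih _))

lemma pd_torusFn (a : Torus ϑ) (μ : Fin 2) (x y : ℝ) :
    pd μ (fun x y => torusFn t a (x, y)) x y = torusFn t (Torus.der μ a) (x, y) := by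
  have hs : IsSmooth fun x y => torusFn t a (x, y) := contDiff_torusFn t a
  fin_cases μ
  · refine (hs.hasDerivAt_pd_zero x y).unique ?_
    have := (hasFDerivAt_torusFn t a (x, y)).comp_hasDerivAt (f := fun x => (x, y)) x
      ((hasDerivAt_id x).prodMk (hasDerivAt_const x y))
    simpa [form2_apply, Function.comp_def] using this
  · refine (hs.hasDerivAt_pd_one x y).unique ?_
    have := (hasFDerivAt_torusFn t a (x, y)).comp_hasDerivAt (f := fun y => (x, y)) y
      ((hasDerivAt_const y x).prodMk (hasDerivAt_id y))
    simpa [form2_apply, Function.comp_def] using this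

end

/-- Smooth functions on the plane with periods `1`. -/
structure IsBiperiodic (F : PlaneFn) : Prop where
  smooth : IsSmooth F
  left : ∀ u v, F (u + 1) v = F u v
  right : ∀ u v, F u (v + 1) = F u v

lemma IsBiperiodic.bounded {F : PlaneFn} (hF : IsBiperiodic F) : ∃ K : ℝ, ∀ u v, ‖F u v‖ ≤ K := by
  -- the function is determined by its values on a compact square
  obtain ⟨K, hK⟩ := (isCompact_Icc (a := (0 : ℝ)) (b := 1)).prod (isCompact_Icc (a := (0 : ℝ)) (b := 1))
    |>.exists_bound_of_continuousOn hF.smooth.continuous.continuousOn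
  refine ⟨K, fun u v => ?_⟩
  have h1 : Function.Periodic (fun u => F u v) 1 := fun u => hF.left u v
  have h2 : Function.Periodic (F (Int.fract u)) 1 := fun v => hF.right _ v
  have e1 := h1.sub_zsmul_eq ⌊u⌋ (x := u)
  have e2 := h2.sub_zsmul_eq ⌊v⌋ (x := v)
  simp only [zsmul_eq_mul, mul_one] at e1 e2
  rw [← e1]
  change ‖F (Int.fract u) v‖ ≤ K
  rw [← e2]
  exact hK (Int.fract u, Int.fract v) ⟨⟨Int.fract_nonneg _, (Int.fract_lt_one _).le⟩,
    Int.fract_nonneg _, (Int.fract_lt_one _).le⟩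

lemma IsBiperiodic.pd {F : PlaneFn} (hF : IsBiperiodic F) (μ : Fin 2) : IsBiperiodic (pd μ F) := by
  refine ⟨hF.smooth.pd μ, fun u v => ?_, fun u v => ?_⟩
  · fin_cases μ
    · have h1 := (hF.smooth.hasDerivAt_pd_zero (u + 1) v).comp_add_const u 1
      exact (h1.congr_of_eventuallyEq (.of_forall fun u => (hF.left u v).symm)).unique
        (hF.smooth.hasDerivAt_pd_zero u v)
    · have h1 := hF.smooth.hasDerivAt_pd_one (u + 1) v
      exact (h1.congr_of_eventuallyEq (.of_forall fun v => (hF.left u v).symm)).unique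
        (hF.smooth.hasDerivAt_pd_one u v)
  · fin_cases μ
    · have h1 := hF.smooth.hasDerivAt_pd_zero u (v + 1)
      exact (h1.congr_of_eventuallyEq (.of_forall fun u => (hF.right u v).symm)).unique
        (hF.smooth.hasDerivAt_pd_zero u v)
    · have h1 := (hF.smooth.hasDerivAt_pd_one u (v + 1)).comp_add_const v 1
      exact (h1.congr_of_eventuallyEq (.of_forall fun v => (hF.right u v).symm)).unique
        (hF.smooth.hasDerivAt_pd_one u v)

/-- The partial Fourier coefficient in the second variable. -/
def fourierV (F : PlaneFn) (q : ℤ) (u : ℝ) : ℂ :=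
  ∫ v in (0 : ℝ)..1, F u v * exp (-(2 * Real.pi * I * q * v))

/-- The Fourier coefficients of a biperiodic function. -/
def fourier2 (F : PlaneFn) (g : ℤ × ℤ) : ℂ :=
  ∫ u in (0 : ℝ)..1, fourierV F g.2 u * exp (-(2 * Real.pi * I * g.1 * u))

lemma norm_exp_neg_int (q : ℤ) (x : ℝ) : ‖exp (-(2 * Real.pi * I * q * x))‖ = 1 :=
  norm_exp_real_I (-(2 * Real.pi * q * x)) _ (by push_cast; ring)

lemma fourierV_norm_le {F : PlaneFn} {K : ℝ} (hK : ∀ u v, ‖F u v‖ ≤ K) (q : ℤ) (u : ℝ) :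
    ‖fourierV F q u‖ ≤ K := by
  have := intervalIntegral.norm_integral_le_of_norm_le_const (a := (0 : ℝ)) (b := 1) (C := K)
    (f := fun v => F u v * exp (-(2 * Real.pi * I * q * v))) fun v _ => by
      rw [norm_mul, norm_exp_neg_int, mul_one]; exact hK u v
  simpa [fourierV] using this

/-- Integration by parts for Fourier coefficients of periodic functions. -/
lemma int_mul_fourier {f f' : ℝ → ℂ} (hf : ∀ x, HasDerivAt f (f' x) x) (hf' : Continuous f')
    (hp : f 1 = f 0) (q : ℤ) :
    ∫ x in (0 : ℝ)..1, f' x * exp (-(2 * Real.pi * I * q * x))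
      = 2 * Real.pi * I * (q * ∫ x in (0 : ℝ)..1, f x * exp (-(2 * Real.pi * I * q * x))) := by
  have hd : ∀ u : ℝ, HasDerivAt (fun u : ℝ => f u * exp (-(2 * Real.pi * I * q * u)))
      (f' u * exp (-(2 * Real.pi * I * q * u))
        - 2 * Real.pi * I * q * (f u * exp (-(2 * Real.pi * I * q * u)))) u := fun u => by
    have he : HasDerivAt (fun u : ℝ => exp (-(2 * Real.pi * I * q * u)))
        (exp (-(2 * Real.pi * I * q * u)) * -(2 * Real.pi * I * q * 1)) u :=
      ((Complex.ofRealCLM.hasDerivAt (x := u)).const_mul (2 * Real.pi * I * q)).neg.cexp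
    refine ((hf u).mul he).congr_deriv ?_
    ring
  have hfc : Continuous f := continuous_iff_continuousAt.2 fun x => (hf x).continuousAt
  have c1 : Continuous fun u : ℝ => f u * exp (-(2 * Real.pi * I * q * u)) := by fun_prop
  have c2 : Continuous fun u : ℝ => f' u * exp (-(2 * Real.pi * I * q * u)) := by fun_prop
  have h1 := intervalIntegral.integral_eq_sub_of_hasDerivAt (a := 0) (b := 1) (fun u _ => hd u)
    ((c2.sub (c1.const_mul _)).intervalIntegrable _ _)
  rw [intervalIntegral.integral_sub (c2.intervalIntegrable _ _) ((c1.const_mul _).intervalIntegrable _ _),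
    intervalIntegral.integral_const_mul, hp] at h1
  have h3 : exp (-(2 * Real.pi * I * q * (1 : ℝ))) = 1 := by
    convert exp_two_pi_int (-q) using 2
    push_cast; ring
  rw [h3] at h1
  simp only [ofReal_zero, mul_zero, neg_zero, exp_zero, sub_self] at h1
  linear_combination h1

lemma hasDerivAt_fourierV {F : PlaneFn} (hF : IsBiperiodic F) (q : ℤ) (u : ℝ) :
    HasDerivAt (fourierV F q) (fourierV (pd 0 F) q u) u := by
  obtain ⟨K, hK⟩ := (hF.pd 0).bounded
  have hc : ∀ {G : PlaneFn}, IsSmooth G → ∀ u : ℝ,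
      Continuous fun v : ℝ => G u v * exp (-(2 * Real.pi * I * q * v)) := fun {G} hG u => by
    have h1 : Continuous fun v : ℝ => G u v := hG.continuous.comp (continuous_const.prodMk continuous_id)
    fun_prop
  exact (intervalIntegral.hasDerivAt_integral_of_dominated_loc_of_deriv_le (bound := fun _ => K)
    Filter.univ_mem
    (.of_forall fun u => (hc hF.smooth u).aestronglyMeasurable)
    ((hc hF.smooth u).intervalIntegrable _ _)
    (hc (hF.pd 0).smooth u).aestronglyMeasurable
    (.of_forall fun v _ u _ => by
      rw [norm_mul, norm_exp_neg_int, mul_one]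
      exact hK u v)
    (by simp) (.of_forall fun v _ u _ => (hF.smooth.hasDerivAt_pd_zero u v).mul_const _)).2

lemma continuous_fourierV {F : PlaneFn} (hF : IsBiperiodic F) (q : ℤ) : Continuous (fourierV F q) :=
  continuous_iff_continuousAt.2 fun u => (hasDerivAt_fourierV hF q u).continuousAt

lemma fourierV_periodic {F : PlaneFn} (hF : IsBiperiodic F) (q : ℤ) :
    Function.Periodic (fourierV F q) 1 := fun u => by
  unfold fourierV
  simp only [hF.left]

/-- Fourier coefficients of a smooth biperiodic function are bounded, and multiplication by an index
corresponds to a derivative. -/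
lemma fourier2_mem {F : PlaneFn} (hF : IsBiperiodic F) : fourier2 F ∈ rapid := by
  refine rapid_of_closed (S := {c | ∃ F, IsBiperiodic F ∧ c = fourier2 F}) ?_ ?_ ⟨F, hF, rfl⟩
  · rintro _ ⟨F, hF, rfl⟩
    obtain ⟨K, hK⟩ := hF.bounded
    exact ⟨K, fun g => fourierV_norm_le (F := fun _ u => fourierV F g.2 u)
      (fun _ u => fourierV_norm_le hK g.2 u) g.1 0⟩
  · rintro _ ⟨F, hF, rfl⟩ μ
    have hpi : (2 * Real.pi * I : ℂ) ≠ 0 := by simp [Real.pi_ne_zero]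
    have : (fun g => (Torus.idx μ g : ℂ) * fourier2 F g)
        = (2 * Real.pi * I : ℂ)⁻¹ • fourier2 (pd μ F) := by
      funext g
      rw [Pi.smul_apply, smul_eq_mul, eq_inv_mul_iff_mul_eq₀ hpi]
      fin_cases μ
      · have := int_mul_fourier (hasDerivAt_fourierV hF g.2)
          (continuous_fourierV (hF.pd 0) g.2) (by simpa using fourierV_periodic hF g.2 0) g.1
        exact this.symm
      · have h1 : ∀ u, fourierV (pd 1 F) g.2 u = 2 * Real.pi * I * (g.2 * fourierV F g.2 u) := fun u =>
          int_mul_fourier (hF.smooth.hasDerivAt_pd_one u)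
            ((hF.pd 1).smooth.continuous.comp (continuous_const.prodMk continuous_id))
            (by simpa using hF.right u 0) g.2
        unfold fourier2
        simp only [Fin.mk_one, h1, mul_assoc, intervalIntegral.integral_const_mul]
        rfl
    rw [this]
    exact Submodule.smul_mem _ _ (Submodule.subset_span ⟨_, hF.pd μ, rfl⟩)

/-- Fourier inversion in two variables, one variable at a time. -/
lemma hasSum_fourier2 {F : PlaneFn} (hF : IsBiperiodic F) (u v : ℝ) :
    HasSum (fun g : ℤ × ℤ => fourier2 F g * exp (2 * Real.pi * I * g.1 * u) *
      exp (2 * Real.pi * I * g.2 * v)) (F u v) := by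
  have hs := rapid_norm (fourier2_mem hF)
  have hs' : Summable fun g : ℤ × ℤ => fourier2 F g * exp (2 * Real.pi * I * g.1 * u) *
      exp (2 * Real.pi * I * g.2 * v) :=
    Summable.of_norm (hs.congr fun g => by
      rw [norm_mul, norm_mul, norm_exp_two_pi, norm_exp_two_pi, mul_one, mul_one])
  have hsw : Summable fun g : ℤ × ℤ => ‖fourier2 F (g.2, g.1)‖ :=
    (Equiv.prodComm ℤ ℤ).summable_iff.2 hs
  have h1 : ∀ q : ℤ, HasSum (fun p : ℤ => fourier2 F (p, q) * exp (2 * Real.pi * I * p * u))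
      (fourierV F q u) := fun q =>
    fourier_inversion (continuous_fourierV hF q) (fourierV_periodic hF q) (hsw.prod_factor q).of_norm u
  have h2 : Summable fun q : ℤ => fourierV F q u := by
    refine Summable.of_norm (Summable.of_nonneg_of_le (fun _ => norm_nonneg _) (fun q => ?_)
      hsw.prod)
    rw [← (h1 q).tsum_eq]
    refine (norm_tsum_le_tsum_norm ?_).trans (le_of_eq (tsum_congr fun p => ?_))
    · exact (hsw.prod_factor q).congr fun p => by rw [norm_mul, norm_exp_two_pi, mul_one]
    · rw [norm_mul, norm_exp_two_pi, mul_one]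
  have h3 := fourier_inversion (f := F u)
    (hF.smooth.continuous.comp (continuous_const.prodMk continuous_id)) (hF.right u) h2 v
  have h4 : HasSum (fun g : ℤ × ℤ => fourier2 F (g.2, g.1) * exp (2 * Real.pi * I * g.2 * u) *
      exp (2 * Real.pi * I * g.1 * v)) (F u v) := by
    have hsum : Summable fun g : ℤ × ℤ => fourier2 F (g.2, g.1) * exp (2 * Real.pi * I * g.2 * u) *
      exp (2 * Real.pi * I * g.1 * v) := (Equiv.prodComm ℤ ℤ).summable_iff.2 hs'
    have h5 := hsum.hasSum.prod_fiberwise fun q => ((h1 q).mul_right (exp (2 * Real.pi * I * q * v)))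
    rw [← h5.unique h3]
    exact hsum.hasSum
  exact (Equiv.prodComm ℤ ℤ).hasSum_iff.1 h4

section

variable {t ϑ : ℝ}

lemma torusFn_add (a b : Torus ϑ) (z : ℝ × ℝ) : torusFn t (a + b) z = torusFn t a z + torusFn t b z := by
  unfold torusFn
  rw [← (summable_wave t a z).tsum_add (summable_wave t b z)]
  refine tsum_congr fun g => ?_
  rw [Torus.coeff_add, add_mul]

lemma torusFn_smul (c : ℂ) (a : Torus ϑ) (z : ℝ × ℝ) : torusFn t (c • a) z = c * torusFn t a z := by
  unfold torusFn
  rw [← tsum_mul_left]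
  refine tsum_congr fun g => ?_
  rw [Torus.coeff_smul, mul_assoc]

/-- The phase relating ordinary plane waves and ordered star products. -/
def wavePhase (t : ℝ) (g : ℤ × ℤ) : ℂ := exp (((-(Real.pi * t * g.1 * g.2) : ℝ) : ℂ) * I)

lemma norm_wavePhase (t : ℝ) (g : ℤ × ℤ) : ‖wavePhase t g‖ = 1 := norm_exp_ofReal_mul_I _

lemma wave_two_pi (t : ℝ) (g : ℤ × ℤ) (u v : ℝ) : wave t g (2 * Real.pi * u, 2 * Real.pi * v)
    = wavePhase t g * exp (2 * Real.pi * I * g.1 * u) * exp (2 * Real.pi * I * g.2 * v) := by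
  unfold wave wavePhase
  rw [← exp_add, ← exp_add]
  congr 1
  push_cast; ring

/-- Uniqueness of the coefficients of a double Fourier series, one variable at a time. -/
lemma torusFn_eq_zero {a : Torus ϑ} (h : ∀ z, torusFn t a z = 0) : a = 0 := by
  ext ⟨p, q⟩
  have hs : ∀ u v : ℝ, Summable fun g : ℤ × ℤ => (a.coeff (g.2, g.1) * wavePhase t (g.2, g.1) *
      exp (2 * Real.pi * I * g.2 * u)) * exp (2 * Real.pi * I * g.1 * v) := fun u v => by
    refine ((summable_wave t a (2 * Real.pi * u, 2 * Real.pi * v)).comp_injective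
      Prod.swap_injective).congr fun g => ?_
    simp only [Function.comp_apply, Prod.swap]
    rw [wave_two_pi]
    ring
  have hn : Summable fun g : ℤ × ℤ => ‖a.coeff (g.2, g.1) * wavePhase t (g.2, g.1)‖ := by
    refine (a.norm_summable.comp_injective Prod.swap_injective).congr fun g => ?_
    simp only [Function.comp_apply, Prod.swap]
    rw [norm_mul, norm_wavePhase, mul_one]
  have h1 : ∀ (u : ℝ) (q : ℤ), ∑' p : ℤ, a.coeff (p, q) * wavePhase t (p, q) *
      exp (2 * Real.pi * I * p * u) = 0 := by
    intro u q
    have hsu : Summable fun g : ℤ × ℤ => ‖a.coeff (g.2, g.1) * wavePhase t (g.2, g.1) *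
      exp (2 * Real.pi * I * g.2 * u)‖ := hn.congr fun g => by
        rw [norm_mul (_ * _), norm_exp_two_pi, mul_one]
    refine fourier_unique (c := fun q => ∑' p : ℤ, a.coeff (p, q) * wavePhase t (p, q) *
      exp (2 * Real.pi * I * p * u)) ?_ (fun v => ?_) q
    · exact Summable.of_nonneg_of_le (fun _ => norm_nonneg _)
        (fun q => norm_tsum_le_tsum_norm (hsu.prod_factor q)) hsu.prod
    · have h2 := h (2 * Real.pi * u, 2 * Real.pi * v)
      unfold torusFn at h2
      rw [← (Equiv.prodComm ℤ ℤ).tsum_eq] at h2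
      rw [← h2]
      have h3 : ∀ g : ℤ × ℤ, a.coeff ((Equiv.prodComm ℤ ℤ) g) * wave t ((Equiv.prodComm ℤ ℤ) g)
          (2 * Real.pi * u, 2 * Real.pi * v) = (a.coeff (g.2, g.1) * wavePhase t (g.2, g.1) *
          exp (2 * Real.pi * I * g.2 * u)) * exp (2 * Real.pi * I * g.1 * v) := fun g => by
        rw [wave_two_pi]
        simp only [Equiv.prodComm_apply, Prod.swap]
        ring
      simp only [h3]
      rw [(hs u v).tsum_prod]
      exact tsum_congr fun q => tsum_mul_right.symm
  have h4 := fourier_unique (c := fun p => a.coeff (p, q) * wavePhase t (p, q)) (hn.prod_factor q)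
    (fun u => h1 u q) p
  have h5 : wavePhase t (p, q) ≠ 0 := exp_ne_zero _
  exact (mul_eq_zero.1 h4).resolve_right h5

/-- Every smooth doubly periodic function is the function of an element of the torus. -/
lemma exists_torusFn_eq {F : PlaneFn} (hs : IsSmooth F) (h1 : ∀ x y, F (x + 2 * Real.pi) y = F x y)
    (h2 : ∀ x y, F x (y + 2 * Real.pi) = F x y) : ∃ a : Torus ϑ, ∀ x y, torusFn t a (x, y) = F x y := by
  have hpi := Real.pi_ne_zero
  have hG : IsBiperiodic fun u v => F (2 * Real.pi * u) (2 * Real.pi * v) := by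
    refine ⟨?_, fun u v => ?_, fun u v => ?_⟩
    · exact ContDiff.comp (g := fun z : ℝ × ℝ => F z.1 z.2) hs
        ((contDiff_const.mul contDiff_fst).prodMk (contDiff_const.mul contDiff_snd))
    · simp only [mul_add, mul_one, h1]
    · simp only [mul_add, mul_one, h2]
  have hmem : (fun g => (wavePhase t g)⁻¹ * fourier2 (fun u v => F (2 * Real.pi * u) (2 * Real.pi * v)) g)
      ∈ rapid := rapid_of_norm_le (fourier2_mem hG) 1 0 fun g => by
    rw [norm_mul, norm_inv, norm_wavePhase]; simp
  refine ⟨Torus.mk _ hmem, fun x y => ?_⟩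
  have h3 := hasSum_fourier2 hG (x / (2 * Real.pi)) (y / (2 * Real.pi))
  have ex : 2 * Real.pi * (x / (2 * Real.pi)) = x := by field_simp
  have ey : 2 * Real.pi * (y / (2 * Real.pi)) = y := by field_simp
  simp only [ex, ey] at h3
  unfold torusFn
  rw [← h3.tsum_eq]
  refine tsum_congr fun g => ?_
  have h4 := wave_two_pi t g (x / (2 * Real.pi)) (y / (2 * Real.pi))
  rw [ex, ey] at h4
  have h5 : wavePhase t g ≠ 0 := exp_ne_zero _
  rw [h4, Torus.coeff_mk]
  field_simp

/-- Star multiplication of plane waves reproduces the product of the noncommutative torus. -/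
lemma starR_wave {θ : ℝ} {k : ℤ} (ht : t = θ + k) (g h : ℤ × ℤ) (x y : ℝ) :
    exp (I * ((0 : ℝ) * x + (h.2 : ℝ) * y)) * (exp (I * ((h.1 : ℝ) * (x - Real.pi * t * h.2 : ℝ)
      + (0 : ℝ) * (y + Real.pi * t * 0 : ℝ))) *
      wave t g (x - Real.pi * t * h.2 - Real.pi * t * 0, y + Real.pi * t * 0 + Real.pi * t * h.1))
      = phase (-θ) g h * wave t (g + h) (x, y) := by
  unfold wave phase
  rw [← exp_add, ← exp_add, ← exp_add]
  have h5 := exp_two_pi_int (g.2 * h.1 * k)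
  rw [← mul_one (exp (-_ + _)), ← h5, ← exp_add]
  congr 1
  rw [ht]
  push_cast [Prod.fst_add, Prod.snd_add]
  ring

end

/-- The standard bundle of rank `1` and charge `0` is trivial: its sections are the doubly periodic
functions. -/
lemma mem_sec_flat {t : ℝ} {φ : VecFn 1} : φ ∈ (stdBundle 1 0 t).sec t ↔ IsSmooth (φ 0) ∧
    (∀ x y, φ 0 (x + 2 * Real.pi) y = φ 0 x y) ∧ ∀ x y, φ 0 x (y + 2 * Real.pi) = φ 0 x y := by
  rw [mem_sec_stdBundle one_pos]
  simp [Fin.forall_fin_one]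

lemma torusFn_periodic {t ϑ : ℝ} (a : Torus ϑ) (x y : ℝ) :
    torusFn t a (x + 2 * Real.pi, y) = torusFn t a (x, y) ∧
    torusFn t a (x, y + 2 * Real.pi) = torusFn t a (x, y) := by
  constructor
  · refine tsum_congr fun g => ?_
    congr 1
    unfold wave
    rw [← mul_one (exp (((_ : ℝ) : ℂ) * I)), ← exp_two_pi_int (-g.1), ← exp_add]
    congr 1
    push_cast; ring
  · refine tsum_congr fun g => ?_
    congr 1
    unfold wave
    rw [← mul_one (exp (((_ : ℝ) : ℂ) * I)), ← exp_two_pi_int (-g.2), ← exp_add]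
    congr 1
    push_cast; ring

lemma isSmooth_torusFn (t : ℝ) {ϑ : ℝ} (a : Torus ϑ) : IsSmooth fun x y => torusFn t a (x, y) :=
  contDiff_torusFn t a

/-- Fourier series as a bijection of the free module of rank one onto the doubly periodic
functions. -/
def flatEquiv (t ϑ : ℝ) : (Fin 1 → Torus ϑ) ≃ₗ[ℂ] (stdBundle 1 0 t).sec t :=
  LinearEquiv.ofBijective
    { toFun := fun φ => ⟨fun i x y => torusFn t (φ i) (x, y),
        mem_sec_flat.2 ⟨isSmooth_torusFn t (φ 0), fun x y => (torusFn_periodic (φ 0) x y).1,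
          fun x y => (torusFn_periodic (φ 0) x y).2⟩⟩
      map_add' := fun φ ψ => Subtype.ext (by funext i x y; exact torusFn_add _ _ _)
      map_smul' := fun c φ => Subtype.ext (by funext i x y; exact torusFn_smul _ _ _) }
    ⟨(injective_iff_map_eq_zero _).2 fun φ h0 => by
        funext i
        exact torusFn_eq_zero fun z => congrFun (congrFun (congrFun (congrArg Subtype.val h0) i) z.1) z.2,
      fun φ => by
        obtain ⟨h1, h2, h3⟩ := mem_sec_flat.1 φ.2
        obtain ⟨a, ha⟩ := exists_torusFn_eq (t := t) (ϑ := ϑ) h1 h2 h3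
        refine ⟨fun _ => a, Subtype.ext ?_⟩
        funext i x y
        rw [Subsingleton.elim i 0]
        exact ha x y⟩

/-- The free module of rank one is the module of sections of the trivial bundle. -/
lemma isSections_freeModule {t θ : ℝ} {k : ℤ} (ht : t = θ + k) :
    (stdBundle 1 0 t).IsSections t (freeModule 1 θ) := by
  refine ⟨flatEquiv t (-θ), ?_, ?_⟩
  · have key : ∀ (φ a : Torus (-θ)) (x y : ℝ), HasSum (fun h : ℤ × ℤ => a.coeff h *
        Wave.starR t (Wave.starR t (fun x y => torusFn t φ (x, y)) (Finsupp.single ((h.1 : ℝ), 0) 1))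
          (Finsupp.single (0, (h.2 : ℝ)) 1) x y) (torusFn t (φ * a) (x, y)) := by
      intro φ a x y
      obtain ⟨F, hF⟩ : ∃ F : ℤ × ℤ → ℤ × ℤ → ℂ, F = fun g h => φ.coeff g * a.coeff h *
        (phase (-θ) g h * wave t (g + h) (x, y)) := ⟨_, rfl⟩
      have hs : Summable fun z : (ℤ × ℤ) × (ℤ × ℤ) => F z.1 z.2 := by
        rw [hF]
        exact summable_prod_bound (a := φ.coeff) (b := a.coeff)
          (B := fun g h => phase (-θ) g h * wave t (g + h) (x, y))
          φ.norm_summable a.norm_summable (K := 1) fun g h => by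
            rw [norm_mul, norm_phase, norm_wave, one_mul]
      have h1 : ∑' g, ∑' h, F g h = torusFn t (φ * a) (x, y) := by
        rw [hF]
        exact Torus.twisted_sum φ a (f := fun g => wave t g (x, y)) (K := 1)
          fun g => (norm_wave t g (x, y)).le
      have h2 : ∑' h, ∑' g, F g h = ∑' g, ∑' h, F g h := Summable.tsum_comm (f := F) hs
      have hs' : Summable fun z : (ℤ × ℤ) × (ℤ × ℤ) => F z.2 z.1 :=
        hs.prod_symm
      rw [← h1, ← h2]
      have h3 : HasSum (fun h => ∑' g, F g h) (∑' h, ∑' g, F g h) := hs'.prod.hasSum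
      refine h3.congr_fun fun h => ?_
      simp only [Wave.starR]
      rw [Finsupp.sum_single_index (by simp), Finsupp.sum_single_index (by simp)]
      unfold torusFn
      rw [← tsum_mul_left, ← tsum_mul_left, ← tsum_mul_left]
      refine tsum_congr fun g => ?_
      have := starR_wave ht g h x y
      simp only [one_mul, hF]
      rw [← this]
      ring
    exact fun φ a i x y => key (φ i) a x y
  · have key : ∀ (μ : Fin 2) (φ : Fin 1 → Torus (-θ)),
        (fun (i : Fin 1) (x y : ℝ) => torusFn t (Torus.der μ (φ i)) (x, y))
          = cov t (stdBundle 1 0 t).A μ (fun i x y => torusFn t (φ i) (x, y)) := by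
      intro μ φ
      rw [stdBundle_A]
      funext i x y
      fin_cases μ
      · simp only [Fin.zero_eta]
        rw [cov_pot_zero]
        exact (pd_torusFn t (φ i) 0 x y).symm
      · simp only [Fin.mk_one]
        rw [cov_pot_one, pd_torusFn]
        simp
    exact fun μ φ => key μ φ

/-! ### Heisenberg modules as modules of sections -/

/-- The Heisenberg module is the module of sections of every standard bundle of the same magnetic
charge whose rank `n + km` is positive. -/
lemma isSections_heis {N : ℕ} {n m k : ℤ} {θ t : ℝ} (hN : 0 < N) (hn : n = N - k * m)
    (hcop : IsCoprime (N : ℤ) m) (ht : t = θ + k) (ht1 : (N : ℝ) - m * t ≠ 0)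
    (ht2 : 2 * (N : ℝ) - m * t ≠ 0) (h : (n : ℝ) - m * θ ≠ 0) :
    (stdBundle N m t).IsSections t (heis n m θ h) := by
  by_cases hm : m = 0
  · subst hm
    -- coprimality to `m = 0` forces rank one
    have h1 : N = 1 := by simpa using Int.isUnit_iff_natAbs_eq.1 (isCoprime_zero_right.1 hcop)
    subst h1
    obtain rfl : n = 1 := by simpa using hn
    have : heis 1 0 θ h = freeModule 1 θ := by
      unfold heis; simp
    rw [this]
    exact isSections_freeModule ht
  · have : NeZero m.natAbs := ⟨Int.natAbs_ne_zero.2 hm⟩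
    rw [heis_of_ne]
    exact isSections_schwartzModule hN hn ht ht1 ht2 h

/-! ### The standard bundles are bundles with connection -/

/-- The phases on the diagonal of the clock matrix. -/
def clock (N : ℕ) (m : ℤ) (k : Fin N) : ℂ := exp (2 * Real.pi * I * (k + 1) * m / N)

/-- The entries of the cyclic shift. -/
def cyc (N : ℕ) (k l : Fin N) : ℂ := if (l : ℕ) = (k + 1) % N then 1 else 0

section

variable {N : ℕ} {m : ℤ} {t : ℝ}

lemma fn_Ω_zero (i j : Fin N) : ((stdBundle N m t).Ω 0 i j).fn
    = fun (_ y : ℝ) => if i = j then clock N m i * exp (I * ((m / N : ℝ) * y)) else 0 := by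
  funext x y
  by_cases h : i = j
  · simp only [stdBundle, if_pos, h, Wave.fn]
    rw [Finsupp.sum_single_index (by simp)]
    simp [clock]
  · simp [stdBundle, h, Wave.fn]

lemma fn_Ω_one (i j : Fin N) : ((stdBundle N m t).Ω 1 i j).fn = fun _ _ => cyc N i j := by
  funext x y
  by_cases h : (j : ℕ) = (i + 1) % N
  · simp only [stdBundle, if_pos, h, Wave.fn, one_ne_zero, if_false, cyc]
    rw [Finsupp.sum_single_index (by simp)]
    simp
  · simp [stdBundle, h, Wave.fn, cyc]

lemma starR_Ω_zero (f : PlaneFn) (i j : Fin N) : Wave.starR t f ((stdBundle N m t).Ω 0 i j)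
    = fun (x y : ℝ) => if i = j then clock N m i * exp (I * ((m / N : ℝ) * y)) *
      f (x - Real.pi * t * (m / N)) y else 0 := by
  funext x y
  by_cases h : i = j
  · simp only [stdBundle, if_pos, h, Wave.starR]
    rw [Finsupp.sum_single_index (by simp)]
    simp [clock]
  · simp [stdBundle, h, Wave.starR]

lemma starR_Ω_one (f : PlaneFn) (i j : Fin N) : Wave.starR t f ((stdBundle N m t).Ω 1 i j)
    = fun x y => f x y * cyc N i j := by
  funext x y
  by_cases h : (j : ℕ) = (i + 1) % N
  · simp only [stdBundle, if_pos, h, Wave.starR, one_ne_zero, if_false, cyc]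
    rw [Finsupp.sum_single_index (by simp)]
    simp
  · simp [stdBundle, h, Wave.starR, cyc]

lemma starL_Ω_zero (f : PlaneFn) (i j : Fin N) : Wave.starL t ((stdBundle N m t).Ω 0 i j) f
    = fun (x y : ℝ) => if i = j then clock N m i * exp (I * ((m / N : ℝ) * y)) *
      f (x + Real.pi * t * (m / N)) y else 0 := by
  funext x y
  by_cases h : i = j
  · simp only [stdBundle, if_pos, h, Wave.starL]
    rw [Finsupp.sum_single_index (by simp)]
    simp [clock]
  · simp [stdBundle, h, Wave.starL]

lemma starL_Ω_one (f : PlaneFn) (i j : Fin N) : Wave.starL t ((stdBundle N m t).Ω 1 i j) f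
    = fun x y => cyc N i j * f x y := by
  funext x y
  by_cases h : (j : ℕ) = (i + 1) % N
  · simp only [stdBundle, if_pos, h, Wave.starL, one_ne_zero, if_false, cyc]
    rw [Finsupp.sum_single_index (by simp)]
    simp
  · simp [stdBundle, h, Wave.starL, cyc]

/-- The clock and shift matrices commute up to the phase `e^{2πim/N}`. -/
lemma clock_succ (i j : Fin N) (hj : (j : ℕ) = (i + 1) % N) :
    clock N m j = clock N m i * exp (2 * Real.pi * I * m / N) := by
  have hN : (N : ℂ) ≠ 0 := by
    have := i.pos
    exact_mod_cast this.ne'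
  unfold clock
  rcases Nat.lt_or_ge (i + 1 : ℕ) N with h1 | h1
  · rw [hj, Nat.mod_eq_of_lt h1, ← exp_add]
    congr 1
    push_cast; field_simp
  · have h2 : (i + 1 : ℕ) = N := by omega
    have h3 : (i : ℂ) + 1 = N := by exact_mod_cast h2
    rw [hj, h2, Nat.mod_self, h3]
    have h4 := exp_two_pi_int m
    have e : 2 * Real.pi * I * (N : ℂ) * m / N = 2 * Real.pi * I * m := by field_simp
    rw [e, h4, one_mul]
    simp

lemma pd_one_wave (c : ℂ) (q : ℝ) : pd 1 (fun _ y => c * exp (I * (q * y)))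
    = fun _ y : ℝ => I * q * (c * exp (I * (q * y))) := by
  funext x y
  have h : HasDerivAt (fun y : ℝ => c * exp (I * (q * y))) (c * (exp (I * (q * y)) * (I * (q * 1)))) y :=
    (((Complex.ofRealCLM.hasDerivAt (x := y)).const_mul (q : ℂ)).const_mul I).cexp.const_mul c
  simp only [pd, one_ne_zero, if_false]
  rw [h.deriv]
  ring

lemma trans_zero_fn (α : Fin 2) : trans α (0 : PlaneFn) = 0 := by
  funext x y
  simp [trans]

/-- The cocycle condition is the commutation relation of clock and shift matrices, twisted by the
star product; the potential changes by the constant `2πc` under the first translation, which is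
compensated by the derivative of `Ω_1`. -/
lemma isBundle_stdBundle (ht1 : (N : ℝ) - m * t ≠ 0) : (stdBundle N m t).IsBundle t := by
  constructor
  · intro i j
    have hN : (N : ℂ) ≠ 0 := by
      have := i.pos
      exact_mod_cast this.ne'
    funext x y
    rw [Finset.sum_apply, Finset.sum_apply, Finset.sum_apply, Finset.sum_apply]
    simp only [starR_Ω_zero, starR_Ω_one, fn_Ω_zero, fn_Ω_one, trans, one_ne_zero, if_false, if_pos,
      ite_mul, zero_mul, Finset.sum_ite_eq, Finset.sum_ite_eq', Finset.mem_univ]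
    by_cases h : (j : ℕ) = (i + 1) % N
    · rw [clock_succ i j h]
      simp only [cyc, h, if_pos, mul_one]
      rw [mul_assoc, ← exp_add]
      congr 2
      push_cast
      field_simp
      ring
    · simp [cyc, h]
  · have hc : ∀ α i j, pd 0 ((stdBundle N m t).Ωfn α i j) = 0 := by
      intro α i j
      unfold Bundle.Ωfn
      funext x y
      fin_cases α
      · simp only [Fin.zero_eta, fn_Ω_zero]
        simp [pd]
      · simp only [Fin.mk_one, fn_Ω_one]
        simp [pd]
    intro α μ
    rw [stdBundle_A]
    set c : ℂ := m / (2 * Real.pi * (N - m * t)) with hcdef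
    fin_cases μ
    · simp only [Fin.zero_eta, pot_zero]
      have : (fun i j : Fin N => trans α ((0 : MatFn N) i j)) = 0 := by
        funext i j; exact trans_zero_fn α
      rw [this, mstar_zero_left, mstar_zero_right]
      funext i j
      simp [mpd, hc]
    · simp only [Fin.mk_one, pot_one]
      funext i j
      have hN : (N : ℂ) ≠ 0 := by
        have := i.pos
        exact_mod_cast this.ne'
      have h1 : (N : ℂ) - m * t ≠ 0 := by exact_mod_cast ht1
      have hpi : (Real.pi : ℂ) ≠ 0 := by exact_mod_cast Real.pi_ne_zero
      have hL : mstar t (fun i j => trans α (linPot c i j)) ((stdBundle N m t).Ωfn α) i j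
          = star t (aff c (if α = 0 then c * (2 * Real.pi) else 0)) ((stdBundle N m t).Ωfn α i j) := by
        unfold mstar
        rw [Finset.sum_eq_single i]
        · congr 1
          funext x y
          fin_cases α
          · simp [linPot, trans, lin, aff]; ring
          · simp [linPot, trans, lin, aff]
        · intro k _ hk
          have : trans α (linPot c i k) = 0 := by
            rw [linPot, if_neg hk.symm, trans_zero_fn]
          change star t (trans α (linPot c i k)) _ = 0
          rw [this, star_zero_left]
        · simp
      simp only [Pi.sub_apply, Pi.smul_apply, Pi.neg_apply]
      rw [hL, mstar_linPot_right, star_aff_left, star_lin_right]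
      funext x y
      simp only [Pi.sub_apply, Pi.smul_apply, Pi.neg_apply, mpd, smul_eq_mul]
      unfold Bundle.Ωfn
      fin_cases α
      · simp only [Fin.zero_eta, fn_Ω_zero]
        by_cases hij : i = j
        · simp only [hij, if_pos, pd_one_wave]
          generalize clock N m j * exp (I * ((m / N : ℝ) * y)) = g
          rw [hcdef]
          have hI : I ^ 2 = -1 := I_sq
          push_cast
          field_simp
          ring_nf
          simp only [hI]
          ring
        · simp [hij, pd]
      · simp only [Fin.mk_one, fn_Ω_one]
        simp [pd]

end

/-! ### The Seiberg-Witten map between standard bundles -/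

/-- The poles `t = N/m`, `t = 2N/m` of the Seiberg-Witten map. -/
def poles (N : ℕ) (m : ℤ) : Finset ℂ := if m = 0 then ∅ else {(N / m : ℂ), (2 * N / m : ℂ)}

/-- The coefficient of the standard constant curvature potential. -/
def stdCoef (N : ℕ) (m : ℤ) (t : ℂ) : ℂ := m / (2 * Real.pi * (N - m * t))

section

variable {N : ℕ} {m : ℤ}

lemma not_mem_poles (hN : 0 < N) {t : ℂ} :
    t ∉ poles N m ↔ (N : ℂ) - m * t ≠ 0 ∧ 2 * (N : ℂ) - m * t ≠ 0 := by
  unfold poles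
  have hN' : (N : ℂ) ≠ 0 := by exact_mod_cast hN.ne'
  split_ifs with h
  · simp [h, hN']
  · have hm : (m : ℂ) ≠ 0 := by exact_mod_cast h
    rw [Finset.mem_insert, Finset.mem_singleton, not_or, eq_div_iff hm, eq_div_iff hm, sub_ne_zero,
      sub_ne_zero, mul_comm t, ne_comm, ne_comm (a := 2 * (N : ℂ))]

lemma not_mem_poles_real (hN : 0 < N) {t : ℝ} :
    (t : ℂ) ∉ poles N m ↔ (N : ℝ) - m * t ≠ 0 ∧ 2 * (N : ℝ) - m * t ≠ 0 := by
  rw [not_mem_poles hN]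
  norm_cast

lemma hasDerivAt_stdCoef {t : ℂ} (ht : (N : ℂ) - m * t ≠ 0) :
    HasDerivAt (stdCoef N m) (2 * Real.pi * stdCoef N m t ^ 2) t := by
  have hpi : (Real.pi : ℂ) ≠ 0 := by exact_mod_cast Real.pi_ne_zero
  have h1 : HasDerivAt (fun t : ℂ => 2 * Real.pi * (N - m * t)) (2 * Real.pi * -(m * 1)) t :=
    (((hasDerivAt_id t).const_mul (m : ℂ)).const_sub (N : ℂ)).const_mul _
  have h2 := (hasDerivAt_const t (m : ℂ)).div h1 (mul_ne_zero (mul_ne_zero two_ne_zero hpi) ht)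
  refine h2.congr_deriv ?_
  unfold stdCoef
  field_simp
  ring

lemma hasDerivAt_pot {t : ℂ} (ht : (N : ℂ) - m * t ≠ 0) (κ : Fin 2) (i j : Fin N) (x y : ℝ) :
    HasDerivAt (fun t => pot (stdCoef N m t) κ i j x y) (swGauge t (pot (stdCoef N m t)) κ i j x y) t := by
  rw [swGauge_pot]
  by_cases h : κ = 1 ∧ i = j
  · obtain ⟨rfl, rfl⟩ := h
    simp only [pot_one, linPot, if_pos, lin, aff, add_zero, and_self]
    exact (hasDerivAt_stdCoef ht).mul_const _
  · rw [if_neg h]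
    have : ∀ c : ℂ, pot c κ i j x y = 0 := fun c => by
      fin_cases κ
      · rfl
      · have hij : i ≠ j := fun hij => h ⟨rfl, hij⟩
        simp [linPot, hij]
    simp only [this]
    exact hasDerivAt_const _ _

lemma smooth_Ωfn (t : ℝ) (α : Fin 2) (i j : Fin N) : IsSmooth ((stdBundle N m t).Ωfn α i j) := by
  unfold Bundle.Ωfn
  fin_cases α
  · simp only [Fin.zero_eta, fn_Ω_zero]
    by_cases h : i = j
    · simp only [h, if_pos]
      exact contDiff_const.mul (contDiff_const.mul (contDiff_const.mul
        (ofRealCLM.contDiff.comp contDiff_snd))).cexp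
    · simp only [h, if_false]
      exact contDiff_const
  · simp only [Fin.mk_one, fn_Ω_one]
    exact contDiff_const

lemma pd_zero_Ωfn (t : ℝ) (α : Fin 2) (i j : Fin N) : pd 0 ((stdBundle N m t).Ωfn α i j) = 0 := by
  unfold Bundle.Ωfn
  funext x y
  fin_cases α
  · simp only [Fin.zero_eta, fn_Ω_zero]
    simp [pd]
  · simp only [Fin.mk_one, fn_Ω_one]
    simp [pd]

/-- The standard potentials with a constant coefficient matrix solve the Seiberg-Witten equations,
since the transition matrices do not depend on `σ¹`. -/
lemma gaugeSolution_std (hN : 0 < N) (t₀ : ℝ) : GaugeSolution (poles N m)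
    (fun t => (pot (stdCoef N m t) : Fin 2 → MatFn N)) (fun _ => (stdBundle N m t₀).Ωfn) where
  poly := by
    refine ⟨1, fun t _ μ i j => ?_⟩
    by_cases h : μ = 1 ∧ i = j
    · obtain ⟨rfl, rfl⟩ := h
      refine ⟨MvPolynomial.C (stdCoef N m t) * MvPolynomial.X 0, ?_, fun x y => ?_⟩
      · refine (MvPolynomial.totalDegree_mul _ _).trans ?_
        rw [MvPolynomial.totalDegree_C, MvPolynomial.totalDegree_X]
      · simp [linPot, lin, aff]
    · refine ⟨0, by simp, fun x y => ?_⟩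
      rw [map_zero]
      fin_cases μ
      · rfl
      · have hij : i ≠ j := fun hij => h ⟨rfl, hij⟩
        simp [linPot, hij]
  odeA t ht κ i j x y := hasDerivAt_pot ((not_mem_poles hN).1 ht).1 κ i j x y
  smooth α i j := (ContDiff.comp (g := fun z : ℝ × ℝ => (stdBundle N m t₀).Ωfn α i j z.1 z.2)
    (smooth_Ωfn t₀ α i j) contDiff_snd).contDiffOn
  odeΩ t _ α i j x y := by
    rw [swAdj_pot, pd_zero_Ωfn]
    simpa using hasDerivAt_const t _

/-- The covariant term `0`. -/
def zeroTerm (P : Finset ℂ) : CovTerm P := ⟨∅, 0, fun _ => analyticOnNhd_const⟩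

/-! ### Matter in the adjoint representation -/

/-- Adjoint sections of the standard bundle in terms of functions. After removal of a common plane
wave, the parameter `t` enters only through the period `2π(N - mt)/N` in the first variable. -/
lemma mem_adjSec_stdBundle {t : ℝ} {Ψ : MatFn N} : Ψ ∈ (stdBundle N m t).adjSec t ↔
    (∀ i j, IsSmooth (Ψ i j)) ∧
      (∀ i j x y, clock N m j * Ψ i j (x + 2 * Real.pi * (N - m * t) / N) y = clock N m i * Ψ i j x y) ∧
      ∀ i j x y, ∑ k, Ψ i k x (y + 2 * Real.pi) * cyc N k j = ∑ k, cyc N i k * Ψ k j x y := by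
  have h0 : ∀ i j, ((∑ k, Wave.starR t (trans 0 (Ψ i k)) ((stdBundle N m t).Ω 0 k j))
      = ∑ k, ((stdBundle N m t).Ω 0 i k).starL t (Ψ k j)) ↔ ∀ x y,
      clock N m j * Ψ i j (x + 2 * Real.pi * (N - m * t) / N) y = clock N m i * Ψ i j x y := by
    intro i j
    have hN : (N : ℝ) ≠ 0 := by
      have := i.pos
      exact_mod_cast this.ne'
    -- both sides carry the plane wave `e^{imσ²/N}`, and the translations by `±πtm/N` from the
    -- two sides combine with the shift by `2π`
    have e : ∀ x y, (∑ k, Wave.starR t (trans 0 (Ψ i k)) ((stdBundle N m t).Ω 0 k j)) x y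
        = exp (I * ((m / N : ℝ) * y)) * (clock N m j *
          Ψ i j ((x + Real.pi * t * (m / N)) + 2 * Real.pi * (N - m * t) / N) y) := fun x y => by
      simp only [Finset.sum_apply, starR_Ω_zero, trans, if_pos, Finset.sum_ite_eq', Finset.mem_univ]
      rw [show x - Real.pi * t * (m / N) + 2 * Real.pi
        = (x + Real.pi * t * (m / N)) + 2 * Real.pi * (N - m * t) / N by field_simp; ring]
      ring
    have e' : ∀ x y, (∑ k, ((stdBundle N m t).Ω 0 i k).starL t (Ψ k j)) x y
        = exp (I * ((m / N : ℝ) * y)) * (clock N m i * Ψ i j (x + Real.pi * t * (m / N)) y) :=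
      fun x y => by
        simp only [Finset.sum_apply, starL_Ω_zero, Finset.sum_ite_eq, Finset.mem_univ, if_pos]
        ring
    constructor
    · intro h x y
      have h1 := congrFun (congrFun h (x - Real.pi * t * (m / N))) y
      rw [e, e', sub_add_cancel] at h1
      exact mul_left_cancel₀ (exp_ne_zero _) h1
    · intro h
      funext x y
      rw [e, e', h]
  have h1 : ∀ i j, ((∑ k, Wave.starR t (trans 1 (Ψ i k)) ((stdBundle N m t).Ω 1 k j))
      = ∑ k, ((stdBundle N m t).Ω 1 i k).starL t (Ψ k j)) ↔ ∀ x y,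
      ∑ k, Ψ i k x (y + 2 * Real.pi) * cyc N k j = ∑ k, cyc N i k * Ψ k j x y := by
    intro i j
    simp only [funext_iff, Finset.sum_apply, starR_Ω_one, starL_Ω_one, trans, one_ne_zero, if_false]
  constructor
  · intro h
    exact ⟨h.1, fun i j => (h0 i j).1 (h.2 0 i j), fun i j => (h1 i j).1 (h.2 1 i j)⟩
  · intro h
    refine ⟨h.1, fun α i j => ?_⟩
    fin_cases α
    · exact (h0 i j).2 (h.2.1 i j)
    · exact (h1 i j).2 (h.2.2 i j)

/-- Rescaling of the first coordinate. -/
def scaleX (r : ℝ) : MatFn N →ₗ[ℂ] MatFn N where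
  toFun Ψ := fun i j x y => Ψ i j (r * x) y
  map_add' _ _ := rfl
  map_smul' _ _ := rfl

lemma scaleX_mem {t t' : ℝ} (ht' : (N : ℝ) - m * t' ≠ 0) {Ψ : MatFn N}
    (hΨ : Ψ ∈ (stdBundle N m t).adjSec t) :
    scaleX ((N - m * t) / (N - m * t')) Ψ ∈ (stdBundle N m t').adjSec t' := by
  rw [mem_adjSec_stdBundle] at hΨ ⊢
  obtain ⟨h1, h2, h3⟩ := hΨ
  refine ⟨fun i j => ?_, fun i j x y => ?_, fun i j x y => h3 i j _ y⟩
  · have : ContDiff ℝ ∞ fun z : ℝ × ℝ => (((N : ℝ) - m * t) / (N - m * t') * z.1, z.2) :=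
      (contDiff_const.mul contDiff_fst).prodMk contDiff_snd
    exact (h1 i j).comp this
  · simp only [scaleX, LinearMap.coe_mk, AddHom.coe_mk]
    rw [← h2 i j]
    congr 2
    field_simp

/-- The Seiberg-Witten map of adjoint matter: the period in the first variable is proportional to `N
- mt`, and the map rescales this variable accordingly. -/
def adjEquiv {t t' : ℝ} (ht : (N : ℝ) - m * t ≠ 0) (ht' : (N : ℝ) - m * t' ≠ 0) :
    (stdBundle N m t).adjSec t ≃ₗ[ℂ] (stdBundle N m t').adjSec t' :=
  LinearEquiv.ofLinearMap
    ((scaleX ((N - m * t) / (N - m * t'))).restrict fun _ h => scaleX_mem ht' h)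
    ((scaleX ((N - m * t') / (N - m * t))).restrict fun _ h => scaleX_mem ht h)
    (by
      ext Ψ : 2
      funext i j x y
      change Ψ.1 i j (_ * (_ * x)) y = Ψ.1 i j x y
      field_simp)
    (by
      ext Ψ : 2
      funext i j x y
      change Ψ.1 i j (_ * (_ * x)) y = Ψ.1 i j x y
      field_simp)

/-- The rescaled sections solve the transport equation of adjoint matter, without covariant terms.
-/
lemma adjSolution_std (hN : 0 < N) {t₀ : ℝ} {Ψ : MatFn N}
    (hΨ : ∀ i j, IsSmooth (Ψ i j)) : AdjSolution (poles N m)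
      (fun t => pot (stdCoef N m t)) (zeroTerm _)
      (fun t => scaleX ((N - m * t₀) / (N - m * t)) Ψ) where
  smooth i j := by
    have h1 : ContDiffOn ℝ ∞ (fun z : ℝ × ℝ × ℝ => (((N : ℝ) - m * t₀) / (N - m * z.1) * z.2.1, z.2.2))
        {z | (z.1 : ℂ) ∉ poles N m} := by
      refine ContDiffOn.prodMk (ContDiffOn.mul (ContDiffOn.div contDiffOn_const ?_ fun z hz => ?_) ?_) ?_
      · exact (contDiff_const.sub (contDiff_const.mul contDiff_fst)).contDiffOn
      · exact ((not_mem_poles_real hN).1 hz).1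
      · exact (contDiff_fst.comp contDiff_snd).contDiffOn
      · exact (contDiff_snd.comp contDiff_snd).contDiffOn
    exact ContDiff.comp_contDiffOn (g := fun z : ℝ × ℝ => Ψ i j z.1 z.2) (hΨ i j) h1
  ode t ht i j x y := by
    obtain ⟨h1, -⟩ := (not_mem_poles_real hN).1 ht
    have h1' : (N : ℂ) - m * t ≠ 0 := by exact_mod_cast h1
    have hpi : (Real.pi : ℂ) ≠ 0 := by exact_mod_cast Real.pi_ne_zero
    have hs : HasDerivAt (fun t : ℝ => ((N : ℝ) - m * t₀) / (N - m * t) * x)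
        ((N - m * t₀) * m / (N - m * t) ^ 2 * x) t := by
      have h2 : HasDerivAt (fun t : ℝ => (N : ℝ) - m * t) (-(m * 1)) t :=
        ((hasDerivAt_id t).const_mul (m : ℝ)).const_sub (N : ℝ)
      refine (((hasDerivAt_const t ((N : ℝ) - m * t₀)).div h2 h1).mul_const x).congr_deriv ?_
      ring
    have hp : pd 0 (scaleX ((N - m * t₀) / (N - m * t)) Ψ i j) x y
        = ((N - m * t₀) / (N - m * t) : ℝ) * pd 0 (Ψ i j) ((N - m * t₀) / (N - m * t) * x) y := by
      have h3 := ((hΨ i j).hasDerivAt_pd_zero ((N - m * t₀) / (N - m * t) * x) y).scomp x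
        ((hasDerivAt_id x).const_mul ((N - m * t₀) / (N - m * t)))
      have h4 : HasDerivAt (fun x => scaleX ((N - m * t₀) / (N - m * t)) Ψ i j x y)
        ((((N - m * t₀) / (N - m * t)) * 1 : ℝ) • pd 0 (Ψ i j) ((N - m * t₀) / (N - m * t) * x) y) x := h3
      simp only [pd, if_pos] at h4 ⊢
      rw [h4.deriv, mul_one, Complex.real_smul]
    have h5 := ((hΨ i j).hasDerivAt_pd_zero ((N - m * t₀) / (N - m * t) * x) y).scomp t hs
    refine HasDerivAt.congr_deriv (f := fun t => scaleX ((N - m * t₀) / (N - m * t)) Ψ i j x y) h5 ?_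
    simp only [CovTerm.adj, zeroTerm, Finset.sum_empty, smul_zero, sub_zero]
    rw [swAdj_pot, hp, Complex.real_smul]
    unfold stdCoef
    push_cast
    field_simp

end

/-! ### Matter in the fundamental representation -/

section

variable {N : ℕ} {m : ℤ}

/-- The dilation `|N - mt|^{1/2} / (2N - mt)` of the Zak transform along the Seiberg-Witten flow;
it is at the same time the amplitude of the section. -/
def dil (N : ℕ) (m : ℤ) (t : ℝ) : ℝ := √|N - m * t| / (2 * N - m * t)

lemma dil_ne_zero {t : ℝ} (h1 : (N : ℝ) - m * t ≠ 0) (h2 : 2 * (N : ℝ) - m * t ≠ 0) : dil N m t ≠ 0 :=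
  div_ne_zero (Real.sqrt_ne_zero'.2 (abs_pos.2 h1)) h2

lemma contDiffAt_dil {t : ℝ} (h1 : (N : ℝ) - m * t ≠ 0) (h2 : 2 * (N : ℝ) - m * t ≠ 0) :
    ContDiffAt ℝ ∞ (dil N m) t := by
  have e1 : ContDiffAt ℝ ∞ (fun t : ℝ => (N : ℝ) - m * t) t := by fun_prop
  have e2 : ContDiffAt ℝ ∞ (fun t : ℝ => 2 * (N : ℝ) - m * t) t := by fun_prop
  have e3 : ContDiffAt ℝ ∞ (fun t : ℝ => |(N : ℝ) - m * t|) t :=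
    ContDiffAt.comp (g := fun x : ℝ => |x|) t (contDiffAt_abs h1) e1
  exact (e3.sqrt (abs_ne_zero.2 h1)).div e2 h2

lemma hasDerivAt_dil {t : ℝ} (h1 : (N : ℝ) - m * t ≠ 0) (h2 : 2 * (N : ℝ) - m * t ≠ 0) :
    HasDerivAt (dil N m) (dil N m t * (-(m ^ 2 * t) / (2 * (N - m * t) * (2 * N - m * t)))) t := by
  have e1 : HasDerivAt (fun t : ℝ => (N : ℝ) - m * t) (-m) t := by
    simpa using ((hasDerivAt_id t).const_mul (m : ℝ)).const_sub (N : ℝ)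
  have e2 : HasDerivAt (fun t : ℝ => 2 * (N : ℝ) - m * t) (-m) t := by
    simpa using ((hasDerivAt_id t).const_mul (m : ℝ)).const_sub (2 * (N : ℝ))
  have e3 : HasDerivAt (fun t : ℝ => |(N : ℝ) - m * t|) (SignType.sign ((N : ℝ) - m * t) * (-m)) t :=
    HasDerivAt.comp (h₂ := fun x : ℝ => |x|) t (hasDerivAt_abs h1) e1
  have h3 : 0 < |(N : ℝ) - m * t| := abs_pos.2 h1
  refine ((e3.sqrt h3.ne').div e2 h2).congr_deriv ?_
  unfold dil
  have hs : √|(N : ℝ) - m * t| ≠ 0 := Real.sqrt_ne_zero'.2 h3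
  have hq : √|(N : ℝ) - m * t| ^ 2 = |(N : ℝ) - m * t| := Real.sq_sqrt h3.le
  have hsgn : (SignType.sign ((N : ℝ) - m * t) : ℝ) * (N - m * t) = |(N : ℝ) - m * t| := sign_mul_self _
  rw [← hq] at hsgn
  set s := √|(N : ℝ) - m * t|
  set g : ℝ := (SignType.sign ((N : ℝ) - m * t) : ℝ)
  have hg : g = s ^ 2 / (N - m * t) := by rw [eq_div_iff h1]; exact hsgn
  rw [hg]
  field_simp
  ring

lemma mulX_derX (f : 𝓢(ℝ, ℂ)) : derX (mulX f) = f + mulX (derX f) := by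
  ext x
  have h := (Complex.ofRealCLM.hasDerivAt (x := x)).mul (f.differentiableAt.hasDerivAt (x := x))
  have e : ⇑(mulX f) = fun x : ℝ => (x : ℂ) * f x := by funext x; simp
  rw [derX_apply, e]
  refine h.deriv.trans ?_
  simp

/-- The Seiberg-Witten flow of a section: a fixed element of `HSpace m`, whose Zak transform is
dilated and multiplied by `dil N m t`. Both sides of the equation are combinations of the Zak
transforms of `h`, `xh` and `xh'`, with equal coefficients. -/
lemma fundSolution_secFn [NeZero m.natAbs] (hN : 0 < N) (r : ℂ) (h : HSpace m) :
    FundSolution (poles N m) (fun t => (pot (stdCoef N m t) : Fin 2 → MatFn N)) (zeroTerm _)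
      (fun t => (r * dil N m t) • secFn N t (dil N m t) h) where
  smooth i := by
    have hd : ContDiffOn ℝ ∞ (fun z : ℝ × ℝ × ℝ => dil N m z.1) {z | (z.1 : ℂ) ∉ poles N m} := by
      intro z hz
      obtain ⟨h1, h2⟩ := (not_mem_poles_real hN).1 hz
      exact (ContDiffAt.comp z (contDiffAt_dil h1 h2) contDiffAt_fst).contDiffWithinAt
    have h1 : ContDiffOn ℝ ∞ (fun z : ℝ × ℝ × ℝ => (dil N m z.1, 2 * (N : ℝ) / (2 * N - m * z.1) * z.2.1,
        (m : ℝ) * (z.2.2 + 2 * Real.pi * (i + 1)) / (2 * Real.pi * N)))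
        {z | (z.1 : ℂ) ∉ poles N m} := by
      refine hd.prodMk (ContDiffOn.prodMk (ContDiffOn.mul (ContDiffOn.div contDiffOn_const ?_
        fun z hz => ?_) ?_) ?_)
      · exact (contDiff_const.sub (contDiff_const.mul contDiff_fst)).contDiffOn
      · exact ((not_mem_poles_real hN).1 hz).2
      · exact (contDiff_fst.comp contDiff_snd).contDiffOn
      · exact ((contDiff_const.mul ((contDiff_snd.comp contDiff_snd).add contDiff_const)).div_const
          _).contDiffOn
    refine ContDiffOn.mul (contDiffOn_const.mul (ofRealCLM.contDiff.comp_contDiffOn hd)) ?_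
    refine (contDiffOn_zak (finite_fam h)).comp h1 fun z hz => ?_
    obtain ⟨h1, h2⟩ := (not_mem_poles_real hN).1 hz
    exact dil_ne_zero h1 h2
  ode t ht i x y := by
    obtain ⟨h1, h2⟩ := (not_mem_poles_real hN).1 ht
    have h1' : (N : ℂ) - m * t ≠ 0 := by exact_mod_cast h1
    have h2' : 2 * (N : ℂ) - m * t ≠ 0 := by exact_mod_cast h2
    have hN' : (N : ℂ) ≠ 0 := by exact_mod_cast hN.ne'
    have hpi : (Real.pi : ℂ) ≠ 0 := by exact_mod_cast Real.pi_ne_zero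
    have hd0 := dil_ne_zero h1 h2
    have hd0' : (dil N m t : ℂ) ≠ 0 := by exact_mod_cast hd0
    have hω : HasDerivAt (fun t : ℝ => 2 * (N : ℝ) / (2 * N - m * t) * x)
        (2 * N * m / (2 * N - m * t) ^ 2 * x) t := by
      have e2 : HasDerivAt (fun t : ℝ => 2 * (N : ℝ) - m * t) (-m) t := by
        simpa using ((hasDerivAt_id t).const_mul (m : ℝ)).const_sub (2 * (N : ℝ))
      refine (((hasDerivAt_const t (2 * (N : ℝ))).div e2 h2).mul_const x).congr_deriv ?_
      ring
    have hz := hasDerivAt_zak_comp (finite_fam h) (hasDerivAt_dil h1 h2) hω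
      (hasDerivAt_const t ((m : ℝ) * (y + 2 * Real.pi * (i + 1)) / (2 * Real.pi * N))) hd0
    have hr := ((hasDerivAt_dil h1 h2).ofReal_comp.const_mul r).mul hz
    refine HasDerivAt.congr_deriv (f := fun t => ((r * dil N m t) • secFn N t (dil N m t) h) i x y)
      hr ?_
    simp only [CovTerm.fund, zeroTerm, Finset.sum_empty, smul_zero, sub_zero]
    rw [swFund_pot]
    have hp0 : pd 0 (((r * dil N m t : ℂ) • secFn N t (dil N m t) h) i)
        = (r * dil N m t * ((2 * N / (2 * N - m * t) : ℝ) * (I / dil N m t)) : ℂ) •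
          secFn N t (dil N m t) (fun j => mulX (h j)) i := by
      rw [Pi.smul_apply, pd_smul]
      funext x y
      simp only [Pi.smul_apply, smul_eq_mul]
      rw [pd_zero_secFn hd0]
      ring
    -- the mixed derivative brings in `(xh)' = h + xh'`
    have hsum : secFn N t (dil N m t) (fun j => derX (mulX (h j))) i x y
        = secFn N t (dil N m t) h i x y + secFn N t (dil N m t) (fun j => mulX (derX (h j))) i x y := by
      have : (fun j => derX (mulX (h j))) = h + fun j => mulX (derX (h j)) := by
        funext j; exact mulX_derX _
      rw [this, secFn_add hd0]; rfl
    rw [hp0, pd_smul]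
    simp only [Pi.smul_apply, smul_eq_mul]
    rw [pd_one_secFn hd0, hsum]
    have e1 : zak (fam h) (dil N m t, 2 * (N : ℝ) / (2 * N - m * t) * x,
        (m : ℝ) * (y + 2 * Real.pi * (i + 1)) / (2 * Real.pi * N)) = secFn N t (dil N m t) h i x y := rfl
    have e2 : zak (famX (fam h)) (dil N m t, 2 * (N : ℝ) / (2 * N - m * t) * x,
        (m : ℝ) * (y + 2 * Real.pi * (i + 1)) / (2 * Real.pi * N))
        = secFn N t (dil N m t) (fun j => mulX (h j)) i x y := rfl
    have e3 : zak (famX (famD (fam h))) (dil N m t, 2 * (N : ℝ) / (2 * N - m * t) * x,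
        (m : ℝ) * (y + 2 * Real.pi * (i + 1)) / (2 * Real.pi * N))
        = secFn N t (dil N m t) (fun j => mulX (derX (h j))) i x y := rfl
    rw [e1, e2, e3]
    generalize secFn N t (dil N m t) (fun j => mulX (derX (h j))) i x y = A
    generalize secFn N t (dil N m t) (fun j => mulX (h j)) i x y = B
    generalize secFn N t (dil N m t) h i x y = D
    generalize dil N m t = d at *
    have hI : I ^ 2 = -1 := I_sq
    have hI3 : I ^ 3 = -I := I_pow_three
    unfold stdCoef
    push_cast
    field_simp
    ring_nf
    simp only [hI, hI3]
    ring

/-- The standard bundles of the same rank and charge are related by a Seiberg-Witten map, without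
covariant terms. -/
lemma swMap_stdBundle (hN : 0 < N) {t t' : ℝ} (h1 : (N : ℝ) - m * t ≠ 0) (h2 : 2 * (N : ℝ) - m * t ≠ 0)
    (h1' : (N : ℝ) - m * t' ≠ 0) (h2' : 2 * (N : ℝ) - m * t' ≠ 0) :
    SWMap t t' (stdBundle N m t) (stdBundle N m t') := by
  have hP := (not_mem_poles_real hN).2 ⟨h1, h2⟩
  have hP' := (not_mem_poles_real hN).2 ⟨h1', h2'⟩
  refine ⟨isBundle_stdBundle h1, isBundle_stdBundle h1', poles N m, fun t => pot (stdCoef N m t),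
    fun _ => (stdBundle N m t).Ωfn, hP, hP', gaugeSolution_std hN t, (stdBundle_A N m t).symm,
    (stdBundle_A N m t').symm, rfl, rfl, ?_, ?_⟩
  · refine ⟨zeroTerm _, ?_⟩
    by_cases hm : m = 0
    · subst hm
      -- charge zero: the potential vanishes and sections are constant along the flow
      have e : (stdBundle N 0 t).sec t = (stdBundle N 0 t').sec t' := by
        ext φ
        rw [mem_sec_stdBundle hN, mem_sec_stdBundle hN]
        simp
      refine ⟨LinearEquiv.ofEq _ _ e, fun φ => ⟨fun _ => φ, ⟨fun i => ?_, fun s _ i x y => ?_⟩, rfl, rfl⟩⟩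
      · exact (ContDiff.comp (g := fun z : ℝ × ℝ => φ.1 i z.1 z.2) (φ.2.1 i) contDiff_snd).contDiffOn
      · refine (hasDerivAt_const s _).congr_deriv ?_
        simp only [CovTerm.fund, zeroTerm, Finset.sum_empty, smul_zero, sub_zero]
        rw [swFund_pot]
        simp [stdCoef]
    · have : NeZero m.natAbs := ⟨Int.natAbs_ne_zero.2 hm⟩
      have hd := dil_ne_zero h1 h2
      have hd' := dil_ne_zero h1' h2'
      have hdC : (dil N m t : ℂ) ≠ 0 := by exact_mod_cast hd
      have hdC' : (dil N m t' : ℂ) ≠ 0 := by exact_mod_cast hd'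
      -- the flow multiplies amplitudes by the ratio of the values of `dil`
      refine ⟨(secEquiv hN h2 hd).symm.trans ((LinearEquiv.smulOfNeZero ℂ (HSpace m)
        ((dil N m t : ℂ)⁻¹ * dil N m t') (mul_ne_zero (inv_ne_zero hdC) hdC')).trans
          (secEquiv hN h2' hd')), fun φ => ?_⟩
      refine ⟨_, fundSolution_secFn hN (dil N m t : ℂ)⁻¹ ((secEquiv hN h2 hd).symm φ), ?_, ?_⟩
      · rw [inv_mul_cancel₀ hdC, one_smul, ← secEquiv_apply hN h2 hd, LinearEquiv.apply_symm_apply]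
      · simp only [LinearEquiv.trans_apply, LinearEquiv.smulOfNeZero_apply, map_smul]
        rw [Submodule.coe_smul, secEquiv_apply]
  · refine ⟨zeroTerm _, adjEquiv h1 h1', fun s _ α => ?_, fun Ψ => ⟨_, adjSolution_std hN (t₀ := t) Ψ.2.1, ?_, rfl⟩⟩
    · simp [CovTerm.adj, zeroTerm]
    · funext i j x y
      change Ψ.1 i j (_ * x) y = _
      rw [div_self h1, one_mul]

end

/-! ### Polynomial solutions of the Seiberg-Witten equation are unique -/

open Filter Topology Asymptotics Polynomial

/-- Functions on the plane which are polynomials of degree at most `d` in each variable. -/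
def polyFn (d : ℕ) : Submodule ℂ PlaneFn where
  carrier := {f | (∀ y : ℝ, ∃ p : ℂ[X], p.natDegree ≤ d ∧ ∀ x : ℝ, f x y = p.eval (x : ℂ)) ∧
    ∀ x : ℝ, ∃ p : ℂ[X], p.natDegree ≤ d ∧ ∀ y : ℝ, f x y = p.eval (y : ℂ)}
  zero_mem' := ⟨fun _ => ⟨0, by simp⟩, fun _ => ⟨0, by simp⟩⟩
  add_mem' := by
    rintro f g ⟨hf, hf'⟩ ⟨hg, hg'⟩
    refine ⟨fun y => ?_, fun x => ?_⟩
    · obtain ⟨p, hp, hp'⟩ := hf y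
      obtain ⟨q, hq, hq'⟩ := hg y
      exact ⟨p + q, natDegree_add_le_of_degree_le hp hq, fun x => by simp [hp', hq']⟩
    · obtain ⟨p, hp, hp'⟩ := hf' x
      obtain ⟨q, hq, hq'⟩ := hg' x
      exact ⟨p + q, natDegree_add_le_of_degree_le hp hq, fun x => by simp [hp', hq']⟩
  smul_mem' := by
    rintro c f ⟨hf, hf'⟩
    refine ⟨fun y => ?_, fun x => ?_⟩
    · obtain ⟨p, hp, hp'⟩ := hf y
      exact ⟨c • p, (natDegree_smul_le c p).trans hp, fun x => by simp [hp']⟩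
    · obtain ⟨p, hp, hp'⟩ := hf' x
      exact ⟨c • p, (natDegree_smul_le c p).trans hp, fun x => by simp [hp']⟩

lemma polyFn_mono {d e : ℕ} (h : d ≤ e) : polyFn d ≤ polyFn e := by
  rintro f ⟨h1, h2⟩
  refine ⟨fun y => ?_, fun x => ?_⟩
  · obtain ⟨p, hp, hp'⟩ := h1 y
    exact ⟨p, hp.trans h, hp'⟩
  · obtain ⟨p, hp, hp'⟩ := h2 x
    exact ⟨p, hp.trans h, hp'⟩

lemma mul_mem_polyFn {d e : ℕ} {f g : PlaneFn} (hf : f ∈ polyFn d) (hg : g ∈ polyFn e) :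
    (fun (x y : ℝ) => f x y * g x y) ∈ polyFn (d + e) := by
  refine ⟨fun y => ?_, fun x => ?_⟩
  · obtain ⟨p, hp, hp'⟩ := hf.1 y
    obtain ⟨q, hq, hq'⟩ := hg.1 y
    exact ⟨p * q, natDegree_mul_le.trans (add_le_add hp hq), fun x => by simp [hp', hq']⟩
  · obtain ⟨p, hp, hp'⟩ := hf.2 x
    obtain ⟨q, hq, hq'⟩ := hg.2 x
    exact ⟨p * q, natDegree_mul_le.trans (add_le_add hp hq), fun x => by simp [hp', hq']⟩

lemma mem_polyFn_of_mvPolynomial {f : PlaneFn} {d : ℕ} (p : MvPolynomial (Fin 2) ℂ)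
    (hd : p.totalDegree ≤ d) (h : ∀ x y : ℝ, f x y = MvPolynomial.eval ![(x : ℂ), (y : ℂ)] p) :
    f ∈ polyFn d := by
  have key : ∀ v : Fin 2 → ℂ[X], (∀ i, (v i).natDegree ≤ 1) →
      (MvPolynomial.aeval v p).natDegree ≤ d := fun v hv =>
    (MvPolynomial.aeval_natDegree_le p hd v (n := 1) hv).trans (by simp)
  have ev : ∀ (v : Fin 2 → ℂ[X]) (z : ℂ), (MvPolynomial.aeval v p).eval z
      = MvPolynomial.eval (fun i => (v i).eval z) p := fun v z => by
    rw [← Polynomial.coe_evalRingHom, MvPolynomial.aeval_def, MvPolynomial.hom_eval₂]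
    rw [MvPolynomial.eval, MvPolynomial.coe_eval₂Hom]
    congr 1
    ext c
    simp
  refine ⟨fun y => ⟨MvPolynomial.aeval ![X, C (y : ℂ)] p, key _ fun i => ?_, fun x => ?_⟩,
    fun x => ⟨MvPolynomial.aeval ![C (x : ℂ), X] p, key _ fun i => ?_, fun y => ?_⟩⟩
  · fin_cases i <;> simp
  · rw [ev, h]
    congr 2
    funext i
    fin_cases i <;> simp
  · fin_cases i <;> simp
  · rw [ev, h]
    congr 2
    funext i
    fin_cases i <;> simp

/-- The weights of numerical differentiation at the nodes `0, …, d`. -/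
def dweight (d k : ℕ) (x : ℝ) : ℂ :=
  (Lagrange.basis (Finset.range (d + 1)) (fun k : ℕ => (k : ℂ)) k).derivative.eval (x : ℂ)

lemma deriv_eq_sum_dweight {d : ℕ} {p : ℂ[X]} (hp : p.natDegree ≤ d) (x : ℝ) :
    deriv (fun x : ℝ => p.eval (x : ℂ)) x
      = ∑ k ∈ Finset.range (d + 1), dweight d k x * p.eval (((k : ℝ)) : ℂ) := by
  have h1 : HasDerivAt (fun x : ℝ => p.eval (x : ℂ)) (p.derivative.eval (x : ℂ)) x :=
    (p.hasDerivAt (x : ℂ)).comp_ofReal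
  rw [h1.deriv]
  have h2 := Lagrange.eq_interpolate (s := Finset.range (d + 1)) (v := fun k : ℕ => (k : ℂ)) (f := p)
    (fun a _ b _ h => Nat.cast_injective h)
    (by
      rw [Finset.card_range]
      exact (Polynomial.degree_le_of_natDegree_le hp).trans_lt (by exact_mod_cast Nat.lt_succ_self d))
  conv_lhs => rw [h2]
  rw [Lagrange.interpolate_apply, Polynomial.derivative_sum, Polynomial.eval_finsetSum]
  refine Finset.sum_congr rfl fun k _ => ?_
  simp only [Polynomial.derivative_C_mul, Polynomial.eval_C_mul, dweight, ofReal_natCast]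
  ring

/-- The derivative of a polynomial of bounded degree is a combination of its values at fixed nodes,
by Lagrange interpolation. -/
lemma pd_zero_eq_sum {d : ℕ} {f : PlaneFn} (hf : f ∈ polyFn d) (x y : ℝ) :
    pd 0 f x y = ∑ k ∈ Finset.range (d + 1), dweight d k x * f k y := by
  obtain ⟨p, hp, hp'⟩ := hf.1 y
  simp only [pd, if_pos, hp']
  exact deriv_eq_sum_dweight hp x

lemma pd_one_eq_sum {d : ℕ} {f : PlaneFn} (hf : f ∈ polyFn d) (x y : ℝ) :
    pd 1 f x y = ∑ k ∈ Finset.range (d + 1), dweight d k y * f x k := by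
  obtain ⟨p, hp, hp'⟩ := hf.2 x
  simp only [pd, one_ne_zero, if_false, hp']
  exact deriv_eq_sum_dweight hp y

lemma exists_deriv_poly {d : ℕ} {f : ℝ → ℂ} (h : ∃ p : ℂ[X], p.natDegree ≤ d ∧ ∀ x : ℝ, f x = p.eval (x : ℂ)) :
    ∃ p : ℂ[X], p.natDegree ≤ d - 1 ∧ ∀ x : ℝ, deriv f x = p.eval (x : ℂ) := by
  obtain ⟨p, hp, hp'⟩ := h
  refine ⟨p.derivative, (natDegree_derivative_le p).trans (Nat.sub_le_sub_right hp 1), fun x => ?_⟩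
  rw [funext hp']
  exact ((p.hasDerivAt (x : ℂ)).comp_ofReal).deriv

lemma exists_poly_sum {d n : ℕ} (w : ℕ → ℂ) {f : ℕ → ℝ → ℂ}
    (h : ∀ k, ∃ p : ℂ[X], p.natDegree ≤ d ∧ ∀ x : ℝ, f k x = p.eval (x : ℂ)) :
    ∃ p : ℂ[X], p.natDegree ≤ d ∧ ∀ x : ℝ, ∑ k ∈ Finset.range n, w k * f k x = p.eval (x : ℂ) := by
  choose p hp hp' using h
  refine ⟨∑ k ∈ Finset.range n, w k • p k, natDegree_sum_le_of_forall_le _ _ fun k _ =>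
    (natDegree_smul_le _ _).trans (hp k), fun x => ?_⟩
  simp [eval_finsetSum, hp']

lemma pd_mem_polyFn {d : ℕ} (μ : Fin 2) {f : PlaneFn} (hf : f ∈ polyFn d) : pd μ f ∈ polyFn d := by
  have hd : d - 1 ≤ d := Nat.sub_le d 1
  fin_cases μ
  · refine ⟨fun y => ?_, fun x => ?_⟩
    · obtain ⟨p, hp, hp'⟩ := exists_deriv_poly (hf.1 y)
      exact ⟨p, hp.trans hd, hp'⟩
    · simp only [Fin.zero_eta, pd_zero_eq_sum hf]
      exact exists_poly_sum _ fun k => hf.2 k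
  · refine ⟨fun y => ?_, fun x => ?_⟩
    · simp only [Fin.mk_one, pd_one_eq_sum hf]
      exact exists_poly_sum _ fun k => hf.1 k
    · obtain ⟨p, hp, hp'⟩ := exists_deriv_poly (hf.2 x)
      exact ⟨p, hp.trans hd, hp'⟩

lemma pd_iterate_mem_polyFn {d : ℕ} (μ : Fin 2) {f : PlaneFn} (hf : f ∈ polyFn d) (n : ℕ) :
    (pd μ)^[n] f ∈ polyFn d := by
  induction n with
  | zero => exact hf
  | succ n ih =>
    rw [Function.iterate_succ_apply']
    exact pd_mem_polyFn μ ih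

lemma pd_iterate_eq_zero {d : ℕ} (μ : Fin 2) {f : PlaneFn} (hf : f ∈ polyFn d) {n : ℕ} (hn : d < n) :
    (pd μ)^[n] f = 0 := by
  have key : ∀ g : ℝ → ℂ, (∃ p : ℂ[X], p.natDegree ≤ d ∧ ∀ x : ℝ, g x = p.eval (x : ℂ)) →
      deriv^[n] g = 0 := by
    rintro g ⟨p, hp, hp'⟩
    have : ∀ k, deriv^[k] g = fun x : ℝ => (derivative^[k] p).eval (x : ℂ) := fun k => by
      induction k with
      | zero => exact funext hp'
      | succ k ih =>
        rw [Function.iterate_succ_apply', Function.iterate_succ_apply', ih]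
        funext x
        exact ((Polynomial.hasDerivAt _ (x : ℂ)).comp_ofReal).deriv
    rw [this, iterate_derivative_eq_zero (hp.trans_lt hn)]
    funext x
    simp
  funext x y
  fin_cases μ
  · have e : ∀ k, ∀ y, (fun x => (pd 0)^[k] f x y) = deriv^[k] fun x => f x y := fun k => by
      induction k with
      | zero => exact fun _ => rfl
      | succ k ih =>
        intro y
        rw [Function.iterate_succ_apply', Function.iterate_succ_apply', ← ih]
        rfl
    exact congrFun ((e n y).trans (key _ (hf.1 y))) x
  · have e : ∀ k, ∀ x, (fun y => (pd 1)^[k] f x y) = deriv^[k] fun y => f x y := fun k => by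
      induction k with
      | zero => exact fun _ => rfl
      | succ k ih =>
        intro y
        rw [Function.iterate_succ_apply', Function.iterate_succ_apply', ← ih]
        rfl
    exact congrFun ((e n x).trans (key _ (hf.2 x))) y

/-- On polynomials the Moyal product is a finite sum. -/
lemma star_eq_sum {d : ℕ} {f : PlaneFn} (hf : f ∈ polyFn d) (t : ℂ) (g : PlaneFn) (x y : ℝ) :
    star t f g x y = ∑ k ∈ Finset.range (2 * d + 1), (I * Real.pi * t) ^ k / (k.factorial : ℂ) *
      ∑ j ∈ Finset.range (k + 1), (-1) ^ j * (k.choose j : ℂ) *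
        (((pd 0)^[k - j] ((pd 1)^[j] f)) x y * ((pd 0)^[j] ((pd 1)^[k - j] g)) x y) := by
  refine tsum_eq_sum fun k hk => ?_
  rw [Finset.mem_range, not_lt] at hk
  refine mul_eq_zero_of_right _ (Finset.sum_eq_zero fun j _ => ?_)
  have h0 : (pd 0)^[k - j] ((pd 1)^[j] f) = 0 := by
    by_cases hj : d < j
    · rw [pd_iterate_eq_zero 1 hf hj, pd_iterate_zero]
    · exact pd_iterate_eq_zero 0 (pd_iterate_mem_polyFn 1 hf j) (by omega)
  rw [h0]
  simp

/-- Two families of polynomials of bounded degree which are bounded near `t₀` and agree there to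
order `n`. -/
structure Close (t₀ : ℂ) (n : ℕ) (f g : ℂ → PlaneFn) : Prop where
  left : ∃ d, ∀ᶠ t in 𝓝 t₀, f t ∈ polyFn d
  right : ∃ d, ∀ᶠ t in 𝓝 t₀, g t ∈ polyFn d
  left_isBigO : ∀ x y, (fun t => f t x y) =O[𝓝 t₀] fun _ => (1 : ℂ)
  right_isBigO : ∀ x y, (fun t => g t x y) =O[𝓝 t₀] fun _ => (1 : ℂ)
  sub_isBigO : ∀ x y, (fun t => f t x y - g t x y) =O[𝓝 t₀] fun t => (t - t₀) ^ n

namespace Close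

variable {t₀ : ℂ} {n : ℕ} {f g f' g' : ℂ → PlaneFn}

lemma zero : Close t₀ n 0 0 where
  left := ⟨0, Eventually.of_forall fun _ => zero_mem _⟩
  right := ⟨0, Eventually.of_forall fun _ => zero_mem _⟩
  left_isBigO _ _ := isBigO_zero _ _
  right_isBigO _ _ := isBigO_zero _ _
  sub_isBigO _ _ := by simpa using isBigO_zero _ _

lemma add (h : Close t₀ n f g) (h' : Close t₀ n f' g') : Close t₀ n (f + f') (g + g') where
  left := by
    obtain ⟨d, hd⟩ := h.left
    obtain ⟨e, he⟩ := h'.left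
    refine ⟨d + e, ?_⟩
    filter_upwards [hd, he] with t h1 h2
    exact add_mem (polyFn_mono (by omega) h1) (polyFn_mono (by omega) h2)
  right := by
    obtain ⟨d, hd⟩ := h.right
    obtain ⟨e, he⟩ := h'.right
    refine ⟨d + e, ?_⟩
    filter_upwards [hd, he] with t h1 h2
    exact add_mem (polyFn_mono (by omega) h1) (polyFn_mono (by omega) h2)
  left_isBigO x y := (h.left_isBigO x y).add (h'.left_isBigO x y)
  right_isBigO x y := (h.right_isBigO x y).add (h'.right_isBigO x y)
  sub_isBigO x y := ((h.sub_isBigO x y).add (h'.sub_isBigO x y)).congr_left fun t => by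
    simp only [Pi.add_apply]; ring

lemma smul (a : ℂ → ℂ) (ha : ContinuousAt a t₀) (h : Close t₀ n f g) :
    Close t₀ n (fun t => a t • f t) fun t => a t • g t := by
  have h1 : a =O[𝓝 t₀] fun _ => (1 : ℂ) := ha.norm.isBoundedUnder_le.isBigO_one ℂ
  refine ⟨?_, ?_, fun x y => ?_, fun x y => ?_, fun x y => ?_⟩
  · obtain ⟨d, hd⟩ := h.left
    exact ⟨d, hd.mono fun t ht => Submodule.smul_mem _ _ ht⟩
  · obtain ⟨d, hd⟩ := h.right
    exact ⟨d, hd.mono fun t ht => Submodule.smul_mem _ _ ht⟩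
  · simpa using h1.mul (h.left_isBigO x y)
  · simpa using h1.mul (h.right_isBigO x y)
  · refine (h1.mul (h.sub_isBigO x y)).congr (fun t => ?_) fun t => one_mul _
    simp only [Pi.smul_apply, smul_eq_mul]; ring

lemma neg (h : Close t₀ n f g) : Close t₀ n (-f) (-g) := by
  have := h.smul (fun _ => -1) continuousAt_const
  simp only [neg_smul, one_smul] at this
  exact this

lemma sub (h : Close t₀ n f g) (h' : Close t₀ n f' g') : Close t₀ n (f - f') (g - g') := by
  rw [sub_eq_add_neg, sub_eq_add_neg]
  exact h.add h'.neg

lemma sum {ι : Type*} (s : Finset ι) {F G : ι → ℂ → PlaneFn} (h : ∀ k ∈ s, Close t₀ n (F k) (G k)) :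
    Close t₀ n (fun t => ∑ k ∈ s, F k t) fun t => ∑ k ∈ s, G k t := by
  classical
  induction s using Finset.induction_on with
  | empty => simp only [Finset.sum_empty]; exact zero
  | insert a s ha ih =>
    simp only [Finset.sum_insert ha]
    exact (h a (Finset.mem_insert_self a s)).add
      (ih fun k hk => h k (Finset.mem_insert_of_mem hk))

lemma mul (h : Close t₀ n f g) (h' : Close t₀ n f' g') :
    Close t₀ n (fun t (x y : ℝ) => f t x y * f' t x y) fun t (x y : ℝ) => g t x y * g' t x y where
  left := by
    obtain ⟨d, hd⟩ := h.left
    obtain ⟨e, he⟩ := h'.left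
    refine ⟨d + e, ?_⟩
    filter_upwards [hd, he] with t h1 h2 using mul_mem_polyFn h1 h2
  right := by
    obtain ⟨d, hd⟩ := h.right
    obtain ⟨e, he⟩ := h'.right
    refine ⟨d + e, ?_⟩
    filter_upwards [hd, he] with t h1 h2 using mul_mem_polyFn h1 h2
  left_isBigO x y := by simpa using (h.left_isBigO x y).mul (h'.left_isBigO x y)
  right_isBigO x y := by simpa using (h.right_isBigO x y).mul (h'.right_isBigO x y)
  sub_isBigO x y := by
    have h1 := (h.sub_isBigO x y).mul (h'.left_isBigO x y)
    have h2 := (h.right_isBigO x y).mul (h'.sub_isBigO x y)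
    simp only [mul_one, one_mul] at h1 h2
    exact (h1.add h2).congr_left fun t => by ring

lemma pd (μ : Fin 2) (h : Close t₀ n f g) :
    Close t₀ n (fun t => pd μ (f t)) fun t => NCT.pd μ (g t) := by
  obtain ⟨d, hd⟩ := h.left
  obtain ⟨e, he⟩ := h.right
  have hf : ∀ᶠ t in 𝓝 t₀, f t ∈ polyFn (d + e) := hd.mono fun t ht => polyFn_mono (by omega) ht
  have hg : ∀ᶠ t in 𝓝 t₀, g t ∈ polyFn (d + e) := he.mono fun t ht => polyFn_mono (by omega) ht
  -- a derivative of a polynomial is a combination of finitely many values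
  obtain ⟨u, v, w, key⟩ : ∃ (u v : ℕ → ℝ → ℝ → ℝ) (w : ℕ → ℝ → ℝ → ℂ), ∀ F ∈ polyFn (d + e), ∀ x y,
      NCT.pd μ F x y = ∑ k ∈ Finset.range (d + e + 1), w k x y * F (u k x y) (v k x y) := by
    fin_cases μ
    · exact ⟨fun k _ _ => k, fun _ _ y => y, fun k x _ => dweight (d + e) k x, fun F hF x y =>
        pd_zero_eq_sum hF x y⟩
    · exact ⟨fun _ x _ => x, fun k _ _ => k, fun k _ y => dweight (d + e) k y, fun F hF x y =>
        pd_one_eq_sum hF x y⟩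
  refine ⟨⟨_, hf.mono fun t ht => pd_mem_polyFn μ ht⟩, ⟨_, hg.mono fun t ht => pd_mem_polyFn μ ht⟩,
    fun x y => ?_, fun x y => ?_, fun x y => ?_⟩
  · refine (IsBigO.sum (s := Finset.range (d + e + 1)) fun k _ =>
      ((h.left_isBigO (u k x y) (v k x y)).const_mul_left (w k x y))).congr' ?_ EventuallyEq.rfl
    filter_upwards [hf] with t ht
    rw [key _ ht, Finset.sum_apply]
  · refine (IsBigO.sum (s := Finset.range (d + e + 1)) fun k _ =>
      ((h.right_isBigO (u k x y) (v k x y)).const_mul_left (w k x y))).congr' ?_ EventuallyEq.rfl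
    filter_upwards [hg] with t ht
    rw [key _ ht, Finset.sum_apply]
  · refine (IsBigO.sum (s := Finset.range (d + e + 1)) fun k _ =>
      ((h.sub_isBigO (u k x y) (v k x y)).const_mul_left (w k x y))).congr' ?_ EventuallyEq.rfl
    filter_upwards [hf, hg] with t ht ht'
    rw [key _ ht, key _ ht', ← Finset.sum_sub_distrib, Finset.sum_apply]
    exact Finset.sum_congr rfl fun k _ => mul_sub _ _ _

lemma pd_iterate (μ : Fin 2) (h : Close t₀ n f g) (k : ℕ) :
    Close t₀ n (fun t => (NCT.pd μ)^[k] (f t)) fun t => (NCT.pd μ)^[k] (g t) := by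
  induction k with
  | zero => exact h
  | succ k ih =>
    simp only [Function.iterate_succ_apply']
    exact ih.pd μ

lemma congr (h : Close t₀ n f g) (hf : ∀ᶠ t in 𝓝 t₀, f t = f' t) (hg : ∀ᶠ t in 𝓝 t₀, g t = g' t) :
    Close t₀ n f' g' where
  left := by
    obtain ⟨d, hd⟩ := h.left
    refine ⟨d, ?_⟩
    filter_upwards [hd, hf] with t h1 h2
    rwa [← h2]
  right := by
    obtain ⟨d, hd⟩ := h.right
    refine ⟨d, ?_⟩
    filter_upwards [hd, hg] with t h1 h2
    rwa [← h2]
  left_isBigO x y := (h.left_isBigO x y).congr' (hf.mono fun t ht => congrFun (congrFun ht x) y) EventuallyEq.rfl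
  right_isBigO x y := (h.right_isBigO x y).congr' (hg.mono fun t ht => congrFun (congrFun ht x) y) EventuallyEq.rfl
  sub_isBigO x y := (h.sub_isBigO x y).congr'
    (by filter_upwards [hf, hg] with t h1 h2; rw [← h1, ← h2]) EventuallyEq.rfl

/-- Star products of close families are close; the sums which compute them have a common finite
range. -/
lemma star (h : Close t₀ n f g) (h' : Close t₀ n f' g') :
    Close t₀ n (fun t => star t (f t) (f' t)) fun t => NCT.star t (g t) (g' t) := by
  obtain ⟨d, hd⟩ := h.left
  obtain ⟨e, he⟩ := h.right
  refine Close.congr (f := fun t => ∑ k ∈ Finset.range (2 * (d + e) + 1),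
    ((I * Real.pi * t) ^ k / (k.factorial : ℂ)) • ∑ j ∈ Finset.range (k + 1),
      ((-1) ^ j * (k.choose j : ℂ)) • fun (x y : ℝ) =>
        (((NCT.pd 0)^[k - j] ((NCT.pd 1)^[j] (f t))) x y *
          ((NCT.pd 0)^[j] ((NCT.pd 1)^[k - j] (f' t))) x y))
    (g := fun t => ∑ k ∈ Finset.range (2 * (d + e) + 1),
    ((I * Real.pi * t) ^ k / (k.factorial : ℂ)) • ∑ j ∈ Finset.range (k + 1),
      ((-1) ^ j * (k.choose j : ℂ)) • fun (x y : ℝ) =>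
        (((NCT.pd 0)^[k - j] ((NCT.pd 1)^[j] (g t))) x y *
          ((NCT.pd 0)^[j] ((NCT.pd 1)^[k - j] (g' t))) x y)) ?_ ?_ ?_
  · refine sum _ fun k _ => smul _ (by fun_prop) (sum _ fun j _ => smul _ continuousAt_const ?_)
    exact ((h.pd_iterate 1 j).pd_iterate 0 (k - j)).mul ((h'.pd_iterate 1 (k - j)).pd_iterate 0 j)
  · filter_upwards [hd] with t ht
    funext x y
    rw [star_eq_sum (polyFn_mono (by omega : d ≤ d + e) ht)]
    simp only [Finset.sum_apply, Pi.smul_apply, smul_eq_mul]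
  · filter_upwards [he] with t ht
    funext x y
    rw [star_eq_sum (polyFn_mono (by omega : e ≤ d + e) ht)]
    simp only [Finset.sum_apply, Pi.smul_apply, smul_eq_mul]

end Close

section

variable {N : ℕ} {t₀ : ℂ} {n : ℕ} {A B A' B' : ℂ → MatFn N}

/-- Entrywise closeness of families of matrices. -/
def MClose (t₀ : ℂ) (n : ℕ) (A B : ℂ → MatFn N) : Prop :=
  ∀ i j, Close t₀ n (fun t => A t i j) fun t => B t i j

lemma MClose.mstar (h : MClose t₀ n A B) (h' : MClose t₀ n A' B') :
    MClose t₀ n (fun t => mstar t (A t) (A' t)) fun t => NCT.mstar t (B t) (B' t) :=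
  fun i j => Close.sum _ fun k _ => (h i k).star (h' k j)

lemma MClose.add (h : MClose t₀ n A B) (h' : MClose t₀ n A' B') :
    MClose t₀ n (fun t => A t + A' t) fun t => B t + B' t := fun i j => (h i j).add (h' i j)

lemma MClose.sub (h : MClose t₀ n A B) (h' : MClose t₀ n A' B') :
    MClose t₀ n (fun t => A t - A' t) fun t => B t - B' t := fun i j => (h i j).sub (h' i j)

lemma MClose.smul (c : ℂ) (h : MClose t₀ n A B) :
    MClose t₀ n (fun t => c • A t) fun t => c • B t :=
  fun i j => (h i j).smul (fun _ => c) continuousAt_const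

lemma MClose.mpd (μ : Fin 2) (h : MClose t₀ n A B) :
    MClose t₀ n (fun t => mpd μ (A t)) fun t => NCT.mpd μ (B t) := fun i j => (h i j).pd μ

lemma MClose.fieldStrength {A B : ℂ → Fin 2 → MatFn N}
    (h : ∀ μ, MClose t₀ n (fun t => A t μ) fun t => B t μ) (μ ν : Fin 2) :
    MClose t₀ n (fun t => fieldStrength t (A t) μ ν) fun t => NCT.fieldStrength t (B t) μ ν :=
  (((h ν).mpd μ).sub ((h μ).mpd ν)).sub ((((h μ).mstar (h ν)).sub ((h ν).mstar (h μ))).smul I)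

lemma MClose.swGauge {A B : ℂ → Fin 2 → MatFn N}
    (h : ∀ μ, MClose t₀ n (fun t => A t μ) fun t => B t μ) (κ : Fin 2) :
    MClose t₀ n (fun t => swGauge t (A t) κ) fun t => NCT.swGauge t (B t) κ := by
  have key : ∀ μ ν, MClose t₀ n
      (fun t => santi t (A t μ) (NCT.mpd ν (A t κ) + NCT.fieldStrength t (A t) ν κ))
      fun t => santi t (B t μ) (NCT.mpd ν (B t κ) + NCT.fieldStrength t (B t) ν κ) := fun μ ν => by
    have h1 := ((h κ).mpd ν).add (MClose.fieldStrength h ν κ)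
    exact ((h μ).mstar h1).add (h1.mstar (h μ))
  exact ((key 0 1).sub (key 1 0)).smul _

end

/-- A function vanishing at `t₀` whose derivative is `O((t - t₀)^n)` is `O((t - t₀)^(n+1))`. -/
lemma isBigO_pow_succ_of_deriv {f f' : ℂ → ℂ} {t₀ : ℂ} {n : ℕ}
    (h : ∀ᶠ t in 𝓝 t₀, HasDerivAt f (f' t) t) (h0 : f t₀ = 0)
    (h' : f' =O[𝓝 t₀] fun t => (t - t₀) ^ n) : f =O[𝓝 t₀] fun t => (t - t₀) ^ (n + 1) := by
  obtain ⟨C, hCpos, hC'⟩ := h'.exists_pos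
  have hC := hC'.bound
  obtain ⟨ε, hε, hb⟩ := Metric.eventually_nhds_iff.1 (h.and hC)
  refine IsBigO.of_bound C (Metric.eventually_nhds_iff.2 ⟨ε, hε, fun t ht => ?_⟩)
  have hm : ∀ s ∈ Metric.closedBall t₀ ‖t - t₀‖, dist s t₀ < ε := fun s hs =>
    (Metric.mem_closedBall.1 hs).trans_lt (by rwa [← dist_eq_norm])
  have hC0 : ∀ s ∈ Metric.closedBall t₀ ‖t - t₀‖, ‖f' s‖ ≤ C * ‖t - t₀‖ ^ n := fun s hs => by
    refine (hb (hm s hs)).2.trans ?_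
    rw [norm_pow]
    have h1 : ‖s - t₀‖ ≤ ‖t - t₀‖ := by simpa [dist_eq_norm] using hs
    gcongr
  have h2 := (convex_closedBall t₀ ‖t - t₀‖).norm_image_sub_le_of_norm_hasDerivWithin_le
    (fun s hs => (hb (hm s hs)).1.hasDerivWithinAt) hC0
    (Metric.mem_closedBall_self (norm_nonneg _)) (show t ∈ Metric.closedBall t₀ ‖t - t₀‖ by
      simp [dist_eq_norm])
  rw [h0, sub_zero] at h2
  rw [norm_pow, pow_succ, ← mul_assoc]
  exact h2

/-- An analytic function of infinite order of vanishing is locally zero. -/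
lemma eventually_eq_zero_of_isBigO_pow {f : ℂ → ℂ} {t₀ : ℂ} (hf : AnalyticAt ℂ f t₀)
    (h : ∀ n : ℕ, f =O[𝓝 t₀] fun t => (t - t₀) ^ n) : ∀ᶠ t in 𝓝 t₀, f t = 0 := by
  by_contra hne
  obtain ⟨n, g, hg, hg0, hfg⟩ := hf.exists_eventuallyEq_pow_smul_nonzero_iff.2 hne
  obtain ⟨C, hC⟩ := (h (n + 1)).bound
  have h1 : ∀ᶠ t in 𝓝[≠] t₀, ‖g t‖ ≤ C * ‖t - t₀‖ := by
    filter_upwards [hC.filter_mono nhdsWithin_le_nhds, hfg.filter_mono nhdsWithin_le_nhds,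
      self_mem_nhdsWithin] with t h2 h3 h4
    have h5 : 0 < ‖t - t₀‖ ^ n := pow_pos (norm_pos_iff.2 (sub_ne_zero.2 h4)) n
    rw [h3, norm_smul, norm_pow, norm_pow, pow_succ, mul_left_comm] at h2
    exact le_of_mul_le_mul_left h2 h5
  have h2 : Tendsto (fun t => C * ‖t - t₀‖) (𝓝[≠] t₀) (𝓝 0) := by
    have : ContinuousAt (fun t : ℂ => C * ‖t - t₀‖) t₀ := by fun_prop
    have h3 := this.tendsto
    simp only [sub_self, norm_zero, mul_zero] at h3
    exact h3.mono_left nhdsWithin_le_nhds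
  have h3 : Tendsto (fun t => ‖g t‖) (𝓝[≠] t₀) (𝓝 ‖g t₀‖) :=
    (hg.continuousAt.norm.tendsto).mono_left nhdsWithin_le_nhds
  have h4 := le_of_tendsto_of_tendsto h3 h2 h1
  exact hg0 (norm_eq_zero.1 (le_antisymm h4 (norm_nonneg _)))

lemma isOpen_compl_finset (P : Finset ℂ) : IsOpen {t : ℂ | t ∉ P} := P.finite_toSet.isClosed.isOpen_compl

lemma isPreconnected_compl_finset (P : Finset ℂ) : IsPreconnected {t : ℂ | t ∉ P} :=
  (P.countable_toSet.isPathConnected_compl_of_one_lt_rank (by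
    rw [Complex.rank_real_complex]; exact Cardinal.one_lt_two)).isConnected.isPreconnected

lemma analyticOnNhd_of_hasDerivAt {P : Finset ℂ} {f f' : ℂ → ℂ}
    (h : ∀ t ∉ P, HasDerivAt f (f' t) t) : AnalyticOnNhd ℂ f {t | t ∉ P} :=
  DifferentiableOn.analyticOnNhd (fun t ht => (h t ht).differentiableAt.differentiableWithinAt)
    (isOpen_compl_finset P)

/-- A polynomial solution of the Seiberg-Witten equation for the gauge potential is determined by its
value at one point. The difference of two solutions has order `n + 1` as soon as it has order `n`,
since the equation is polynomial in the potential and its derivatives, and the derivatives of a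
polynomial of bounded degree are controlled by its values. -/
theorem GaugeSolution.eq {N : ℕ} {P P' : Finset ℂ} {A B Ωt Ωt' : ℂ → Fin 2 → MatFn N}
    (hA : GaugeSolution P A Ωt) (hB : GaugeSolution P' B Ωt') {t₀ t : ℂ} (h₀ : t₀ ∉ P) (h₀' : t₀ ∉ P')
    (ht : t ∉ P) (ht' : t ∉ P') (h : A t₀ = B t₀) : A t = B t := by
  have mem : ∀ s, s ∉ P ∪ P' → s ∉ P ∧ s ∉ P' := fun s hs => by
    rwa [Finset.mem_union, not_or] at hs
  have hU : ∀ᶠ s in 𝓝 t₀, s ∉ P ∪ P' := (isOpen_compl_finset (P ∪ P')).mem_nhds (by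
    simp [h₀, h₀'])
  have ode : ∀ κ i j x y, ∀ s ∉ P ∪ P', HasDerivAt (fun t => A t κ i j x y - B t κ i j x y)
      (swGauge s (A s) κ i j x y - swGauge s (B s) κ i j x y) s := fun κ i j x y s hs =>
    (hA.odeA s (mem s hs).1 κ i j x y).sub (hB.odeA s (mem s hs).2 κ i j x y)
  have pA : ∃ d, ∀ᶠ s in 𝓝 t₀, ∀ κ i j, A s κ i j ∈ polyFn d := by
    obtain ⟨d, hd⟩ := hA.poly
    refine ⟨d, hU.mono fun s hs κ i j => ?_⟩
    obtain ⟨p, hp, hp'⟩ := hd s (mem s hs).1 κ i j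
    exact mem_polyFn_of_mvPolynomial p hp hp'
  have pB : ∃ d, ∀ᶠ s in 𝓝 t₀, ∀ κ i j, B s κ i j ∈ polyFn d := by
    obtain ⟨d, hd⟩ := hB.poly
    refine ⟨d, hU.mono fun s hs κ i j => ?_⟩
    obtain ⟨p, hp, hp'⟩ := hd s (mem s hs).2 κ i j
    exact mem_polyFn_of_mvPolynomial p hp hp'
  have close : ∀ n κ, MClose t₀ n (fun t => A t κ) fun t => B t κ := by
    have bdd : ∀ κ i j x y, ((fun t => A t κ i j x y) =O[𝓝 t₀] fun _ => (1 : ℂ)) ∧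
        (fun t => B t κ i j x y) =O[𝓝 t₀] fun _ => (1 : ℂ) := fun κ i j x y =>
      ⟨((hA.odeA t₀ h₀ κ i j x y).continuousAt.norm.isBoundedUnder_le).isBigO_one ℂ,
        ((hB.odeA t₀ h₀' κ i j x y).continuousAt.norm.isBoundedUnder_le).isBigO_one ℂ⟩
    have mk : ∀ n, (∀ κ i j x y, (fun t => A t κ i j x y - B t κ i j x y) =O[𝓝 t₀]
        fun t => (t - t₀) ^ n) → ∀ κ, MClose t₀ n (fun t => A t κ) fun t => B t κ :=
      fun n hn κ i j => ⟨pA.imp fun d hd => hd.mono fun s hs => hs κ i j,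
        pB.imp fun d hd => hd.mono fun s hs => hs κ i j, fun x y => (bdd κ i j x y).1,
        fun x y => (bdd κ i j x y).2, hn κ i j⟩
    intro n
    induction n with
    | zero =>
      refine mk 0 fun κ i j x y => ?_
      simpa using (bdd κ i j x y).1.sub (bdd κ i j x y).2
    | succ n ih =>
      refine mk (n + 1) fun κ i j x y => isBigO_pow_succ_of_deriv (hU.mono (ode κ i j x y)) ?_
        ((MClose.swGauge ih κ i j).sub_isBigO x y)
      rw [h, sub_self]
  funext κ i j x y
  have an := analyticOnNhd_of_hasDerivAt (ode κ i j x y)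
  have h1 := eventually_eq_zero_of_isBigO_pow (an t₀ (by simp [h₀, h₀']))
    fun n => (close n κ i j).sub_isBigO x y
  have h2 := an.eqOn_zero_of_preconnected_of_eventuallyEq_zero (isPreconnected_compl_finset _)
    (show t₀ ∈ {t | t ∉ P ∪ P'} by simp [h₀, h₀']) h1 (show t ∈ {t | t ∉ P ∪ P'} by simp [ht, ht'])
  exact sub_eq_zero.1 h2

/-! ### The Seiberg-Witten image of a standard bundle -/

/-- The character `e^{iq·σ}` of the plane. -/
def planeChar (q : ℝ × ℝ) : Multiplicative (ℝ × ℝ) →* ℂ where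
  toFun z := exp (I * (q.1 * z.toAdd.1 + q.2 * z.toAdd.2))
  map_one' := by simp
  map_mul' z w := by
    rw [← exp_add]
    congr 1
    simp only [toAdd_mul, Prod.fst_add, Prod.snd_add]
    push_cast
    ring

/-- Two frequencies `a ≠ b` are separated at the point `π/(a - b)`. -/
lemma planeChar_injective : Function.Injective planeChar := by
  intro q q' h
  have key : ∀ a b : ℝ, (∀ x : ℝ, exp (I * (a * x)) = exp (I * (b * x))) → a = b := fun a b hab => by
    by_contra hne
    have hpi : (Real.pi : ℂ) ≠ 0 := by exact_mod_cast Real.pi_ne_zero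
    have hd : (a : ℂ) - b ≠ 0 := sub_ne_zero.2 (by exact_mod_cast hne)
    have h1 := hab (Real.pi / (a - b))
    rw [← div_eq_one_iff_eq (exp_ne_zero _), ← exp_sub] at h1
    have h2 : I * (a * ((Real.pi / (a - b) : ℝ) : ℂ)) - I * (b * ((Real.pi / (a - b) : ℝ) : ℂ))
        = Real.pi * I := by
      push_cast
      field_simp
    rw [h2, exp_pi_mul_I] at h1
    norm_num at h1
  refine Prod.ext (key _ _ fun x => ?_) (key _ _ fun y => ?_)
  · simpa [planeChar] using DFunLike.congr_fun h (Multiplicative.ofAdd (x, 0))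
  · simpa [planeChar] using DFunLike.congr_fun h (Multiplicative.ofAdd (0, y))

/-- A sum of plane waves is determined by its function. -/
lemma Wave.fn_injective : Function.Injective Wave.fn := by
  -- distinct characters are linearly independent
  have h1 : LinearIndependent ℂ fun q => (planeChar q : Multiplicative (ℝ × ℝ) → ℂ) :=
    (linearIndependent_monoidHom (Multiplicative (ℝ × ℝ)) ℂ).comp planeChar planeChar_injective
  intro p p' h
  refine h1.finsuppLinearCombination_injective (funext fun z => ?_)
  have key : ∀ p : Wave, Finsupp.linearCombination ℂ
      (fun q => (planeChar q : Multiplicative (ℝ × ℝ) → ℂ)) p z = p.fn z.toAdd.1 z.toAdd.2 := fun p => by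
    rw [Finsupp.linearCombination_apply, Finsupp.sum, Finset.sum_apply]
    rfl
  rw [key, key, h]

section

variable {N : ℕ} {m : ℤ}

lemma Ωfn_apply_eq (t : ℝ) (α : Fin 2) (i j : Fin N) (x x' y : ℝ) :
    (stdBundle N m t).Ωfn α i j x y = (stdBundle N m t).Ωfn α i j x' y := by
  unfold Bundle.Ωfn
  fin_cases α
  · simp only [Fin.zero_eta, fn_Ω_zero]
  · simp only [Fin.mk_one, fn_Ω_one]

lemma stdBundle_A' (t : ℝ) : (stdBundle N m t).A = pot (stdCoef N m t) := stdBundle_A N m t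

/-- For the standard potential the transition matrices are constant along the rays
`σ¹ ∝ N - mt`, which are the characteristics of their Seiberg-Witten equation. -/
lemma hasDerivAt_characteristic {P : Finset ℂ} {A Ωt : ℂ → Fin 2 → MatFn N}
    (hG : GaugeSolution P A Ωt) {t₀ s : ℝ} (h₀ : (N : ℝ) - m * t₀ ≠ 0) (hs : (s : ℂ) ∉ P)
    (hs' : (N : ℝ) - m * s ≠ 0) (hA : A s = pot (stdCoef N m s)) (α : Fin 2) (i j : Fin N) (x y : ℝ) :
    HasDerivAt (fun s : ℝ => Ωt s α i j (x * ((N - m * s) / (N - m * t₀))) y) 0 s := by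
  -- the chain rule for `s ↦ Ω(s, ρ(s), y)` combines the evolution equation with the motion of the
  -- point
  obtain ⟨F, hF⟩ : ∃ F : ℂ × ℝ × ℝ → ℂ, F = fun z => Ωt z.1 α i j z.2.1 z.2.2 := ⟨_, rfl⟩
  obtain ⟨ρ, hρ⟩ : ∃ ρ : ℝ → ℝ, ρ = fun s => x * ((N - m * s) / (N - m * t₀)) := ⟨_, rfl⟩
  have hd : DifferentiableAt ℝ F ((s : ℂ), ρ s, y) := by
    have h1 := hG.smooth α i j
    rw [← hF] at h1
    refine (h1.contDiffAt (IsOpen.mem_nhds ?_ hs)).differentiableAt (by simp)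
    exact (isOpen_compl_finset P).preimage continuous_fst
  have hf := hd.hasFDerivAt
  have hρ' : HasDerivAt ρ (x * (-(m * 1) / (N - m * t₀))) s := by
    rw [hρ]
    exact ((((hasDerivAt_id s).const_mul (m : ℝ)).const_sub (N : ℝ)).div_const _).const_mul x
  have hc : HasDerivAt (fun s : ℝ => (s : ℂ)) 1 s := Complex.ofRealCLM.hasDerivAt
  have c0 : HasDerivAt (fun s : ℝ => ((s : ℂ), ρ s, y)) (1, x * (-(m * 1) / (N - m * t₀)), 0) s :=
    hc.prodMk (hρ'.prodMk (hasDerivAt_const s y))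
  have c1 : HasDerivAt (fun r : ℝ => ((r : ℂ), ρ s, y)) (1, 0, 0) s :=
    hc.prodMk ((hasDerivAt_const s (ρ s)).prodMk (hasDerivAt_const s y))
  have c2 : HasDerivAt (fun r : ℝ => ((s : ℂ), r, y)) (0, 1, 0) (ρ s) :=
    (hasDerivAt_const _ (s : ℂ)).prodMk ((hasDerivAt_id _).prodMk (hasDerivAt_const _ y))
  have d0 := hf.comp_hasDerivAt s c0
  have d1 := hf.comp_hasDerivAt s c1
  have d2 := HasFDerivAt.comp_hasDerivAt (ρ s) (f := fun r : ℝ => ((s : ℂ), r, y)) hf c2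
  have e1 := (hG.odeΩ s hs α i j (ρ s) y).comp_ofReal
  rw [hA, swAdj_pot] at e1
  have e2 : HasDerivAt (fun r : ℝ => Ωt s α i j r y) (pd 0 (Ωt s α i j) (ρ s) y) (ρ s) := by
    have h1 : DifferentiableAt ℝ (fun r : ℝ => Ωt s α i j r y) (ρ s) := by
      have := d2.differentiableAt
      rw [hF] at this
      exact this
    simp only [pd, if_pos]
    exact h1.hasDerivAt
  rw [hF] at d1 d2 d0
  have u1 := d1.unique e1
  have u2 := d2.unique e2
  have d0' : HasDerivAt (fun s : ℝ => Ωt s α i j (ρ s) y) _ s := d0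
  rw [hρ] at d0'
  refine d0'.congr_deriv ?_
  have split : ((1, x * (-(m * 1) / (N - m * t₀)), 0) : ℂ × ℝ × ℝ)
      = (1, 0, 0) + (x * (-(m * 1) / (N - m * t₀))) • ((0, 1, 0) : ℂ × ℝ × ℝ) := by
    simp
  rw [← hF] at u1 u2 ⊢
  rw [← hρ, split, map_add, map_smul, u1, u2, hρ]
  have h₀' : (N : ℂ) - m * t₀ ≠ 0 := by exact_mod_cast h₀
  have hs'' : (N : ℂ) - m * s ≠ 0 := by exact_mod_cast hs'
  have hpi : (Real.pi : ℂ) ≠ 0 := by exact_mod_cast Real.pi_ne_zero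
  rw [Complex.real_smul]
  unfold stdCoef
  push_cast
  field_simp
  ring

/-- The solution of the Seiberg-Witten equations through a standard bundle consists of standard
bundles. -/
lemma GaugeSolution.eq_std {P : Finset ℂ} {A Ωt : ℂ → Fin 2 → MatFn N} (hG : GaugeSolution P A Ωt)
    (hN : 0 < N) {t₀ t₁ : ℝ} (h₀ : (t₀ : ℂ) ∉ P) (h₁ : (t₁ : ℂ) ∉ P) (h₀' : (t₀ : ℂ) ∉ poles N m)
    (h₁' : (t₁ : ℂ) ∉ poles N m) (hA : A t₀ = (stdBundle N m t₀).A)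
    (hΩ : Ωt t₀ = (stdBundle N m t₀).Ωfn) :
    A t₁ = (stdBundle N m t₁).A ∧ Ωt t₁ = (stdBundle N m t₀).Ωfn := by
  have hAt : ∀ t, t ∉ P → t ∉ poles N m → A t = pot (stdCoef N m t) := fun t ht ht' =>
    hG.eq (gaugeSolution_std hN t₀) h₀ h₀' ht ht' (hA.trans (stdBundle_A' t₀))
  refine ⟨(hAt t₁ h₁ h₁').trans (stdBundle_A' t₁).symm, ?_⟩
  have hn0 := ((not_mem_poles_real hN).1 h₀').1
  have hU : ∀ᶠ s : ℝ in 𝓝 t₀, (s : ℂ) ∉ P ∪ poles N m :=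
    Complex.continuous_ofReal.continuousAt.eventually
      ((isOpen_compl_finset (P ∪ poles N m)).mem_nhds (by simp [h₀, h₀']))
  have mem : ∀ s : ℂ, s ∉ P ∪ poles N m → s ∉ P ∧ s ∉ poles N m := fun s hs => by
    rwa [Finset.mem_union, not_or] at hs
  obtain ⟨ε, hε, hb⟩ := Metric.eventually_nhds_iff.1 hU
  funext α i j x y
  -- along real `s` near `t₀` the characteristics reach `t₀`, where the matrices do not depend on
  -- `σ¹`
  have loc : ∀ᶠ s : ℝ in 𝓝 t₀, Ωt s α i j x y - Ωt t₀ α i j x y = 0 := by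
    refine Metric.eventually_nhds_iff.2 ⟨ε, hε, fun s hs => ?_⟩
    have hns := ((not_mem_poles_real hN).1 (mem s (hb hs)).2).1
    obtain ⟨X, hX⟩ : ∃ X : ℝ, X = x * ((N - m * t₀) / (N - m * s)) := ⟨_, rfl⟩
    have h1 := (convex_ball t₀ ε).norm_image_sub_le_of_norm_hasDerivWithin_le (𝕜 := ℝ) (C := 0)
      (f := fun s : ℝ => Ωt s α i j (X * ((N - m * s) / (N - m * t₀))) y)
      (x := t₀) (y := s) (f' := 0) (fun r hr => by
        have hr' := mem r (hb (Metric.mem_ball.1 hr))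
        exact (hasDerivAt_characteristic hG hn0 hr'.1 ((not_mem_poles_real hN).1 hr'.2).1
          (hAt r hr'.1 hr'.2) α i j X y).hasDerivWithinAt)
      (by simp) (Metric.mem_ball_self hε) (Metric.mem_ball.2 hs)
    have h2 : X * ((N - m * s) / (N - m * t₀)) = x := by
      rw [hX]
      field_simp
    have h3 : Ωt t₀ α i j (X * ((N - m * t₀) / (N - m * t₀))) y = Ωt t₀ α i j x y := by
      rw [hΩ]
      exact Ωfn_apply_eq _ _ _ _ _ _ _
    rw [zero_mul] at h1
    simp only [h2, h3] at h1
    exact norm_eq_zero.1 (le_antisymm h1 (norm_nonneg _))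
  have hd : ∀ s ∉ P ∪ poles N m, HasDerivAt (fun s => Ωt s α i j x y - Ωt t₀ α i j x y)
      (swAdj s (A s) (Ωt s α) i j x y) s := fun s hs =>
    (hG.odeΩ s (mem s hs).1 α i j x y).sub_const _
  -- analytic continuation over the complement of the poles, which is connected
  have an := analyticOnNhd_of_hasDerivAt hd
  have tend : Tendsto (fun s : ℝ => (s : ℂ)) (𝓝[≠] t₀) (𝓝[≠] (t₀ : ℂ)) :=
    tendsto_nhdsWithin_iff.2 ⟨Complex.continuous_ofReal.continuousAt.tendsto.mono_left
      nhdsWithin_le_nhds, eventually_nhdsWithin_of_forall fun s hs => by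
        simpa using hs⟩
  have freq : ∃ᶠ s in 𝓝[≠] (t₀ : ℂ), Ωt s α i j x y - Ωt t₀ α i j x y = 0 :=
    tend.frequently (loc.filter_mono nhdsWithin_le_nhds).frequently
  have h1 := an.eqOn_zero_of_preconnected_of_frequently_eq_zero (isPreconnected_compl_finset _)
    (show (t₀ : ℂ) ∈ {t | t ∉ P ∪ poles N m} by simp [h₀, h₀']) freq
    (show (t₁ : ℂ) ∈ {t | t ∉ P ∪ poles N m} by simp [h₁, h₁'])
  rw [← hΩ]
  exact sub_eq_zero.1 h1

/-- The image of a standard bundle under a Seiberg-Witten map is the standard bundle. -/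
theorem SWMap.eq_std (hN : 0 < N) {t t' : ℝ} {E' : Bundle N} (h : SWMap t t' (stdBundle N m t) E')
    (h1 : (N : ℝ) - m * t ≠ 0) (h2 : 2 * (N : ℝ) - m * t ≠ 0) (h1' : (N : ℝ) - m * t' ≠ 0)
    (h2' : 2 * (N : ℝ) - m * t' ≠ 0) : E' = stdBundle N m t' := by
  obtain ⟨-, -, P, A, Ωt, hP, hP', hG, hA, hA', hΩ, hΩ', -⟩ := h
  obtain ⟨e1, e2⟩ := hG.eq_std hN hP hP' ((not_mem_poles_real hN).2 ⟨h1, h2⟩)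
    ((not_mem_poles_real hN).2 ⟨h1', h2'⟩) hA hΩ
  have hE : E'.Ω = (stdBundle N m t').Ω := by
    funext α i j
    refine Wave.fn_injective ?_
    have := hΩ'.symm.trans e2
    exact congrFun (congrFun (congrFun this α) i) j
  have hE' := hA'.symm.trans e1
  cases E'
  simp only at hE hE'
  subst hE hE'
  rfl

end

/-! ### Seiberg-Witten images of Heisenberg modules -/

/-- The module of sections of a bundle is unique up to isomorphism. -/
lemma Bundle.IsSections.iso {N : ℕ} {θ₀ t : ℝ} {E : Bundle N} {M M' : TorusModule θ₀}
    (h : E.IsSections t M) (h' : E.IsSections t M') : M.Iso M' := by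
  obtain ⟨R, h1, h2⟩ := h
  obtain ⟨R', h1', h2'⟩ := h'
  have e : ∀ φ, R' (R'.symm (R φ)) = R φ := fun φ => R'.apply_symm_apply _
  refine ⟨R.trans R'.symm, fun a φ => ?_, fun μ φ => ?_⟩
  · rw [LinearEquiv.trans_apply, LinearEquiv.trans_apply, LinearEquiv.symm_apply_eq]
    refine Subtype.ext ?_
    funext i x y
    have h3 := h1' (R'.symm (R φ)) a i x y
    rw [e] at h3
    exact (h1 φ a i x y).unique h3
  · rw [LinearEquiv.trans_apply, LinearEquiv.trans_apply, LinearEquiv.symm_apply_eq]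
    refine Subtype.ext ?_
    rw [h2, h2', e]

lemma Bundle.IsSections.of_iso {N : ℕ} {θ₀ t : ℝ} {E : Bundle N} {M M' : TorusModule θ₀}
    (h : E.IsSections t M) (e : M'.Iso M) : E.IsSections t M' := by
  obtain ⟨R, h1, h2⟩ := h
  obtain ⟨e, h3, h4⟩ := e
  refine ⟨e.trans R, fun φ a i x y => ?_, fun μ φ => ?_⟩
  · rw [LinearEquiv.trans_apply, LinearEquiv.trans_apply, h3]
    exact h1 (e φ) a i x y
  · rw [LinearEquiv.trans_apply, LinearEquiv.trans_apply, h4]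
    exact h2 μ (e φ)

/-- The curvature of a Heisenberg module. -/
lemma heis_comm {n m : ℤ} {θ : ℝ} (h : (n : ℝ) - m * θ ≠ 0) (φ : (heis n m θ h).carrier) :
    (heis n m θ h).D 0 ((heis n m θ h).D 1 φ) - (heis n m θ h).D 1 ((heis n m θ h).D 0 φ)
      = (-(I * m / (n - m * θ)) * (1 / (2 * Real.pi)) : ℂ) • φ := by
  suffices H : ∀ M, heis n m θ h = M → ∀ φ : M.carrier, M.D 0 (M.D 1 φ) - M.D 1 (M.D 0 φ)
      = (-(I * m / (n - m * θ)) * (1 / (2 * Real.pi)) : ℂ) • φ from H _ rfl φ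
  by_cases hm : m = 0
  · subst hm
    rintro M hM
    rw [heis_zero] at hM
    subst hM
    have key : ∀ φ : Fin n.natAbs → Torus (-θ),
        (Torus.der 0).compLeft _ ((Torus.der 1).compLeft _ φ)
          - (Torus.der 1).compLeft _ ((Torus.der 0).compLeft _ φ) = 0 := fun φ => by
      refine sub_eq_zero.2 (funext fun i => Torus.ext fun g => ?_)
      simp only [LinearMap.compLeft_apply, Function.comp_apply, Torus.coeff_der]
      ring
    intro φ
    rw [Int.cast_zero, mul_zero, zero_div, neg_zero, zero_mul, zero_smul]
    exact key φ
  · have : NeZero m.natAbs := ⟨Int.natAbs_ne_zero.2 hm⟩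
    rintro M hM
    rw [heis_of_ne] at hM
    subst hM
    exact heisD_comm n m θ

lemma heis_nontrivial {n m : ℤ} {θ : ℝ} (h : (n : ℝ) - m * θ ≠ 0) :
    ∃ φ : (heis n m θ h).carrier, φ ≠ 0 := by
  suffices H : ∀ M, heis n m θ h = M → ∃ φ : M.carrier, φ ≠ 0 from H _ rfl
  by_cases hm : m = 0
  · subst hm
    rintro M hM
    rw [heis_zero] at hM
    subst hM
    have hn : 0 < n.natAbs := Int.natAbs_pos.2 fun hn => by simp [hn] at h
    have key : ∃ φ : Fin n.natAbs → Torus (-θ), φ ≠ 0 := ⟨fun _ => 1, fun h0 => by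
      have := congrArg (fun a : Torus (-θ) => a.coeff 0) (congrFun h0 ⟨0, hn⟩)
      simp [Torus.coeff_one] at this⟩
    exact key
  · have : NeZero m.natAbs := ⟨Int.natAbs_ne_zero.2 hm⟩
    rintro M hM
    rw [heis_of_ne] at hM
    subst hM
    have key : ∃ φ : HSpace m, φ ≠ 0 := by
      obtain ⟨f, hf, -⟩ := exists_schwartz_bump 0 one_pos
      refine ⟨fun _ => f, fun h0 => ?_⟩
      have h1 : f = 0 := congrFun h0 0
      simp [h1] at hf
    exact key

lemma eq_or_eq_neg_of_isCoprime {n m n' m' : ℤ} (h : IsCoprime n m) (h' : IsCoprime n' m')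
    (e : m * n' = m' * n) : (n' = n ∧ m' = m) ∨ (n' = -n ∧ m' = -m) := by
  have h1 : n ∣ n' := h.dvd_of_dvd_mul_left ⟨m', by rw [e, mul_comm]⟩
  have h2 : n' ∣ n := h'.dvd_of_dvd_mul_left ⟨m, by rw [← e, mul_comm]⟩
  have h3 : m ∣ m' := h.symm.dvd_of_dvd_mul_right ⟨n', e.symm⟩
  have h4 : m' ∣ m := h'.symm.dvd_of_dvd_mul_right ⟨n, e⟩
  rcases Int.natAbs_eq_natAbs_iff.1 (Int.natAbs_eq_of_dvd_dvd h1 h2) with a | a <;>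
    rcases Int.natAbs_eq_natAbs_iff.1 (Int.natAbs_eq_of_dvd_dvd h3 h4) with b | b
  · exact Or.inl ⟨a.symm, b.symm⟩
  · have : m * n = 0 := by subst a; rw [b] at e; rw [b]; linarith
    rcases mul_eq_zero.1 this with h0 | h0
    · exact Or.inl ⟨a.symm, by omega⟩
    · exact Or.inr ⟨by omega, by omega⟩
  · have : m * n = 0 := by subst b; rw [a] at e; rw [a]; linarith
    rcases mul_eq_zero.1 this with h0 | h0
    · exact Or.inr ⟨by omega, by omega⟩
    · exact Or.inl ⟨by omega, b.symm⟩
  · exact Or.inr ⟨by omega, by omega⟩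

/-- The curvature distinguishes the Heisenberg modules `E_{n,m}` with coprime `n, m`, up to a common
sign of `n, m`. -/
lemma eq_or_eq_neg_of_heis_iso {n m n' m' : ℤ} {θ : ℝ} (hc : IsCoprime n m) (hc' : IsCoprime n' m')
    {h : (n : ℝ) - m * θ ≠ 0} {h' : (n' : ℝ) - m' * θ ≠ 0}
    (e : (heis n m θ h).Iso (heis n' m' θ h')) : (n' = n ∧ m' = m) ∨ (n' = -n ∧ m' = -m) := by
  obtain ⟨e, -, hD⟩ := e
  obtain ⟨φ, hφ⟩ := heis_nontrivial h
  -- the isomorphism intertwines the curvatures, which are the scalars `m/(n - mθ)` up to a common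
  -- factor
  have h1 := congrArg e (heis_comm h φ)
  rw [map_sub, hD, hD, hD, hD, map_smul, heis_comm h' (e φ)] at h1
  have h2 : (e φ : (heis n' m' θ h').carrier) ≠ 0 := fun h0 => hφ (e.map_eq_zero_iff.1 h0)
  have h3 := smul_left_injective ℂ h2 h1
  have hn : (n : ℂ) - m * θ ≠ 0 := by exact_mod_cast h
  have hn' : (n' : ℂ) - m' * θ ≠ 0 := by exact_mod_cast h'
  have hpi : (Real.pi : ℂ) ≠ 0 := by exact_mod_cast Real.pi_ne_zero
  refine eq_or_eq_neg_of_isCoprime hc hc' ?_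
  have h4 : (m' * (n - m * θ) : ℂ) = m * (n' - m' * θ) := by
    have aux : ∀ a b : ℂ, a ≠ 0 → b ≠ 0 → -(I * m' / b) * (1 / (2 * Real.pi))
        = -(I * m / a) * (1 / (2 * Real.pi)) → m' * a = m * b := fun a b ha hb hab => by
      field_simp at hab
      linear_combination -hab
    exact aux _ _ hn hn' h3
  have h5 : (m * n' : ℂ) = m' * n := by linear_combination -h4
  exact_mod_cast h5

/-- Whether two Heisenberg modules are isomorphic does not depend on the parameter. -/
lemma heis_iso_of_iso {n m n' m' : ℤ} {θ θ' : ℝ} (hc : IsCoprime n m) (hc' : IsCoprime n' m')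
    {h : (n : ℝ) - m * θ ≠ 0} {h' : (n' : ℝ) - m' * θ ≠ 0} {k : (n : ℝ) - m * θ' ≠ 0}
    {k' : (n' : ℝ) - m' * θ' ≠ 0} (e : (heis n m θ h).Iso (heis n' m' θ h')) :
    (heis n m θ' k).Iso (heis n' m' θ' k') := by
  rcases eq_or_eq_neg_of_heis_iso hc hc' e with ⟨h1, h2⟩ | ⟨h1, h2⟩
  · exact heis_congr h1.symm h2.symm _ _
  · subst h1 h2
    exact heis_neg n m θ' k k'

/-- A Seiberg-Witten map relates Heisenberg modules with the same `n, m`. -/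
theorem IsSW.exists_heis {θ θ' : ℝ} {M : TorusModule θ} {M' : TorusModule θ'} (h : IsSW M M') :
    ∃ (n m : ℤ) (h : (n : ℝ) - m * θ ≠ 0) (h' : (n : ℝ) - m * θ' ≠ 0), IsCoprime n m ∧
      M.Iso (heis n m θ h) ∧ M'.Iso (heis n m θ' h') := by
  obtain ⟨k, N, m, E', hN, hc, a, a', b, b', hS, hM, hM'⟩ := h
  obtain rfl := hS.eq_std hN a b a' b'
  have e : ∀ θ : ℝ, ((N - k * m : ℤ) : ℝ) - m * θ = N - m * (θ + k) := fun θ => by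
    push_cast; ring
  have h1 : ((N - k * m : ℤ) : ℝ) - m * θ ≠ 0 := by rwa [e]
  have h1' : ((N - k * m : ℤ) : ℝ) - m * θ' ≠ 0 := by rwa [e]
  refine ⟨N - k * m, m, h1, h1', ?_, hM.iso (isSections_heis hN rfl hc rfl a b h1),
    hM'.iso (isSections_heis hN rfl hc rfl a' b' h1')⟩
  have := hc.add_mul_right_left (-k)
  rwa [neg_mul, ← sub_eq_add_neg] at this

/-- Heisenberg modules with the same `n, m` are modules of sections of the standard bundles of rank
`n + km` at the shifted parameters, which are related by a Seiberg-Witten map. -/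
theorem swRel_heis {n m k : ℤ} {θ θ' : ℝ} (hc : IsCoprime n m) {h : (n : ℝ) - m * θ ≠ 0}
    {h' : (n : ℝ) - m * θ' ≠ 0} {M : TorusModule θ} {M' : TorusModule θ'}
    (hM : M.Iso (heis n m θ h)) (hM' : M'.Iso (heis n m θ' h')) (hk : 0 < n + k * m)
    (h2 : (m : ℝ) * (θ + k) ≠ 2 * (n + k * m)) (h2' : (m : ℝ) * (θ' + k) ≠ 2 * (n + k * m)) :
    SWRel k M M' := by
  obtain ⟨N, hN⟩ := Int.eq_ofNat_of_zero_le hk.le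
  have hN' : (N : ℝ) = n + k * m := by exact_mod_cast hN.symm
  have hpos : 0 < N := by omega
  have hn : n = N - k * m := by omega
  have hcop : IsCoprime (N : ℤ) m := by
    have := hc.add_mul_right_left k
    rwa [hN] at this
  have a : (N : ℝ) - m * (θ + k) ≠ 0 := by rw [hN']; convert h using 1; ring
  have a' : (N : ℝ) - m * (θ' + k) ≠ 0 := by rw [hN']; convert h' using 1; ring
  have b : 2 * (N : ℝ) - m * (θ + k) ≠ 0 := by rw [hN']; exact sub_ne_zero.2 (Ne.symm h2)
  have b' : 2 * (N : ℝ) - m * (θ' + k) ≠ 0 := by rw [hN']; exact sub_ne_zero.2 (Ne.symm h2')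
  exact ⟨N, m, stdBundle N m (θ' + k), hpos, hcop, a, a', b, b',
    swMap_stdBundle hpos a b a' b',
    (isSections_heis hpos hn hcop rfl a b h).of_iso hM,
    (isSections_heis hpos hn hcop rfl a' b' h').of_iso hM'⟩

/-- A shift `k` for which the rank is positive and the excluded values are avoided always exists. -/
theorem isSW_heis {n m : ℤ} {θ θ' : ℝ} (hc : IsCoprime n m) {h : (n : ℝ) - m * θ ≠ 0}
    {h' : (n : ℝ) - m * θ' ≠ 0} {M : TorusModule θ} {M' : TorusModule θ'}
    (hM : M.Iso (heis n m θ h)) (hM' : M'.Iso (heis n m θ' h')) : IsSW M M' := by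
  by_cases hm : m = 0
  · -- a free module: the rank can be taken positive
    subst hm
    have key : ∀ {n : ℤ} (h : (n : ℝ) - (0 : ℤ) * θ ≠ 0) (h' : (n : ℝ) - (0 : ℤ) * θ' ≠ 0),
        0 < n → IsCoprime n 0 → M.Iso (heis n 0 θ h) → M'.Iso (heis n 0 θ' h') → IsSW M M' :=
      fun h h' hn hc hM hM' =>
        ⟨0, swRel_heis hc hM hM' (by simpa using hn) (by simpa using hn.ne')
          (by simpa using hn.ne')⟩
    rcases lt_trichotomy n 0 with hn | hn | hn
    · have e : ∀ θ : ℝ, (n : ℝ) - (0 : ℤ) * θ ≠ 0 → ((-n : ℤ) : ℝ) - (-0 : ℤ) * θ ≠ 0 :=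
        fun θ hθ => by
          rw [neg_zero]
          simpa using hθ
      exact key (e θ h) (e θ' h') (by omega) hc.neg_left
        (hM.trans (heis_neg n 0 θ h (e θ h))) (hM'.trans (heis_neg n 0 θ' h' (e θ' h')))
    · subst hn
      exact absurd h (by simp)
    · exact key h h' hn hc hM hM'
  · -- a shift `k = mj` with `j` large makes the rank `n + km` positive and avoids the excluded value
    obtain ⟨j, hj⟩ := exists_nat_gt (max |(n : ℝ)| (max (m * θ - 2 * n) (m * θ' - 2 * n)))
    have h1 : |(n : ℝ)| < j := (le_max_left _ _).trans_lt hj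
    have h2 : m * θ - 2 * n < (j : ℝ) :=
      ((le_max_left _ _).trans (le_max_right _ _)).trans_lt hj
    have h3 : m * θ' - 2 * n < (j : ℝ) :=
      ((le_max_right _ _).trans (le_max_right _ _)).trans_lt hj
    have hmm : (1 : ℝ) ≤ m * m := by
      have : 1 ≤ m * m := by
        have := Int.one_le_abs hm
        nlinarith [abs_mul_abs_self m]
      exact_mod_cast this
    have hjm : (j : ℝ) ≤ m * j * m := by nlinarith [(Nat.cast_nonneg j : (0 : ℝ) ≤ j)]
    refine ⟨m * j, swRel_heis hc hM hM' ?_ ?_ ?_⟩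
    · have : (0 : ℝ) < n + m * j * m := by linarith [neg_abs_le (n : ℝ)]
      exact_mod_cast this
    · push_cast
      intro h0
      nlinarith
    · push_cast
      intro h0
      nlinarith

/-! ### Compatibility of Seiberg-Witten maps with duality -/

/-- Duality by a fixed element of `GL(2,ℤ)` carries Seiberg-Witten related modules to
Seiberg-Witten related modules, since it changes `(n, m)` independently of `θ`. -/
theorem IsSW.tDual {g : Matrix (Fin 2) (Fin 2) ℤ} {θ θ' θ₁ θ₁' : ℝ} {M : TorusModule θ}
    {M' : TorusModule θ'} {N : TorusModule θ₁} {N' : TorusModule θ₁'} (h : IsSW M M')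
    (hN : TDual M g N) (hN' : TDual M' g N') : IsSW N N' := by
  obtain ⟨n, m, _, _, hc, e, e'⟩ := h.exists_heis
  obtain ⟨hc', _, e₁⟩ := hN.iso_heis hc e
  obtain ⟨_, _, e₁'⟩ := hN'.iso_heis hc e'
  exact isSW_heis hc' e₁ e₁'

/-- The bimodules are the duals of the free modules `E_{1,0}`, which are Seiberg-Witten related. -/
lemma isSW_toRight {g : Matrix (Fin 2) (Fin 2) ℤ} {θ θ' θ₁ θ₁' : ℝ} {B : TorusBimodule θ θ₁}
    {B' : TorusBimodule θ' θ₁'} (h : TDual (freeModule 1 θ) g ((freeModule 1 θ).tensor B))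
    (h' : TDual (freeModule 1 θ') g ((freeModule 1 θ').tensor B')) : IsSW B.toRight B'.toRight := by
  have e : ∀ θ : ℝ, ∃ h0 : ((1 : ℤ) : ℝ) - (0 : ℤ) * θ ≠ 0,
      (freeModule 1 θ).Iso (heis 1 0 θ h0) := fun θ => by
    have h0 : ((1 : ℤ) : ℝ) - (0 : ℤ) * θ ≠ 0 := by simp
    refine ⟨h0, ?_⟩
    rw [heis_zero]
    exact TorusModule.Iso.refl _
  obtain ⟨_, e₀⟩ := e θ
  obtain ⟨_, e₀'⟩ := e θ'
  obtain ⟨hc, _, e₁⟩ := h.iso_heis isCoprime_one_left e₀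
  obtain ⟨_, _, e₁'⟩ := h'.iso_heis isCoprime_one_left e₀'
  exact isSW_heis hc ((freeModule_tensor B).symm.trans e₁) ((freeModule_tensor B').symm.trans e₁')

end NCT

end

theorem mainTheorem6 :
    -- the three families of bimodules are complete Morita equivalence bimodules
    (∀ (s : ℤ) (θ : ℝ) (h : (s : ℝ) - θ ≠ 0), (NCT.bimodS s θ h).IsCompleteMorita) ∧
    (∀ θ : ℝ, (NCT.bimodT θ).IsCompleteMorita ∧ (NCT.bimodR θ).IsCompleteMorita) ∧
    -- horizontal arrows: the T-dual modules with connection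
    (∀ (n m : ℤ) (θ : ℝ) (h : (n : ℝ) - m * θ ≠ 0), IsCoprime n m →
      (∀ (s : ℤ) (hs : (s : ℝ) - θ ≠ 0), ∃ h',
        ((NCT.heis n m θ h).tensor (NCT.bimodS s θ hs)).Iso
          (NCT.heis m (-n + m * s) (1 / (s - θ)) h')) ∧
      (∃ h', ((NCT.heis n m θ h).tensor (NCT.bimodT θ)).Iso (NCT.heis (n + m) m (θ + 1) h')) ∧
      (∃ h', ((NCT.heis n m θ h).tensor (NCT.bimodR θ)).Iso (NCT.heis n (-m) (-θ) h'))) ∧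
    -- vertical arrows: the Seiberg-Witten image of a Heisenberg module with connection
    (∀ (n m : ℤ) (θ θ' : ℝ) (h : (n : ℝ) - m * θ ≠ 0) (h' : (n : ℝ) - m * θ' ≠ 0), IsCoprime n m →
      (∀ M' : NCT.TorusModule θ', NCT.IsSW (NCT.heis n m θ h) M' ↔ M'.Iso (NCT.heis n m θ' h')) ∧
      (∀ k : ℤ, 0 < n + k * m → (m : ℝ) * (θ + k) ≠ 2 * (n + k * m) →
        (m : ℝ) * (θ' + k) ≠ 2 * (n + k * m) →
        NCT.SWRel k (NCT.heis n m θ h) (NCT.heis n m θ' h'))) ∧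
    -- commutativity of the squares
    (∀ (θ θ' : ℝ) (M : NCT.TorusModule θ) (M' : NCT.TorusModule θ'), NCT.IsSW M M' →
      (∀ (s : ℤ) (h : (s : ℝ) - θ ≠ 0) (h' : (s : ℝ) - θ' ≠ 0),
        NCT.IsSW (M.tensor (NCT.bimodS s θ h)) (M'.tensor (NCT.bimodS s θ' h'))) ∧
      NCT.IsSW (M.tensor (NCT.bimodT θ)) (M'.tensor (NCT.bimodT θ')) ∧
      NCT.IsSW (M.tensor (NCT.bimodR θ)) (M'.tensor (NCT.bimodR θ'))) ∧
    -- the Seiberg-Witten maps relate the equivalence bimodules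
    (∀ θ θ' : ℝ,
      (∀ (s : ℤ) (h : (s : ℝ) - θ ≠ 0) (h' : (s : ℝ) - θ' ≠ 0),
        NCT.IsSW (NCT.bimodS s θ h).toRight (NCT.bimodS s θ' h').toRight) ∧
      NCT.IsSW (NCT.bimodT θ).toRight (NCT.bimodT θ').toRight ∧
      NCT.IsSW (NCT.bimodR θ).toRight (NCT.bimodR θ').toRight) ∧
    -- the T-duality group: all its elements are realized, they act in the stated way ...
    (∀ (g : Matrix.GeneralLinearGroup (Fin 2) ℤ) (θ : ℝ) (M : NCT.TorusModule θ),
      (g.1 1 0 : ℝ) * θ + g.1 1 1 ≠ 0 →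
        ∃ (θ₁ : ℝ) (N : NCT.TorusModule θ₁), NCT.TDual M g.1 N) ∧
    (∀ (g : Matrix (Fin 2) (Fin 2) ℤ) (θ θ₁ : ℝ) (M : NCT.TorusModule θ) (N : NCT.TorusModule θ₁),
      NCT.TDual M g N → IsUnit g.det ∧ (g 1 0 : ℝ) * θ + g 1 1 ≠ 0 ∧
        θ₁ = (g 0 0 * θ + g 0 1) / (g 1 0 * θ + g 1 1)) ∧
    (∀ (g : Matrix (Fin 2) (Fin 2) ℤ) (n m : ℤ) (θ θ₁ : ℝ) (h : (n : ℝ) - m * θ ≠ 0)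
      (N : NCT.TorusModule θ₁), IsCoprime n m → NCT.TDual (NCT.heis n m θ h) g N →
        ∃ h', N.Iso (NCT.heis (g 0 0 * n + g 0 1 * m) (g 1 0 * n + g 1 1 * m) θ₁ h')) ∧
    -- ... and they are compatible with the Seiberg-Witten maps
    (∀ (g : Matrix (Fin 2) (Fin 2) ℤ) (θ θ' θ₁ θ₁' : ℝ)
      (M : NCT.TorusModule θ) (M' : NCT.TorusModule θ')
      (N : NCT.TorusModule θ₁) (N' : NCT.TorusModule θ₁'),
      NCT.TDual M g N → NCT.TDual M' g N' → NCT.IsSW M M' → NCT.IsSW N N') := by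
  refine ⟨fun s θ h => NCT.bimodS_isCompleteMorita s θ h,
    fun θ => ⟨NCT.bimodT_isCompleteMorita θ, NCT.bimodR_isCompleteMorita θ⟩,
    fun n m θ h hc => ⟨fun s hs => NCT.heis_tensor_bimodS n m θ h hc s hs,
      NCT.heis_tensor_bimodT n m θ h, NCT.heis_tensor_bimodR n m θ h⟩,
    fun n m θ θ' h h' hc => ⟨fun M' => ⟨fun hM => ?_, fun hM => ?_⟩, fun k hk h2 h2' => ?_⟩,
    fun θ θ' M M' hM => ?_, fun θ θ' => ⟨fun s h h' => ?_, ?_, ?_⟩, fun g θ M h => ?_,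
    fun g θ θ₁ M N h => h.mobius,
    fun g n m θ θ₁ h N hc hN => (hN.iso_heis hc (NCT.TorusModule.Iso.refl _)).2,
    fun g θ θ' θ₁ θ₁' M M' N N' hN hN' hM => ?_⟩
  · obtain ⟨n', m', k, k', hc', e, e'⟩ := hM.exists_heis
    exact e'.trans (NCT.heis_iso_of_iso hc hc' e).symm
  · exact NCT.isSW_heis hc (NCT.TorusModule.Iso.refl _) hM
  · exact NCT.swRel_heis hc (NCT.TorusModule.Iso.refl _) (NCT.TorusModule.Iso.refl _) hk h2 h2'
  · refine ⟨fun s hs hs' => ?_, ?_, ?_⟩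
    · exact hM.tDual (NCT.TDual.S (g := 1) s hs .refl) (NCT.TDual.S (g := 1) s hs' .refl)
    · exact hM.tDual (NCT.TDual.T (g := 1) .refl) (NCT.TDual.T (g := 1) .refl)
    · exact hM.tDual (NCT.TDual.R (g := 1) .refl) (NCT.TDual.R (g := 1) .refl)
  · exact NCT.isSW_toRight (NCT.TDual.S (g := 1) s h .refl) (NCT.TDual.S (g := 1) s h' .refl)
  · exact NCT.isSW_toRight (NCT.TDual.T (g := 1) .refl) (NCT.TDual.T (g := 1) .refl)
  · exact NCT.isSW_toRight (NCT.TDual.R (g := 1) .refl) (NCT.TDual.R (g := 1) .refl)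
  · have hu : IsUnit (g.1 0 0 * g.1 1 1 - g.1 0 1 * g.1 1 0) := by
      rw [← Matrix.det_fin_two]
      exact (Matrix.isUnit_iff_isUnit_det _).1 g.isUnit
    have := NCT.hasDual_of_isUnit _ _ _ _ _ θ le_rfl hu h M
    rwa [← Matrix.eta_fin_two] at this
  · exact hM.tDual hN hN'
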